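/- Setting. Let $M$ be an oriented smooth Riemannian manifold (Hausdorff, second countable, without boundary) of dimension $d\ge 2$. A measurable $d-1$-form $F$ is a (measurable) calibration if $dF=0$ in the sense of distributions and its comass, i.e. the essential supremum over $x\in M$ of the pointwise comass $|F_x|=\sup_{|v_i|\le 1}|F_x(v_1,\dots,v_{d-1})|$, equals $1$. A (Lipschitz, codimension one) lamination $\lambda$ is a nonempty closed set $\operatorname{supp}\lambda\subseteq M$ together with an atlas of flow boxes covering $\operatorname{supp}\lambda$. A flow box is a bijective chart $\Psi_\alpha:I\times J\to U_\alpha\subseteq M$, locally Lipschitz in both directions, where $I\subseteq\mathbb R$ is an open interval, $J\subset\mathbb R^{d-1}$ an open box and $U_\alpha$ is open, with a relatively closed set $K_\alpha\subseteq I$ such that $\Psi_\alpha(k,\cdot)$ is a $C^1$ embedding for each $k\in K_\alpha$ and $\operatorname{supp}\lambda\cap U_\alpha=\Psi_\alpha(K_\alpha\times J)$. The transition maps are required to map plaques $\sigma_{\alpha,k}=\Psi_\alpha(\{k\}\times J)$, $k\in K_\alpha$, locally into plaques, acting injectively on the local leaf spaces $K_\alpha$; the leaves are the classes of points of $\operatorname{supp}\lambda$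 joined by chains of plaques. $\lambda$ is oriented if the transition maps preserve the orientations of the plaques (given by that of $J$), and measured if it carries Radon measures $\mu_\alpha$ on $K_\alpha$ with $\operatorname{supp}\mu_\alpha=K_\alpha$ that are mapped to each other by the transition maps. Given a partition of unity $(\chi_\alpha)$ on $\operatorname{supp}\lambda$ subordinate to $(U_\alpha)$, the Ruelle--Sullivan current of a measured oriented lamination acts on continuous compactly supported $d-1$-forms by $$\int_M T_\lambda\wedge\varphi=\sum_\alpha\int_{K_\alpha}\int_{\sigma_{\alpha,k}}\chi_\alpha\varphi\,d\mu_\alpha(k).$$ For $U\subseteq M$ open, $\operatorname{Mass}_U(T_\lambda)$ is the supremum of $\int_M T_\lambda\wedge\varphi$ over continuous $\varphi$ with $|\varphi_x|\le 1$ for all $x$ and compact support in $U$; $\operatorname{Mass}=\operatorname{Mass}_M$. The product $T_\lambda\wedge F$ is Anzellotti's: locally $T_\lambda=du$ with $u\in L^1_{loc}$, and $T_\lambda\wedge F$ is the signed measure with $\int\chi\,T_\lambda\wedge F=-\int u\,d\chi\wedge F$ for smooth $\chi$ compactly supported where $T_\lambda = du$. The trace (pullback) of $F$ to an oriented $C^1$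 hypersurface is Anzellotti's: locally, if the hypersurface is oriented as the boundary of $\Omega$, then $\int_{\partial\Omega}\chi F=\int_\Omega d\chi\wedge F$ for smooth compactly supported $\chi$. A leaf $N$ of $\lambda$ is $F$-calibrated if $F$ pulls back to its area form, i.e. $\int_{N'}F=\operatorname{vol}(N')$ for every compact piece $N'$ of a plaque contained in $N$. Proposition. Let $F$ be a measurable calibration and $\lambda$ a measured oriented lamination. (a) If $M$ is compact, or more generally if $\operatorname{Mass}(T_\lambda)<\infty$, then $T_\lambda$ is $F$-calibrated, i.e. $\int_M T_\lambda\wedge F=\operatorname{Mass}(T_\lambda)$, if and only if every leaf of $\lambda$ is $F$-calibrated. (b) Without any assumption on the mass, $\int_U T_\lambda\wedge F=\operatorname{Mass}_U(T_\lambda)$ for every open set $U$ with compact closure if and only if every leaf of $\lambda$ is $F$-calibrated. -/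

import Mathlib

open Set MeasureTheory Manifold Bundle
open scoped ContDiff ENNReal Topology

/-- The Euclidean space `ℝ^m`. -/
abbrev Euc (m : ℕ) : Type := EuclideanSpace ℝ (Fin m)

/-- The `i`-th standard basis vector of `ℝ^m`. -/
noncomputable def stdVec {m : ℕ} (i : Fin m) : Euc m := EuclideanSpace.single i (1 : ℝ)

/-- The value of an `m`-form on the standard basis of `ℝ^m`, i.e. the coefficient `h` of
`w = h dx^1 ∧ ⋯ ∧ dx^m`. -/
noncomputable def topCoeff {m : ℕ} (w : Euc m [⋀^Fin m]→L[ℝ] ℝ) : ℝ := w stdVec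

/-- The coefficient of `ℓ ∧ w` for a covector `ℓ` and an `n`-covector `w` on `ℝ^{n+1}`. The wedge
product is `(ℓ ∧ w)(v_0, …, v_n) = ∑ i, (-1)^i ℓ(v_i) w(v_0, …, v̂_i, …, v_n)`, the convention
for which `d (χ w) = dχ ∧ w + χ dw`. -/
noncomputable def wedgeCoeff {n : ℕ} (ℓ : Euc (n + 1) →L[ℝ] ℝ)
    (w : Euc (n + 1) [⋀^Fin n]→L[ℝ] ℝ) : ℝ :=
  topCoeff (ContinuousAlternatingMap.alternatizeUncurryFin (ℓ.smulRight w))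

/-- `χ` is a smooth function on `ℝ^m` with compact support contained in `V`. -/
def IsTestFun {m : ℕ} {G : Type*} [NormedAddCommGroup G] [NormedSpace ℝ G]
    (V : Set (Euc m)) (χ : Euc m → G) : Prop :=
  ContDiff ℝ ∞ χ ∧ HasCompactSupport χ ∧ tsupport χ ⊆ V

section Forms

variable (n : ℕ) (M : Type*) [TopologicalSpace M] [ChartedSpace (Euc (n + 1)) M]

/-- The atlas of `M` is oriented: all changes of charts have positive Jacobian determinant. -/
def IsOrientedAtlas : Prop :=
  ∀ e ∈ atlas (Euc (n + 1)) M, ∀ e' ∈ atlas (Euc (n + 1)) M, ∀ x ∈ e.source ∩ e'.source,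
    0 < (fderiv ℝ (fun z => e' (e.symm z)) (e x)).det

/-- Not necessarily continuous differential `n`-forms on the `(n+1)`-dimensional manifold `M`. -/
abbrev RoughForm : Type _ :=
  (x : M) → (TangentSpace 𝓘(ℝ, Euc (n + 1)) x) [⋀^Fin n]→L[ℝ] ℝ

variable {n M}

/-- The expression of a form in a chart, i.e. the pullback `(e⁻¹)^* φ` (relevant on `e.target`). -/
noncomputable def formInChart (φ : RoughForm n M) (e : OpenPartialHomeomorph M (Euc (n + 1)))
    (z : Euc (n + 1)) : Euc (n + 1) [⋀^Fin n]→L[ℝ] ℝ :=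
  (φ (e.symm z)).compContinuousLinearMap
    (mfderiv 𝓘(ℝ, Euc (n + 1)) 𝓘(ℝ, Euc (n + 1)) e.symm z)

open Classical in
/-- The pullback `e^* η` of a form on `ℝ^{n+1}`, extended by zero outside of the chart domain. -/
noncomputable def formOfChart (e : OpenPartialHomeomorph M (Euc (n + 1)))
    (η : Euc (n + 1) → Euc (n + 1) [⋀^Fin n]→L[ℝ] ℝ) : RoughForm n M := fun x =>
  if x ∈ e.source then
    (η (e x)).compContinuousLinearMap
      (mfderiv 𝓘(ℝ, Euc (n + 1)) 𝓘(ℝ, Euc (n + 1)) e x)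
  else 0

/-- `φ` is a continuous form whose support is compact and contained in `U`. -/
def IsContCptForm (U : Set M) (φ : RoughForm n M) : Prop :=
  (∀ e ∈ atlas (Euc (n + 1)) M, ContinuousOn (formInChart φ e) e.target) ∧
    IsCompact (closure {x | φ x ≠ 0}) ∧ closure {x | φ x ≠ 0} ⊆ U

/-- `F` is measurable (up to null sets), read in charts. -/
def IsMeasurableForm (F : RoughForm n M) : Prop :=
  ∀ e ∈ atlas (Euc (n + 1)) M,
    AEStronglyMeasurable (formInChart F e) (volume.restrict e.target)

/-- `dF = 0` in the sense of distributions: `∫_M dχ ∧ F = 0` for every smooth function `χ` with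
compact support in a chart domain. -/
def IsClosedForm (F : RoughForm n M) : Prop :=
  ∀ e ∈ atlas (Euc (n + 1)) M, ∀ χ : Euc (n + 1) → ℝ, IsTestFun e.target χ →
    ∫ z in e.target, wedgeCoeff (fderiv ℝ χ z) (formInChart F e z) = 0

variable [RiemannianBundle (fun x : M => TangentSpace 𝓘(ℝ, Euc (n + 1)) x)]

/-- The pointwise comass `|F_x|` of an `n`-form: the supremum of `|F_x(v_1, …, v_n)|` over tangent
vectors of length at most one. -/
noncomputable def ptComass (F : RoughForm n M) (x : M) : ℝ≥0∞ :=
  ⨆ (v : Fin n → TangentSpace 𝓘(ℝ, Euc (n + 1)) x) (_ : ∀ i, ‖v i‖ ≤ 1),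
    ENNReal.ofReal |F x v|

/-- The comass (`L^∞` norm) of a measurable `n`-form: the essential supremum of its pointwise
comass. A subset of `M` is null if it is null in every chart. -/
noncomputable def comass (F : RoughForm n M) : ℝ≥0∞ :=
  sInf {c | ∀ e ∈ atlas (Euc (n + 1)) M,
    ∀ᵐ z ∂(volume.restrict e.target), ptComass F (e.symm z) ≤ c}

/-- A measurable (`L^∞`) calibration: a measurable closed `n`-form of comass one. -/
structure IsCalibration (F : RoughForm n M) : Prop where
  measurable : IsMeasurableForm F
  closed : IsClosedForm F
  comass_eq : comass F = 1

/-- The mass of the current `T` in the open set `U`: the supremum of `T(φ)` over the continuous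
forms `φ` of comass at most one with compact support in `U`. The mass of `T` is `massOn T univ`. -/
noncomputable def massOn (T : RoughForm n M → ℝ) (U : Set M) : ℝ≥0∞ :=
  ⨆ (φ : RoughForm n M) (_ : IsContCptForm U φ ∧ ∀ x, ptComass φ x ≤ 1), ENNReal.ofReal (T φ)

end Forms

section Hypersurfaces

variable {n : ℕ} {M : Type*} [TopologicalSpace M] [ChartedSpace (Euc (n + 1)) M]

/-- The `i`-th coordinate tangent vector of a parametrized hypersurface `ψ : ℝ^n ⊇ J → M`. -/
noncomputable def coordVec (ψ : Euc n → M) (y : Euc n) (i : Fin n) :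
    TangentSpace 𝓘(ℝ, Euc (n + 1)) (ψ y) :=
  mfderiv 𝓘(ℝ, Euc n) 𝓘(ℝ, Euc (n + 1)) ψ y (stdVec i)

/-- `ψ` restricts to a `C^1` immersion of `J`. -/
def IsC1ImmersionOn (ψ : Euc n → M) (J : Set (Euc n)) : Prop :=
  ContMDiffOn 𝓘(ℝ, Euc n) 𝓘(ℝ, Euc (n + 1)) 1 ψ J ∧
    ∀ y ∈ J, Function.Injective (mfderiv 𝓘(ℝ, Euc n) 𝓘(ℝ, Euc (n + 1)) ψ y)

/-- `f dy^1 ∧ ⋯ ∧ dy^n` is the Anzellotti trace `ψ^* F` of the closed `L^∞` form `F` on the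
oriented hypersurface parametrized by `ψ : J → M`.

Near each of its points, in a chart `e` of the oriented atlas, the hypersurface is the zero set
of a `C^1` function `g` without critical points on `V`, and it is oriented as the boundary of
`Ω = {g < 0}` (an outward vector followed by the oriented tangent basis is positively oriented);
the trace is characterized by the Gauss-Green formula `∫_{∂Ω} χ F = ∫_Ω dχ ∧ F` for all smooth
`χ` with compact support in `V`. -/
def IsTraceDensity (F : RoughForm n M) (ψ : Euc n → M) (J : Set (Euc n)) (f : Euc n → ℝ) : Prop :=
  LocallyIntegrableOn f J ∧
  ∀ y₀ ∈ J, ∃ e ∈ atlas (Euc (n + 1)) M, ∃ V : Set (Euc (n + 1)), ∃ g : Euc (n + 1) → ℝ,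
    ψ y₀ ∈ e.source ∧ IsOpen V ∧ V ⊆ e.target ∧ e (ψ y₀) ∈ V ∧
    ContDiffOn ℝ 1 g V ∧ (∀ z ∈ V, fderiv ℝ g z ≠ 0) ∧
    {z ∈ V | g z = 0} = V ∩ e.symm ⁻¹' (ψ '' J) ∧
    (∀ y ∈ J, ψ y ∈ e.source → e (ψ y) ∈ V →
      ∀ w : Euc (n + 1), 0 < fderiv ℝ g (e (ψ y)) w →
        0 < (EuclideanSpace.basisFun (Fin (n + 1)) ℝ).toBasis.det
          (Fin.cons w (fun i => fderiv ℝ (fun y' => e (ψ y')) y (stdVec i)))) ∧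
    ∀ χ : Euc (n + 1) → ℝ, IsTestFun V χ →
      ∫ y in J ∩ ψ ⁻¹' (e.source ∩ e ⁻¹' V), χ (e (ψ y)) * f y =
        ∫ z in {z ∈ V | g z < 0}, wedgeCoeff (fderiv ℝ χ z) (formInChart F e z)

variable [RiemannianBundle (fun x : M => TangentSpace 𝓘(ℝ, Euc (n + 1)) x)]

/-- The Riemannian area density `√ det ⟨∂_i ψ, ∂_j ψ⟩` of a parametrized hypersurface. -/
noncomputable def areaDensity (ψ : Euc n → M) (y : Euc n) : ℝ :=
  Real.sqrt (Matrix.det (Matrix.of fun i j : Fin n => inner ℝ (coordVec ψ y i) (coordVec ψ y j)))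

/-- The oriented hypersurface parametrized by `ψ : J → M` is calibrated by `F`: the trace of `F`
exists and each compact piece `N` satisfies `∫_N F = vol(N)`; equivalently, `F` pulls back to the
area form. -/
def IsCalibratedPatch (F : RoughForm n M) (ψ : Euc n → M) (J : Set (Euc n)) : Prop :=
  ∃ f : Euc n → ℝ, IsTraceDensity F ψ J f ∧
    ∀ C ⊆ J, IsCompact C → ∫ y in C, f y = ∫ y in C, areaDensity ψ y

end Hypersurfaces

section Laminations

variable (n : ℕ) (M : Type*) [TopologicalSpace M] [ChartedSpace (Euc (n + 1)) M]

/-- A Lipschitz laminar flow box: a Lipschitz coordinate chart `Ψ : I × J → M` (a homeomorphism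
onto an open subset of `M` such that `Ψ` and its inverse are locally Lipschitz, as read in the
charts of `M`) from the product of an open interval and an open box, and a relatively closed set
`K ⊆ I` (the local leaf space) such that `Ψ` restricts to a `C^1` embedding of each
`{k} × J`, `k ∈ K`. -/
structure FlowBox where
  I : Set ℝ
  J : Set (Euc n)
  K : Set ℝ
  chart : OpenPartialHomeomorph (ℝ × Euc n) M
  I_open : IsOpen I
  I_interval : I.OrdConnected
  J_box : ∃ a b : Fin n → ℝ, J = {y | ∀ i, y i ∈ Ioo (a i) (b i)}
  source_eq : chart.source = I ×ˢ J
  K_closed : ∃ C : Set ℝ, IsClosed C ∧ K = C ∩ I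
  lipschitz : ∀ e ∈ atlas (Euc (n + 1)) M,
    LocallyLipschitzOn (chart.source ∩ chart ⁻¹' e.source) (fun p => e (chart p))
  lipschitz_symm : ∀ e ∈ atlas (Euc (n + 1)) M,
    LocallyLipschitzOn (e.target ∩ e.symm ⁻¹' chart.target) (fun z => chart.symm (e.symm z))
  leaf_C1 : ∀ k ∈ K, IsC1ImmersionOn (fun y => chart (k, y)) J

variable {n M}

/-- The parametrization `Ψ(k, ·)` of the plaque of a flow box at height `k`. -/
def FlowBox.leaf (B : FlowBox n M) (k : ℝ) (y : Euc n) : M := B.chart (k, y)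

/-- The plaque `Ψ({k} × J)`. -/
def FlowBox.plaque (B : FlowBox n M) (k : ℝ) : Set M := B.leaf k '' B.J

/-- On `P ×ˢ Q`, which is a neighborhood of a point of the overlap of the flow boxes `B` and `B'`,
the transition map sends plaques of `B` into plaques of `B'`, and acts on the local leaf space
by the injective map `h`. -/
def IsLocalHolonomy (B B' : FlowBox n M) (P : Set ℝ) (Q : Set (Euc n)) (h : ℝ → ℝ) : Prop :=
  IsOpen P ∧ IsOpen Q ∧ P ×ˢ Q ⊆ B.chart.source ∩ B.chart ⁻¹' B'.chart.target ∧
    (∀ k ∈ P ∩ B.K, ∀ y ∈ Q, (B'.chart.symm (B.chart (k, y))).1 = h k) ∧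
    InjOn h (P ∩ B.K)

variable (n M)

/-- A Lipschitz codimension-one lamination: a nonempty closed set `supp` and an atlas of laminar
flow boxes covering it, in each of which `supp` is the union of the plaques, and whose transition
maps preserve the local leaf spaces (they locally map plaques to plaques). The atlas may, but need
not, be maximal. -/
structure Lamination where
  supp : Set M
  atlas : Set (FlowBox n M)
  supp_closed : IsClosed supp
  supp_nonempty : supp.Nonempty
  cover : supp ⊆ ⋃ B ∈ atlas, B.chart.target
  supp_inter : ∀ B ∈ atlas, supp ∩ B.chart.target = B.chart '' (B.K ×ˢ B.J)
  compatible : ∀ B ∈ atlas, ∀ B' ∈ atlas, ∀ k ∈ B.K, ∀ y ∈ B.J, B.chart (k, y) ∈ B'.chart.target →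
    ∃ P Q h, k ∈ P ∧ y ∈ Q ∧ IsLocalHolonomy B B' P Q h

variable {n M}

/-- The lamination is oriented by its atlas: the transition maps preserve the orientation of the
plaques given by the standard orientation of `J ⊆ ℝ^n`. -/
def Lamination.IsOriented (L : Lamination n M) : Prop :=
  ∀ B ∈ L.atlas, ∀ B' ∈ L.atlas, ∀ k ∈ B.K, ∀ y ∈ B.J, B.chart (k, y) ∈ B'.chart.target →
    0 < (fderiv ℝ (fun y' => (B'.chart.symm (B.chart (k, y'))).2) y).det

/-- A transverse measure: Radon measures `μ_B` on the local leaf spaces `K_B` with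
`supp μ_B = K_B`, which are carried to each other by the transition maps. -/
structure TransverseMeasure (L : Lamination n M) where
  μ : L.atlas → Measure ℝ
  radon : ∀ B, ∀ C ⊆ B.1.I, IsCompact C → μ B C < ⊤
  null_compl : ∀ B, μ B (B.1.K)ᶜ = 0
  full_support : ∀ B, ∀ k ∈ B.1.K, ∀ P : Set ℝ, IsOpen P → k ∈ P → 0 < μ B P
  invariant : ∀ B B' : L.atlas, ∀ P Q h, IsLocalHolonomy B.1 B'.1 P Q h → Q.Nonempty →
    ∀ S ⊆ P ∩ B.1.K, MeasurableSet S → μ B' (h '' S) = μ B S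

/-- Two points lie on a common plaque. -/
def Lamination.SamePlaque (L : Lamination n M) (x x' : M) : Prop :=
  ∃ B ∈ L.atlas, ∃ k ∈ B.K, x ∈ B.plaque k ∧ x' ∈ B.plaque k

/-- The leaves of the lamination: the classes of points of `supp` connected by a chain of
plaques. -/
def Lamination.IsLeaf (L : Lamination n M) (N : Set M) : Prop :=
  ∃ x ∈ L.supp, N = {x' | Relation.EqvGen L.SamePlaque x x'}

/-- The Ruelle-Sullivan current of a measured oriented lamination, computed with the partition of
unity `ρ`:
`T(φ) = ∑_B ∫_{K_B} ∫_{J} (ρ_B φ)(Ψ_B(k, y))(∂_1 Ψ_B, …, ∂_n Ψ_B) dy dμ_B(k)`. -/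
noncomputable def ruelleSullivan (L : Lamination n M) (m : TransverseMeasure L)
    (ρ : PartitionOfUnity L.atlas M L.supp) (φ : RoughForm n M) : ℝ :=
  ∑ᶠ B : L.atlas, ∫ k in B.1.K,
    (∫ y in B.1.J, ρ B (B.1.leaf k y) * φ (B.1.leaf k y) (coordVec (B.1.leaf k) y)) ∂(m.μ B)

variable [RiemannianBundle (fun x : M => TangentSpace 𝓘(ℝ, Euc (n + 1)) x)]

/-- A leaf `N` (with the orientation coming from the atlas of `L`) is `F`-calibrated: every
compact piece `N'` of each of its plaques satisfies `∫_{N'} F = vol(N')`. -/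
def Lamination.IsCalibratedLeaf (L : Lamination n M) (F : RoughForm n M) (N : Set M) : Prop :=
  ∀ B ∈ L.atlas, ∀ k ∈ B.K, B.plaque k ⊆ N → IsCalibratedPatch F (B.leaf k) B.J

/-- A lamination is `F`-calibrated if every leaf is. -/
def Lamination.IsCalibrated (L : Lamination n M) (F : RoughForm n M) : Prop :=
  ∀ N, L.IsLeaf N → L.IsCalibratedLeaf F N

end Laminations

section Anzellotti

variable {n : ℕ} {M : Type*} [TopologicalSpace M] [ChartedSpace (Euc (n + 1)) M]

/-- `T = du` in the chart `e` on the open set `V ⊆ e.target`, where `u` is a locally integrable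
function (expressed in the chart): `T(φ) = - ∫ u dφ` for all smooth `φ` compactly supported in
`V`. -/
def IsPotential (T : RoughForm n M → ℝ) (e : OpenPartialHomeomorph M (Euc (n + 1)))
    (V : Set (Euc (n + 1))) (u : Euc (n + 1) → ℝ) : Prop :=
  LocallyIntegrableOn u V ∧
  ∀ η : Euc (n + 1) → Euc (n + 1) [⋀^Fin n]→L[ℝ] ℝ, IsTestFun V η →
    T (formOfChart e η) = - ∫ z in V, u z * topCoeff (extDeriv η z)

variable [MeasurableSpace M]

/-- The integral of a function against a finite signed measure. -/
noncomputable def signedIntegral (ν : SignedMeasure M) (g : M → ℝ) : ℝ :=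
  ∫ x, g x ∂ν.toJordanDecomposition.posPart - ∫ x, g x ∂ν.toJordanDecomposition.negPart

open Classical in
/-- On the open set `U`, the signed measure `ν` is the Anzellotti wedge product `T ∧ F` of a closed
current `T` and a closed `L^∞` form `F`: near each point of `U` one can write `T = du`, and
`∫ χ dν = - ∫ u dχ ∧ F` for all smooth `χ` with compact support near that point. -/
def IsAnzellottiWedgeOn (T : RoughForm n M → ℝ) (F : RoughForm n M) (U : Set M)
    (ν : SignedMeasure M) : Prop :=
  ∀ x ∈ U, ∃ e ∈ atlas (Euc (n + 1)) M, ∃ V : Set (Euc (n + 1)), ∃ u : Euc (n + 1) → ℝ,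
    x ∈ e.source ∧ IsOpen V ∧ V ⊆ e.target ∩ e.symm ⁻¹' U ∧ e x ∈ V ∧ IsPotential T e V u ∧
    ∀ χ : Euc (n + 1) → ℝ, IsTestFun V χ →
      signedIntegral ν (fun x' => if x' ∈ e.source then χ (e x') else 0) =
        - ∫ z in V, u z * wedgeCoeff (fderiv ℝ χ z) (formInChart F e z)

/-- The current `T` is `F`-calibrated in the open set `U`: the Anzellotti product `T ∧ F` is a
finite signed measure on `U`, and `∫_U T ∧ F` is the mass of `T` in `U`. -/
def IsCalibratedCurrentOn [RiemannianBundle (fun x : M => TangentSpace 𝓘(ℝ, Euc (n + 1)) x)]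
    (T : RoughForm n M → ℝ) (F : RoughForm n M) (U : Set M) : Prop :=
  ∃ ν : SignedMeasure M, IsAnzellottiWedgeOn T F U ν ∧ ((ν U : ℝ) : EReal) = (massOn T U : EReal)

end Anzellotti

/-! ### Top-degree forms and hyperplane forms on Euclidean space -/

/-- The determinant of `m` vectors of `ℝ^m`. -/
noncomputable def stdDet {m : ℕ} (v : Fin m → Euc m) : ℝ :=
  (EuclideanSpace.basisFun (Fin m) ℝ).toBasis.det v

lemma stdVec_eq_basis {m : ℕ} :
    (stdVec : Fin m → Euc m) = (EuclideanSpace.basisFun (Fin m) ℝ).toBasis := by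
  funext i
  simp [stdVec]

lemma topForm_apply {m : ℕ} (w : Euc m [⋀^Fin m]→L[ℝ] ℝ) (v : Fin m → Euc m) :
    w v = topCoeff w * stdDet v := by
  have h := AlternatingMap.eq_smul_basis_det (EuclideanSpace.basisFun (Fin m) ℝ).toBasis
    w.toAlternatingMap
  have h2 := congrArg (fun f => f v) h
  simp only [AlternatingMap.smul_apply, smul_eq_mul] at h2
  rw [topCoeff, stdVec_eq_basis]
  exact h2

lemma stdDet_comp {m : ℕ} (A : Euc m →L[ℝ] Euc m) (v : Fin m → Euc m) :
    stdDet (fun i => A (v i)) = A.det * stdDet v :=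
  Module.Basis.det_comp _ (A : Euc m →ₗ[ℝ] Euc m) v

lemma stdDet_stdVec {m : ℕ} : stdDet (stdVec : Fin m → Euc m) = 1 := by
  rw [stdVec_eq_basis, stdDet, Module.Basis.det_self]

lemma det_eq_stdDet {m : ℕ} (A : Euc m →L[ℝ] Euc m) :
    A.det = stdDet (fun i => A (stdVec i)) := by
  rw [stdDet_comp, stdDet_stdVec, mul_one]

lemma topForm_comp {m : ℕ} (w : Euc m [⋀^Fin m]→L[ℝ] ℝ) (A : Euc m →L[ℝ] Euc m) :
    topCoeff (w.compContinuousLinearMap A) = A.det * topCoeff w := by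
  have : topCoeff (w.compContinuousLinearMap A) = w (fun i => A (stdVec i)) := rfl
  rw [this, topForm_apply, det_eq_stdDet, mul_comm]

/-- The value of an `n`-form on `ℝ^{n+1}` on the standard basis with the `i`-th vector omitted. -/
noncomputable def omitCoeff {n : ℕ} (w : Euc (n + 1) [⋀^Fin n]→L[ℝ] ℝ) (i : Fin (n + 1)) : ℝ :=
  w (fun j => stdVec (i.succAbove j))

/-- The vector `X` with `w = ι_X (dx^0 ∧ ⋯ ∧ dx^n)`. -/
noncomputable def formVec {n : ℕ} (w : Euc (n + 1) [⋀^Fin n]→L[ℝ] ℝ) : Euc (n + 1) :=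
  ∑ i : Fin (n + 1), ((-1) ^ (i : ℕ) * omitCoeff w i) • stdVec i

lemma wedge_apply {n : ℕ} (ℓ : Euc (n + 1) →L[ℝ] ℝ) (w : Euc (n + 1) [⋀^Fin n]→L[ℝ] ℝ)
    (v : Fin (n + 1) → Euc (n + 1)) :
    ContinuousAlternatingMap.alternatizeUncurryFin (ℓ.smulRight w) v =
      ∑ i : Fin (n + 1), (-1) ^ (i : ℕ) * (ℓ (v i) * w (fun j => v (i.succAbove j))) := by
  rw [ContinuousAlternatingMap.alternatizeUncurryFin_apply]
  refine Finset.sum_congr rfl fun i _ => ?_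
  simp only [ContinuousLinearMap.smulRight_apply, ContinuousAlternatingMap.smul_apply, smul_eq_mul,
    zsmul_eq_mul]
  push_cast
  rfl

lemma wedgeCoeff_eq {n : ℕ} (ℓ : Euc (n + 1) →L[ℝ] ℝ) (w : Euc (n + 1) [⋀^Fin n]→L[ℝ] ℝ) :
    wedgeCoeff ℓ w = ℓ (formVec w) := by
  rw [wedgeCoeff, topCoeff, wedge_apply, formVec, map_sum]
  refine Finset.sum_congr rfl fun i _ => ?_
  rw [map_smul, smul_eq_mul, omitCoeff]
  ring

lemma wedge_apply_cons {n : ℕ} (ℓ : Euc (n + 1) →L[ℝ] ℝ) (w : Euc (n + 1) [⋀^Fin n]→L[ℝ] ℝ)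
    (x : Euc (n + 1)) (v : Fin n → Euc (n + 1)) (hv : ∀ i, ℓ (v i) = 0) :
    ContinuousAlternatingMap.alternatizeUncurryFin (ℓ.smulRight w) (Fin.cons x v) = ℓ x * w v := by
  rw [wedge_apply, Fin.sum_univ_succ]
  simp [hv]

/-- `(ℓ ∧ w)(x, v) = ℓ(x) w(v)` when `ℓ` vanishes on the vectors `v`. -/
lemma wedgeCoeff_mul_stdDet {n : ℕ} (ℓ : Euc (n + 1) →L[ℝ] ℝ)
    (w : Euc (n + 1) [⋀^Fin n]→L[ℝ] ℝ) (x : Euc (n + 1)) (v : Fin n → Euc (n + 1))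
    (hv : ∀ i, ℓ (v i) = 0) :
    wedgeCoeff ℓ w * stdDet (Fin.cons x v : Fin (n + 1) → Euc (n + 1)) = ℓ x * w v := by
  rw [← wedge_apply_cons ℓ w x v hv, topForm_apply, wedgeCoeff]

lemma wedgeCoeff_comp {n : ℕ} (ℓ : Euc (n + 1) →L[ℝ] ℝ) (w : Euc (n + 1) [⋀^Fin n]→L[ℝ] ℝ)
    (A : Euc (n + 1) →L[ℝ] Euc (n + 1)) :
    wedgeCoeff (ℓ.comp A) (w.compContinuousLinearMap A) = A.det * wedgeCoeff ℓ w := by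
  rw [wedgeCoeff, wedgeCoeff, ← topForm_comp]
  congr 1
  ext v
  rw [wedge_apply, ContinuousAlternatingMap.compContinuousLinearMap_apply, wedge_apply]
  rfl

lemma stdDet_cons_add {n : ℕ} (x y : Euc (n + 1)) (v : Fin n → Euc (n + 1)) :
    stdDet (Fin.cons (x + y) v : Fin (n + 1) → Euc (n + 1)) =
      stdDet (Fin.cons x v : Fin (n + 1) → Euc (n + 1)) +
      stdDet (Fin.cons y v : Fin (n + 1) → Euc (n + 1)) :=
  MultilinearMap.cons_add
    (EuclideanSpace.basisFun (Fin (n + 1)) ℝ).toBasis.det.toMultilinearMap v x y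

lemma stdDet_cons_smul {n : ℕ} (c : ℝ) (x : Euc (n + 1)) (v : Fin n → Euc (n + 1)) :
    stdDet (Fin.cons (c • x) v : Fin (n + 1) → Euc (n + 1)) =
      c * stdDet (Fin.cons x v : Fin (n + 1) → Euc (n + 1)) :=
  MultilinearMap.cons_smul
    (EuclideanSpace.basisFun (Fin (n + 1)) ℝ).toBasis.det.toMultilinearMap v c x

lemma stdDet_ne_zero_iff {m : ℕ} (v : Fin m → Euc m) :
    stdDet v ≠ 0 ↔ LinearIndependent ℝ v := by
  have := (EuclideanSpace.basisFun (Fin m) ℝ).toBasis.is_basis_iff_det (v := v)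
  rw [stdDet, ← isUnit_iff_ne_zero, ← this]
  refine ⟨fun h => h.1, fun h => ⟨h, ?_⟩⟩
  exact h.span_eq_top_of_card_eq_finrank' (by simp)

lemma stdDet_cons_eq_zero_of_mem_span {n : ℕ} {x : Euc (n + 1)} {v : Fin n → Euc (n + 1)}
    (hx : x ∈ Submodule.span ℝ (range v)) :
    stdDet (Fin.cons x v : Fin (n + 1) → Euc (n + 1)) = 0 := by
  by_contra h
  have h1 := (stdDet_ne_zero_iff _).1 h
  rw [linearIndependent_finCons] at h1
  exact h1.2 hx

lemma exists_stdDet_cons_pos {n : ℕ} {v : Fin n → Euc (n + 1)} (hv : LinearIndependent ℝ v) :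
    ∃ x, 0 < stdDet (Fin.cons x v : Fin (n + 1) → Euc (n + 1)) := by
  obtain ⟨x, hx⟩ : ∃ x, x ∉ Submodule.span ℝ (range v) := by
    by_contra! h
    have h1 : Submodule.span ℝ (range v) = ⊤ := by
      rw [eq_top_iff]; intro x _; exact h x
    have h2 := finrank_span_eq_card hv
    rw [h1] at h2
    simp at h2
  have h1 : stdDet (Fin.cons x v : Fin (n + 1) → Euc (n + 1)) ≠ 0 := by
    rw [stdDet_ne_zero_iff, linearIndependent_finCons]
    exact ⟨hv, hx⟩
  rcases lt_or_gt_of_ne h1 with h | h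
  · refine ⟨(-1 : ℝ) • x, ?_⟩
    rw [stdDet_cons_smul]; linarith
  · exact ⟨x, h⟩

/-- A covector vanishing on a hyperplane `span v` is determined by its value on a transverse
vector. -/
lemma covector_mul_stdDet {n : ℕ} (ℓ : Euc (n + 1) →L[ℝ] ℝ) {v : Fin n → Euc (n + 1)}
    (hli : LinearIndependent ℝ v) (hv : ∀ i, ℓ (v i) = 0) (x y : Euc (n + 1)) :
    ℓ y * stdDet (Fin.cons x v : Fin (n + 1) → Euc (n + 1)) =
      ℓ x * stdDet (Fin.cons y v : Fin (n + 1) → Euc (n + 1)) := by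
  obtain ⟨u, hu⟩ := exists_stdDet_cons_pos hli
  have key : ∀ z, stdDet (Fin.cons z v : Fin (n + 1) → Euc (n + 1)) * ℓ u =
      stdDet (Fin.cons u v : Fin (n + 1) → Euc (n + 1)) * ℓ z := by
    intro z
    have hz : z ∈ Submodule.span ℝ (range (Fin.cons u v : Fin (n + 1) → Euc (n + 1))) := by
      have := ((stdDet_ne_zero_iff _).1 hu.ne').span_eq_top_of_card_eq_finrank' (by simp)
      rw [this]; trivial
    rw [Fin.range_cons, Submodule.mem_span_insert] at hz
    obtain ⟨a, s, hs, rfl⟩ := hz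
    have h0 : ℓ s = 0 := by
      have : Submodule.span ℝ (range v) ≤ LinearMap.ker (ℓ : Euc (n + 1) →ₗ[ℝ] ℝ) := by
        rw [Submodule.span_le]; rintro _ ⟨i, rfl⟩; exact hv i
      exact this hs
    rw [stdDet_cons_add, stdDet_cons_smul, stdDet_cons_eq_zero_of_mem_span hs]
    simp [h0]; ring
  have h1 := key x
  have h2 := key y
  have : stdDet (Fin.cons u v : Fin (n + 1) → Euc (n + 1)) ≠ 0 := hu.ne'
  apply mul_left_cancel₀ this
  linear_combination (-stdDet (Fin.cons x v : Fin (n + 1) → Euc (n + 1))) * h2 +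
    stdDet (Fin.cons y v : Fin (n + 1) → Euc (n + 1)) * h1

lemma form_apply_eq_stdDet {n : ℕ} (w : Euc (n + 1) [⋀^Fin n]→L[ℝ] ℝ) (v : Fin n → Euc (n + 1)) :
    w v = stdDet (Fin.cons (formVec w) v : Fin (n + 1) → Euc (n + 1)) := by
  by_cases hv : LinearIndependent ℝ v
  · obtain ⟨u, hu⟩ := exists_stdDet_cons_pos hv
    let ℓ₀ : Euc (n + 1) →ₗ[ℝ] ℝ :=
      ((EuclideanSpace.basisFun (Fin (n + 1)) ℝ).toBasis.det.toMultilinearMap.toLinearMap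
        (Fin.cons u v) 0)
    have hℓ₀ : ∀ y, ℓ₀ y = stdDet (Fin.cons y v : Fin (n + 1) → Euc (n + 1)) := by
      intro y
      have : Function.update (Fin.cons u v : Fin (n + 1) → Euc (n + 1)) 0 y = Fin.cons y v :=
        Fin.update_cons_zero _ _ _
      change (EuclideanSpace.basisFun (Fin (n + 1)) ℝ).toBasis.det (Function.update _ 0 y) = _
      rw [this, stdDet]
    let ℓ := ℓ₀.toContinuousLinearMap
    have hℓ : ∀ y, ℓ y = stdDet (Fin.cons y v : Fin (n + 1) → Euc (n + 1)) := hℓ₀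
    have hz : ∀ i, ℓ (v i) = 0 := fun i => by
      rw [hℓ]; exact stdDet_cons_eq_zero_of_mem_span (Submodule.subset_span ⟨i, rfl⟩)
    have h1 := wedgeCoeff_mul_stdDet ℓ w u v hz
    rw [wedgeCoeff_eq, hℓ, hℓ] at h1
    have := hu.ne'
    rw [mul_comm] at h1
    exact (mul_left_cancel₀ this h1).symm
  · have h1 : w v = 0 := w.toAlternatingMap.map_linearDependent v hv
    rw [h1]
    by_contra h
    have := (stdDet_ne_zero_iff _).1 (Ne.symm h)
    rw [linearIndependent_finCons] at this
    exact hv this.1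

lemma continuous_stdDet {m : ℕ} : Continuous (stdDet : (Fin m → Euc m) → ℝ) := by
  have : (stdDet : (Fin m → Euc m) → ℝ) = fun v => Matrix.det (Matrix.of fun i j => v j i) := by
    funext v
    rw [stdDet, Module.Basis.det_apply]
    congr 1
  rw [this]
  refine Continuous.matrix_det ?_
  exact continuous_matrix fun i j => by
    simp only [Matrix.of_apply]; fun_prop

/-- The determinant as a continuous alternating form. -/
noncomputable def detForm (m : ℕ) : Euc m [⋀^Fin m]→L[ℝ] ℝ :=
  { (EuclideanSpace.basisFun (Fin m) ℝ).toBasis.det with cont := continuous_stdDet }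

/-- The `n`-form `ι_X (dx^0 ∧ ⋯ ∧ dx^n)`, as a linear function of `X`. -/
noncomputable def vecForm (n : ℕ) : Euc (n + 1) →L[ℝ] Euc (n + 1) [⋀^Fin n]→L[ℝ] ℝ :=
  (detForm (n + 1)).curryLeft

lemma vecForm_apply {n : ℕ} (x : Euc (n + 1)) (v : Fin n → Euc (n + 1)) :
    vecForm n x v = stdDet (Fin.cons x v : Fin (n + 1) → Euc (n + 1)) := rfl

lemma vecForm_formVec {n : ℕ} (w : Euc (n + 1) [⋀^Fin n]→L[ℝ] ℝ) : vecForm n (formVec w) = w := by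
  ext v
  rw [vecForm_apply, ← form_apply_eq_stdDet]

lemma formVec_vecForm {n : ℕ} (x : Euc (n + 1)) : formVec (vecForm n x) = x := by
  refine EuclideanSpace.basisFun (Fin (n + 1)) ℝ |>.toBasis.ext_elem fun i => ?_
  have hi : ∀ y : Euc (n + 1), (EuclideanSpace.basisFun (Fin (n + 1)) ℝ).toBasis.repr y i =
      (EuclideanSpace.proj i : Euc (n + 1) →L[ℝ] ℝ) y := fun y => by simp
  rw [hi, hi, ← wedgeCoeff_eq]
  have hl : ∀ j : Fin n, (EuclideanSpace.proj i : Euc (n + 1) →L[ℝ] ℝ) (stdVec (i.succAbove j)) = 0 := by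
    intro j
    simp [stdVec]
  have hli : LinearIndependent ℝ (fun j => stdVec (i.succAbove j) : Fin n → Euc (n + 1)) := by
    have : LinearIndependent ℝ (stdVec : Fin (n + 1) → Euc (n + 1)) := by
      rw [stdVec_eq_basis]; exact Module.Basis.linearIndependent _
    exact this.comp _ Fin.succAbove_right_injective
  have h1 := wedgeCoeff_mul_stdDet _ (vecForm n x) (stdVec i) _ hl
  have h2 := covector_mul_stdDet (EuclideanSpace.proj i : Euc (n + 1) →L[ℝ] ℝ) hli hl (stdVec i) x
  rw [vecForm_apply, ← h2] at h1
  have h3 : LinearIndependent ℝ (Fin.cons (stdVec i) (fun j => stdVec (i.succAbove j)) :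
      Fin (n + 1) → Euc (n + 1)) := by
    rw [linearIndependent_finCons]
    refine ⟨hli, fun h => ?_⟩
    have : Submodule.span ℝ (range fun j => (stdVec (i.succAbove j) : Euc (n + 1))) ≤
        LinearMap.ker ((EuclideanSpace.proj i : Euc (n + 1) →L[ℝ] ℝ) : Euc (n + 1) →ₗ[ℝ] ℝ) := by
      rw [Submodule.span_le]; rintro _ ⟨j, rfl⟩; exact hl j
    have h4 : (EuclideanSpace.proj i : Euc (n + 1) →L[ℝ] ℝ) (stdVec i) = 0 := this h
    simp [stdVec] at h4
  exact mul_right_cancel₀ ((stdDet_ne_zero_iff _).2 h3) h1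

lemma continuous_formVec {n : ℕ} :
    Continuous (formVec : (Euc (n + 1) [⋀^Fin n]→L[ℝ] ℝ) → Euc (n + 1)) := by
  unfold formVec omitCoeff
  refine continuous_finsetSum _ fun i _ => ?_
  have : Continuous fun w : Euc (n + 1) [⋀^Fin n]→L[ℝ] ℝ =>
      w (fun j => stdVec (i.succAbove j)) :=
    (ContinuousAlternatingMap.apply ℝ (Euc (n+1)) ℝ (fun j => stdVec (i.succAbove j))).continuous
  exact (continuous_const.mul this).smul continuous_const

/-- `w ↦ X` where `w = ι_X (dx^0 ∧ ⋯ ∧ dx^n)`, as a continuous linear map. -/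
noncomputable def formVecL (n : ℕ) : (Euc (n + 1) [⋀^Fin n]→L[ℝ] ℝ) →L[ℝ] Euc (n + 1) where
  toFun := formVec
  map_add' w w' := by
    simp [formVec, omitCoeff, mul_add, add_smul, Finset.sum_add_distrib]
  map_smul' c w := by
    simp only [formVec, omitCoeff, ContinuousAlternatingMap.smul_apply, smul_eq_mul,
      RingHom.id_apply, Finset.smul_sum, smul_smul]
    exact Finset.sum_congr rfl fun i _ => by congr 1; ring
  cont := continuous_formVec

/-- The exterior derivative of `ι_Y (dx^0 ∧ ⋯ ∧ dx^n)` is the divergence of `Y`. -/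
lemma topCoeff_extDeriv {n : ℕ} {η : Euc (n + 1) → Euc (n + 1) [⋀^Fin n]→L[ℝ] ℝ} {z : Euc (n + 1)}
    (hη : DifferentiableAt ℝ η z) :
    topCoeff (extDeriv η z) = ∑ i, wedgeCoeff (fderiv ℝ (fun x => formVec (η x) i) z)
      (vecForm n (stdVec i)) := by
  have hd : ∀ i, fderiv ℝ (fun x => formVec (η x) i) z =
      (EuclideanSpace.proj i : Euc (n + 1) →L[ℝ] ℝ).comp ((formVecL n).comp (fderiv ℝ η z)) := by
    intro i
    have h1 : HasFDerivAt (fun x => formVec (η x) i) ((EuclideanSpace.proj i :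
        Euc (n + 1) →L[ℝ] ℝ).comp ((formVecL n).comp (fderiv ℝ η z))) z := by
      have h2 : HasFDerivAt (fun x => formVecL n (η x)) ((formVecL n).comp (fderiv ℝ η z)) z :=
        (formVecL n).hasFDerivAt.comp z hη.hasFDerivAt
      exact (EuclideanSpace.proj i : Euc (n + 1) →L[ℝ] ℝ).hasFDerivAt.comp z h2
    exact h1.fderiv
  have hl : ∀ i : Fin (n + 1), wedgeCoeff (fderiv ℝ (fun x => formVec (η x) i) z)
      (vecForm n (stdVec i)) = formVec (fderiv ℝ η z (stdVec i)) i := by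
    intro i
    rw [wedgeCoeff_eq, hd, formVec_vecForm]
    rfl
  simp_rw [hl]
  rw [extDeriv, topCoeff, ContinuousAlternatingMap.alternatizeUncurryFin_apply]
  refine Finset.sum_congr rfl fun i _ => ?_
  simp only [formVec, stdVec, omitCoeff]
  simp only [WithLp.ofLp_sum, Finset.sum_apply, PiLp.smul_apply, PiLp.single_apply, smul_eq_mul,
    mul_ite, mul_one, mul_zero, Finset.sum_ite_eq, Finset.mem_univ, if_true, zsmul_eq_mul]
  push_cast
  rfl

lemma det_gram_eq_sq {V : Type*} [NormedAddCommGroup V] [InnerProductSpace ℝ V] {n : ℕ}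
    (b : OrthonormalBasis (Fin n) ℝ V) (v : Fin n → V) :
    (Matrix.gram ℝ v).det = b.toBasis.det v ^ 2 := by
  have : Matrix.gram ℝ v = (b.toBasis.toMatrix v).transpose * (b.toBasis.toMatrix v) := by
    ext i j
    rw [Matrix.gram_apply, Matrix.mul_apply, ← b.sum_inner_mul_inner]
    refine Finset.sum_congr rfl fun k _ => ?_
    simp [Module.Basis.toMatrix_apply, b.repr_apply_apply, real_inner_comm]
  rw [this, Matrix.det_mul, Matrix.det_transpose, Module.Basis.det_apply, sq]

/-- The comass inequality `|φ(v)| ≤ |φ| vol(v)`. -/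
lemma abs_alternating_le_sqrt_det_gram {V : Type*} [NormedAddCommGroup V] [InnerProductSpace ℝ V]
    [FiniteDimensional ℝ V] {n : ℕ} (φ : V [⋀^Fin n]→ₗ[ℝ] ℝ) {c : ℝ} (hc : 0 ≤ c)
    (hφ : ∀ v, (∀ i, ‖v i‖ ≤ 1) → |φ v| ≤ c) (v : Fin n → V) :
    |φ v| ≤ c * √(Matrix.gram ℝ v).det := by
  by_cases hv : LinearIndependent ℝ v
  · let S := Submodule.span ℝ (range v)
    have hS : Module.finrank ℝ S = n := by simpa using finrank_span_eq_card hv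
    let b : OrthonormalBasis (Fin n) ℝ S := (stdOrthonormalBasis ℝ S).reindex (finCongr hS)
    let v' : Fin n → S := fun i => ⟨v i, Submodule.subset_span ⟨i, rfl⟩⟩
    have h1 := AlternatingMap.eq_smul_basis_det b.toBasis (φ.compLinearMap S.subtype)
    have h2 := congrArg (fun f => f v') h1
    simp only [AlternatingMap.smul_apply, AlternatingMap.compLinearMap_apply, smul_eq_mul] at h2
    have h3 : φ v = φ (fun i => (b i : V)) * b.toBasis.det v' := by
      simpa [v'] using h2
    have h4 : (Matrix.gram ℝ v).det = b.toBasis.det v' ^ 2 := by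
      rw [← det_gram_eq_sq b v']
      rfl
    rw [h3, h4, Real.sqrt_sq_eq_abs, abs_mul]
    gcongr
    exact hφ _ fun i => (b.norm_eq_one i).le
  · rw [show φ v = 0 from φ.map_linearDependent v hv, abs_zero]
    positivity

/-- Every independent family of vectors is calibrated by some form of comass at most one. -/
lemma exists_alternating_eq_sqrt_det_gram {V : Type*} [NormedAddCommGroup V]
    [InnerProductSpace ℝ V] [FiniteDimensional ℝ V] {n : ℕ} {v : Fin n → V}
    (hv : LinearIndependent ℝ v) :
    ∃ φ : V [⋀^Fin n]→ₗ[ℝ] ℝ, (∀ x, |φ x| ≤ ∏ i, ‖x i‖) ∧ φ v = √(Matrix.gram ℝ v).det := by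
  let S := Submodule.span ℝ (range v)
  have hS : Module.finrank ℝ S = n := by simpa using finrank_span_eq_card hv
  let b : OrthonormalBasis (Fin n) ℝ S := (stdOrthonormalBasis ℝ S).reindex (finCongr hS)
  let v' : Fin n → S := fun i => ⟨v i, Submodule.subset_span ⟨i, rfl⟩⟩
  let s : ℝ := SignType.sign (b.toBasis.det v')
  have hs : |s| ≤ 1 := by
    rcases SignType.trichotomy (SignType.sign (b.toBasis.det v')) with h | h | h <;> simp [s, h]
  have : Fact (Module.finrank ℝ S = n) := ⟨hS⟩
  refine ⟨s • (b.toBasis.det.compLinearMap (S.orthogonalProjectionOnto : V →ₗ[ℝ] S)), fun x => ?_, ?_⟩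
  · rw [AlternatingMap.smul_apply, AlternatingMap.compLinearMap_apply, smul_eq_mul, abs_mul,
      ← Orientation.volumeForm_robust' b.toBasis.orientation b]
    calc _ ≤ 1 * ∏ i, ‖S.orthogonalProjectionOnto (x i)‖ := by
          gcongr
          exact Orientation.abs_volumeForm_apply_le _ _
      _ ≤ 1 * ∏ i, ‖x i‖ := by
          gcongr
          exact S.norm_orthogonalProjectionOnto_apply_le _
      _ = _ := one_mul _
  · have h4 : (Matrix.gram ℝ v).det = b.toBasis.det v' ^ 2 := by
      rw [← det_gram_eq_sq b v']
      rfl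
    have h5 : (fun i => (S.orthogonalProjectionOnto : V →ₗ[ℝ] S) (v i)) = v' := by
      funext i
      exact S.orthogonalProjectionOnto_mem_subspace_eq_self (v' i)
    rw [AlternatingMap.smul_apply, AlternatingMap.compLinearMap_apply, h5, smul_eq_mul, h4,
      Real.sqrt_sq_eq_abs]
    exact sign_mul_self _

lemma exists_alternating_comp_eq_sqrt_det_gram {V : Type*} [NormedAddCommGroup V]
    [InnerProductSpace ℝ V] {m n : ℕ} (A : Euc m ≃ₗ[ℝ] V) {v : Fin n → Euc m}
    (hv : LinearIndependent ℝ v) :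
    ∃ w : Euc m [⋀^Fin n]→L[ℝ] ℝ, (∀ u, (∀ i, ‖A (u i)‖ ≤ 1) → |w u| ≤ 1) ∧
      w v = √(Matrix.gram ℝ fun i => A (v i)).det := by
  have hfin : FiniteDimensional ℝ V := A.finiteDimensional
  have h1 : LinearIndependent ℝ (fun i => A (v i)) := hv.map' (A : Euc m →ₗ[ℝ] V) A.ker
  obtain ⟨φ, hφ, hφv⟩ := exists_alternating_eq_sqrt_det_gram h1
  refine ⟨(φ.mkContinuous 1 fun m => by rw [one_mul]; exact hφ m).compContinuousLinearMap
    (A : Euc m →ₗ[ℝ] V).toContinuousLinearMap, fun u hu => ?_, hφv⟩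
  calc _ ≤ ∏ i, ‖A (u i)‖ := hφ _
    _ ≤ 1 := Finset.prod_le_one (fun _ _ => norm_nonneg _) fun i _ => hu i

lemma sqrt_det_gram_comp_pos {V : Type*} [NormedAddCommGroup V]
    [InnerProductSpace ℝ V] {m n : ℕ} (A : Euc m ≃ₗ[ℝ] V) {v : Fin n → Euc m}
    (hv : LinearIndependent ℝ v) : 0 < √(Matrix.gram ℝ fun i => A (v i)).det := by
  have h1 : LinearIndependent ℝ (fun i => A (v i)) := hv.map' (A : Euc m →ₗ[ℝ] V) A.ker
  have h2 := Matrix.det_gram_ne_zero_iff_linearIndependent.2 h1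
  exact Real.sqrt_pos.2 (lt_of_le_of_ne (Matrix.posSemidef_gram ℝ _).det_nonneg h2.symm)

section ChartForms

variable {n : ℕ} {M : Type*} [TopologicalSpace M] [ChartedSpace (Euc (n + 1)) M]

local notation "𝓔" => 𝓘(ℝ, Euc (n + 1))

lemma mfderiv_chart_symm_comp [IsManifold 𝓘(ℝ, Euc (n + 1)) ∞ M]
    {e : OpenPartialHomeomorph M (Euc (n + 1))}
    (he : e ∈ atlas (Euc (n + 1)) M) {x : M} (hx : x ∈ e.source) :
    (mfderiv 𝓔 𝓔 e.symm (e x)).comp (mfderiv 𝓔 𝓔 e x) = ContinuousLinearMap.id ℝ _ := by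
  have : IsManifold 𝓘(ℝ, Euc (n + 1)) 1 M := IsManifold.of_le (n := ∞) (by simp)
  exact (mdifferentiable_of_mem_atlas he).symm_comp_deriv hx

lemma mfderiv_chart_comp_symm [IsManifold 𝓘(ℝ, Euc (n + 1)) ∞ M]
    {e : OpenPartialHomeomorph M (Euc (n + 1))}
    (he : e ∈ atlas (Euc (n + 1)) M) {z : Euc (n + 1)} (hz : z ∈ e.target) :
    (mfderiv 𝓔 𝓔 e (e.symm z)).comp (mfderiv 𝓔 𝓔 e.symm z) = ContinuousLinearMap.id ℝ _ := by
  have : IsManifold 𝓘(ℝ, Euc (n + 1)) 1 M := IsManifold.of_le (n := ∞) (by simp)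
  exact (mdifferentiable_of_mem_atlas he).comp_symm_deriv hz

/-- Tangent vectors at `x` with the model space as their type. -/
def toTan (x : M) (v : Euc (n + 1)) : TangentSpace 𝓘(ℝ, Euc (n + 1)) x := v

/-- The differential of a chart, with values in the model space. -/
noncomputable def tanChart (e : OpenPartialHomeomorph M (Euc (n + 1))) (x : M)
    (v : TangentSpace 𝓘(ℝ, Euc (n + 1)) x) : Euc (n + 1) := mfderiv 𝓔 𝓔 e x v

/-- The differential of the inverse of a chart, as a function on the model space. -/
noncomputable def chartTan (e : OpenPartialHomeomorph M (Euc (n + 1))) (z v : Euc (n + 1)) :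
    TangentSpace 𝓘(ℝ, Euc (n + 1)) (e.symm z) := mfderiv 𝓔 𝓔 e.symm z v

lemma chartTan_tanChart [IsManifold 𝓘(ℝ, Euc (n + 1)) ∞ M]
    {e : OpenPartialHomeomorph M (Euc (n + 1))}
    (he : e ∈ atlas (Euc (n + 1)) M) {x : M} (hx : x ∈ e.source) (v : Euc (n + 1)) :
    chartTan e (e x) (tanChart e x (toTan x v)) = toTan _ v :=
  congrArg (fun A => A v) (mfderiv_chart_symm_comp he hx)

lemma tanChart_chartTan [IsManifold 𝓘(ℝ, Euc (n + 1)) ∞ M]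
    {e : OpenPartialHomeomorph M (Euc (n + 1))}
    (he : e ∈ atlas (Euc (n + 1)) M) {z : Euc (n + 1)} (hz : z ∈ e.target) (v : Euc (n + 1)) :
    tanChart e (e.symm z) (chartTan e z v) = v :=
  congrArg (fun A => A v) (mfderiv_chart_comp_symm he hz)

lemma formInChart_apply (φ : RoughForm n M) (e : OpenPartialHomeomorph M (Euc (n + 1)))
    (z : Euc (n + 1)) (v : Fin n → Euc (n + 1)) :
    formInChart φ e z v = φ (e.symm z) (fun i => chartTan e z (v i)) := rfl

lemma form_congr_point (φ : RoughForm n M) {x x' : M} (h : x' = x) (v : Fin n → Euc (n + 1)) :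
    φ x' (fun i => toTan x' (v i)) = φ x (fun i => toTan x (v i)) := by
  subst h; rfl

/-- Evaluating a form at a point of a chart domain, in the chart. -/
lemma form_apply_eq_formInChart [IsManifold 𝓘(ℝ, Euc (n + 1)) ∞ M] (φ : RoughForm n M)
    {e : OpenPartialHomeomorph M (Euc (n + 1))} (he : e ∈ atlas (Euc (n + 1)) M) {x : M}
    (hx : x ∈ e.source) (v : Fin n → TangentSpace 𝓘(ℝ, Euc (n + 1)) x) :
    φ x v = formInChart φ e (e x) (fun i => tanChart e x (v i)) := by
  rw [formInChart_apply]
  have h2 : φ x v = φ (e.symm (e x)) (fun i => toTan (e.symm (e x)) (v i)) :=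
    (form_congr_point φ (e.left_inv hx) v).symm
  rw [h2]
  exact congrArg _ (funext fun i => (chartTan_tanChart he hx (v i)).symm)

/-- The chain rule for a parametrization read in a chart. -/
lemma tanChart_mfderiv [IsManifold 𝓘(ℝ, Euc (n + 1)) ∞ M]
    {e : OpenPartialHomeomorph M (Euc (n + 1))} (he : e ∈ atlas (Euc (n + 1)) M)
    {ψ : Euc n → M} {y : Euc n} (hψ : MDifferentiableAt 𝓘(ℝ, Euc n) 𝓔 ψ y)
    (hy : ψ y ∈ e.source) :
    DifferentiableAt ℝ (fun y' => e (ψ y')) y ∧ ∀ v : Euc n,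
    tanChart e (ψ y) (mfderiv 𝓘(ℝ, Euc n) 𝓔 ψ y v) = fderiv ℝ (fun y' => e (ψ y')) y v := by
  have : IsManifold 𝓘(ℝ, Euc (n + 1)) 1 M := IsManifold.of_le (n := ∞) (by simp)
  have he' : MDifferentiableAt 𝓔 𝓔 e (ψ y) := mdifferentiableAt_atlas he hy
  have h1 := he'.comp y hψ
  have h2 := mfderiv_comp y he' hψ
  rw [mfderiv_eq_fderiv] at h2
  refine ⟨mdifferentiableAt_iff_differentiableAt.1 h1, fun v => ?_⟩
  exact (congrArg (fun A => A v) h2).symm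

lemma form_coordVec_eq [IsManifold 𝓘(ℝ, Euc (n + 1)) ∞ M] (φ : RoughForm n M)
    {e : OpenPartialHomeomorph M (Euc (n + 1))} (he : e ∈ atlas (Euc (n + 1)) M)
    {ψ : Euc n → M} {y : Euc n} (hψ : MDifferentiableAt 𝓘(ℝ, Euc n) 𝓔 ψ y)
    (hy : ψ y ∈ e.source) :
    φ (ψ y) (coordVec ψ y) =
      formInChart φ e (e (ψ y)) (fun i => fderiv ℝ (fun y' => e (ψ y')) y (stdVec i)) := by
  rw [form_apply_eq_formInChart φ he hy]
  exact congrArg _ (funext fun i => (tanChart_mfderiv he hψ hy).2 (stdVec i))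

lemma formOfChart_apply {e : OpenPartialHomeomorph M (Euc (n + 1))}
    (η : Euc (n + 1) → Euc (n + 1) [⋀^Fin n]→L[ℝ] ℝ) {x : M} (hx : x ∈ e.source)
    (v : Fin n → TangentSpace 𝓘(ℝ, Euc (n + 1)) x) :
    formOfChart e η x v = η (e x) (fun i => tanChart e x (v i)) := by
  rw [formOfChart, if_pos hx]
  rfl

lemma formOfChart_of_notMem {e : OpenPartialHomeomorph M (Euc (n + 1))}
    (η : Euc (n + 1) → Euc (n + 1) [⋀^Fin n]→L[ℝ] ℝ) {x : M} (hx : x ∉ e.source) :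
    formOfChart e η x = 0 := if_neg hx

lemma formInChart_formOfChart [IsManifold 𝓘(ℝ, Euc (n + 1)) ∞ M]
    {e : OpenPartialHomeomorph M (Euc (n + 1))} (he : e ∈ atlas (Euc (n + 1)) M)
    (η : Euc (n + 1) → Euc (n + 1) [⋀^Fin n]→L[ℝ] ℝ) {z : Euc (n + 1)} (hz : z ∈ e.target) :
    formInChart (formOfChart e η) e z = η z := by
  ext v
  rw [formInChart_apply, formOfChart_apply η (e.map_target hz), e.right_inv hz]
  exact congrArg _ (funext fun i => tanChart_chartTan he hz (v i))

/-- The change of charts. -/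
lemma fderiv_transition_apply [IsManifold 𝓘(ℝ, Euc (n + 1)) ∞ M]
    {e e' : OpenPartialHomeomorph M (Euc (n + 1))} (he : e ∈ atlas (Euc (n + 1)) M)
    (he' : e' ∈ atlas (Euc (n + 1)) M) {z : Euc (n + 1)} (hz : z ∈ e.target)
    (hz' : e.symm z ∈ e'.source) (v : Euc (n + 1)) :
    fderiv ℝ (fun z => e' (e.symm z)) z v = tanChart e' (e.symm z) (chartTan e z v) := by
  have : IsManifold 𝓘(ℝ, Euc (n + 1)) 1 M := IsManifold.of_le (n := ∞) (by simp)
  have h1 : MDifferentiableAt 𝓔 𝓔 e' (e.symm z) := mdifferentiableAt_atlas he' hz'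
  have h2 : MDifferentiableAt 𝓔 𝓔 e.symm z := mdifferentiableAt_atlas_symm he hz
  have h3 := mfderiv_comp z h1 h2
  rw [mfderiv_eq_fderiv] at h3
  exact congrArg (fun A => A v) h3

lemma formInChart_transition [IsManifold 𝓘(ℝ, Euc (n + 1)) ∞ M] (φ : RoughForm n M)
    {e e' : OpenPartialHomeomorph M (Euc (n + 1))} (he : e ∈ atlas (Euc (n + 1)) M)
    (he' : e' ∈ atlas (Euc (n + 1)) M) {z : Euc (n + 1)} (hz : z ∈ e.target)
    (hz' : e.symm z ∈ e'.source) :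
    formInChart φ e z = (formInChart φ e' (e' (e.symm z))).compContinuousLinearMap
      (fderiv ℝ (fun z => e' (e.symm z)) z) := by
  ext v
  rw [formInChart_apply, form_apply_eq_formInChart φ he' hz',
    ContinuousAlternatingMap.compContinuousLinearMap_apply]
  exact congrArg _ (funext fun i => (fderiv_transition_apply he he' hz hz' (v i)).symm)

lemma contDiffOn_transition [IsManifold 𝓘(ℝ, Euc (n + 1)) ∞ M]
    {e e' : OpenPartialHomeomorph M (Euc (n + 1))} (he : e ∈ atlas (Euc (n + 1)) M)
    (he' : e' ∈ atlas (Euc (n + 1)) M) :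
    ContDiffOn ℝ ∞ (fun z => e' (e.symm z)) (e.target ∩ e.symm ⁻¹' e'.source) := by
  have h := HasGroupoid.compatible (G := contDiffGroupoid ∞ 𝓘(ℝ, Euc (n + 1))) he he'
  have h3 := (mem_groupoid_of_pregroupoid.1 h).1
  simpa [contDiffPregroupoid, Function.comp_def] using h3

omit [ChartedSpace (Euc (n + 1)) M] in
lemma isOpen_transition_domain (e e' : OpenPartialHomeomorph M (Euc (n + 1))) :
    IsOpen (e.target ∩ e.symm ⁻¹' e'.source) :=
  e.symm.isOpen_inter_preimage e'.open_source

lemma continuousOn_compContinuousLinearMap {X : Type*} [TopologicalSpace X] {s : Set X}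
    {η : X → Euc (n + 1) [⋀^Fin n]→L[ℝ] ℝ} {A : X → Euc (n + 1) →L[ℝ] Euc (n + 1)}
    (hη : ContinuousOn η s) (hA : ContinuousOn A s) :
    ContinuousOn (fun x => (η x).compContinuousLinearMap (A x)) s := by
  have h : Continuous fun p : (Euc (n + 1) [⋀^Fin n]→L[ℝ] ℝ) × (Euc (n + 1) →L[ℝ] Euc (n + 1)) =>
      p.1.compContinuousLinearMap p.2 := by
    refine continuous_iff_continuousAt.2 fun p => ?_
    exact (ContinuousAlternatingMap.hasStrictFDerivAt_compContinuousLinearMap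
      (𝕜 := ℝ) p).continuousAt
  exact h.comp_continuousOn (hη.prodMk hA)

/-- The form `e^* η` is continuous with compact support. -/
lemma isContCptForm_formOfChart [IsManifold 𝓘(ℝ, Euc (n + 1)) ∞ M] [T2Space M]
    {e : OpenPartialHomeomorph M (Euc (n + 1))} (he : e ∈ atlas (Euc (n + 1)) M)
    {η : Euc (n + 1) → Euc (n + 1) [⋀^Fin n]→L[ℝ] ℝ} (hη : Continuous η)
    (hc : HasCompactSupport η) (ht : tsupport η ⊆ e.target) {U : Set M}
    (hU : e.symm '' tsupport η ⊆ U) : IsContCptForm U (formOfChart e η) := by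
  have hcpt : IsCompact (e.symm '' tsupport η) :=
    hc.isCompact.image_of_continuousOn (e.continuousOn_symm.mono ht)
  have hsub : {x | formOfChart e η x ≠ 0} ⊆ e.symm '' tsupport η := by
    intro x hx
    by_cases hxe : x ∈ e.source
    · refine ⟨e x, subset_tsupport _ fun h0 => hx ?_, e.left_inv hxe⟩
      rw [formOfChart, if_pos hxe, h0]
      rfl
    · exact absurd (if_neg hxe) hx
  have hcl : closure {x | formOfChart e η x ≠ 0} ⊆ e.symm '' tsupport η :=
    closure_minimal hsub hcpt.isClosed
  refine ⟨fun e' he' => ?_, hcpt.of_isClosed_subset isClosed_closure hcl, hcl.trans hU⟩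
  intro z hz
  by_cases hze : e'.symm z ∈ e.source
  · have hopen := isOpen_transition_domain e' e
    have hmem : z ∈ e'.target ∩ e'.symm ⁻¹' e.source := ⟨hz, hze⟩
    have hd := contDiffOn_transition he' he
    have h1 : ContinuousOn (fun z => (η (e (e'.symm z))).compContinuousLinearMap
        (fderiv ℝ (fun z => e (e'.symm z)) z)) (e'.target ∩ e'.symm ⁻¹' e.source) :=
      continuousOn_compContinuousLinearMap (hη.comp_continuousOn hd.continuousOn)
        (hd.continuousOn_fderiv_of_isOpen hopen (by simp))
    have h2 : ContinuousOn (formInChart (formOfChart e η) e')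
        (e'.target ∩ e'.symm ⁻¹' e.source) := by
      refine h1.congr fun z hz => ?_
      rw [formInChart_transition _ he' he hz.1 hz.2,
        formInChart_formOfChart he η (e.map_source hz.2)]
    exact (h2.continuousAt (hopen.mem_nhds hmem)).continuousWithinAt
  · have hnot : e'.symm z ∉ e.symm '' tsupport η := by
      rintro ⟨z', hz', h⟩
      exact hze (h ▸ e.map_target (ht hz'))
    have hev : ∀ᶠ z' in 𝓝[e'.target] z, formInChart (formOfChart e η) e' z' = 0 := by
      have := e'.continuousOn_symm z hz (hcpt.isClosed.isOpen_compl.mem_nhds hnot)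
      filter_upwards [this] with z' hz'
      have : formOfChart e η (e'.symm z') = 0 := by
        by_contra h
        exact hz' (hsub h)
      rw [formInChart, this]
      rfl
    refine continuousWithinAt_const.congr_of_eventuallyEq hev ?_
    have : formOfChart e η (e'.symm z) = 0 := by
      by_contra h
      exact hnot (hsub h)
    rw [formInChart, this]
    rfl

variable [RiemannianBundle (fun x : M => TangentSpace 𝓘(ℝ, Euc (n + 1)) x)]

/-- The area `√ det ⟨v_i, v_j⟩` of tangent vectors, read in a chart. -/
noncomputable def areaChart (e : OpenPartialHomeomorph M (Euc (n + 1))) (z : Euc (n + 1))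
    (v : Fin n → Euc (n + 1)) : ℝ :=
  √(Matrix.gram ℝ fun i => chartTan e z (v i)).det

lemma areaChart_nonneg (e : OpenPartialHomeomorph M (Euc (n + 1))) (z : Euc (n + 1))
    (v : Fin n → Euc (n + 1)) : 0 ≤ areaChart e z v := Real.sqrt_nonneg _

lemma inner_congr_point {x x' : M} (h : x' = x) (v w : Euc (n + 1)) :
    inner ℝ (toTan x' v) (toTan x' w) = inner ℝ (toTan x v) (toTan x w) := by
  subst h; rfl

lemma areaDensity_eq [IsManifold 𝓘(ℝ, Euc (n + 1)) ∞ M]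
    {e : OpenPartialHomeomorph M (Euc (n + 1))} (he : e ∈ atlas (Euc (n + 1)) M)
    {ψ : Euc n → M} {y : Euc n} (hψ : MDifferentiableAt 𝓘(ℝ, Euc n) 𝓔 ψ y)
    (hy : ψ y ∈ e.source) :
    areaDensity ψ y =
      areaChart e (e (ψ y)) (fun i => fderiv ℝ (fun y' => e (ψ y')) y (stdVec i)) := by
  rw [areaDensity, areaChart]
  congr 2
  ext i j
  rw [Matrix.of_apply, Matrix.gram_apply, ← (tanChart_mfderiv he hψ hy).2,
    ← (tanChart_mfderiv he hψ hy).2]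
  have h1 := fun k => chartTan_tanChart he hy (coordVec ψ y k)
  have h2 := inner_congr_point (e.left_inv hy) (coordVec ψ y i) (coordVec ψ y j)
  rw [← h1, ← h1] at h2
  exact h2.symm

section Metric

variable [IsManifold 𝓘(ℝ, Euc (n + 1)) ∞ M]
  [IsContMDiffRiemannianBundle 𝓘(ℝ, Euc (n + 1)) ∞ (Euc (n + 1))
      (fun x : M => TangentSpace 𝓘(ℝ, Euc (n + 1)) x)]

omit [RiemannianBundle (fun x : M => TangentSpace 𝓘(ℝ, Euc (n + 1)) x)]
  [IsContMDiffRiemannianBundle 𝓘(ℝ, Euc (n + 1)) ∞ (Euc (n + 1))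
      (fun x : M => TangentSpace 𝓘(ℝ, Euc (n + 1)) x)] in
lemma continuousOn_chartTan {e : OpenPartialHomeomorph M (Euc (n + 1))}
    (he : e ∈ atlas (Euc (n + 1)) M) :
    ContinuousOn (fun p : Euc (n + 1) × Euc (n + 1) =>
      (⟨e.symm p.1, chartTan e p.1 p.2⟩ : TangentBundle 𝓔 M)) (e.target ×ˢ univ) := by
  have h1 : ContMDiffOn 𝓔 𝓔 ∞ e.symm e.target :=
    contMDiffOn_symm_of_mem_maximalAtlas (IsManifold.subset_maximalAtlas he)
  have h2 := h1.continuousOn_tangentMapWithin (by simp) e.open_target.uniqueMDiffOn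
  have h3 : Continuous fun p : Euc (n + 1) × Euc (n + 1) =>
      (⟨p.1, p.2⟩ : TangentBundle 𝓔 (Euc (n + 1))) :=
    (tangentBundleModelSpaceHomeomorph 𝓔).symm.continuous
  refine (h2.comp h3.continuousOn fun p hp => hp.1).congr fun p hp => ?_
  have : mfderivWithin 𝓔 𝓔 e.symm e.target p.1 = mfderiv 𝓔 𝓔 e.symm p.1 :=
    mfderivWithin_of_isOpen e.open_target hp.1
  simp only [Function.comp_apply, tangentMapWithin, chartTan]
  rw [this]

lemma continuousOn_inner_chartTan {e : OpenPartialHomeomorph M (Euc (n + 1))}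
    (he : e ∈ atlas (Euc (n + 1)) M) {X : Type*} [TopologicalSpace X] {s : Set X}
    {f g h : X → Euc (n + 1)} (hf : ContinuousOn f s) (hfs : ∀ x ∈ s, f x ∈ e.target)
    (hg : ContinuousOn g s) (hh : ContinuousOn h s) :
    ContinuousOn (fun x => (inner ℝ (chartTan e (f x) (g x)) (chartTan e (f x) (h x)) : ℝ)) s := by
  have : IsContinuousRiemannianBundle (Euc (n + 1))
      (fun x : M => TangentSpace 𝓘(ℝ, Euc (n + 1)) x) := by
    obtain ⟨g, hg, h⟩ := IsContMDiffRiemannianBundle.exists_contMDiff (IB := 𝓘(ℝ, Euc (n + 1)))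
      (n := ∞) (F := Euc (n + 1)) (E := fun x : M => TangentSpace 𝓘(ℝ, Euc (n + 1)) x)
    exact ⟨g, hg.continuous, h⟩
  have h1 := (continuousOn_chartTan he).comp (hf.prodMk hg) fun x hx => ⟨hfs x hx, mem_univ _⟩
  have h2 := (continuousOn_chartTan he).comp (hf.prodMk hh) fun x hx => ⟨hfs x hx, mem_univ _⟩
  exact ContinuousOn.inner_bundle (F := Euc (n + 1)) (b := fun x => e.symm (f x)) h1 h2

lemma continuousOn_norm_chartTan {e : OpenPartialHomeomorph M (Euc (n + 1))}
    (he : e ∈ atlas (Euc (n + 1)) M) :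
    ContinuousOn (fun p : Euc (n + 1) × Euc (n + 1) => ‖chartTan e p.1 p.2‖)
      (e.target ×ˢ univ) := by
  have := continuousOn_inner_chartTan he (s := e.target ×ˢ univ) (f := Prod.fst) (g := Prod.snd)
    (h := Prod.snd) continuousOn_fst (fun p hp => hp.1) continuousOn_snd continuousOn_snd
  refine (Real.continuous_sqrt.comp_continuousOn this).congr fun p _ => ?_
  exact norm_eq_sqrt_real_inner _

lemma ContinuousOn.areaChart {e : OpenPartialHomeomorph M (Euc (n + 1))}
    (he : e ∈ atlas (Euc (n + 1)) M) {X : Type*} [TopologicalSpace X] {s : Set X}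
    {f : X → Euc (n + 1)} {v : X → Fin n → Euc (n + 1)} (hf : ContinuousOn f s)
    (hfs : ∀ x ∈ s, f x ∈ e.target) (hv : ∀ i, ContinuousOn (fun x => v x i) s) :
    ContinuousOn (fun x => areaChart e (f x) (v x)) s := by
  refine Real.continuous_sqrt.comp_continuousOn ?_
  refine continuousOn_iff_continuous_domRestrict.2 ?_
  refine Continuous.matrix_det (continuous_matrix fun i j => ?_)
  exact continuousOn_iff_continuous_domRestrict.1
    (continuousOn_inner_chartTan he hf hfs (hv i) (hv j))

end Metric

/-- The constant covector `w` has comass at most `c` at the point `z` of the chart `e`. -/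
def ComassLe (e : OpenPartialHomeomorph M (Euc (n + 1))) (z : Euc (n + 1))
    (w : Euc (n + 1) [⋀^Fin n]→L[ℝ] ℝ) (c : ℝ) : Prop :=
  ∀ u : Fin n → Euc (n + 1), (∀ i, ‖chartTan e z (u i)‖ ≤ 1) → |w u| ≤ c

omit [RiemannianBundle (fun x : M => TangentSpace 𝓘(ℝ, Euc (n + 1)) x)] in
lemma toTan_chartTan_tanChart [IsManifold 𝓘(ℝ, Euc (n + 1)) ∞ M]
    {e : OpenPartialHomeomorph M (Euc (n + 1))}
    (he : e ∈ atlas (Euc (n + 1)) M) {z : Euc (n + 1)} (hz : z ∈ e.target)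
    (v : TangentSpace 𝓘(ℝ, Euc (n + 1)) (e.symm z)) :
    chartTan e z (tanChart e (e.symm z) v) = v := by
  have h := chartTan_tanChart he (e.map_target hz) v
  rw [e.right_inv hz] at h
  exact h

lemma ptComass_le_iff (F : RoughForm n M) (x : M) {c : ℝ} (hc : 0 ≤ c) :
    ptComass F x ≤ ENNReal.ofReal c ↔ ∀ v, (∀ i, ‖v i‖ ≤ 1) → |F x v| ≤ c := by
  rw [ptComass, iSup₂_le_iff]
  exact forall₂_congr fun v _ => ENNReal.ofReal_le_ofReal_iff hc

lemma comassLe_formInChart_iff [IsManifold 𝓘(ℝ, Euc (n + 1)) ∞ M] (F : RoughForm n M)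
    {e : OpenPartialHomeomorph M (Euc (n + 1))}
    (he : e ∈ atlas (Euc (n + 1)) M) {z : Euc (n + 1)} (hz : z ∈ e.target) {c : ℝ} (hc : 0 ≤ c) :
    ComassLe e z (formInChart F e z) c ↔ ptComass F (e.symm z) ≤ ENNReal.ofReal c := by
  rw [ptComass_le_iff _ _ hc]
  constructor
  · intro h v hv
    have := h (fun i => tanChart e (e.symm z) (v i)) fun i => by
      rw [toTan_chartTan_tanChart he hz]; exact hv i
    rw [formInChart_apply] at this
    simpa only [toTan_chartTan_tanChart he hz] using this
  · intro h u hu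
    rw [formInChart_apply]
    exact h _ hu

section LinearAlgebra

variable [IsManifold 𝓘(ℝ, Euc (n + 1)) ∞ M]

/-- The differential of the inverse of a chart as a linear equivalence. -/
noncomputable def chartTanEquiv {e : OpenPartialHomeomorph M (Euc (n + 1))}
    (he : e ∈ atlas (Euc (n + 1)) M) {z : Euc (n + 1)} (hz : z ∈ e.target) :
    Euc (n + 1) ≃ₗ[ℝ] TangentSpace 𝓘(ℝ, Euc (n + 1)) (e.symm z) where
  toFun := chartTan e z
  invFun := tanChart e (e.symm z)
  map_add' v w := map_add (mfderiv 𝓔 𝓔 e.symm z) v w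
  map_smul' c v := map_smul (mfderiv 𝓔 𝓔 e.symm z) c v
  left_inv v := tanChart_chartTan he hz v
  right_inv v := toTan_chartTan_tanChart he hz v

lemma ComassLe.abs_le {e : OpenPartialHomeomorph M (Euc (n + 1))}
    (he : e ∈ atlas (Euc (n + 1)) M) {z : Euc (n + 1)} (hz : z ∈ e.target)
    {w : Euc (n + 1) [⋀^Fin n]→L[ℝ] ℝ} {c : ℝ} (hc : 0 ≤ c) (h : ComassLe e z w c)
    (v : Fin n → Euc (n + 1)) : |w v| ≤ c * areaChart e z v := by
  let A := chartTanEquiv he hz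
  have hfin : FiniteDimensional ℝ (TangentSpace 𝓘(ℝ, Euc (n + 1)) (e.symm z)) :=
    A.finiteDimensional
  have h1 := abs_alternating_le_sqrt_det_gram
    (w.toAlternatingMap.compLinearMap (A.symm : _ →ₗ[ℝ] Euc (n + 1))) hc
    (fun u hu => by
      refine h (fun i => A.symm (u i)) fun i => ?_
      have : chartTan e z (A.symm (u i)) = u i := A.apply_symm_apply _
      rw [this]; exact hu i) (fun i => A (v i))
  have h2 : (w.toAlternatingMap.compLinearMap (A.symm : _ →ₗ[ℝ] Euc (n + 1)))
      (fun i => A (v i)) = w v := by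
    rw [AlternatingMap.compLinearMap_apply]
    exact congrArg _ (funext fun i => A.symm_apply_apply _)
  rw [h2] at h1
  exact h1

lemma areaChart_pos {e : OpenPartialHomeomorph M (Euc (n + 1))}
    (he : e ∈ atlas (Euc (n + 1)) M) {z : Euc (n + 1)} (hz : z ∈ e.target)
    {v : Fin n → Euc (n + 1)} (hv : LinearIndependent ℝ v) : 0 < areaChart e z v :=
  sqrt_det_gram_comp_pos (chartTanEquiv he hz) hv

lemma exists_comassLe_eq_areaChart {e : OpenPartialHomeomorph M (Euc (n + 1))}
    (he : e ∈ atlas (Euc (n + 1)) M) {z : Euc (n + 1)} (hz : z ∈ e.target)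
    {v : Fin n → Euc (n + 1)} (hv : LinearIndependent ℝ v) :
    ∃ w : Euc (n + 1) [⋀^Fin n]→L[ℝ] ℝ, ComassLe e z w 1 ∧ w v = areaChart e z v :=
  exists_alternating_comp_eq_sqrt_det_gram (chartTanEquiv he hz) hv

variable [IsContMDiffRiemannianBundle 𝓘(ℝ, Euc (n + 1)) ∞ (Euc (n + 1))
      (fun x : M => TangentSpace 𝓘(ℝ, Euc (n + 1)) x)]

lemma ComassLe.eventually {e : OpenPartialHomeomorph M (Euc (n + 1))}
    (he : e ∈ atlas (Euc (n + 1)) M) {z₀ : Euc (n + 1)} (hz₀ : z₀ ∈ e.target)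
    {w : Euc (n + 1) [⋀^Fin n]→L[ℝ] ℝ} (h : ComassLe e z₀ w 1) {c : ℝ} (hc : 1 < c) :
    ∀ᶠ z in 𝓝 z₀, ComassLe e z w c := by
  obtain ⟨r, hr1, hrc⟩ : ∃ r : ℝ, 1 < r ∧ r ^ n ≤ c := by
    have : ContinuousAt (fun r : ℝ => r ^ n) 1 := (continuous_pow n).continuousAt
    have h1 : ∀ᶠ r : ℝ in 𝓝 1, r ^ n < c := this.eventually (gt_mem_nhds (by simpa using hc))
    have h2 : ∀ᶠ r : ℝ in 𝓝[>] 1, r ^ n < c ∧ 1 < r :=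
      (h1.filter_mono nhdsWithin_le_nhds).and self_mem_nhdsWithin
    obtain ⟨r, hr⟩ := h2.exists
    exact ⟨r, hr.2, hr.1.le⟩
  have key : ∀ᶠ z in 𝓝 z₀, ∀ u ∈ Metric.sphere (0 : Euc (n + 1)) 1,
      ‖chartTan e z₀ u‖ < r * ‖chartTan e z u‖ := by
    refine (isCompact_sphere (0 : Euc (n + 1)) 1).eventually_forall_of_forall_eventually
      fun u hu => ?_
    have hne : 0 < ‖chartTan e z₀ u‖ := by
      rw [norm_pos_iff]
      intro h0
      have : (chartTanEquiv he hz₀) u = 0 := h0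
      rw [LinearEquiv.map_eq_zero_iff] at this
      simp [this] at hu
    have hopen : e.target ×ˢ (univ : Set (Euc (n + 1))) ∈ 𝓝 (z₀, u) :=
      prod_mem_nhds (e.open_target.mem_nhds hz₀) Filter.univ_mem
    have h1 := (continuousOn_norm_chartTan he).continuousAt hopen
    have h2 : ContinuousAt (fun p : Euc (n + 1) × Euc (n + 1) => ‖chartTan e z₀ p.2‖) (z₀, u) := by
      have : ContinuousAt (fun p : Euc (n + 1) × Euc (n + 1) => (z₀, p.2)) (z₀, u) := by fun_prop
      exact ContinuousAt.comp (g := fun p : Euc (n + 1) × Euc (n + 1) => ‖chartTan e p.1 p.2‖)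
        (f := fun p : Euc (n + 1) × Euc (n + 1) => (z₀, p.2)) h1 this
    have h3 := (h1.const_mul r).sub h2
    have h4 : 0 < r * ‖chartTan e z₀ u‖ - ‖chartTan e z₀ u‖ := by nlinarith
    filter_upwards [h3.eventually (lt_mem_nhds h4)] with p hp
    have hp' : 0 < r * ‖chartTan e p.1 p.2‖ - ‖chartTan e z₀ p.2‖ := hp
    linarith
  filter_upwards [key, e.open_target.mem_nhds hz₀] with z hz hzt u hu
  have hsm : ∀ (z' : Euc (n + 1)) (a : ℝ) (v : Euc (n + 1)),
      chartTan e z' (a • v) = a • chartTan e z' v := fun z' a v =>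
    map_smul (mfderiv 𝓔 𝓔 e.symm z') a v
  have hle : ∀ v, ‖chartTan e z₀ v‖ ≤ r * ‖chartTan e z v‖ := by
    intro v
    by_cases hv : v = 0
    · have h0 : chartTan e z₀ v = 0 := by
        rw [hv]; exact map_zero (mfderiv 𝓔 𝓔 e.symm z₀)
      rw [h0, norm_zero]; positivity
    · have h1 := hz ((‖v‖⁻¹ : ℝ) • v) (by simp [norm_smul, hv])
      rw [hsm, hsm, norm_smul, norm_smul] at h1
      have h2 : 0 < ‖(‖v‖⁻¹ : ℝ)‖ := by simpa using hv
      have h3 : ‖(‖v‖⁻¹ : ℝ)‖ * ‖chartTan e z₀ v‖ < ‖(‖v‖⁻¹ : ℝ)‖ * (r * ‖chartTan e z v‖) := by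
        linarith
      exact (lt_of_mul_lt_mul_left h3 h2.le).le
  have hr0 : 0 < r := by linarith
  have h1 := h (fun i => r⁻¹ • u i) fun i => by
    rw [hsm, norm_smul, Real.norm_eq_abs, abs_of_pos (by positivity)]
    rw [inv_mul_le_iff₀ hr0]
    calc _ ≤ r * ‖chartTan e z (u i)‖ := hle _
      _ ≤ r * 1 := by gcongr; exact hu i
  have h2 : w (fun i => r⁻¹ • u i) = r⁻¹ ^ n * w u := by
    have := w.toMultilinearMap.map_smul_univ (fun _ => r⁻¹) u
    simpa using this
  rw [h2, abs_mul, abs_of_pos (by positivity), inv_pow] at h1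
  rw [inv_mul_le_iff₀ (by positivity)] at h1
  linarith

end LinearAlgebra

end ChartForms

/-! ### Test functions -/

lemma exists_testFun_eq_one {m : ℕ} {C O : Set (Euc m)} (hC : IsCompact C) (hO : IsOpen O)
    (h : C ⊆ O) : ∃ χ : Euc m → ℝ, IsTestFun O χ ∧ (∀ z, χ z ∈ Icc (0 : ℝ) 1) ∧
      ∀ᶠ z in 𝓝ˢ C, χ z = 1 := by
  obtain ⟨C', hC', hCC', hC'O⟩ := exists_compact_between hC hO h
  obtain ⟨f, h0, h1, h2⟩ := exists_contMDiffMap_zero_one_nhds_of_isClosed (n := ⊤) 𝓘(ℝ, Euc m)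
    (s := (interior C')ᶜ) (t := C) isOpen_interior.isClosed_compl hC.isClosed
    (disjoint_compl_left_iff_subset.2 hCC')
  have hsub : tsupport f ⊆ C' := by
    refine closure_minimal (fun z hz => ?_) hC'.isClosed
    by_contra hzC
    exact hz (h0.self_of_nhdsSet z fun hz' => hzC (interior_subset hz'))
  exact ⟨f, ⟨f.contMDiff.contDiff, hC'.of_isClosed_subset (isClosed_tsupport _) hsub,
    hsub.trans hC'O⟩, h2, h1⟩

lemma IsTestFun.mono {m : ℕ} {G : Type*} [NormedAddCommGroup G] [NormedSpace ℝ G]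
    {V W : Set (Euc m)} {χ : Euc m → G} (h : IsTestFun V χ) (hVW : V ⊆ W) : IsTestFun W χ :=
  ⟨h.1, h.2.1, h.2.2.trans hVW⟩

lemma IsTestFun.add {m : ℕ} {G : Type*} [NormedAddCommGroup G] [NormedSpace ℝ G]
    {V : Set (Euc m)} {χ χ' : Euc m → G} (h : IsTestFun V χ) (h' : IsTestFun V χ') :
    IsTestFun V (fun z => χ z + χ' z) :=
  ⟨h.1.add h'.1, h.2.1.add h'.2.1, (tsupport_add _ _).trans (union_subset h.2.2 h'.2.2)⟩

lemma IsTestFun.const_mul {m : ℕ} {V : Set (Euc m)} {χ : Euc m → ℝ} (h : IsTestFun V χ) (c : ℝ) :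
    IsTestFun V (fun z => c * χ z) :=
  ⟨contDiff_const.mul h.1, h.2.1.mul_left, (tsupport_mul_subset_right).trans h.2.2⟩

lemma IsTestFun.mul_left {m : ℕ} {V W : Set (Euc m)} {χ ζ : Euc m → ℝ} (h : IsTestFun V χ)
    (hζ : ContDiff ℝ ∞ ζ) (hW : tsupport ζ ⊆ W) : IsTestFun (W ∩ V) (fun z => ζ z * χ z) :=
  ⟨hζ.mul h.1, h.2.1.mul_left, subset_inter ((tsupport_mul_subset_left).trans hW)
    ((tsupport_mul_subset_right).trans h.2.2)⟩

lemma IsTestFun.eq_zero_of_notMem {m : ℕ} {G : Type*} [NormedAddCommGroup G] [NormedSpace ℝ G]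
    {V : Set (Euc m)} {χ : Euc m → G} (h : IsTestFun V χ) {z : Euc m} (hz : z ∉ V) : χ z = 0 :=
  image_eq_zero_of_notMem_tsupport fun h' => hz (h.2.2 h')

lemma IsTestFun.fderiv_eq_zero {m : ℕ} {G : Type*} [NormedAddCommGroup G] [NormedSpace ℝ G]
    {V : Set (Euc m)} {χ : Euc m → G} (h : IsTestFun V χ) {z : Euc m} (hz : z ∉ V) :
    fderiv ℝ χ z = 0 :=
  image_eq_zero_of_notMem_tsupport fun h' => hz (h.2.2 (tsupport_fderiv_subset ℝ h'))

lemma IsTestFun.differentiable {m : ℕ} {G : Type*} [NormedAddCommGroup G] [NormedSpace ℝ G]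
    {V : Set (Euc m)} {χ : Euc m → G} (h : IsTestFun V χ) : Differentiable ℝ χ :=
  h.1.differentiable (by simp)

lemma IsTestFun.continuous_fderiv {m : ℕ} {G : Type*} [NormedAddCommGroup G] [NormedSpace ℝ G]
    {V : Set (Euc m)} {χ : Euc m → G} (h : IsTestFun V χ) : Continuous (fderiv ℝ χ) :=
  h.1.continuous_fderiv (by simp)

/-- Localization of a test function by a smooth partition of unity. -/
lemma IsTestFun.exists_partition {m : ℕ} {V : Set (Euc m)} {χ : Euc m → ℝ} (h : IsTestFun V χ)
    {O : Euc m → Set (Euc m)} (hO : ∀ z ∈ V, IsOpen (O z) ∧ z ∈ O z) :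
    ∃ (t : Finset (Euc m)) (ζ : Euc m → Euc m → ℝ), (∀ i ∈ t, i ∈ V) ∧ (∀ i z, 0 ≤ ζ i z) ∧
      (∀ i ∈ t, IsTestFun (O i ∩ V) (fun z => ζ i z * χ z)) ∧
      ∀ z, χ z = ∑ i ∈ t, ζ i z * χ z := by
  obtain ⟨t, ht⟩ := h.2.1.isCompact.elim_nhds_subcover' (fun z _ => O z)
    (fun z hz => (hO z (h.2.2 hz)).1.mem_nhds (hO z (h.2.2 hz)).2)
  obtain ⟨f, hf⟩ := SmoothPartitionOfUnity.exists_isSubordinate 𝓘(ℝ, Euc m)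
    (isClosed_tsupport χ) (fun i : {i // i ∈ t} => O i.1)
    (fun i => (hO _ (h.2.2 i.1.2)).1) (by simpa [iUnion_subtype] using ht)
  classical
  refine ⟨t.map ⟨Subtype.val, Subtype.val_injective⟩, fun i z => if hi : ∃ h : i ∈ tsupport χ,
    ⟨i, h⟩ ∈ t then f ⟨⟨i, hi.1⟩, hi.2⟩ z else 0, ?_, ?_, ?_, ?_⟩
  · intro i hi
    simp only [Finset.mem_map, Function.Embedding.coeFn_mk] at hi
    obtain ⟨j, _, rfl⟩ := hi
    exact h.2.2 j.2
  · intro i z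
    dsimp only
    split_ifs
    · exact f.nonneg _ _
    · exact le_rfl
  · intro i hi
    simp only [Finset.mem_map, Function.Embedding.coeFn_mk] at hi
    obtain ⟨j, hj, rfl⟩ := hi
    have hj' : ∃ h : j.1 ∈ tsupport χ, ⟨j.1, h⟩ ∈ t := ⟨j.2, hj⟩
    simp only [dif_pos hj']
    exact h.mul_left (f ⟨j, hj⟩).contMDiff.contDiff (hf ⟨j, hj⟩)
  · intro z
    by_cases hz : z ∈ tsupport χ
    · have h1 := f.sum_eq_one hz
      rw [finsum_eq_sum_of_fintype] at h1
      rw [← Finset.sum_mul, Finset.sum_map]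
      have h2 : ∑ x ∈ t, (if hi : ∃ h : x.1 ∈ tsupport χ, ⟨x.1, h⟩ ∈ t then
          f ⟨⟨x.1, hi.1⟩, hi.2⟩ z else 0) = ∑ i : {i // i ∈ t}, f i z := by
        rw [← Finset.sum_coe_sort t]
        refine Finset.sum_congr rfl fun j _ => ?_
        have hj' : ∃ h : j.1.1 ∈ tsupport χ, ⟨j.1.1, h⟩ ∈ t := ⟨j.1.2, j.2⟩
        rw [dif_pos hj']
      simp only [Function.Embedding.coeFn_mk]
      rw [h2, h1, one_mul]
    · simp [image_eq_zero_of_notMem_tsupport hz]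

/-! ### Closed bounded vector fields (i.e. hyperplane forms) -/

/-- `G` is a measurable, locally bounded vector field on `V` with zero divergence in the sense of
distributions. -/
structure IsDivFree {m : ℕ} (V : Set (Euc m)) (G : Euc m → Euc m) : Prop where
  isOpen : IsOpen V
  meas : AEStronglyMeasurable G (volume.restrict V)
  bdd : ∀ C ⊆ V, IsCompact C → ∃ b : ℝ, ∀ᵐ z ∂(volume.restrict C), ‖G z‖ ≤ b
  closed : ∀ χ : Euc m → ℝ, IsTestFun V χ → ∫ z in V, fderiv ℝ χ z (G z) = 0

lemma IsDivFree.integrableOn {m : ℕ} {V : Set (Euc m)} {G : Euc m → Euc m} (hG : IsDivFree V G)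
    {C : Set (Euc m)} (hCV : C ⊆ V) (hC : IsCompact C) : IntegrableOn G C := by
  obtain ⟨b, hb⟩ := hG.bdd C hCV hC
  have : IsFiniteMeasure (volume.restrict C) := ⟨by simpa using hC.measure_lt_top⟩
  refine Integrable.of_bound ?_ b hb
  exact hG.meas.mono_measure (Measure.restrict_mono hCV le_rfl)

/-- Pairing of a compactly supported continuous covector field with a locally bounded vector
field. -/
lemma IsDivFree.integrableOn_apply {m : ℕ} {V : Set (Euc m)} {G : Euc m → Euc m}
    (hG : IsDivFree V G) {ℓ : Euc m → Euc m →L[ℝ] ℝ} (hℓ : Continuous ℓ)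
    (hc : HasCompactSupport ℓ) (ht : tsupport ℓ ⊆ V) :
    IntegrableOn (fun z => ℓ z (G z)) V := by
  have h1 : IntegrableOn (fun z => ℓ z (G z)) (tsupport ℓ) := by
    obtain ⟨b, hb⟩ := hℓ.bounded_above_of_compact_support hc
    have hI := hG.integrableOn ht hc.isCompact
    refine (hI.norm.const_mul b).mono' ?_ ?_
    · have h2 := hI.aestronglyMeasurable
      exact (continuous_fst.clm_apply continuous_snd).comp_aestronglyMeasurable
        ((hℓ.aestronglyMeasurable).prodMk h2)
    · refine Filter.Eventually.of_forall fun z => ?_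
      exact ((ℓ z).le_opNorm _).trans (by gcongr; exact hb z)
  refine h1.of_forall_sdiff_eq_zero hG.isOpen.measurableSet fun z hz => ?_
  rw [image_eq_zero_of_notMem_tsupport hz.2]; rfl

/-- The distributional equation `div G = 0` may be tested with `C^1` functions. -/
lemma IsDivFree.integral_fderiv_eq_zero {m : ℕ} {V : Set (Euc m)} {G : Euc m → Euc m}
    (hG : IsDivFree V G) {χ : Euc m → ℝ} (hχ : ContDiff ℝ 1 χ) (hc : HasCompactSupport χ)
    (ht : tsupport χ ⊆ V) : ∫ z in V, fderiv ℝ χ z (G z) = 0 := by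
  obtain ⟨δ, hδ, hδV⟩ := hc.isCompact.exists_cthickening_subset_open hG.isOpen ht
  set C := Metric.cthickening δ (tsupport χ) with hCdef
  have hC : IsCompact C := hc.isCompact.cthickening
  obtain ⟨b, hb⟩ := hG.bdd C hδV hC
  have hcd : Continuous (fderiv ℝ χ) := hχ.continuous_fderiv (by simp)
  have huc : UniformContinuous (fderiv ℝ χ) :=
    (hc.fderiv (𝕜 := ℝ)).uniformContinuous_of_continuous hcd
  by_contra hne
  set A := ∫ z in V, fderiv ℝ χ z (G z) with hA
  have hpos : 0 < |A| := abs_pos.2 hne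
  set B := max b 0 * volume.real C + 1 with hB
  have hBpos : 0 < B := by positivity
  set ε := |A| / (2 * B) with hε
  have hεpos : 0 < ε := by positivity
  obtain ⟨r, hr, hrε⟩ := Metric.uniformContinuous_iff.1 huc ε hεpos
  let φ : ContDiffBump (0 : Euc m) := ⟨min r δ / 4, min r δ / 2, by positivity, by
    have : 0 < min r δ := lt_min hr hδ
    linarith⟩
  have hφr : φ.rOut < r := by
    have : 0 < min r δ := lt_min hr hδ
    have h2 : min r δ ≤ r := min_le_left _ _
    change min r δ / 2 < r
    linarith
  have hφδ : φ.rOut ≤ δ := by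
    have : 0 < min r δ := lt_min hr hδ
    have h2 : min r δ ≤ δ := min_le_right _ _
    change min r δ / 2 ≤ δ
    linarith
  set χ' := convolution (φ.normed volume) χ (ContinuousLinearMap.lsmul ℝ ℝ) volume with hχ'
  have hsm : ContDiff ℝ ∞ χ' := φ.hasCompactSupport_normed.contDiff_convolution_left _
    φ.contDiff_normed hχ.continuous.locallyIntegrable
  have hsupp : Function.support χ' ⊆ C := by
    intro z hz
    have h1 := support_convolution_subset (L := ContinuousLinearMap.lsmul ℝ ℝ) (μ := volume) hz
    obtain ⟨x, hx, y, hy, rfl⟩ := h1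
    rw [φ.support_normed_eq] at hx
    refine Metric.mem_cthickening_of_dist_le _ y _ _ (subset_tsupport _ hy) ?_
    have : dist x 0 < φ.rOut := hx
    rw [dist_eq_norm] at this ⊢
    simp only [sub_zero] at this
    simp only [add_sub_cancel_right]
    linarith
  have htest : IsTestFun V χ' := by
    have h1 : tsupport χ' ⊆ C := closure_minimal hsupp hC.isClosed
    exact ⟨hsm, hC.of_isClosed_subset (isClosed_tsupport _) h1, h1.trans hδV⟩
  have hderiv : ∀ z, ‖fderiv ℝ χ' z - fderiv ℝ χ z‖ ≤ ε := by
    intro z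
    have h1 := hc.hasFDerivAt_convolution_right (ContinuousLinearMap.lsmul ℝ ℝ) (μ := volume)
      ((φ.continuous_normed (μ := volume)).locallyIntegrable) hχ z
    have h2 : fderiv ℝ χ' z = convolution (φ.normed volume) (fderiv ℝ χ)
        (ContinuousLinearMap.lsmul ℝ ℝ) volume z := by
      rw [h1.fderiv]
      rfl
    rw [h2, ← dist_eq_norm]
    refine φ.dist_normed_convolution_le hcd.aestronglyMeasurable fun x hx => ?_
    refine (hrε ?_).le
    exact (Metric.mem_ball.1 hx).trans hφr
  have h0 := hG.closed χ' htest
  have hI1 := hG.integrableOn_apply hcd (hc.fderiv (𝕜 := ℝ))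
    ((tsupport_fderiv_subset ℝ).trans ht)
  have hI2 := hG.integrableOn_apply htest.continuous_fderiv (htest.2.1.fderiv (𝕜 := ℝ))
    ((tsupport_fderiv_subset ℝ).trans htest.2.2)
  have hA' : A = ∫ z in V, (fderiv ℝ χ z - fderiv ℝ χ' z) (G z) := by
    have : ∫ z in V, (fderiv ℝ χ z - fderiv ℝ χ' z) (G z) =
        (∫ z in V, fderiv ℝ χ z (G z)) - ∫ z in V, fderiv ℝ χ' z (G z) :=
      integral_sub hI1 hI2
    rw [this, h0, sub_zero]
  have hzero : ∀ z ∈ V \ C, (fderiv ℝ χ z - fderiv ℝ χ' z) (G z) = 0 := by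
    intro z hz
    have h1 : fderiv ℝ χ z = 0 := image_eq_zero_of_notMem_tsupport fun h =>
      hz.2 (Metric.self_subset_cthickening _ (tsupport_fderiv_subset ℝ h))
    have h2 : fderiv ℝ χ' z = 0 := image_eq_zero_of_notMem_tsupport fun h =>
      hz.2 ((closure_minimal hsupp hC.isClosed) (tsupport_fderiv_subset ℝ h))
    rw [h1, h2]; simp
  rw [setIntegral_eq_of_subset_of_forall_sdiff_eq_zero hG.isOpen.measurableSet hδV hzero] at hA'
  have hle : ‖∫ z in C, (fderiv ℝ χ z - fderiv ℝ χ' z) (G z)‖ ≤ (ε * max b 0) * volume.real C := by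
    refine norm_setIntegral_le_of_norm_le_const_ae hC.measure_lt_top ?_
    filter_upwards [hb] with z hz
    refine (ContinuousLinearMap.le_opNorm _ _).trans ?_
    gcongr
    · rw [norm_sub_rev]; exact hderiv z
    · exact hz.trans (le_max_left _ _)
  rw [← hA', Real.norm_eq_abs] at hle
  have : ε * B = |A| / 2 := by rw [hε]; field_simp
  nlinarith

/-- A function with vanishing distributional gradient is locally constant. -/
lemma exists_ae_eq_const_of_integral_mul_fderiv_eq_zero {m : ℕ} {V : Set (Euc m)} (hV : IsOpen V)
    {u : Euc m → ℝ} (hu : LocallyIntegrableOn u V)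
    (h : ∀ χ : Euc m → ℝ, IsTestFun V χ → ∀ v, ∫ z in V, u z * fderiv ℝ χ z v = 0)
    {z₀ : Euc m} (hz₀ : z₀ ∈ V) :
    ∃ r > 0, ∃ c : ℝ, Metric.ball z₀ r ⊆ V ∧
      ∀ᵐ z ∂(volume.restrict (Metric.ball z₀ r)), u z = c := by
  obtain ⟨R, hR, hRV⟩ := Metric.nhds_basis_closedBall.mem_iff.1 (hV.mem_nhds hz₀)
  set w : Euc m → ℝ := (Metric.ball z₀ R).indicator u with hw
  have hbV : Metric.ball z₀ R ⊆ V := Metric.ball_subset_closedBall.trans hRV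
  have hwint : Integrable w := by
    rw [hw, integrable_indicator_iff Metric.isOpen_ball.measurableSet]
    exact (hu.integrableOn_compact_subset hRV (isCompact_closedBall _ _)).mono_set
      Metric.ball_subset_closedBall
  let φ : ℕ → ContDiffBump (0 : Euc m) := fun k => ⟨R / 8 / (k + 1), R / 4 / (k + 1),
    by positivity, by gcongr; linarith⟩
  have hφ0 : Filter.Tendsto (fun k => (φ k).rOut) Filter.atTop (𝓝 0) := by
    have := (tendsto_one_div_add_atTop_nhds_zero_nat (𝕜 := ℝ)).const_mul (R / 4)
    simpa [φ, div_eq_mul_inv] using this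
  have hφR : ∀ k, (φ k).rOut ≤ R / 4 := by
    intro k
    change R / 4 / (k + 1) ≤ R / 4
    exact div_le_self (by positivity) (by linarith [(Nat.cast_nonneg k : (0 : ℝ) ≤ k)])
  have hconv := ContDiffBump.ae_convolution_tendsto_right_of_locallyIntegrable (μ := volume)
    (φ := φ) (K := 2) hφ0 (Filter.Eventually.of_forall fun k => by
      change R / 4 / (k + 1) ≤ 2 * (R / 8 / (k + 1))
      apply le_of_eq; ring) hwint.locallyIntegrable
  have hderiv : ∀ k, ∀ x ∈ Metric.ball z₀ (R / 2), HasFDerivAt (convolution ((φ k).normed volume) w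
      (ContinuousLinearMap.lsmul ℝ ℝ) volume) (0 : Euc m →L[ℝ] ℝ) x := by
    intro k x hx
    have h1 := ((φ k).hasCompactSupport_normed (μ := volume)).hasFDerivAt_convolution_left
      (ContinuousLinearMap.lsmul ℝ ℝ) (μ := volume) ((φ k).contDiff_normed)
      hwint.locallyIntegrable x
    suffices h0 : convolution (fderiv ℝ ((φ k).normed volume)) w
        ((ContinuousLinearMap.lsmul ℝ ℝ).precompL (Euc m)) volume x = 0 by
      rw [h0] at h1; exact h1
    refine ContinuousLinearMap.ext fun v => ?_
    set χ : Euc m → ℝ := fun t => (φ k).normed volume (x - t) with hχ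
    have hsupp : Function.support χ ⊆ Metric.closedBall x (R / 4) := by
      intro t ht
      have h2 : x - t ∈ Function.support ((φ k).normed volume) := ht
      rw [(φ k).support_normed_eq] at h2
      have h3 : dist (x - t) 0 < (φ k).rOut := h2
      rw [Metric.mem_closedBall, dist_comm, dist_eq_norm]
      rw [dist_zero_right] at h3
      linarith [hφR k]
    have htsupp : tsupport χ ⊆ Metric.closedBall x (R / 4) :=
      closure_minimal hsupp Metric.isClosed_closedBall
    have hballs : Metric.closedBall x (R / 4) ⊆ Metric.ball z₀ R := by
      intro t ht
      have h2 := Metric.mem_ball.1 hx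
      have h3 := Metric.mem_closedBall.1 ht
      exact Metric.mem_ball.2 (by linarith [dist_triangle t x z₀])
    have htest : IsTestFun V χ := by
      refine ⟨?_, (isCompact_closedBall x (R / 4)).of_isClosed_subset (isClosed_tsupport _) htsupp,
        htsupp.trans (hballs.trans hbV)⟩
      exact ((φ k).contDiff_normed (n := ⊤)).comp (contDiff_const.sub contDiff_id)
    have h2 := h χ htest v
    have hd : ∀ t, fderiv ℝ χ t v = - fderiv ℝ ((φ k).normed volume) (x - t) v := by
      intro t
      have hd1 : HasFDerivAt χ ((fderiv ℝ ((φ k).normed volume) (x - t)).comp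
          (-ContinuousLinearMap.id ℝ (Euc m))) t := by
        have hh : HasFDerivAt (fun t => x - t) (-ContinuousLinearMap.id ℝ (Euc m)) t := by
          simpa using (hasFDerivAt_id t).const_sub x
        exact (((φ k).contDiff_normed (n := 1)).differentiable (by simp) _).hasFDerivAt.comp t hh
      rw [hd1.fderiv]; simp
    have h3 : ∀ t, fderiv ℝ ((φ k).normed volume) (x - t) v * w t =
        - V.indicator (fun t => u t * fderiv ℝ χ t v) t := by
      intro t
      by_cases ht : t ∈ Metric.ball z₀ R
      · rw [hw, indicator_of_mem ht, indicator_of_mem (hbV ht), hd]; ring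
      · have h4 : fderiv ℝ χ t = 0 := image_eq_zero_of_notMem_tsupport fun h' =>
          ht (hballs (htsupp (tsupport_fderiv_subset ℝ h')))
        rw [hw, indicator_of_notMem ht]
        simp [indicator, h4]
    have h5 : convolution (fderiv ℝ ((φ k).normed volume)) w
        ((ContinuousLinearMap.lsmul ℝ ℝ).precompL (Euc m)) volume x v =
        ∫ t, fderiv ℝ ((φ k).normed volume) (x - t) v * w t := by
      rw [convolution_eq_swap]
      have hI : Integrable fun t => ((ContinuousLinearMap.lsmul ℝ ℝ : ℝ →L[ℝ] ℝ →L[ℝ] ℝ).precompL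
          (Euc m)) (fderiv ℝ ((φ k).normed volume) (x - t)) (w t) := by
        have hex := ((φ k).hasCompactSupport_normed (μ := volume)).fderiv (𝕜 := ℝ)
          |>.convolutionExists_left (ContinuousLinearMap.precompL (Euc m)
            (ContinuousLinearMap.lsmul ℝ ℝ : ℝ →L[ℝ] ℝ →L[ℝ] ℝ)) (μ := volume)
            (((φ k).contDiff_normed (n := 1)).continuous_fderiv (by simp))
            hwint.locallyIntegrable x
        exact hex.integrable_swap
      rw [ContinuousLinearMap.integral_apply hI]
      rfl
    rw [h5]
    simp_rw [h3]
    rw [integral_neg, integral_indicator hV.measurableSet, h2]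
    simp
  have hconst : ∀ k, ∀ x ∈ Metric.ball z₀ (R / 2), convolution ((φ k).normed volume) w
      (ContinuousLinearMap.lsmul ℝ ℝ) volume x = convolution ((φ k).normed volume) w
      (ContinuousLinearMap.lsmul ℝ ℝ) volume z₀ := by
    intro k x hx
    refine (convex_ball z₀ (R / 2)).is_const_of_fderivWithin_eq_zero (𝕜 := ℝ)
      (fun y hy => (hderiv k y hy).differentiableAt.differentiableWithinAt)
      (fun y hy => ?_) hx (Metric.mem_ball_self (by positivity))
    rw [fderivWithin_of_isOpen Metric.isOpen_ball hy, (hderiv k y hy).fderiv]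
  have hsub : Metric.ball z₀ (R / 2) ⊆ Metric.ball z₀ R := Metric.ball_subset_ball (by linarith)
  have hlim : ∀ᵐ z ∂(volume.restrict (Metric.ball z₀ (R / 2))),
      Filter.Tendsto (fun k => convolution ((φ k).normed volume) w
      (ContinuousLinearMap.lsmul ℝ ℝ) volume z₀) Filter.atTop (𝓝 (u z)) := by
    rw [ae_restrict_iff' Metric.isOpen_ball.measurableSet]
    filter_upwards [hconv] with z hz hzb
    simp_rw [hconst _ z hzb] at hz
    rwa [hw, indicator_of_mem (hsub hzb)] at hz
  have hne : (ae (volume.restrict (Metric.ball z₀ (R / 2)))).NeBot := by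
    rw [ae_neBot]
    intro h0
    rw [Measure.restrict_eq_zero] at h0
    exact (Metric.measure_ball_pos volume z₀ (by positivity : 0 < R / 2)).ne' h0
  obtain ⟨z₁, hz₁⟩ := hlim.exists
  refine ⟨R / 2, by positivity, u z₁, hsub.trans hbV, ?_⟩
  filter_upwards [hlim] with z hz
  exact tendsto_nhds_unique hz hz₁

/-! ### Flattening a hypersurface -/

/-- The last `n` coordinates of a point of `ℝ^{n+1}`. -/
noncomputable def tailE (n : ℕ) : Euc (n + 1) →L[ℝ] Euc n :=
  LinearMap.toContinuousLinearMap
    { toFun := fun q => WithLp.toLp 2 fun i => q i.succ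
      map_add' := fun _ _ => rfl
      map_smul' := fun _ _ => rfl }

/-- The point of `ℝ^{n+1}` with first coordinate `t` and remaining coordinates `y`. -/
noncomputable def consE {n : ℕ} (t : ℝ) (y : Euc n) : Euc (n + 1) :=
  WithLp.toLp 2 (Fin.cons t y : Fin (n + 1) → ℝ)

@[simp] lemma tailE_apply {n : ℕ} (q : Euc (n + 1)) (i : Fin n) : tailE n q i = q i.succ := rfl

@[simp] lemma consE_zero {n : ℕ} (t : ℝ) (y : Euc n) : consE t y 0 = t := rfl

@[simp] lemma tailE_consE {n : ℕ} (t : ℝ) (y : Euc n) : tailE n (consE t y) = y := rfl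

@[simp] lemma consE_tailE {n : ℕ} (q : Euc (n + 1)) : consE (q 0) (tailE n q) = q := by
  ext i
  refine Fin.cases rfl (fun j => rfl) i

lemma continuous_consE {n : ℕ} : Continuous fun p : ℝ × Euc n => consE p.1 p.2 := by
  refine (PiLp.continuous_toLp 2 _).comp (continuous_pi fun i => ?_)
  refine Fin.cases ?_ (fun j => ?_) i
  · exact continuous_fst
  · simp only [Fin.cons_succ]; fun_prop

lemma measurePreserving_consE (n : ℕ) :
    MeasurePreserving (fun p : ℝ × Euc n => consE p.1 p.2)
      ((volume : Measure ℝ).prod (volume : Measure (Euc n))) volume := by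
  have h1 := (volume_preserving_piFinSuccAbove (fun _ : Fin (n + 1) => ℝ) 0).symm
  have h2 := (EuclideanSpace.volume_preserving_symm_measurableEquiv_toLp (Fin (n + 1))).symm
  have h3 := (MeasurePreserving.id (volume : Measure ℝ)).prod
    (EuclideanSpace.volume_preserving_symm_measurableEquiv_toLp (Fin n))
  have h4 := h2.comp (h1.comp h3)
  have h5 : (fun p : ℝ × Euc n => consE p.1 p.2) =
      (MeasurableEquiv.toLp 2 (Fin (n + 1) → ℝ)).symm.symm ∘
      (MeasurableEquiv.piFinSuccAbove (fun _ : Fin (n + 1) => ℝ) 0).symm ∘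
      Prod.map id (MeasurableEquiv.toLp 2 (Fin n → ℝ)).symm := ?_
  · rw [h5]; exact h4
  funext p
  simp only [Function.comp_apply, consE]
  ext i
  refine Fin.cases ?_ (fun j => ?_) i <;> simp [MeasurableEquiv.piFinSuccAbove]

lemma integral_consE {n : ℕ} {f : Euc (n + 1) → ℝ} (hf : Integrable f) :
    ∫ q, f q = ∫ t : ℝ, ∫ y : Euc n, f (consE t y) := by
  have hm := measurePreserving_consE n
  have hemb : MeasurableEmbedding (fun p : ℝ × Euc n => consE p.1 p.2) := by
    refine continuous_consE.measurableEmbedding fun p p' h => ?_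
    have h1 := congrArg (fun q => q 0) h
    have h2 := congrArg (tailE n) h
    exact Prod.ext h1 h2
  rw [← hm.integral_comp hemb, integral_prod]
  exact (hm.integrable_comp_emb hemb).2 hf

lemma continuous_indicator_of_compact {X Y : Type*} [TopologicalSpace X] [T2Space X]
    [TopologicalSpace Y] [Zero Y] {S C : Set X} {f : X → Y} (hS : IsOpen S) (hC : IsCompact C)
    (hCS : C ⊆ S) (hf : ContinuousOn f S) (h0 : ∀ x ∈ S, x ∉ C → f x = 0) :
    Continuous (S.indicator f) := by
  refine continuous_iff_continuousAt.2 fun x => ?_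
  by_cases hx : x ∈ S
  · refine (hf.continuousAt (hS.mem_nhds hx)).congr ?_
    filter_upwards [hS.mem_nhds hx] with y hy
    rw [indicator_of_mem hy]
  · have hxC : x ∉ C := fun h => hx (hCS h)
    refine (continuousAt_const (y := (0 : Y))).congr ?_
    filter_upwards [hC.isClosed.isOpen_compl.mem_nhds hxC] with y hy
    by_cases hyS : y ∈ S
    · rw [indicator_of_mem hyS, h0 y hyS hy]
    · rw [indicator_of_notMem hyS]

/-- Coordinate tangent vectors of a parametrized hypersurface of `ℝ^{n+1}`. -/
noncomputable def tanVec {n : ℕ} (ψ : Euc n → Euc (n + 1)) (y : Euc n) (i : Fin n) : Euc (n + 1) :=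
  fderiv ℝ ψ y (stdVec i)

/-- A `C^1` diffeomorphism `q ↦ ψ(q_1, …, q_n) + q_0 w` straightening the hypersurface `ψ`. -/
structure Flattening {n : ℕ} (ψ : Euc n → Euc (n + 1)) (J : Set (Euc n)) (w : Euc (n + 1)) where
  Φ : OpenPartialHomeomorph (Euc (n + 1)) (Euc (n + 1))
  apply : ∀ q, Φ q = ψ (tailE n q) + q 0 • w
  tail_mem : ∀ q ∈ Φ.source, tailE n q ∈ J
  det_pos : ∀ q ∈ Φ.source,
    0 < stdDet (Fin.cons w (tanVec ψ (tailE n q)) : Fin (n + 1) → Euc (n + 1))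
  contDiffOn_symm : ContDiffOn ℝ 1 Φ.symm Φ.target

section Flattening

variable {n : ℕ} {ψ : Euc n → Euc (n + 1)} {J : Set (Euc n)} {w : Euc (n + 1)}

/-- The derivative of `q ↦ ψ(q_1, …, q_n) + q_0 w`. -/
noncomputable def flatDeriv (ψ : Euc n → Euc (n + 1)) (w : Euc (n + 1)) (y : Euc n) :
    Euc (n + 1) →L[ℝ] Euc (n + 1) :=
  (fderiv ℝ ψ y).comp (tailE n) + (EuclideanSpace.proj 0 : Euc (n + 1) →L[ℝ] ℝ).smulRight w

lemma flatDeriv_stdVec (y : Euc n) : (fun i => flatDeriv ψ w y (stdVec i)) =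
    (Fin.cons w (tanVec ψ y) : Fin (n + 1) → Euc (n + 1)) := by
  funext i
  refine Fin.cases ?_ (fun j => ?_) i
  · have : tailE n (stdVec 0) = 0 := by ext j; simp [stdVec]
    have h0 : (stdVec 0 : Euc (n + 1)) 0 = 1 := by simp [stdVec]
    simp [flatDeriv, this, h0]
  · have : tailE n (stdVec j.succ) = stdVec j := by
      ext k; simp [stdVec]
    have h0 : (stdVec j.succ : Euc (n + 1)) 0 = 0 := by simp [stdVec]
    simp [flatDeriv, this, h0, tanVec]

lemma det_flatDeriv (y : Euc n) : (flatDeriv ψ w y).det =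
    stdDet (Fin.cons w (tanVec ψ y) : Fin (n + 1) → Euc (n + 1)) := by
  rw [det_eq_stdDet, flatDeriv_stdVec]

lemma contDiffAt_flat (hJ : IsOpen J) (hψ : ContDiffOn ℝ 1 ψ J) {q : Euc (n + 1)}
    (hq : tailE n q ∈ J) :
    ContDiffAt ℝ 1 (fun q => ψ (tailE n q) + q 0 • w) q := by
  have h1 : ContDiffAt ℝ 1 (fun q => ψ (tailE n q)) q :=
    (hψ.contDiffAt (hJ.mem_nhds hq)).comp q (tailE n).contDiff.contDiffAt
  have h2 : ContDiffAt ℝ 1 (fun q : Euc (n + 1) => q 0 • w) q :=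
    ((EuclideanSpace.proj 0 : Euc (n + 1) →L[ℝ] ℝ).contDiff.smul contDiff_const).contDiffAt
  exact h1.add h2

lemma hasFDerivAt_flat (hJ : IsOpen J) (hψ : ContDiffOn ℝ 1 ψ J) {q : Euc (n + 1)}
    (hq : tailE n q ∈ J) :
    HasFDerivAt (fun q => ψ (tailE n q) + q 0 • w) (flatDeriv ψ w (tailE n q)) q := by
  have h1 : HasFDerivAt (fun q => ψ (tailE n q)) ((fderiv ℝ ψ (tailE n q)).comp (tailE n)) q :=
    (((hψ.contDiffAt (hJ.mem_nhds hq)).differentiableAt (by simp)).hasFDerivAt).comp q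
      (tailE n).hasFDerivAt
  have h2 : HasFDerivAt (fun q : Euc (n + 1) => q 0 • w)
      ((EuclideanSpace.proj 0 : Euc (n + 1) →L[ℝ] ℝ).smulRight w) q :=
    (EuclideanSpace.proj 0 : Euc (n + 1) →L[ℝ] ℝ).hasFDerivAt.smul_const w
  exact h1.add h2

lemma continuousOn_tanVec (hJ : IsOpen J) (hψ : ContDiffOn ℝ 1 ψ J) (i : Fin n) :
    ContinuousOn (fun y => tanVec ψ y i) J :=
  (hψ.continuousOn_fderiv_of_isOpen hJ le_rfl).clm_apply continuousOn_const

lemma continuousOn_stdDet_cons {X : Type*} [TopologicalSpace X] {s : Set X}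
    {f : X → Euc (n + 1)} {v : X → Fin n → Euc (n + 1)} (hf : ContinuousOn f s)
    (hv : ∀ i, ContinuousOn (fun x => v x i) s) :
    ContinuousOn (fun x => stdDet (Fin.cons (f x) (v x) : Fin (n + 1) → Euc (n + 1))) s := by
  refine continuous_stdDet.comp_continuousOn (continuousOn_pi.2 fun i => ?_)
  refine Fin.cases hf (fun j => hv j) i

lemma exists_flattening (hJ : IsOpen J) (hψ : ContDiffOn ℝ 1 ψ J) {y₀ : Euc n} (hy₀ : y₀ ∈ J)
    (hw : 0 < stdDet (Fin.cons w (tanVec ψ y₀) : Fin (n + 1) → Euc (n + 1))) :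
    ∃ Fl : Flattening ψ J w, consE 0 y₀ ∈ Fl.Φ.source := by
  set f : Euc (n + 1) → Euc (n + 1) := fun q => ψ (tailE n q) + q 0 • w with hf
  have hq : tailE n (consE 0 y₀) ∈ J := by simpa using hy₀
  have hc := contDiffAt_flat (w := w) hJ hψ hq
  have hd := hasFDerivAt_flat (w := w) hJ hψ hq
  have hdet : ∀ q, 0 < stdDet (Fin.cons w (tanVec ψ (tailE n q)) : Fin (n + 1) → Euc (n + 1)) →
      (flatDeriv ψ w (tailE n q)).det ≠ 0 := fun q h => by rw [det_flatDeriv]; exact h.ne'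
  let A := (flatDeriv ψ w (tailE n (consE 0 y₀))).toContinuousLinearEquivOfDetNeZero
    (hdet _ (by simpa using hw))
  have hdA : HasFDerivAt f (A : Euc (n + 1) →L[ℝ] Euc (n + 1)) (consE 0 y₀) := hd
  let Φ₀ := hc.toOpenPartialHomeomorph f hdA (by simp)
  have hΦ₀ : ∀ q, Φ₀ q = f q := fun q => rfl
  set S : Set (Euc (n + 1)) := {q | tailE n q ∈ J ∧
    0 < stdDet (Fin.cons w (tanVec ψ (tailE n q)) : Fin (n + 1) → Euc (n + 1))} with hS
  have hSo : IsOpen S := by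
    have h1 : IsOpen {q : Euc (n + 1) | tailE n q ∈ J} := hJ.preimage (tailE n).continuous
    have h2 : ContinuousOn (fun q => stdDet (Fin.cons w (tanVec ψ (tailE n q)) :
        Fin (n + 1) → Euc (n + 1))) {q : Euc (n + 1) | tailE n q ∈ J} :=
      continuousOn_stdDet_cons continuousOn_const fun i =>
        (continuousOn_tanVec hJ hψ i).comp (tailE n).continuous.continuousOn fun q hq => hq
    exact h2.isOpen_inter_preimage h1 isOpen_Ioi
  have hsrc : (Φ₀.restrOpen S hSo).source ⊆ S := by
    rw [Φ₀.restrOpen_source]; exact inter_subset_right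
  refine ⟨⟨Φ₀.restrOpen S hSo, fun q => rfl, fun q hq => (hsrc hq).1, fun q hq => (hsrc hq).2, ?_⟩, ?_⟩
  · intro z hz
    have hq := (Φ₀.restrOpen S hSo).map_target hz
    set q := (Φ₀.restrOpen S hSo).symm z
    have h1 := hasFDerivAt_flat (w := w) hJ hψ (hsrc hq).1
    exact ((Φ₀.restrOpen S hSo).contDiffAt_symm (f₀' :=
      (flatDeriv ψ w (tailE n q)).toContinuousLinearEquivOfDetNeZero (hdet _ (hsrc hq).2)) hz
      h1 (contDiffAt_flat hJ hψ (hsrc hq).1)).contDiffWithinAt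
  · rw [Φ₀.restrOpen_source]
    exact ⟨hc.mem_toOpenPartialHomeomorph_source hdA (by simp), by simpa using hy₀, by simpa using hw⟩

namespace Flattening

variable (Fl : Flattening ψ J w)

/-- The defining function of the hypersurface: the first coordinate of the inverse of the
flattening. -/
noncomputable def g (z : Euc (n + 1)) : ℝ := Fl.Φ.symm z 0

/-- The coordinate tangent vectors of the translated hypersurface through a point. -/
noncomputable def vec (z : Euc (n + 1)) : Fin n → Euc (n + 1) := tanVec ψ (tailE n (Fl.Φ.symm z))

lemma contDiffOn_g : ContDiffOn ℝ 1 Fl.g Fl.Φ.target :=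
  (EuclideanSpace.proj 0 : Euc (n + 1) →L[ℝ] ℝ).contDiff.comp_contDiffOn Fl.contDiffOn_symm

lemma fderiv_g (hJ : IsOpen J) (hψ : ContDiffOn ℝ 1 ψ J) {z : Euc (n + 1)} (hz : z ∈ Fl.Φ.target) :
    fderiv ℝ Fl.g z w = 1 ∧ ∀ i, fderiv ℝ Fl.g z (Fl.vec z i) = 0 := by
  have hq := Fl.Φ.map_target hz
  set q := Fl.Φ.symm z with hqdef
  have hzq : Fl.Φ q = z := Fl.Φ.right_inv hz
  have h1 : HasFDerivAt Fl.Φ (flatDeriv ψ w (tailE n q)) q :=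
    (hasFDerivAt_flat hJ hψ (Fl.tail_mem q hq)).congr_of_eventuallyEq
      (Filter.Eventually.of_forall Fl.apply)
  have h2 : DifferentiableAt ℝ Fl.g (Fl.Φ q) := by
    rw [hzq]
    exact (Fl.contDiffOn_g.contDiffAt (Fl.Φ.open_target.mem_nhds hz)).differentiableAt (by simp)
  have h3 := h2.hasFDerivAt.comp q h1
  have h4 : HasFDerivAt (Fl.g ∘ Fl.Φ) (EuclideanSpace.proj 0 : Euc (n + 1) →L[ℝ] ℝ) q := by
    refine (EuclideanSpace.proj 0 : Euc (n + 1) →L[ℝ] ℝ).hasFDerivAt.congr_of_eventuallyEq ?_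
    filter_upwards [Fl.Φ.open_source.mem_nhds hq] with p hp
    simp only [Function.comp_apply, g, Fl.Φ.left_inv hp]
    rfl
  have h5 := h3.unique h4
  rw [hzq] at h5
  have h6 : ∀ i, fderiv ℝ Fl.g z ((Fin.cons w (tanVec ψ (tailE n q)) :
      Fin (n + 1) → Euc (n + 1)) i) = (stdVec i : Euc (n + 1)) 0 := by
    intro i
    rw [← flatDeriv_stdVec]
    exact congrArg (fun B => B (stdVec i)) h5
  refine ⟨?_, fun i => ?_⟩
  · have := h6 0; simpa [stdVec] using this
  · have := h6 i.succ
    simp only [Fin.cons_succ] at this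
    exact this.trans (by simp [stdVec])

lemma linearIndependent_vec {z : Euc (n + 1)} (hz : z ∈ Fl.Φ.target) :
    LinearIndependent ℝ (Fl.vec z) := by
  have h := (stdDet_ne_zero_iff _).1 (Fl.det_pos _ (Fl.Φ.map_target hz)).ne'
  rw [linearIndependent_finCons] at h
  exact h.1

lemma fderiv_g_mul (hJ : IsOpen J) (hψ : ContDiffOn ℝ 1 ψ J) {z : Euc (n + 1)}
    (hz : z ∈ Fl.Φ.target) (x : Euc (n + 1)) :
    fderiv ℝ Fl.g z x * stdDet (Fin.cons w (Fl.vec z) : Fin (n + 1) → Euc (n + 1)) =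
      stdDet (Fin.cons x (Fl.vec z) : Fin (n + 1) → Euc (n + 1)) := by
  have h := Fl.fderiv_g hJ hψ hz
  rw [covector_mul_stdDet _ (Fl.linearIndependent_vec hz) h.2 w x, h.1, one_mul]

lemma continuousOn_vec (hJ : IsOpen J) (hψ : ContDiffOn ℝ 1 ψ J) (i : Fin n) :
    ContinuousOn (fun z => Fl.vec z i) Fl.Φ.target :=
  (continuousOn_tanVec hJ hψ i).comp ((tailE n).continuous.comp_continuousOn Fl.Φ.continuousOn_symm)
    fun _ hz => Fl.tail_mem _ (Fl.Φ.map_target hz)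

end Flattening

end Flattening

/-! ### The one-sided Gauss-Green inequality -/

/-- A smooth decreasing cutoff, `1` for `t ≤ -1/(k+1)` and `0` for `t ≥ 0`. -/
noncomputable def cutoff (k : ℕ) (t : ℝ) : ℝ := Real.smoothTransition (-((k + 1) * t))

lemma contDiff_cutoff (k : ℕ) : ContDiff ℝ ∞ (cutoff k) :=
  Real.smoothTransition.contDiff.comp (by fun_prop)

lemma cutoff_of_nonneg (k : ℕ) {t : ℝ} (ht : 0 ≤ t) : cutoff k t = 0 :=
  Real.smoothTransition.zero_of_nonpos (by nlinarith [(Nat.cast_nonneg k : (0 : ℝ) ≤ k)])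

lemma cutoff_of_le (k : ℕ) {t : ℝ} (ht : t ≤ -(1 / (k + 1))) : cutoff k t = 1 := by
  refine Real.smoothTransition.one_of_one_le ?_
  have : (0 : ℝ) < k + 1 := by positivity
  have h2 : (k + 1) * t ≤ (k + 1) * (-(1 / (k + 1))) := by gcongr
  have h3 : ((k : ℝ) + 1) * (-(1 / (k + 1))) = -1 := by field_simp
  linarith

lemma cutoff_mem (k : ℕ) (t : ℝ) : cutoff k t ∈ Icc (0 : ℝ) 1 :=
  ⟨Real.smoothTransition.nonneg _, Real.smoothTransition.le_one _⟩

lemma antitone_cutoff (k : ℕ) : Antitone (cutoff k) := fun s t hst =>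
  Real.smoothTransition.monotone (by
    have : (0 : ℝ) < k + 1 := by positivity
    nlinarith)

lemma deriv_cutoff_nonpos (k : ℕ) (t : ℝ) : deriv (cutoff k) t ≤ 0 :=
  (antitone_cutoff k).deriv_nonpos

lemma tendsto_cutoff (t : ℝ) : Filter.Tendsto (fun k => cutoff k t) Filter.atTop
    (𝓝 (if t < 0 then 1 else 0)) := by
  split_ifs with ht
  · refine tendsto_const_nhds.congr' ?_
    have h := (tendsto_one_div_add_atTop_nhds_zero_nat (𝕜 := ℝ)).eventually
      (gt_mem_nhds (show (0 : ℝ) < -t by linarith))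
    filter_upwards [h] with k hk
    exact (cutoff_of_le k (by linarith)).symm
  · simp_rw [cutoff_of_nonneg _ (not_lt.1 ht)]
    exact tendsto_const_nhds

lemma deriv_cutoff_eq_zero (k : ℕ) {t : ℝ} (ht : t ∉ Icc (-(1 / (k + 1)) : ℝ) 0) :
    deriv (cutoff k) t = 0 := by
  rw [mem_Icc, not_and_or, not_le, not_le] at ht
  rcases ht with ht | ht
  · have : cutoff k =ᶠ[𝓝 t] fun _ => 1 := by
      filter_upwards [gt_mem_nhds ht] with s hs using cutoff_of_le k (le_of_lt hs)
    rw [this.deriv_eq]; simp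
  · have : cutoff k =ᶠ[𝓝 t] fun _ => 0 := by
      filter_upwards [lt_mem_nhds ht] with s hs using cutoff_of_nonneg k (le_of_lt hs)
    rw [this.deriv_eq]; simp

/-- The derivatives of the cutoffs form an approximate identity. -/
lemma integral_deriv_cutoff_mul_le (k : ℕ) {H : ℝ → ℝ} (hH : Continuous H) {b : ℝ}
    (hb : ∀ t ∈ Icc (-(1 / (k + 1)) : ℝ) 0, H t ≤ b) :
    ∫ t, -deriv (cutoff k) t * H t ≤ b := by
  have hpos : (0 : ℝ) < 1 / (k + 1) := by positivity
  have hcd : Continuous (deriv (cutoff k)) := (contDiff_cutoff k).continuous_deriv (by simp)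
  have h1 : ∫ t, -deriv (cutoff k) t * H t =
      ∫ t in Icc (-(1 / (k + 1)) : ℝ) 0, -deriv (cutoff k) t * H t := by
    refine (setIntegral_eq_integral_of_forall_compl_eq_zero fun t ht => ?_).symm
    rw [deriv_cutoff_eq_zero k ht]; simp
  have h2 : ∫ t in Icc (-(1 / (k + 1)) : ℝ) 0, -deriv (cutoff k) t = 1 := by
    rw [integral_neg, integral_Icc_eq_integral_Ioc, ← intervalIntegral.integral_of_le (by linarith),
      intervalIntegral.integral_deriv_eq_sub'
        (cutoff k) rfl (fun t _ => (contDiff_cutoff k).differentiable (by simp) t)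
        hcd.continuousOn, cutoff_of_nonneg k le_rfl, cutoff_of_le k le_rfl]
    ring
  calc _ = ∫ t in Icc (-(1 / (k + 1)) : ℝ) 0, -deriv (cutoff k) t * H t := h1
    _ ≤ ∫ t in Icc (-(1 / (k + 1)) : ℝ) 0, -deriv (cutoff k) t * b := by
        refine setIntegral_mono_on ?_ ?_ measurableSet_Icc fun t ht => ?_
        · exact (hcd.neg.mul hH).integrableOn_Icc
        · exact (hcd.neg.mul continuous_const).integrableOn_Icc
        · exact mul_le_mul_of_nonneg_left (hb t ht) (by linarith [deriv_cutoff_nonpos k t])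
    _ = b := by rw [integral_mul_const, h2, one_mul]

section

variable {n : ℕ} {ψ : Euc n → Euc (n + 1)} {J : Set (Euc n)} {w : Euc (n + 1)}

lemma Flattening.measurableSet_slice (Fl : Flattening ψ J w) :
    IsOpen {y | consE 0 y ∈ Fl.Φ.source} :=
  Fl.Φ.open_source.preimage (continuous_consE.comp (Continuous.prodMk_right 0))

/-- Change of variables to flattened coordinates. -/
lemma Flattening.integral_target (Fl : Flattening ψ J w) (hJ : IsOpen J) (hψ : ContDiffOn ℝ 1 ψ J)
    (f : Euc (n + 1) → ℝ) :
    ∫ z in Fl.Φ.target, f z =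
      ∫ q in Fl.Φ.source, stdDet (Fin.cons w (tanVec ψ (tailE n q)) : Fin (n + 1) → Euc (n + 1)) *
        f (Fl.Φ q) := by
  rw [← Fl.Φ.image_source_eq_target, integral_image_eq_integral_abs_det_fderiv_smul volume
    Fl.Φ.open_source.measurableSet (f' := fun q => flatDeriv ψ w (tailE n q)) ?_ Fl.Φ.injOn]
  · refine setIntegral_congr_fun Fl.Φ.open_source.measurableSet fun q hq => ?_
    simp only [det_flatDeriv, smul_eq_mul]
    rw [abs_of_pos (Fl.det_pos q hq)]
  · intro q hq
    exact ((hasFDerivAt_flat hJ hψ (Fl.tail_mem q hq)).congr_of_eventuallyEq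
      (Filter.Eventually.of_forall Fl.apply)).hasFDerivWithinAt

/-- Concentration of the cutoff derivatives on the hypersurface, for a continuous compactly
supported integrand. -/
lemma Flattening.eventually_integral_le (Fl : Flattening ψ J w) (hJ : IsOpen J)
    (hψ : ContDiffOn ℝ 1 ψ J) {b : Euc (n + 1) → ℝ} {C : Set (Euc (n + 1))} (hC : IsCompact C)
    (hCt : C ⊆ Fl.Φ.target) (hb : ContinuousOn b Fl.Φ.target) (hb0 : ∀ z ∉ C, b z = 0)
    {ε : ℝ} (hε : 0 < ε) :
    ∀ᶠ k in Filter.atTop, ∫ z in Fl.Φ.target, -deriv (cutoff k) (Fl.g z) *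
        (b z / stdDet (Fin.cons w (Fl.vec z) : Fin (n + 1) → Euc (n + 1))) ≤
      (∫ y in {y | consE 0 y ∈ Fl.Φ.source}, b (ψ y)) + ε := by
  set h : Euc (n + 1) → ℝ := Fl.Φ.source.indicator fun q => b (Fl.Φ q) with hh
  have hC' : IsCompact (Fl.Φ.symm '' C) := hC.image_of_continuousOn (Fl.Φ.continuousOn_symm.mono hCt)
  have hC's : Fl.Φ.symm '' C ⊆ Fl.Φ.source := by
    rintro _ ⟨z, hz, rfl⟩; exact Fl.Φ.map_target (hCt hz)
  have hh0 : ∀ q, q ∉ Fl.Φ.symm '' C → h q = 0 := by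
    intro q hq
    by_cases hqs : q ∈ Fl.Φ.source
    · rw [hh, indicator_of_mem hqs]
      exact hb0 _ fun h' => hq ⟨_, h', Fl.Φ.left_inv hqs⟩
    · rw [hh, indicator_of_notMem hqs]
  have hcont : Continuous h := by
    refine continuous_indicator_of_compact Fl.Φ.open_source hC' hC's
      (hb.comp Fl.Φ.continuousOn fun q hq => Fl.Φ.map_source hq) fun q hqs hq => ?_
    have := hh0 q hq
    rwa [hh, indicator_of_mem hqs] at this
  have hcs : HasCompactSupport h := HasCompactSupport.intro hC' fun q hq => hh0 q hq
  set C'' := tailE n '' (Fl.Φ.symm '' C) with hC''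
  have hC''c : IsCompact C'' := hC'.image (tailE n).continuous
  set H : ℝ → ℝ := fun t => ∫ y, h (consE t y) with hH
  have hHcont : Continuous H := by
    have h1 : ∀ t, H t = ∫ y in C'', h (consE t y) := by
      intro t
      refine (setIntegral_eq_integral_of_forall_compl_eq_zero fun y hy => ?_).symm
      exact hh0 _ fun h' => hy ⟨_, h', tailE_consE _ _⟩
    simp_rw [funext h1]
    exact continuous_parametric_integral_of_continuous
      (f := fun t y => h (consE t y)) (hcont.comp continuous_consE) hC''c
  have hH0 : H 0 = ∫ y in {y | consE 0 y ∈ Fl.Φ.source}, b (ψ y) := by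
    rw [hH, ← integral_indicator Fl.measurableSet_slice.measurableSet]
    refine integral_congr_ae (Filter.Eventually.of_forall fun y => ?_)
    by_cases hy : consE 0 y ∈ Fl.Φ.source
    · have : Fl.Φ (consE 0 y) = ψ y := by rw [Fl.apply]; simp
      simp only [hh]
      rw [indicator_of_mem hy, indicator_of_mem (show y ∈ {y | consE 0 y ∈ Fl.Φ.source} from hy),
        this]
    · simp only [hh]
      rw [indicator_of_notMem hy,
        indicator_of_notMem (show y ∉ {y | consE 0 y ∈ Fl.Φ.source} from hy)]
  have hev : ∀ᶠ k : ℕ in Filter.atTop, ∀ t ∈ Icc (-(1 / (k + 1)) : ℝ) 0, H t ≤ H 0 + ε := by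
    obtain ⟨δ, hδ, hδH⟩ := Metric.continuous_iff.1 hHcont 0 ε hε
    have h2 := (tendsto_one_div_add_atTop_nhds_zero_nat (𝕜 := ℝ)).eventually (gt_mem_nhds hδ)
    filter_upwards [h2] with k hk t ht
    have h3 := hδH t (by
      rw [Real.dist_eq, sub_zero, abs_lt]; constructor <;> linarith [ht.1, ht.2])
    rw [Real.dist_eq] at h3
    linarith [(abs_lt.1 h3).2]
  filter_upwards [hev] with k hk
  rw [Fl.integral_target hJ hψ, ← hH0]
  have hcd : Continuous (deriv (cutoff k)) := (contDiff_cutoff k).continuous_deriv (by simp)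
  have h4 : ∫ q in Fl.Φ.source, stdDet (Fin.cons w (tanVec ψ (tailE n q)) :
        Fin (n + 1) → Euc (n + 1)) * (-deriv (cutoff k) (Fl.g (Fl.Φ q)) * (b (Fl.Φ q) /
        stdDet (Fin.cons w (Fl.vec (Fl.Φ q)) : Fin (n + 1) → Euc (n + 1)))) =
      ∫ q, -deriv (cutoff k) (q 0) * h q := by
    rw [← integral_indicator Fl.Φ.open_source.measurableSet]
    refine integral_congr_ae (Filter.Eventually.of_forall fun q => ?_)
    by_cases hq : q ∈ Fl.Φ.source
    · have h5 := Fl.det_pos q hq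
      simp only [hh]
      rw [indicator_of_mem hq, indicator_of_mem hq]
      simp only [Flattening.g, Flattening.vec, Fl.Φ.left_inv hq]
      field_simp
    · simp only [hh]
      rw [indicator_of_notMem hq, indicator_of_notMem hq, mul_zero]
  rw [h4, integral_consE]
  · have h6 : ∀ t : ℝ, ∫ y : Euc n, -deriv (cutoff k) ((consE t y : Euc (n + 1)) 0) * h (consE t y)
        = -deriv (cutoff k) t * H t := by
      intro t
      simp only [consE_zero]
      rw [integral_const_mul]
    simp_rw [h6]
    exact integral_deriv_cutoff_mul_le k hHcont hk
  · refine Continuous.integrable_of_hasCompactSupport ?_ hcs.mul_left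
    exact (hcd.comp (EuclideanSpace.proj 0 : Euc (n + 1) →L[ℝ] ℝ).continuous).neg.mul hcont

/-- The one-sided Gauss-Green inequality for a divergence free vector field `G` and the domain
`{g < 0}`, if the normal component of `G` is at most `a`. -/
lemma Flattening.integral_le (Fl : Flattening ψ J w) (hJ : IsOpen J)
    (hψ : ContDiffOn ℝ 1 ψ J) {V : Set (Euc (n + 1))} (hV : V ⊆ Fl.Φ.target)
    {G : Euc (n + 1) → Euc (n + 1)} (hG : IsDivFree V G) {a : Euc (n + 1) → ℝ}
    (ha : ContinuousOn a V)
    (hle : ∀ᵐ z ∂(volume.restrict V),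
      stdDet (Fin.cons (G z) (Fl.vec z) : Fin (n + 1) → Euc (n + 1)) ≤ a z)
    {χ : Euc (n + 1) → ℝ} (hχ : IsTestFun V χ) (h0 : ∀ z, 0 ≤ χ z) :
    ∫ z in {z ∈ V | Fl.g z < 0}, fderiv ℝ χ z (G z) ≤
      ∫ y in {y | consE 0 y ∈ Fl.Φ.source}, χ (ψ y) * a (ψ y) := by
  have hVo := hG.isOpen
  have hgc := Fl.contDiffOn_g
  set C := tsupport χ with hCdef
  have hC : IsCompact C := hχ.2.1
  have hCV : C ⊆ V := hχ.2.2
  have hgcont : ContinuousOn Fl.g V := (hgc.mono hV).continuousOn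
  set b : Euc (n + 1) → ℝ := fun z => V.indicator (fun z => χ z * a z) z with hb
  have hbcont : Continuous b := continuous_indicator_of_compact hVo hC hCV
    (hχ.1.continuous.continuousOn.mul ha) fun z _ hz => by
      rw [image_eq_zero_of_notMem_tsupport hz, zero_mul]
  have hb0 : ∀ z ∉ C, b z = 0 := fun z hz => by
    by_cases hzV : z ∈ V
    · simp only [hb]; rw [indicator_of_mem hzV, image_eq_zero_of_notMem_tsupport hz, zero_mul]
    · simp only [hb]; rw [indicator_of_notMem hzV]
  -- the cut off test functions
  have key : ∀ k, ∫ z in V, cutoff k (Fl.g z) * fderiv ℝ χ z (G z) ≤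
      ∫ z in Fl.Φ.target, -deriv (cutoff k) (Fl.g z) *
        (b z / stdDet (Fin.cons w (Fl.vec z) : Fin (n + 1) → Euc (n + 1))) := by
    intro k
    have hcd : Continuous (deriv (cutoff k)) := (contDiff_cutoff k).continuous_deriv (by simp)
    set χk : Euc (n + 1) → ℝ := V.indicator fun z => cutoff k (Fl.g z) * χ z with hχk
    have hoff : ∀ z, z ∉ C → χk =ᶠ[𝓝 z] fun _ => 0 := by
      intro z hz
      filter_upwards [hC.isClosed.isOpen_compl.mem_nhds hz] with y hy
      simp only [hχk, indicator]
      rw [image_eq_zero_of_notMem_tsupport hy, mul_zero, ite_self]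
    have hon : ∀ z ∈ V, χk =ᶠ[𝓝 z] fun z => cutoff k (Fl.g z) * χ z := by
      intro z hz
      filter_upwards [hVo.mem_nhds hz] with y hy
      rw [hχk, indicator_of_mem hy]
    have hgat : ∀ z ∈ V, ContDiffAt ℝ 1 Fl.g z := fun z hz =>
      hgc.contDiffAt (Fl.Φ.open_target.mem_nhds (hV hz))
    have hC1 : ContDiff ℝ 1 χk := by
      rw [contDiff_iff_contDiffAt]
      intro z
      by_cases hz : z ∈ C
      · refine ContDiffAt.congr_of_eventuallyEq ?_ (hon z (hCV hz))
        exact ((((contDiff_cutoff k).of_le (by simp)).contDiffAt).comp z (hgat z (hCV hz))).mul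
          (hχ.1.of_le (by simp)).contDiffAt
      · exact contDiffAt_const.congr_of_eventuallyEq (hoff z hz)
    have hsupp : tsupport χk ⊆ C := by
      refine closure_minimal (fun z hz => ?_) hC.isClosed
      by_contra h
      exact hz (hoff z h).self_of_nhds
    have hcs : HasCompactSupport χk := hC.of_isClosed_subset (isClosed_tsupport _) hsupp
    have hz0 := hG.integral_fderiv_eq_zero hC1 hcs (hsupp.trans hCV)
    have hfd : ∀ z ∈ V, fderiv ℝ χk z = cutoff k (Fl.g z) • fderiv ℝ χ z +
        (χ z * deriv (cutoff k) (Fl.g z)) • fderiv ℝ Fl.g z := by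
      intro z hz
      rw [(hon z hz).fderiv_eq]
      have h1 : HasFDerivAt (fun z => cutoff k (Fl.g z))
          (deriv (cutoff k) (Fl.g z) • fderiv ℝ Fl.g z) z :=
        (((contDiff_cutoff k).differentiable (by simp) _).hasDerivAt).comp_hasFDerivAt z
          ((hgat z hz).differentiableAt (by simp)).hasFDerivAt
      have h2 : HasFDerivAt (fun z => cutoff k (Fl.g z) * χ z) _ z :=
        h1.mul (hχ.differentiable z).hasFDerivAt
      rw [h2.fderiv, smul_smul]
    have hI0 := hG.integrableOn_apply (hC1.continuous_fderiv (by simp)) (hcs.fderiv (𝕜 := ℝ))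
      ((tsupport_fderiv_subset ℝ).trans (hsupp.trans hCV))
    have hI1 : IntegrableOn (fun z => cutoff k (Fl.g z) * fderiv ℝ χ z (G z)) V := by
      have hI := hG.integrableOn_apply hχ.continuous_fderiv (hχ.2.1.fderiv (𝕜 := ℝ))
        ((tsupport_fderiv_subset ℝ).trans hCV)
      refine hI.norm.mono' ?_ (Filter.Eventually.of_forall fun z => ?_)
      · refine AEStronglyMeasurable.mul ?_ hI.aestronglyMeasurable
        exact ((contDiff_cutoff k).continuous.comp_continuousOn hgcont).aestronglyMeasurable
          hVo.measurableSet
      · rw [norm_mul, Real.norm_of_nonneg (cutoff_mem k _).1]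
        exact mul_le_of_le_one_left (norm_nonneg _) (cutoff_mem k _).2
    have hI2 : IntegrableOn (fun z => χ z * deriv (cutoff k) (Fl.g z) * fderiv ℝ Fl.g z (G z)) V := by
      refine (hI0.sub hI1).congr_fun (fun z hz => ?_) hVo.measurableSet
      simp only [Pi.sub_apply]
      rw [hfd z hz]
      simp
    have hsum : (∫ z in V, cutoff k (Fl.g z) * fderiv ℝ χ z (G z)) +
        ∫ z in V, χ z * deriv (cutoff k) (Fl.g z) * fderiv ℝ Fl.g z (G z) = 0 := by
      rw [← hz0, ← integral_add hI1 hI2]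
      refine setIntegral_congr_fun hVo.measurableSet fun z hz => ?_
      rw [hfd z hz]
      simp
    set r : Euc (n + 1) → ℝ := fun z => -deriv (cutoff k) (Fl.g z) *
        (b z / stdDet (Fin.cons w (Fl.vec z) : Fin (n + 1) → Euc (n + 1))) with hr
    have hD : ∀ z ∈ Fl.Φ.target, 0 < stdDet (Fin.cons w (Fl.vec z) : Fin (n + 1) → Euc (n + 1)) :=
      fun z hz => Fl.det_pos _ (Fl.Φ.map_target hz)
    have hrV : ∫ z in Fl.Φ.target, r z = ∫ z in V, r z := by
      refine setIntegral_eq_of_subset_of_forall_sdiff_eq_zero Fl.Φ.open_target.measurableSet hV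
        fun z hz => ?_
      rw [hr]; simp only
      rw [hb0 z fun h => hz.2 (hCV h)]; simp
    have hrcont : Continuous (Fl.Φ.target.indicator r) := by
      refine continuous_indicator_of_compact Fl.Φ.open_target hC (hCV.trans hV) ?_ fun z _ hz => ?_
      · refine ((hcd.comp_continuousOn hgc.continuousOn).neg).mul (hbcont.continuousOn.div ?_ ?_)
        · exact continuousOn_stdDet_cons continuousOn_const fun i => Fl.continuousOn_vec hJ hψ i
        · exact fun z hz => (hD z hz).ne'
      · rw [hr]; simp only
        rw [hb0 z hz]; simp
    have hrI : IntegrableOn r V := by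
      have h1 : Integrable (Fl.Φ.target.indicator r) := by
        refine hrcont.integrable_of_hasCompactSupport (HasCompactSupport.intro hC fun z hz => ?_)
        simp only [indicator]
        split_ifs
        · rw [hr]; simp only
          rw [hb0 z hz]; simp
        · rfl
      exact (integrable_indicator_iff Fl.Φ.open_target.measurableSet).1 h1 |>.mono_set hV
    rw [hrV]
    have hle' : -∫ z in V, χ z * deriv (cutoff k) (Fl.g z) * fderiv ℝ Fl.g z (G z) ≤
        ∫ z in V, r z := by
      rw [← integral_neg]
      refine setIntegral_mono_ae_restrict hI2.neg hrI ?_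
      filter_upwards [hle, ae_restrict_mem hVo.measurableSet] with z hz hzV
      have h1 := Fl.fderiv_g_mul hJ hψ (hV hzV) (G z)
      have h2 := hD z (hV hzV)
      have h3 : fderiv ℝ Fl.g z (G z) ≤
          a z / stdDet (Fin.cons w (Fl.vec z) : Fin (n + 1) → Euc (n + 1)) := by
        rw [le_div_iff₀ h2, h1]; exact hz
      have h4 : 0 ≤ χ z * -deriv (cutoff k) (Fl.g z) :=
        mul_nonneg (h0 z) (by linarith [deriv_cutoff_nonpos k (Fl.g z)])
      have h5 := mul_le_mul_of_nonneg_left h3 h4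
      have h6 : b z = χ z * a z := by simp only [hb]; rw [indicator_of_mem hzV]
      simp only [hr, h6, Pi.neg_apply]
      calc _ = χ z * -deriv (cutoff k) (Fl.g z) * fderiv ℝ Fl.g z (G z) := by ring
        _ ≤ _ := h5
        _ = _ := by ring
    linarith
  -- the limit
  have hI := hG.integrableOn_apply hχ.continuous_fderiv (hχ.2.1.fderiv (𝕜 := ℝ))
    ((tsupport_fderiv_subset ℝ).trans hCV)
  have hlim : Filter.Tendsto (fun k => ∫ z in V, cutoff k (Fl.g z) * fderiv ℝ χ z (G z))
      Filter.atTop (𝓝 (∫ z in V, (if Fl.g z < 0 then 1 else 0) * fderiv ℝ χ z (G z))) := by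
    refine tendsto_integral_of_dominated_convergence (fun z => ‖fderiv ℝ χ z (G z)‖) ?_ hI.norm ?_ ?_
    · intro k
      refine AEStronglyMeasurable.mul ?_ hI.aestronglyMeasurable
      exact ((contDiff_cutoff k).continuous.comp_continuousOn hgcont).aestronglyMeasurable
          hVo.measurableSet
    · intro k
      refine Filter.Eventually.of_forall fun z => ?_
      rw [norm_mul, Real.norm_of_nonneg (cutoff_mem k _).1]
      exact mul_le_of_le_one_left (norm_nonneg _) (cutoff_mem k _).2
    · exact Filter.Eventually.of_forall fun z => (tendsto_cutoff _).mul_const _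
  have hside : ∫ z in V, (if Fl.g z < 0 then 1 else 0) * fderiv ℝ χ z (G z) =
      ∫ z in {z ∈ V | Fl.g z < 0}, fderiv ℝ χ z (G z) := by
    have hm : MeasurableSet {z ∈ V | Fl.g z < 0} :=
      (hgcont.isOpen_inter_preimage hVo isOpen_Iio).measurableSet
    rw [← integral_indicator hVo.measurableSet, ← integral_indicator hm]
    congr 1
    funext z
    simp only [indicator, Set.mem_ofPred_eq]
    by_cases h1 : z ∈ V <;> by_cases h2 : Fl.g z < 0 <;> simp [h1, h2]
  rw [hside] at hlim
  have hrhs : ∫ y in {y | consE 0 y ∈ Fl.Φ.source}, b (ψ y) ≤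
      ∫ y in {y | consE 0 y ∈ Fl.Φ.source}, χ (ψ y) * a (ψ y) := by
    refine le_of_eq (integral_congr_ae (Filter.Eventually.of_forall fun y => ?_))
    simp only [hb, indicator]
    split_ifs with hy
    · rfl
    · rw [hχ.eq_zero_of_notMem hy, zero_mul]
  refine le_of_forall_pos_le_add fun ε hε => ?_
  have hev := Fl.eventually_integral_le hJ hψ hC (hCV.trans hV) hbcont.continuousOn hb0 hε
  refine le_of_tendsto hlim ?_
  filter_upwards [hev] with k hk
  linarith [key k]

end

/-! ### Laminar boxes in Euclidean space -/

/-- A Lipschitz laminar flow box in `ℝ^{n+1}`. -/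
structure LeafBox (n : ℕ) where
  X : OpenPartialHomeomorph (ℝ × Euc n) (Euc (n + 1))
  I : Set ℝ
  J : Set (Euc n)
  K : Set ℝ
  source_eq : X.source = I ×ˢ J
  I_open : IsOpen I
  J_open : IsOpen J
  J_convex : Convex ℝ J
  K_subset : K ⊆ I
  contDiffOn : ∀ k ∈ K, ContDiffOn ℝ 1 (fun y => X (k, y)) J
  indep : ∀ k ∈ K, ∀ y ∈ J, LinearIndependent ℝ (tanVec (fun y => X (k, y)) y)
  lipschitz : ∃ C, LipschitzOnWith C X (I ×ˢ J)

namespace LeafBox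

variable {n : ℕ} (β : LeafBox n)

/-- The leaf at height `k`. -/
def leaf (k : ℝ) (y : Euc n) : Euc (n + 1) := β.X (k, y)

/-- The height of a point of the box. -/
noncomputable def ht (z : Euc (n + 1)) : ℝ := (β.X.symm z).1

variable {β}

lemma mem_source {k : ℝ} {y : Euc n} (hk : k ∈ β.I) (hy : y ∈ β.J) : (k, y) ∈ β.X.source := by
  rw [β.source_eq]; exact ⟨hk, hy⟩

lemma leaf_mem {k : ℝ} {y : Euc n} (hk : k ∈ β.I) (hy : y ∈ β.J) : β.leaf k y ∈ β.X.target :=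
  β.X.map_source (mem_source hk hy)

lemma symm_leaf {k : ℝ} {y : Euc n} (hk : k ∈ β.I) (hy : y ∈ β.J) :
    β.X.symm (β.leaf k y) = (k, y) := β.X.left_inv (mem_source hk hy)

lemma ht_leaf {k : ℝ} {y : Euc n} (hk : k ∈ β.I) (hy : y ∈ β.J) : β.ht (β.leaf k y) = k := by
  rw [ht, symm_leaf hk hy]

lemma symm_mem {z : Euc (n + 1)} (hz : z ∈ β.X.target) :
    β.ht z ∈ β.I ∧ (β.X.symm z).2 ∈ β.J := by
  have := β.X.map_target hz
  rw [β.source_eq] at this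
  exact this

lemma leaf_ht {z : Euc (n + 1)} (hz : z ∈ β.X.target) : β.leaf (β.ht z) (β.X.symm z).2 = z :=
  β.X.right_inv hz

lemma continuousOn_ht : ContinuousOn β.ht β.X.target :=
  continuous_fst.comp_continuousOn β.X.continuousOn_symm

lemma continuousOn_leaf {k : ℝ} (hk : k ∈ β.I) : ContinuousOn (β.leaf k) β.J :=
  β.X.continuousOn.comp (Continuous.prodMk_right k).continuousOn fun _ hy => mem_source hk hy

lemma contDiffOn_leaf {k : ℝ} (hk : k ∈ β.K) : ContDiffOn ℝ 1 (β.leaf k) β.J := β.contDiffOn k hk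

lemma indep_leaf {k : ℝ} (hk : k ∈ β.K) {y : Euc n} (hy : y ∈ β.J) :
    LinearIndependent ℝ (tanVec (β.leaf k) y) := β.indep k hk y hy

lemma _root_.IsPreconnected.pos_or_neg {X : Type*} [TopologicalSpace X] {P : Set X}
    (hP : IsPreconnected P) {f : X → ℝ} (hf : ContinuousOn f P) (h0 : ∀ p ∈ P, f p ≠ 0) :
    (∀ p ∈ P, 0 < f p) ∨ ∀ p ∈ P, f p < 0 := by
  by_contra! h
  obtain ⟨⟨a, ha, ha'⟩, b, hb, hb'⟩ := h
  obtain ⟨c, hc, hc'⟩ := hP.intermediate_value ha hb hf ⟨ha', hb'⟩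
  exact h0 c hc hc'

/-- A function vanishing exactly on a leaf, without critical points, changes sign across it. -/
lemma exists_side {k : ℝ} (hk : k ∈ β.I) {y₀ : Euc n} (hy₀ : y₀ ∈ β.J)
    {V : Set (Euc (n + 1))} (hV : IsOpen V) (hzV : β.leaf k y₀ ∈ V)
    {g : Euc (n + 1) → ℝ} (hg : ContinuousOn g V) (hd : fderiv ℝ g (β.leaf k y₀) ≠ 0)
    (h0 : ∀ z ∈ V, z ∈ β.X.target → (g z = 0 ↔ β.ht z = k)) :
    ∃ s : ℝ, (s = 1 ∨ s = -1) ∧ ∃ W ⊆ V ∩ β.X.target, IsOpen W ∧ β.leaf k y₀ ∈ W ∧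
      ∀ z ∈ W, (g z < 0 ↔ s * β.ht z < s * k) ∧ (0 < g z ↔ s * k < s * β.ht z) := by
  have hsrc := mem_source hk hy₀
  have hnhds : β.X.source ∩ β.X ⁻¹' V ∈ 𝓝 (k, y₀) :=
    (β.X.isOpen_inter_preimage hV).mem_nhds ⟨hsrc, hzV⟩
  obtain ⟨δ, hδ, hball⟩ := Metric.mem_nhds_iff.1 hnhds
  rw [← ball_prod_same] at hball
  set D := Metric.ball k δ ×ˢ Metric.ball y₀ δ with hD
  have hDs : D ⊆ β.X.source := fun p hp => (hball hp).1
  have hgX : ContinuousOn (fun p => g (β.X p)) D :=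
    hg.comp (β.X.continuousOn.mono hDs) fun p hp => (hball hp).2
  have hne : ∀ p ∈ D, p.1 ≠ k → g (β.X p) ≠ 0 := by
    intro p hp hpk h
    have := (h0 _ (hball hp).2 (β.X.map_source (hDs hp))).1 h
    rw [ht, β.X.left_inv (hDs hp)] at this
    exact hpk this
  have hup : Ioo k (k + δ) ×ˢ Metric.ball y₀ δ ⊆ D := by
    refine prod_mono_left ?_
    rw [Real.ball_eq_Ioo]; exact Ioo_subset_Ioo_left (by linarith)
  have hdn : Ioo (k - δ) k ×ˢ Metric.ball y₀ δ ⊆ D := by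
    refine prod_mono_left ?_
    rw [Real.ball_eq_Ioo]; exact Ioo_subset_Ioo_right (by linarith)
  have hconn := (convex_ball y₀ δ).isPreconnected
  have h1 := (isPreconnected_Ioo.prod hconn).pos_or_neg (hgX.mono hup)
    fun p hp => hne p (hup hp) hp.1.1.ne'
  have h2 := (isPreconnected_Ioo.prod hconn).pos_or_neg (hgX.mono hdn)
    fun p hp => hne p (hdn hp) hp.1.2.ne
  set W := β.X '' D with hW
  have hWo : IsOpen W :=
    β.X.isOpen_image_of_subset_source (Metric.isOpen_ball.prod Metric.isOpen_ball) hDs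
  have hWV : W ⊆ V ∩ β.X.target := by
    rintro _ ⟨p, hp, rfl⟩; exact ⟨(hball hp).2, β.X.map_source (hDs hp)⟩
  have hz₀ : β.leaf k y₀ ∈ W :=
    ⟨(k, y₀), ⟨Metric.mem_ball_self hδ, Metric.mem_ball_self hδ⟩, rfl⟩
  have hcase : ∀ p ∈ D, p.1 = k ∨ p ∈ Ioo k (k + δ) ×ˢ Metric.ball y₀ δ ∨
      p ∈ Ioo (k - δ) k ×ˢ Metric.ball y₀ δ := by
    intro p hp
    have hp1 := hp.1
    rw [Real.ball_eq_Ioo] at hp1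
    rcases lt_trichotomy p.1 k with h | h | h
    · exact Or.inr (Or.inr ⟨⟨hp1.1, h⟩, hp.2⟩)
    · exact Or.inl h
    · exact Or.inr (Or.inl ⟨⟨h, hp1.2⟩, hp.2⟩)
  have hzero : ∀ p ∈ D, p.1 = k → g (β.X p) = 0 := by
    intro p hp hpk
    refine (h0 _ (hball hp).2 (β.X.map_source (hDs hp))).2 ?_
    rw [ht, β.X.left_inv (hDs hp), hpk]
  have hg0 : g (β.leaf k y₀) = 0 :=
    hzero (k, y₀) ⟨Metric.mem_ball_self hδ, Metric.mem_ball_self hδ⟩ rfl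
  rcases h1 with h1 | h1 <;> rcases h2 with h2 | h2
  · refine absurd (IsLocalMin.fderiv_eq_zero ?_) hd
    filter_upwards [hWo.mem_nhds hz₀]
    rintro _ ⟨p, hp, rfl⟩
    rw [hg0]
    rcases hcase p hp with h | h | h
    · exact (hzero p hp h).ge
    · exact (h1 p h).le
    · exact (h2 p h).le
  · refine ⟨1, Or.inl rfl, W, hWV, hWo, hz₀, ?_⟩
    rintro _ ⟨p, hp, rfl⟩
    rw [ht, β.X.left_inv (hDs hp), one_mul, one_mul]
    rcases hcase p hp with h | h | h
    · simp [hzero p hp h, h]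
    · have := h1 p h
      have h' := h.1.1
      constructor <;> constructor <;> intro <;> linarith
    · have := h2 p h
      have h' := h.1.2
      constructor <;> constructor <;> intro <;> linarith
  · refine ⟨-1, Or.inr rfl, W, hWV, hWo, hz₀, ?_⟩
    rintro _ ⟨p, hp, rfl⟩
    rw [ht, β.X.left_inv (hDs hp)]
    rcases hcase p hp with h | h | h
    · simp [hzero p hp h, h]
    · have := h1 p h
      have h' := h.1.1
      constructor <;> constructor <;> intro <;> linarith
    · have := h2 p h
      have h' := h.1.2
      constructor <;> constructor <;> intro <;> linarith
  · refine absurd (IsLocalMax.fderiv_eq_zero ?_) hd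
    filter_upwards [hWo.mem_nhds hz₀]
    rintro _ ⟨p, hp, rfl⟩
    rw [hg0]
    rcases hcase p hp with h | h | h
    · exact (hzero p hp h).le
    · exact (h1 p h).le
    · exact (h2 p h).le

variable (β)

/-- Moving from the leaf at height `k` in a positively oriented direction, the height times `s`
increases. -/
def NormalSign (k s : ℝ) (y : Euc n) : Prop :=
  ∀ w, 0 < stdDet (Fin.cons w (tanVec (β.leaf k) y) : Fin (n + 1) → Euc (n + 1)) →
    ∀ᶠ t in 𝓝[>] (0 : ℝ), s * k < s * β.ht (β.leaf k y + t • w)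

variable {β}

lemma NormalSign.unique {k s s' : ℝ} {y : Euc n} (hk : k ∈ β.K) (hy : y ∈ β.J)
    (hs : s = 1 ∨ s = -1) (hs' : s' = 1 ∨ s' = -1)
    (h : β.NormalSign k s y) (h' : β.NormalSign k s' y) : s = s' := by
  obtain ⟨w, hw⟩ := exists_stdDet_cons_pos (indep_leaf hk hy)
  obtain ⟨t, h1, h2⟩ := ((h w hw).and (h' w hw)).exists
  rcases hs with rfl | rfl <;> rcases hs' with rfl | rfl
  · rfl
  · linarith
  · linarith
  · rfl

lemma fderiv_tanVec_eq_zero {k : ℝ} (hk : k ∈ β.K) {y : Euc n} (hy : y ∈ β.J)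
    {W : Set (Euc (n + 1))} (hW : IsOpen W) (hyW : β.leaf k y ∈ W) {g : Euc (n + 1) → ℝ}
    (hg : DifferentiableAt ℝ g (β.leaf k y))
    (h0 : ∀ z ∈ W, z ∈ β.X.target → β.ht z = k → g z = 0) (i : Fin n) :
    fderiv ℝ g (β.leaf k y) (tanVec (β.leaf k) y i) = 0 := by
  have hc := (contDiffOn_leaf hk).contDiffAt (β.J_open.mem_nhds hy)
  have h1 : (fun y => g (β.leaf k y)) =ᶠ[𝓝 y] fun _ => 0 := by
    filter_upwards [hc.continuousAt.preimage_mem_nhds (hW.mem_nhds hyW), β.J_open.mem_nhds hy]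
      with y' h' hy'
    exact h0 _ h' (leaf_mem (β.K_subset hk) hy') (ht_leaf (β.K_subset hk) hy')
  have hcd : HasFDerivAt (β.leaf k) (fderiv ℝ (β.leaf k) y) y :=
    (hc.differentiableAt (by simp)).hasFDerivAt
  have h2 : HasFDerivAt (fun y => g (β.leaf k y))
      ((fderiv ℝ g (β.leaf k y)).comp (fderiv ℝ (β.leaf k) y)) y := hg.hasFDerivAt.comp y hcd
  have h3 := h1.fderiv_eq (𝕜 := ℝ)
  rw [h2.fderiv] at h3
  have h4 := congrArg (fun A : Euc n →L[ℝ] ℝ => A (stdVec i)) h3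
  simpa [tanVec] using h4

lemma normalSign_of_side {k s : ℝ} (hk : k ∈ β.K) {y : Euc n} (hy : y ∈ β.J)
    {W : Set (Euc (n + 1))} (hW : IsOpen W) (hyW : β.leaf k y ∈ W)
    {g : Euc (n + 1) → ℝ} (hg : DifferentiableAt ℝ g (β.leaf k y))
    (hd : fderiv ℝ g (β.leaf k y) ≠ 0)
    (hor : ∀ w, 0 < fderiv ℝ g (β.leaf k y) w →
      0 < stdDet (Fin.cons w (tanVec (β.leaf k) y) : Fin (n + 1) → Euc (n + 1)))
    (h0 : ∀ z ∈ W, g z = 0 ↔ β.ht z = k) (hs : ∀ z ∈ W, 0 < g z → s * k < s * β.ht z) :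
    β.NormalSign k s y := by
  intro w hw
  have hℓ := fderiv_tanVec_eq_zero hk hy hW hyW hg fun z hz _ => (h0 z hz).2
  have hgw : 0 < fderiv ℝ g (β.leaf k y) w := by
    obtain ⟨x, hx⟩ : ∃ x, 0 < fderiv ℝ g (β.leaf k y) x := by
      by_contra! h
      refine hd (ContinuousLinearMap.ext fun x => le_antisymm (h x) ?_)
      have := h (-x)
      simp only [map_neg] at this
      simp only [zero_apply]
      linarith
    have h1 := covector_mul_stdDet _ (indep_leaf hk hy) hℓ x w
    have h2 := hor x hx
    have h3 : 0 < fderiv ℝ g (β.leaf k y) w *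
        stdDet (Fin.cons x (tanVec (β.leaf k) y) : Fin (n + 1) → Euc (n + 1)) := by
      rw [h1]; exact mul_pos hx hw
    exact pos_of_mul_pos_left h3 h2.le
  have hcurve : HasDerivAt (fun t : ℝ => β.leaf k y + t • w) w 0 := by
    simpa using ((hasDerivAt_id (0 : ℝ)).smul_const w).const_add (β.leaf k y)
  have hg0 : g (β.leaf k y) = 0 := (h0 _ hyW).2 (ht_leaf (β.K_subset hk) hy)
  have hcomp : HasDerivAt (fun t : ℝ => g (β.leaf k y + t • w)) (fderiv ℝ g (β.leaf k y) w) 0 := by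
    refine HasFDerivAt.comp_hasDerivAt (l := g) (0 : ℝ) ?_ hcurve
    simpa using hg.hasFDerivAt
  have h4 : ∀ᶠ t in 𝓝[>] (0 : ℝ), 0 < g (β.leaf k y + t • w) := by
    have h5 := (hasDerivAt_iff_tendsto_slope.1 hcomp).eventually (lt_mem_nhds hgw)
    have h6 : ∀ᶠ t in 𝓝[>] (0 : ℝ), 0 < slope (fun t : ℝ => g (β.leaf k y + t • w)) 0 t :=
      h5.filter_mono (nhdsWithin_mono _ fun t ht => (ne_of_gt ht))
    filter_upwards [h6, self_mem_nhdsWithin] with t ht ht0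
    rw [slope_def_field] at ht
    simp only [zero_smul, add_zero, hg0, sub_zero] at ht
    exact (div_pos_iff_of_pos_right ht0).1 ht
  have h7 : ∀ᶠ t in 𝓝[>] (0 : ℝ), β.leaf k y + t • w ∈ W := by
    have := hcurve.continuousAt.preimage_mem_nhds (hW.mem_nhds (by simpa using hyW))
    exact mem_nhdsWithin_of_mem_nhds this
  filter_upwards [h4, h7] with t h8 h9 using hs _ h9 h8

/-- Near each point of a leaf there is a flattening, whose sides are given by the height. -/
lemma exists_local_flattening {k : ℝ} (hk : k ∈ β.K) {y₀ : Euc n} (hy₀ : y₀ ∈ β.J) :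
    ∃ (w : Euc (n + 1)) (Fl : Flattening (β.leaf k) β.J w) (s : ℝ), (s = 1 ∨ s = -1) ∧
      ∃ W ⊆ Fl.Φ.target ∩ β.X.target, IsOpen W ∧ β.leaf k y₀ ∈ W ∧
        (∀ y ∈ β.J, β.leaf k y ∈ W → consE 0 y ∈ Fl.Φ.source) ∧
        (∀ z ∈ W, (Fl.g z = 0 ↔ β.ht z = k) ∧ (Fl.g z < 0 ↔ s * β.ht z < s * k) ∧
          (0 < Fl.g z ↔ s * k < s * β.ht z)) ∧
        ∀ y ∈ β.J, β.leaf k y ∈ W → β.NormalSign k s y := by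
  have hkI := β.K_subset hk
  obtain ⟨w, hw⟩ := exists_stdDet_cons_pos (indep_leaf hk hy₀)
  obtain ⟨Fl, hFl⟩ := exists_flattening β.J_open (contDiffOn_leaf hk) hy₀ hw
  have happ : ∀ y, Fl.Φ (consE 0 y) = β.leaf k y := fun y => by rw [Fl.apply]; simp
  set V : Set (Euc (n + 1)) := Fl.Φ.target ∩ (β.X.target ∩ β.X.symm ⁻¹'
    (Prod.snd ⁻¹' {y | consE 0 y ∈ Fl.Φ.source})) with hV
  have hVo : IsOpen V := Fl.Φ.open_target.inter
    (β.X.symm.isOpen_inter_preimage (Fl.measurableSet_slice.preimage continuous_snd))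
  have hz₀ : β.leaf k y₀ ∈ V := by
    refine ⟨happ y₀ ▸ Fl.Φ.map_source hFl, leaf_mem hkI hy₀, ?_⟩
    rw [mem_preimage, symm_leaf hkI hy₀]; exact hFl
  have hslice : ∀ y ∈ β.J, β.leaf k y ∈ V → consE 0 y ∈ Fl.Φ.source := by
    intro y hy h
    have := h.2.2
    rw [mem_preimage, symm_leaf hkI hy] at this
    exact this
  have hg0 : ∀ y, consE 0 y ∈ Fl.Φ.source → Fl.g (β.leaf k y) = 0 := by
    intro y hy
    rw [← happ y, Flattening.g, Fl.Φ.left_inv hy]; rfl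
  have h0 : ∀ z ∈ V, (Fl.g z = 0 ↔ β.ht z = k) := by
    intro z hz
    constructor
    · intro h
      have h1 : Fl.Φ.symm z = consE 0 (tailE n (Fl.Φ.symm z)) := by
        conv_lhs => rw [← consE_tailE (Fl.Φ.symm z)]
        rw [show Fl.Φ.symm z 0 = 0 from h]
      have h2 := Fl.Φ.right_inv hz.1
      rw [h1, happ] at h2
      rw [← h2]
      exact ht_leaf hkI (Fl.tail_mem _ (Fl.Φ.map_target hz.1))
    · intro h
      have h1 := leaf_ht hz.2.1
      rw [h] at h1
      rw [← h1]
      exact hg0 _ hz.2.2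
  have hgd : ∀ z ∈ V, DifferentiableAt ℝ Fl.g z := fun z hz =>
    (Fl.contDiffOn_g.contDiffAt (Fl.Φ.open_target.mem_nhds hz.1)).differentiableAt (by simp)
  have hgne : ∀ z ∈ V, fderiv ℝ Fl.g z ≠ 0 := by
    intro z hz h
    have := (Fl.fderiv_g β.J_open (contDiffOn_leaf hk) hz.1).1
    rw [h] at this
    simp at this
  obtain ⟨s, hs, W, hWV, hWo, hzW, hside⟩ := exists_side hkI hy₀ hVo hz₀
    (Fl.contDiffOn_g.continuousOn.mono fun z hz => hz.1) (hgne _ hz₀) fun z hz _ => h0 z hz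
  refine ⟨w, Fl, s, hs, W, fun z hz => ⟨(hWV hz).1.1, (hWV hz).2⟩, hWo, hzW,
    fun y hy h => hslice y hy (hWV h).1, fun z hz => ⟨h0 z (hWV hz).1, hside z hz⟩, ?_⟩
  intro y hy hyW
  have hyV := (hWV hyW).1
  refine normalSign_of_side hk hy hWo hyW (hgd _ hyV) (hgne _ hyV) ?_
    (fun z hz => h0 z (hWV hz).1) fun z hz => (hside z hz).2.1
  intro x hx
  have h1 := Fl.fderiv_g_mul β.J_open (contDiffOn_leaf hk) hyV.1 x
  have h2 : Fl.vec (β.leaf k y) = tanVec (β.leaf k) y := by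
    rw [Flattening.vec, ← happ y, Fl.Φ.left_inv (hslice y hy hyV), tailE_consE]
  have h3 := Fl.det_pos _ (Fl.Φ.map_target hyV.1)
  rw [h2] at h1
  rw [← h1]
  refine mul_pos hx ?_
  rw [← h2]; exact h3

lemma exists_normalSign {k : ℝ} (hk : k ∈ β.K) :
    ∃ s : ℝ, (s = 1 ∨ s = -1) ∧ ∀ y ∈ β.J, β.NormalSign k s y := by
  have hloc : ∀ y₀ ∈ β.J, ∃ s : ℝ, (s = 1 ∨ s = -1) ∧ ∀ᶠ y in 𝓝 y₀, β.NormalSign k s y := by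
    intro y₀ hy₀
    obtain ⟨w, Fl, s, hs, W, -, hWo, hzW, -, -, h⟩ := exists_local_flattening hk hy₀
    refine ⟨s, hs, ?_⟩
    filter_upwards [((continuousOn_leaf (β.K_subset hk)).continuousAt
      (β.J_open.mem_nhds hy₀)).preimage_mem_nhds (hWo.mem_nhds hzW), β.J_open.mem_nhds hy₀]
      with y h1 h2 using h y h2 h1
  set A : ℝ → Set (Euc n) := fun s => interior {y | β.NormalSign k s y} with hA
  have hcov : β.J ⊆ A 1 ∪ A (-1) := by
    intro y hy
    obtain ⟨s, rfl | rfl, h⟩ := hloc y hy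
    · exact Or.inl (mem_interior_iff_mem_nhds.2 h)
    · exact Or.inr (mem_interior_iff_mem_nhds.2 h)
  rcases isPreconnected_iff_subset_of_disjoint.1 β.J_convex.isPreconnected (A 1) (A (-1))
    isOpen_interior isOpen_interior hcov (by
      refine eq_empty_of_forall_notMem fun y hy => ?_
      have := NormalSign.unique hk hy.1 (Or.inl rfl) (Or.inr rfl) (interior_subset hy.2.1)
        (interior_subset hy.2.2)
      norm_num at this) with h | h
  · exact ⟨1, Or.inl rfl, fun y hy => interior_subset (h hy)⟩
  · exact ⟨-1, Or.inr rfl, fun y hy => interior_subset (h hy)⟩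

lemma volume_leaf {k : ℝ} (hk : k ∈ β.K) : volume {z ∈ β.X.target | β.ht z = k} = 0 := by
  have h1 : {z ∈ β.X.target | β.ht z = k} ⊆ β.leaf k '' β.J := by
    rintro z ⟨hz, h⟩
    exact ⟨_, (symm_mem hz).2, by rw [← h, leaf_ht hz]⟩
  have h2 : β.leaf k '' β.J ⊆ (fun q : Euc (n + 1) => β.leaf k (tailE n q) + q 0 • (0 : Euc (n + 1))) ''
      (tailE n ⁻¹' β.J) := by
    rintro _ ⟨y, hy, rfl⟩
    exact ⟨consE 0 y, hy, by simp⟩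
  refine measure_mono_null (h1.trans h2) (addHaar_image_eq_zero_of_det_fderivWithin_eq_zero volume
    (f' := fun q => flatDeriv (β.leaf k) 0 (tailE n q)) (fun q hq => ?_) fun q _ => ?_)
  · exact (hasFDerivAt_flat β.J_open (contDiffOn_leaf hk) hq).hasFDerivWithinAt
  · rw [det_flatDeriv]
    exact stdDet_cons_eq_zero_of_mem_span (Submodule.zero_mem _)

lemma measurableSet_below (k : ℝ) : MeasurableSet {z ∈ β.X.target | β.ht z < k} :=
  (continuousOn_ht.isOpen_inter_preimage β.X.open_target isOpen_Iio).measurableSet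

lemma measurableSet_above (k : ℝ) : MeasurableSet {z ∈ β.X.target | k < β.ht z} :=
  (continuousOn_ht.isOpen_inter_preimage β.X.open_target isOpen_Ioi).measurableSet

variable (β)

/-- The flux `∫ Dχ(G)` over the part of the box below height `k`. -/
noncomputable def flux (G : Euc (n + 1) → Euc (n + 1)) (χ : Euc (n + 1) → ℝ) (k : ℝ) : ℝ :=
  ∫ z in {z ∈ β.X.target | β.ht z < k}, fderiv ℝ χ z (G z)

variable {β}

section Flux

variable {G : Euc (n + 1) → Euc (n + 1)} {A : Euc (n + 1) → (Fin n → Euc (n + 1)) → ℝ}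

lemma integrableOn_flux (hG : IsDivFree β.X.target G) {χ : Euc (n + 1) → ℝ}
    (hχ : IsTestFun β.X.target χ) : IntegrableOn (fun z => fderiv ℝ χ z (G z)) β.X.target :=
  hG.integrableOn_apply hχ.continuous_fderiv (hχ.2.1.fderiv (𝕜 := ℝ))
    ((tsupport_fderiv_subset ℝ).trans hχ.2.2)

/-- The flux through a leaf, from the two sides. -/
lemma integral_above_eq (hG : IsDivFree β.X.target G) {χ : Euc (n + 1) → ℝ}
    (hχ : IsTestFun β.X.target χ) {k : ℝ} (hk : k ∈ β.K) :
    ∫ z in {z ∈ β.X.target | k < β.ht z}, fderiv ℝ χ z (G z) = -β.flux G χ k := by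
  have hI := integrableOn_flux hG hχ
  have h1 : ∫ z in β.X.target, fderiv ℝ χ z (G z) =
      ∫ z in {z ∈ β.X.target | β.ht z < k} ∪ {z ∈ β.X.target | k < β.ht z},
        fderiv ℝ χ z (G z) := by
    refine setIntegral_congr_set (Filter.EventuallyLE.antisymm ?_
      (LE.le.eventuallyLE ?_))
    · refine ae_le_set.2 (measure_mono_null ?_ (volume_leaf hk))
      rintro z ⟨hz, hz'⟩
      refine ⟨hz, ?_⟩
      by_contra h
      rcases lt_or_gt_of_ne h with h | h
      · exact hz' (Or.inl ⟨hz, h⟩)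
      · exact hz' (Or.inr ⟨hz, h⟩)
    · rintro z (hz | hz) <;> exact hz.1
  rw [hG.closed χ hχ, setIntegral_union ?_ (measurableSet_above k)
    (hI.mono_set fun z hz => hz.1) (hI.mono_set fun z hz => hz.1)] at h1
  · rw [flux]; linarith
  · exact disjoint_left.2 fun z hz hz' => lt_asymm hz.2 hz'.2

/-- The integral of `χ A` over the leaf at height `k`. -/
noncomputable def leafInt (β : LeafBox n) (A : Euc (n + 1) → (Fin n → Euc (n + 1)) → ℝ)
    (χ : Euc (n + 1) → ℝ) (k : ℝ) : ℝ :=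
  ∫ y in β.J, χ (β.leaf k y) * A (β.leaf k y) (tanVec (β.leaf k) y)

/-- The points of a leaf in a compact set. -/
lemma isCompact_leaf_preimage {k : ℝ} (hk : k ∈ β.I) {C : Set (Euc (n + 1))} (hC : IsCompact C)
    (hCt : C ⊆ β.X.target) : IsCompact {y ∈ β.J | β.leaf k y ∈ C} := by
  have h1 : IsCompact (C ∩ β.X.target ∩ {z | β.ht z = k}) := by
    have : C ∩ β.X.target ∩ {z | β.ht z = k} = C ∩ β.ht ⁻¹' {k} := by
      ext z; exact ⟨fun h => ⟨h.1.1, h.2⟩, fun h => ⟨⟨h.1, hCt h.1⟩, h.2⟩⟩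
    rw [this]
    exact hC.of_isClosed_subset ((continuousOn_ht.mono hCt).preimage_isClosed_of_isClosed
      hC.isClosed isClosed_singleton) inter_subset_left
  have h2 : {y ∈ β.J | β.leaf k y ∈ C} =
      (fun z => (β.X.symm z).2) '' (C ∩ β.X.target ∩ {z | β.ht z = k}) := by
    ext y
    constructor
    · rintro ⟨hy, h⟩
      exact ⟨β.leaf k y, ⟨⟨h, leaf_mem hk hy⟩, ht_leaf hk hy⟩, by simp only [symm_leaf hk hy]⟩
    · rintro ⟨z, ⟨⟨hz, hzt⟩, hzk⟩, rfl⟩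
      have h3 := leaf_ht hzt
      rw [show β.ht z = k from hzk] at h3
      refine ⟨(symm_mem hzt).2, ?_⟩
      simp only [h3]; exact hz
  rw [h2]
  exact h1.image_of_continuousOn (continuous_snd.comp_continuousOn
    (β.X.continuousOn_symm.mono fun z hz => hz.1.2))

lemma continuousOn_leafInt (hA : ContinuousOn (fun p : _ × _ => A p.1 p.2) (β.X.target ×ˢ univ))
    {k : ℝ} (hk : k ∈ β.K) :
    ContinuousOn (fun y => A (β.leaf k y) (tanVec (β.leaf k) y)) β.J := by
  refine hA.comp ((continuousOn_leaf (β.K_subset hk)).prodMk (continuousOn_pi.2 fun i =>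
    continuousOn_tanVec β.J_open (contDiffOn_leaf hk) i)) fun y hy => ?_
  exact ⟨leaf_mem (β.K_subset hk) hy, trivial⟩

lemma integrableOn_leafInt
    (hA : ContinuousOn (fun p : _ × _ => A p.1 p.2) (β.X.target ×ˢ univ))
    {χ : Euc (n + 1) → ℝ} (hχ : Continuous χ) (hc : HasCompactSupport χ)
    (ht : tsupport χ ⊆ β.X.target) {k : ℝ} (hk : k ∈ β.K) :
    IntegrableOn (fun y => χ (β.leaf k y) * A (β.leaf k y) (tanVec (β.leaf k) y)) β.J := by
  have hC := isCompact_leaf_preimage (β.K_subset hk) hc ht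
  have hcont := continuous_indicator_of_compact β.J_open hC (fun y hy => hy.1)
    ((hχ.comp_continuousOn (continuousOn_leaf (β.K_subset hk))).mul (continuousOn_leafInt hA hk))
    fun y hy hy' => by
      rw [Pi.mul_apply, Function.comp_apply]
      rw [image_eq_zero_of_notMem_tsupport (fun h => hy' ⟨hy, h⟩), zero_mul]
  refine (integrable_indicator_iff β.J_open.measurableSet).1
    (hcont.integrable_of_hasCompactSupport (HasCompactSupport.intro hC fun y hy => ?_))
  by_cases hyJ : y ∈ β.J
  · rw [indicator_of_mem hyJ]
    rw [Pi.mul_apply, Function.comp_apply,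
      image_eq_zero_of_notMem_tsupport (fun h => hy ⟨hyJ, h⟩), zero_mul]
  · rw [indicator_of_notMem hyJ]

lemma mul_flux_eq (hG : IsDivFree β.X.target G) {O : Set (Euc (n + 1))} {χ : Euc (n + 1) → ℝ}
    (hOt : O ⊆ β.X.target) (hχ : IsTestFun O χ) {k s : ℝ} (hk : k ∈ β.K) (hs : s = 1 ∨ s = -1) :
    s * β.flux G χ k = ∫ z in {z ∈ O | s * β.ht z < s * k}, fderiv ℝ χ z (G z) := by
  rcases hs with rfl | rfl
  · simp only [one_mul]
    exact setIntegral_eq_of_subset_of_forall_sdiff_eq_zero (measurableSet_below k)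
      (fun z hz => ⟨hOt hz.1, hz.2⟩) fun z hz => by
        rw [hχ.fderiv_eq_zero fun h => hz.2 ⟨h, hz.1.2⟩]; rfl
  · simp only [neg_one_mul, neg_lt_neg_iff]
    rw [← integral_above_eq hG (hχ.mono hOt) hk]
    exact setIntegral_eq_of_subset_of_forall_sdiff_eq_zero (measurableSet_above k)
      (fun z hz => ⟨hOt hz.1, hz.2⟩) fun z hz => by
        rw [hχ.fderiv_eq_zero fun h => hz.2 ⟨h, hz.1.2⟩]; rfl

lemma exists_off_leaf (hG : IsDivFree β.X.target G)
    (A : Euc (n + 1) → (Fin n → Euc (n + 1)) → ℝ) {k : ℝ} (hk : k ∈ β.I)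
    {z₀ : Euc (n + 1)} (hz₀ : z₀ ∈ β.X.target) (hzk : β.ht z₀ ≠ k) :
    ∃ O, IsOpen O ∧ z₀ ∈ O ∧ ∀ χ, IsTestFun (O ∩ β.X.target) χ →
      β.flux G χ k = 0 ∧ β.leafInt A χ k = 0 := by
  have hleaf0 : ∀ {O : Set (Euc (n + 1))} {χ : Euc (n + 1) → ℝ}, (∀ z ∈ O, β.ht z ≠ k) →
      IsTestFun O χ → β.leafInt A χ k = 0 := by
    intro O χ hO hχ
    refine setIntegral_eq_zero_of_forall_eq_zero fun y hy => ?_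
    rw [hχ.eq_zero_of_notMem fun h => hO _ h (ht_leaf hk hy), zero_mul]
  rcases lt_or_gt_of_ne hzk with h | h
  · have hO := continuousOn_ht.isOpen_inter_preimage β.X.open_target (isOpen_Iio (a := k))
    refine ⟨_, hO, ⟨hz₀, h⟩, fun χ hχ' => ?_⟩
    have hχ := hχ'.mono (W := β.X.target ∩ β.ht ⁻¹' Iio k) inter_subset_left
    refine ⟨?_, hleaf0 (fun z hz => ne_of_lt hz.2) hχ⟩
    rw [flux, ← hG.closed χ (hχ.mono inter_subset_left)]
    refine (setIntegral_eq_of_subset_of_forall_sdiff_eq_zero β.X.open_target.measurableSet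
      (fun z hz => hz.1) fun z hz => ?_).symm
    rw [hχ.fderiv_eq_zero hz.2]; rfl
  · have hO := continuousOn_ht.isOpen_inter_preimage β.X.open_target (isOpen_Ioi (a := k))
    refine ⟨_, hO, ⟨hz₀, h⟩, fun χ hχ' => ?_⟩
    have hχ := hχ'.mono (W := β.X.target ∩ β.ht ⁻¹' Ioi k) inter_subset_left
    refine ⟨setIntegral_eq_zero_of_forall_eq_zero fun z hz => ?_,
      hleaf0 (fun z hz => ne_of_gt hz.2) hχ⟩
    rw [hχ.fderiv_eq_zero fun h => lt_asymm h.2 hz.2]; rfl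

/-- The one-sided Gauss-Green inequality, near a point of the box. -/
lemma exists_flux_le (hG : IsDivFree β.X.target G)
    (hA : ContinuousOn (fun p : _ × _ => A p.1 p.2) (β.X.target ×ˢ univ))
    (hle : ∀ᵐ z ∂(volume.restrict β.X.target), ∀ v : Fin n → Euc (n + 1),
      stdDet (Fin.cons (G z) v : Fin (n + 1) → Euc (n + 1)) ≤ A z v)
    {k s : ℝ} (hk : k ∈ β.K) (hs : s = 1 ∨ s = -1) (hsJ : ∀ y ∈ β.J, β.NormalSign k s y)
    {z₀ : Euc (n + 1)} (hz₀ : z₀ ∈ β.X.target) :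
    ∃ O, IsOpen O ∧ z₀ ∈ O ∧ ∀ χ, IsTestFun (O ∩ β.X.target) χ → (∀ z, 0 ≤ χ z) →
      s * β.flux G χ k ≤ β.leafInt A χ k := by
  have hkI := β.K_subset hk
  have hsub : ∀ {O : Set (Euc (n + 1))} {χ : Euc (n + 1) → ℝ}, IsOpen O → O ⊆ β.X.target →
      IsTestFun O χ → ∫ z in O, fderiv ℝ χ z (G z) = 0 := by
    intro O χ hO hOt hχ
    rw [← hG.closed χ (hχ.mono hOt)]
    refine (setIntegral_eq_of_subset_of_forall_sdiff_eq_zero β.X.open_target.measurableSet hOt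
        fun z hz => ?_).symm
    rw [hχ.fderiv_eq_zero hz.2]; rfl
  by_cases hzk : β.ht z₀ = k
  · obtain ⟨w, Fl, s', hs', W, hWt, hWo, hzW, hsrc, hside, hsign⟩ :=
      exists_local_flattening hk (symm_mem hz₀).2
    have hyz : β.leaf k (β.X.symm z₀).2 = z₀ := by rw [← hzk, leaf_ht hz₀]
    obtain rfl : s = s' := NormalSign.unique hk (symm_mem hz₀).2 hs hs'
      (hsJ _ (symm_mem hz₀).2) (hsign _ (symm_mem hz₀).2 hzW)
    have hWX : W ⊆ β.X.target := fun z hz => (hWt hz).2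
    refine ⟨W, hWo, hyz ▸ hzW, fun χ hχ' h0 => ?_⟩
    have hχ : IsTestFun W χ := hχ'.mono inter_subset_left
    have hGW : IsDivFree W G := ⟨hWo, hG.meas.mono_measure (Measure.restrict_mono hWX le_rfl),
      fun C hC hCc => hG.bdd C (hC.trans hWX) hCc, fun χ hχ => hsub hWo hWX hχ⟩
    have h1 := Fl.integral_le β.J_open (contDiffOn_leaf hk) (fun z hz => (hWt hz).1) hGW
      (a := fun z => A z (Fl.vec z)) (hA.comp (continuousOn_id.prodMk (continuousOn_pi.2 fun i =>
        (Fl.continuousOn_vec β.J_open (contDiffOn_leaf hk) i).mono fun z hz => (hWt hz).1))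
        fun z hz => ⟨hWX hz, trivial⟩)
      ((hle.filter_mono (ae_mono (Measure.restrict_mono hWX le_rfl))).mono fun z hz => hz _) hχ h0
    have h2 : ∫ y in {y | consE 0 y ∈ Fl.Φ.source}, χ (β.leaf k y) *
        A (β.leaf k y) (Fl.vec (β.leaf k y)) = β.leafInt A χ k := by
      rw [leafInt, ← integral_indicator Fl.measurableSet_slice.measurableSet,
        ← integral_indicator β.J_open.measurableSet]
      refine integral_congr_ae (Filter.Eventually.of_forall fun y => ?_)
      simp only [indicator]
      by_cases hy : consE 0 y ∈ Fl.Φ.source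
      · have hyJ : y ∈ β.J := by simpa using Fl.tail_mem _ hy
        rw [if_pos (show y ∈ {y | consE 0 y ∈ Fl.Φ.source} from hy), if_pos hyJ]
        have h3 : Fl.Φ (consE 0 y) = β.leaf k y := by rw [Fl.apply]; simp
        rw [show Fl.vec (β.leaf k y) = tanVec (β.leaf k) y by
          rw [Flattening.vec, ← h3, Fl.Φ.left_inv hy, tailE_consE]]
      · rw [if_neg (show y ∉ {y | consE 0 y ∈ Fl.Φ.source} from hy)]
        split_ifs with hyJ
        · rw [hχ.eq_zero_of_notMem fun h => hy (hsrc y hyJ h), zero_mul]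
        · rfl
    rw [h2] at h1
    refine le_trans (le_of_eq ?_) h1
    rw [mul_flux_eq hG hWX hχ hk hs]
    congr 2
    ext z
    exact and_congr_right fun hz => (hside z hz).2.1.symm
  · obtain ⟨O, hO, hzO, h⟩ := exists_off_leaf hG A hkI hz₀ hzk
    refine ⟨O, hO, hzO, fun χ hχ _ => ?_⟩
    rw [(h χ hχ).1, (h χ hχ).2, mul_zero]

lemma flux_sum (hG : IsDivFree β.X.target G) {ι : Type*} (t : Finset ι)
    {χ : ι → Euc (n + 1) → ℝ} (hχ : ∀ i ∈ t, IsTestFun β.X.target (χ i)) (k : ℝ) :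
    β.flux G (fun z => ∑ i ∈ t, χ i z) k = ∑ i ∈ t, β.flux G (χ i) k := by
  simp only [flux]
  rw [← integral_finsetSum _ fun i hi => (integrableOn_flux hG (hχ i hi)).mono_set fun z hz => hz.1]
  congr 1
  funext z
  rw [fderiv_fun_sum fun i hi => (hχ i hi).differentiable z]
  simp

lemma leafInt_sum (hA : ContinuousOn (fun p : _ × _ => A p.1 p.2) (β.X.target ×ˢ univ))
    {ι : Type*} (t : Finset ι) {χ : ι → Euc (n + 1) → ℝ}
    (hχ : ∀ i ∈ t, IsTestFun β.X.target (χ i)) {k : ℝ} (hk : k ∈ β.K) :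
    β.leafInt A (fun z => ∑ i ∈ t, χ i z) k = ∑ i ∈ t, β.leafInt A (χ i) k := by
  simp only [leafInt]
  rw [← integral_finsetSum _ fun i hi => integrableOn_leafInt hA (hχ i hi).1.continuous
    (hχ i hi).2.1 (hχ i hi).2.2 hk]
  congr 1
  funext y
  rw [Finset.sum_mul]

/-- The one-sided Gauss-Green inequality for a leaf. -/
lemma flux_le (hG : IsDivFree β.X.target G)
    (hA : ContinuousOn (fun p : _ × _ => A p.1 p.2) (β.X.target ×ˢ univ))
    (hle : ∀ᵐ z ∂(volume.restrict β.X.target), ∀ v : Fin n → Euc (n + 1),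
      stdDet (Fin.cons (G z) v : Fin (n + 1) → Euc (n + 1)) ≤ A z v)
    {k s : ℝ} (hk : k ∈ β.K) (hs : s = 1 ∨ s = -1) (hsJ : ∀ y ∈ β.J, β.NormalSign k s y)
    {χ : Euc (n + 1) → ℝ} (hχ : IsTestFun β.X.target χ) (h0 : ∀ z, 0 ≤ χ z) :
    s * β.flux G χ k ≤ β.leafInt A χ k := by
  choose! O hO using fun z (hz : z ∈ β.X.target) => exists_flux_le hG hA hle hk hs hsJ hz
  obtain ⟨t, ζ, ht, hζ, hζχ, hsum⟩ := hχ.exists_partition (O := O)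
    fun z hz => ⟨(hO z hz).1, (hO z hz).2.1⟩
  have hX : ∀ i ∈ t, IsTestFun β.X.target (fun z => ζ i z * χ z) := fun i hi =>
    (hζχ i hi).mono inter_subset_right
  rw [funext hsum, flux_sum hG t hX, leafInt_sum hA t hX hk, Finset.mul_sum]
  exact Finset.sum_le_sum fun i hi => (hO i (ht i hi)).2.2 _ (hζχ i hi)
    fun z => mul_nonneg (hζ i z) (h0 z)

lemma isDivFree_const {V : Set (Euc (n + 1))} (hV : IsOpen V) (η : Euc (n + 1)) :
    IsDivFree V fun _ => η := by
  refine ⟨hV, aestronglyMeasurable_const, fun C _ _ => ⟨‖η‖, Filter.Eventually.of_forall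
    fun _ => le_rfl⟩, fun χ hχ => ?_⟩
  rw [setIntegral_eq_integral_of_forall_compl_eq_zero fun z hz => by
    rw [hχ.fderiv_eq_zero hz]; rfl]
  have hI : Integrable (fun z => fderiv ℝ χ z η) :=
    (hχ.continuous_fderiv.clm_apply continuous_const).integrable_of_hasCompactSupport
      (hχ.2.1.fderiv_apply ℝ η)
  have h := integral_mul_fderiv_eq_neg_fderiv_mul_of_integrable (μ := volume) (𝕜 := ℝ) (v := η)
    (f := fun _ : Euc (n + 1) => (1 : ℝ)) (g := χ) (by simp) (by simpa using hI)
    (by simpa using hχ.1.continuous.integrable_of_hasCompactSupport hχ.2.1)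
    (fun z _ => differentiableAt_const _) fun z _ => hχ.differentiable z
  simpa using h

lemma leafInt_eq_of_nonneg (hG : IsDivFree β.X.target G)
    (hA : ContinuousOn (fun p : _ × _ => A p.1 p.2) (β.X.target ×ˢ univ)) {k s : ℝ} (hk : k ∈ β.K)
    {V : Set (Euc (n + 1))} (hV : IsOpen V) (hVX : V ⊆ β.X.target)
    (hpos : ∀ χ : Euc (n + 1) → ℝ, IsTestFun V χ → (∀ z, 0 ≤ χ z) →
      β.leafInt A χ k = s * β.flux G χ k)
    {χ : Euc (n + 1) → ℝ} (hχ : IsTestFun V χ) : β.leafInt A χ k = s * β.flux G χ k := by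
  obtain ⟨θ, hθ, hθ01, hθ1⟩ := exists_testFun_eq_one hχ.2.1 hV hχ.2.2
  obtain ⟨b, hb⟩ := hχ.1.continuous.bounded_above_of_compact_support hχ.2.1
  have hb0 : 0 ≤ b := (norm_nonneg _).trans (hb 0)
  have hp : ∀ z, 0 ≤ χ z + b * θ z := by
    intro z
    by_cases hz : z ∈ tsupport χ
    · have h1 : θ z = 1 := hθ1.self_of_nhdsSet z hz
      have h2 := hb z
      rw [Real.norm_eq_abs] at h2
      rw [h1]; linarith [(abs_le.1 h2).1]
    · rw [image_eq_zero_of_notMem_tsupport hz, zero_add]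
      exact mul_nonneg hb0 (hθ01 z).1
  have hbθ := hθ.const_mul b
  have h1 := hpos _ (hχ.add hbθ) hp
  have h2 := hpos _ hbθ fun z => mul_nonneg hb0 (hθ01 z).1
  have h3 : β.leafInt A (fun z => χ z + b * θ z) k =
      β.leafInt A χ k + β.leafInt A (fun z => b * θ z) k := by
    have hi := fun (χ : Euc (n + 1) → ℝ) (hχ : IsTestFun β.X.target χ) =>
      integrableOn_leafInt hA hχ.1.continuous hχ.2.1 hχ.2.2 hk
    simp only [leafInt]
    rw [← integral_add (hi _ (hχ.mono hVX)) (hi _ (hbθ.mono hVX))]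
    congr 1
    funext y
    ring
  have h4 : β.flux G (fun z => χ z + b * θ z) k =
      β.flux G χ k + β.flux G (fun z => b * θ z) k := by
    simp only [flux]
    rw [← integral_add ((integrableOn_flux hG (hχ.mono hVX)).mono_set fun z hz => hz.1)
      ((integrableOn_flux hG (hbθ.mono hVX)).mono_set fun z hz => hz.1)]
    congr 1
    funext z
    rw [fderiv_fun_add (hχ.differentiable z) (hbθ.differentiable z)]
    rfl
  rw [h3, h4, h2] at h1
  linarith

/-- The Gauss-Green formula for a leaf and a constant vector field. -/
lemma leafInt_const (η : Euc (n + 1)) {k s : ℝ} (hk : k ∈ β.K) (hs : s = 1 ∨ s = -1)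
    (hsJ : ∀ y ∈ β.J, β.NormalSign k s y) {χ : Euc (n + 1) → ℝ} (hχ : IsTestFun β.X.target χ) :
    β.leafInt (fun _ v => stdDet (Fin.cons η v : Fin (n + 1) → Euc (n + 1))) χ k =
      s * β.flux (fun _ => η) χ k := by
  have hA : ∀ η : Euc (n + 1), ContinuousOn (fun p : Euc (n + 1) × (Fin n → Euc (n + 1)) =>
      stdDet (Fin.cons η p.2 : Fin (n + 1) → Euc (n + 1))) (β.X.target ×ˢ univ) := fun η =>
    continuousOn_stdDet_cons continuousOn_const fun i => by fun_prop
  have hpos : ∀ χ : Euc (n + 1) → ℝ, IsTestFun β.X.target χ → (∀ z, 0 ≤ χ z) →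
      β.leafInt (fun _ v => stdDet (Fin.cons η v : Fin (n + 1) → Euc (n + 1))) χ k =
        s * β.flux (fun _ => η) χ k := by
    intro χ hχ h0
    have h1 := flux_le (isDivFree_const β.X.open_target η) (hA η)
      (Filter.Eventually.of_forall fun _ _ => le_rfl) hk hs hsJ hχ h0
    have h2 := flux_le (isDivFree_const β.X.open_target (-η)) (hA (-η))
      (Filter.Eventually.of_forall fun _ _ => le_rfl) hk hs hsJ hχ h0
    have h3 : β.flux (fun _ => -η) χ k = -β.flux (fun _ => η) χ k := by
      simp only [flux, map_neg, integral_neg]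
    have h4 : β.leafInt (fun _ v => stdDet (Fin.cons (-η) v : Fin (n + 1) → Euc (n + 1))) χ k =
        -β.leafInt (fun _ v => stdDet (Fin.cons η v : Fin (n + 1) → Euc (n + 1))) χ k := by
      simp only [leafInt]
      rw [← integral_neg]
      congr 1
      funext y
      rw [← neg_one_smul ℝ η, stdDet_cons_smul]; ring
    rw [h3, h4] at h2
    linarith
  exact leafInt_eq_of_nonneg (isDivFree_const β.X.open_target η) (hA η) hk β.X.open_target subset_rfl
    hpos hχ

end Flux

end LeafBox

/-! ### Weak continuity of Jacobian determinants -/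

lemma det_add_pos {n : ℕ} {A : Euc n →L[ℝ] Euc n} {s : ℝ} (hA : ‖A‖ < s) :
    0 < (s • ContinuousLinearMap.id ℝ (Euc n) + A).det := by
  have hs : 0 < s := (norm_nonneg _).trans_lt hA
  have hcont : Continuous fun t : ℝ => (s • ContinuousLinearMap.id ℝ (Euc n) + t • A).det :=
    ContinuousLinearMap.continuous_det.comp (by fun_prop)
  have hne : ∀ t ∈ Icc (0 : ℝ) 1, (s • ContinuousLinearMap.id ℝ (Euc n) + t • A).det ≠ 0 := by
    intro t ht h
    have h1 := LinearMap.bot_lt_ker_of_det_eq_zero h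
    obtain ⟨x, hx, hx0⟩ := Submodule.exists_mem_ne_zero_of_ne_bot h1.ne'
    have h2 : s • x + t • A x = 0 := by simpa using hx
    have h3 : ‖s • x‖ = ‖t • A x‖ := by rw [eq_neg_of_add_eq_zero_left h2, norm_neg]
    rw [norm_smul, norm_smul, Real.norm_of_nonneg hs.le, Real.norm_of_nonneg ht.1] at h3
    have h4 : 0 < ‖x‖ := norm_pos_iff.2 hx0
    have h5 : t * ‖A x‖ ≤ ‖A‖ * ‖x‖ :=
      (mul_le_of_le_one_left (norm_nonneg _) ht.2).trans (A.le_opNorm x)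
    nlinarith
  have h01 : (0 : ℝ) ∈ Icc (0 : ℝ) 1 := ⟨le_rfl, zero_le_one⟩
  have h11 : (1 : ℝ) ∈ Icc (0 : ℝ) 1 := ⟨zero_le_one, le_rfl⟩
  rcases isPreconnected_Icc.pos_or_neg hcont.continuousOn hne with h | h
  · simpa using h 1 h11
  · have := h 0 h01
    rw [show (0 : ℝ) • A = 0 from zero_smul ℝ A, add_zero, ContinuousLinearMap.det,
      ContinuousLinearMap.toLinearMap_smul, LinearMap.det_smul] at this
    have h6 : (0 : ℝ) < s ^ Module.finrank ℝ (Euc n) := by positivity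
    simp at this
    rw [finrank_euclideanSpace, Fintype.card_fin] at h6
    linarith

open scoped Pointwise in
/-- If `h` is `C^1` with compact support, then the determinant of `s + Dh` has the same integral as
that of `s`, for large `s`. -/
lemma integral_det_add_fderiv_eq_zero {n : ℕ} {h : Euc n → Euc n} (hh : ContDiff ℝ 1 h)
    (hc : HasCompactSupport h) : ∃ S > 0, ∀ s ≥ S,
      ∫ x, ((s • ContinuousLinearMap.id ℝ (Euc n) + fderiv ℝ h x).det - s ^ n) = 0 := by
  obtain ⟨b, hb⟩ := (hh.continuous_fderiv (by simp)).bounded_above_of_compact_support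
    (hc.fderiv (𝕜 := ℝ))
  have hb0 : 0 ≤ b := (norm_nonneg _).trans (hb 0)
  refine ⟨b + 1, by positivity, fun s hs => ?_⟩
  have hs0 : 0 < s := by linarith
  set f : Euc n → Euc n := fun x => s • x + h x with hf
  have hf' : ∀ x, HasFDerivAt f (s • ContinuousLinearMap.id ℝ (Euc n) + fderiv ℝ h x) x := fun x =>
    ((hasFDerivAt_id x).const_smul s).add ((hh.differentiable (by simp)) x).hasFDerivAt
  have hlip : LipschitzWith (Real.toNNReal b) h :=
    lipschitzWith_of_nnnorm_fderiv_le (hh.differentiable (by simp)) fun x => by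
      rw [← NNReal.coe_le_coe, coe_nnnorm, Real.coe_toNNReal b hb0]; exact hb x
  have hlip' : ∀ x y, ‖h x - h y‖ ≤ b * ‖x - y‖ := fun x y => by
    have := hlip.dist_le_mul x y
    rwa [dist_eq_norm, dist_eq_norm, Real.coe_toNNReal b hb0] at this
  have hinj : Function.Injective f := by
    intro x y hxy
    have h1 : s • (x - y) = -(h x - h y) := by
      have : s • x + h x = s • y + h y := hxy
      rw [smul_sub, neg_sub, sub_eq_sub_iff_add_eq_add, add_comm (h y)]; exact this
    have h2 := hlip' x y
    have h3 : s * ‖x - y‖ = ‖h x - h y‖ := by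
      rw [← norm_neg (h x - h y), ← h1, norm_smul, Real.norm_of_nonneg hs0.le]
    have h4 : ‖x - y‖ = 0 := by nlinarith [norm_nonneg (x - y)]
    exact sub_eq_zero.1 (norm_eq_zero.1 h4)
  have hsurj : Function.Surjective f := by
    intro y
    have hcon : ContractingWith (Real.toNNReal (b / s)) fun x => s⁻¹ • (y - h x) := by
      refine ⟨?_, LipschitzWith.of_dist_le_mul fun x x' => ?_⟩
      · rw [← NNReal.coe_lt_coe, Real.coe_toNNReal _ (by positivity), NNReal.coe_one, div_lt_one hs0]
        linarith
      · rw [Real.coe_toNNReal _ (by positivity), dist_eq_norm, ← smul_sub, norm_smul,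
          sub_sub_sub_cancel_left, Real.norm_of_nonneg (by positivity), dist_eq_norm, norm_sub_rev x]
        calc s⁻¹ * ‖h x' - h x‖ ≤ s⁻¹ * (b * ‖x' - x‖) := by gcongr; exact hlip' _ _
          _ = b / s * ‖x' - x‖ := by ring
    have h1 := hcon.fixedPoint_isFixedPt
    set x := ContractingWith.fixedPoint _ hcon
    refine ⟨x, ?_⟩
    have h2 : s⁻¹ • (y - h x) = x := h1
    rw [hf]
    simp only
    conv_lhs => rw [← h2]
    rw [smul_inv_smul₀ hs0.ne', h2, sub_add_cancel]
  obtain ⟨R, hR⟩ := hc.isBounded.subset_closedBall 0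
  set B := Metric.closedBall (0 : Euc n) R
  have hoff : ∀ x ∉ B, h x = 0 := fun x hx => image_eq_zero_of_notMem_tsupport fun h' => hx (hR h')
  have himg : f '' B = s • B := by
    have h1 : f '' Bᶜ = s • Bᶜ := by
      refine image_congr fun x hx => ?_
      rw [hf]; simp only; rw [hoff x hx, add_zero]
    rw [← compl_inj_iff, ← image_compl_eq ⟨hinj, hsurj⟩, h1]
    exact image_compl_eq (MulAction.bijective (Units.mk0 s hs0.ne'))
  have h1 := integral_image_eq_integral_abs_det_fderiv_smul volume
    (measurableSet_closedBall : MeasurableSet B) (fun x _ => (hf' x).hasFDerivWithinAt)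
    hinj.injOn (fun _ => (1 : ℝ))
  rw [himg] at h1
  simp only [smul_eq_mul, mul_one] at h1
  have hpos : ∀ x, 0 < (s • ContinuousLinearMap.id ℝ (Euc n) + fderiv ℝ h x).det := fun x =>
    det_add_pos ((hb x).trans_lt (by linarith))
  simp_rw [abs_of_pos (hpos _)] at h1
  have hcont : Continuous fun x => (s • ContinuousLinearMap.id ℝ (Euc n) + fderiv ℝ h x).det :=
    ContinuousLinearMap.continuous_det.comp (continuous_const.add (hh.continuous_fderiv (by simp)))
  have hvB : volume B < ⊤ := measure_closedBall_lt_top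
  rw [← setIntegral_eq_integral_of_forall_compl_eq_zero (s := B), integral_sub, ← h1]
  · rw [setIntegral_const, setIntegral_const, Measure.real, Measure.addHaar_smul,
      ENNReal.toReal_mul, finrank_euclideanSpace, Fintype.card_fin, ENNReal.toReal_ofReal (abs_nonneg _),
      abs_of_pos (by positivity)]
    simp [Measure.real, mul_comm]
  · exact hcont.continuousOn.integrableOn_compact (isCompact_closedBall _ _)
  · exact integrableOn_const hvB.ne
  · intro x hx
    have : fderiv ℝ h x = 0 := by
      have hx' : x ∉ tsupport (fderiv ℝ h) := fun h' => hx (hR (tsupport_fderiv_subset ℝ h'))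
      exact image_eq_zero_of_notMem_tsupport hx'
    rw [this, add_zero, ContinuousLinearMap.det, ContinuousLinearMap.toLinearMap_smul,
      LinearMap.det_smul]
    simp

/-- The value at `0` of a polynomial family is a fixed combination of values at other points. -/
lemma exists_det_eq_sum (n : ℕ) (hn : 1 ≤ n) (S : ℝ) : ∃ c : Fin (n + 1) → ℝ,
    ∀ A : Euc n →L[ℝ] Euc n, A.det = ∑ i : Fin (n + 1), c i *
      (((S + i) • ContinuousLinearMap.id ℝ (Euc n) + A).det - (S + i) ^ n) := by
  set v : Fin (n + 1) → ℝ := fun i => S + i with hv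
  have hinj : Function.Injective v := fun i j h => by
    simp only [hv, add_right_inj, Nat.cast_inj] at h
    exact Fin.ext h
  refine ⟨fun i => (Lagrange.basis Finset.univ v i).eval 0, fun A => ?_⟩
  set b := (EuclideanSpace.basisFun (Fin n) ℝ).toBasis
  set N : Matrix (Fin n) (Fin n) ℝ := LinearMap.toMatrix b b (A : Euc n →ₗ[ℝ] Euc n) with hN
  set p : Polynomial ℝ := (-N).charpoly - Polynomial.X ^ n with hp
  have heval : ∀ t : ℝ, p.eval t = (t • ContinuousLinearMap.id ℝ (Euc n) + A).det - t ^ n := by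
    intro t
    rw [hp, Polynomial.eval_sub, Matrix.eval_charpoly, Polynomial.eval_pow, Polynomial.eval_X,
      ContinuousLinearMap.det, ← LinearMap.det_toMatrix b]
    congr 2
    rw [ContinuousLinearMap.toLinearMap_add, ContinuousLinearMap.toLinearMap_smul, map_add, map_smul,
      ContinuousLinearMap.coe_id, LinearMap.toMatrix_id, sub_neg_eq_add, ← hN]
    congr 1
    ext i j
    simp [Matrix.scalar_apply, Matrix.diagonal_apply, Matrix.one_apply]
  have hdeg : p.degree < (Finset.univ : Finset (Fin (n + 1))).card := by
    rw [Finset.card_univ, Fintype.card_fin]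
    refine (Polynomial.degree_sub_le _ _).trans_lt ?_
    rw [Matrix.charpoly_degree_eq_dim, Polynomial.degree_X_pow, Fintype.card_fin, max_self]
    exact_mod_cast Nat.lt_succ_self n
  have h1 := Lagrange.eq_interpolate (hinj.injOn) hdeg
  have h2 := congrArg (Polynomial.eval 0) h1
  have hz : (0 : ℝ) • ContinuousLinearMap.id ℝ (Euc n) = 0 := by ext; simp
  rw [heval, Lagrange.interpolate_apply, Polynomial.eval_finsetSum, hz, zero_add, zero_pow (by omega), sub_zero] at h2
  rw [h2]
  refine Finset.sum_congr rfl fun i _ => ?_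
  rw [Polynomial.eval_mul, Polynomial.eval_C, heval, mul_comm]

/-- The integral of the Jacobian of a compactly supported map vanishes. -/
lemma integral_det_fderiv_eq_zero {n : ℕ} (hn : 1 ≤ n) {h : Euc n → Euc n} (hh : ContDiff ℝ 1 h)
    (hc : HasCompactSupport h) : ∫ x, (fderiv ℝ h x).det = 0 := by
  obtain ⟨S, -, hS⟩ := integral_det_add_fderiv_eq_zero hh hc
  obtain ⟨c, hcs⟩ := exists_det_eq_sum n hn S
  rw [integral_congr_ae (Filter.Eventually.of_forall fun x => hcs (fderiv ℝ h x)),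
    integral_finsetSum]
  · refine Finset.sum_eq_zero fun i _ => ?_
    rw [integral_const_mul, hS _ (by linarith [(Nat.cast_nonneg (i : ℕ) : (0 : ℝ) ≤ (i : ℕ))]),
      mul_zero]
  · intro i _
    refine Integrable.const_mul ?_ _
    refine Continuous.integrable_of_hasCompactSupport ?_ ?_
    · exact (ContinuousLinearMap.continuous_det.comp (continuous_const.add
        (hh.continuous_fderiv (by simp)))).sub continuous_const
    · refine (hc.fderiv (𝕜 := ℝ)).mono fun x hx h0 => hx ?_
      simp only
      rw [h0, add_zero, ContinuousLinearMap.det, ContinuousLinearMap.toLinearMap_smul,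
        LinearMap.det_smul]
      simp

/-- The matrix of partial derivatives of a family of functions. -/
noncomputable def partials {n : ℕ} (a : Fin n → Euc n → ℝ) (x : Euc n) :
    Matrix (Fin n) (Fin n) ℝ := Matrix.of fun i j => fderiv ℝ (a i) x (stdVec j)

lemma integral_det_partials_eq_zero {n : ℕ} (hn : 1 ≤ n) {a : Fin n → Euc n → ℝ}
    (ha : ∀ i, ContDiff ℝ 1 (a i)) (hc : ∀ i, HasCompactSupport (a i)) :
    ∫ x, (partials a x).det = 0 := by
  set h : Euc n → Euc n := fun x => WithLp.toLp 2 fun i => a i x with hh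
  have hC : ContDiff ℝ 1 h := contDiff_euclidean.2 ha
  have hsupp : HasCompactSupport h := by
    refine HasCompactSupport.intro (K := ⋃ i, tsupport (a i))
      (isCompact_iUnion fun i => hc i) fun x hx => ?_
    ext i
    exact image_eq_zero_of_notMem_tsupport (f := a i) fun h' => hx (mem_iUnion.2 ⟨i, h'⟩)
  rw [← integral_det_fderiv_eq_zero hn hC hsupp]
  congr 1
  funext x
  rw [ContinuousLinearMap.det, ← LinearMap.det_toMatrix (EuclideanSpace.basisFun (Fin n) ℝ).toBasis]
  congr 1
  ext i j
  rw [LinearMap.toMatrix_apply, partials, Matrix.of_apply, ← stdVec_eq_basis]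
  have h1 : HasFDerivAt (fun x => (EuclideanSpace.proj i : Euc n →L[ℝ] ℝ) (h x)) _ x :=
    (EuclideanSpace.proj i : Euc n →L[ℝ] ℝ).hasFDerivAt.comp x
      ((hC.differentiable (by simp)) x).hasFDerivAt
  have h2 : (fun x => (EuclideanSpace.proj i : Euc n →L[ℝ] ℝ) (h x)) = a i := by
    funext x; rfl
  rw [h2] at h1
  rw [h1.fderiv]
  rfl

lemma abs_det_partials_le {n : ℕ} {a : Fin n → Euc n → ℝ} {x : Euc n} {b : ℝ}
    (h : ∀ i j, |fderiv ℝ (a i) x (stdVec j)| ≤ b) :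
    |(partials a x).det| ≤ n.factorial * b ^ n := by
  have := Matrix.det_le (A := partials a x) (abv := AbsoluteValue.abs) (x := b) h
  simpa [nsmul_eq_mul] using this

lemma det_partials_update {n : ℕ} (a : Fin n → Euc n → ℝ) (i : Fin n) (g : Euc n → ℝ) (x : Euc n) :
    partials (Function.update a i g) x =
      (partials a x).updateRow i fun j => fderiv ℝ g x (stdVec j) := by
  ext k j
  by_cases h : k = i
  · subst h; simp [partials]
  · simp [partials, h]

lemma det_partials_congr {n : ℕ} {a b : Fin n → Euc n → ℝ} {x : Euc n}
    (h : ∀ i, a i =ᶠ[𝓝 x] b i) : (partials a x).det = (partials b x).det := by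
  congr 1
  ext i j
  simp only [partials, Matrix.of_apply]
  rw [(h i).fderiv_eq]

lemma integrableOn_of_compact_support {m : ℕ} {S C : Set (Euc m)} {f : Euc m → ℝ} (hS : IsOpen S)
    (hC : IsCompact C) (hCS : C ⊆ S) (hf : ContinuousOn f S) (h0 : ∀ x ∉ C, f x = 0) :
    IntegrableOn f S := by
  refine (integrable_indicator_iff hS.measurableSet).1
    ((continuous_indicator_of_compact hS hC hCS hf fun x _ => h0 x).integrable_of_hasCompactSupport
      (HasCompactSupport.intro hC fun x hx => ?_))
  by_cases hxS : x ∈ S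
  · rw [indicator_of_mem hxS, h0 x hx]
  · rw [indicator_of_notMem hxS]

section WeakContinuity

variable {n : ℕ} {J : Set (Euc n)} {θ : Euc n → ℝ}

lemma continuousOn_det_partials (hJ : IsOpen J) {a : Fin n → Euc n → ℝ}
    (ha : ∀ i, ContDiffOn ℝ 1 (a i) J) : ContinuousOn (fun x => (partials a x).det) J := by
  refine (continuous_id.matrix_det).comp_continuousOn (continuousOn_pi.2 fun i =>
    continuousOn_pi.2 fun j => ?_)
  exact ((ha i).continuousOn_fderiv_of_isOpen hJ le_rfl).clm_apply continuousOn_const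

/-- Integration by parts for Jacobian determinants. -/
lemma integral_mul_det_partials (hn : 1 ≤ n) (hJ : IsOpen J) (hθ : ContDiff ℝ 1 θ)
    (hc : HasCompactSupport θ) (hθJ : tsupport θ ⊆ J) {a : Fin n → Euc n → ℝ}
    (ha : ∀ i, ContDiffOn ℝ 1 (a i) J) (i : Fin n) :
    ∫ x in J, θ x * (partials a x).det =
      -∫ x in J, a i x * (partials (Function.update a i θ) x).det := by
  obtain ⟨ζ, hζ, -, hζ1⟩ := exists_testFun_eq_one hc hJ hθJ
  have hmul : ∀ {f g : Euc n → ℝ}, ContDiff ℝ 1 f → tsupport f ⊆ J → ContDiffOn ℝ 1 g J →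
      ContDiff ℝ 1 fun x => f x * g x := by
    intro f g hf hfJ hg
    rw [contDiff_iff_contDiffAt]
    intro x
    by_cases hx : x ∈ J
    · exact hf.contDiffAt.mul (hg.contDiffAt (hJ.mem_nhds hx))
    · refine contDiffAt_const (c := (0 : ℝ)) |>.congr_of_eventuallyEq ?_
      filter_upwards [(isClosed_tsupport f).isOpen_compl.mem_nhds fun h => hx (hfJ h)] with y hy
      rw [image_eq_zero_of_notMem_tsupport hy, zero_mul]
  set h : Fin n → Euc n → ℝ := Function.update (fun j x => ζ x * a j x) i fun x => θ x * a i x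
    with hh
  have hC : ∀ j, ContDiff ℝ 1 (h j) := by
    intro j
    by_cases hj : j = i
    · subst hj; simp only [hh, Function.update_self]; exact hmul hθ hθJ (ha j)
    · simp only [hh, ne_eq, hj, not_false_eq_true, Function.update_of_ne]
      exact hmul (hζ.1.of_le (by simp)) hζ.2.2 (ha j)
  have hS : ∀ j, HasCompactSupport (h j) := by
    intro j
    by_cases hj : j = i
    · subst hj; simp only [hh, Function.update_self]; exact hc.mul_right
    · simp only [hh, ne_eq, hj, not_false_eq_true, Function.update_of_ne]; exact hζ.2.1.mul_right
  have h0 := integral_det_partials_eq_zero hn hC hS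
  have hrow : ∀ {b : Fin n → Euc n → ℝ} {f : Euc n → ℝ} {x}, x ∉ tsupport f →
      (partials (Function.update b i f) x).det = 0 := by
    intro b f x hx
    rw [det_partials_update]
    refine Matrix.det_eq_zero_of_row_eq_zero i fun j => ?_
    rw [Matrix.updateRow_self, fderiv_of_notMem_tsupport ℝ hx]
    rfl
  have hpt : ∀ x ∈ J, (partials h x).det =
      θ x * (partials a x).det + a i x * (partials (Function.update a i θ) x).det := by
    intro x hxJ
    by_cases hx : x ∈ tsupport θ
    · have h1 : (partials h x).det =
          (partials (Function.update a i fun x => θ x * a i x) x).det := by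
        refine det_partials_congr fun j => ?_
        by_cases hj : j = i
        · subst hj; simp only [hh, Function.update_self]; exact Filter.EventuallyEq.rfl
        · simp only [hh, ne_eq, hj, not_false_eq_true, Function.update_of_ne]
          filter_upwards [hζ1.filter_mono (nhds_le_nhdsSet hx)] with y hy
          rw [hy, one_mul]
      have hd : ∀ j, fderiv ℝ (fun x => θ x * a i x) x (stdVec j) =
          θ x * fderiv ℝ (a i) x (stdVec j) + a i x * fderiv ℝ θ x (stdVec j) := by
        intro j
        rw [fderiv_fun_mul ((hθ.differentiable (by simp)) x)
          (((ha i).contDiffAt (hJ.mem_nhds hxJ)).differentiableAt (by simp))]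
        simp
      rw [h1, det_partials_update, det_partials_update]
      have h2 : (fun j => fderiv ℝ (fun x => θ x * a i x) x (stdVec j)) =
          θ x • (partials a x) i + a i x • fun j => fderiv ℝ θ x (stdVec j) := by
        funext j; simp [hd, partials]
      rw [h2, Matrix.det_updateRow_add, Matrix.det_updateRow_smul, Matrix.det_updateRow_smul,
        Matrix.updateRow_eq_self]
    · rw [hrow hx, image_eq_zero_of_notMem_tsupport hx, hh, hrow]
      · ring
      · intro h'
        exact hx (tsupport_mul_subset_left h')
  have hoff : ∀ x ∉ J, (partials h x).det = 0 := fun x hx => by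
    rw [hh]
    exact hrow fun h' => hx (hθJ (tsupport_mul_subset_left h'))
  rw [← setIntegral_eq_integral_of_forall_compl_eq_zero hoff,
    setIntegral_congr_fun hJ.measurableSet hpt, integral_add] at h0
  · linarith
  · refine integrableOn_of_compact_support hJ hc hθJ
      (hθ.continuous.continuousOn.mul (continuousOn_det_partials hJ ha)) fun x hx => ?_
    rw [image_eq_zero_of_notMem_tsupport hx, zero_mul]
  · refine integrableOn_of_compact_support hJ hc hθJ ((ha i).continuousOn.mul
      (continuousOn_det_partials hJ fun j => ?_)) fun x hx => ?_
    · by_cases hj : j = i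
      · subst hj; simpa using hθ.contDiffOn
      · simpa [hj] using ha j
    · rw [hrow hx, mul_zero]

lemma contDiffOn_update {a : Fin n → Euc n → ℝ} (ha : ∀ i, ContDiffOn ℝ 1 (a i) J) (i : Fin n)
    {g : Euc n → ℝ} (hg : ContDiffOn ℝ 1 g J) (j : Fin n) :
    ContDiffOn ℝ 1 (Function.update a i g j) J := by
  by_cases hj : j = i
  · subst hj; simpa using hg
  · simpa [hj] using ha j

lemma det_partials_update_eq_zero {a : Fin n → Euc n → ℝ} {i : Fin n} {f : Euc n → ℝ} {x : Euc n}
    (hx : x ∉ tsupport f) : (partials (Function.update a i f) x).det = 0 := by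
  rw [det_partials_update]
  refine Matrix.det_eq_zero_of_row_eq_zero i fun j => ?_
  rw [Matrix.updateRow_self, fderiv_of_notMem_tsupport ℝ hx]
  rfl

/-- Jacobian determinants are weakly continuous under uniform convergence with uniform Lipschitz
bounds. -/
lemma exists_abs_integral_det_partials_sub_le (hn : 1 ≤ n) (hJ : IsOpen J) (hθ : ContDiff ℝ 1 θ)
    (hc : HasCompactSupport θ) (hθJ : tsupport θ ⊆ J) (b : ℝ) :
    ∃ C, 0 ≤ C ∧ ∀ (a a' : Fin n → Euc n → ℝ) (ε : ℝ), (∀ i, ContDiffOn ℝ 1 (a i) J) →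
      (∀ i, ContDiffOn ℝ 1 (a' i) J) →
      (∀ i j, ∀ x ∈ J, |fderiv ℝ (a i) x (stdVec j)| ≤ b) →
      (∀ i j, ∀ x ∈ J, |fderiv ℝ (a' i) x (stdVec j)| ≤ b) →
      (∀ i, ∀ x ∈ J, |a i x - a' i x| ≤ ε) →
      |(∫ x in J, θ x * (partials a x).det) - ∫ x in J, θ x * (partials a' x).det| ≤ C * ε := by
  obtain ⟨b', hb'⟩ := (hθ.continuous_fderiv (by simp)).bounded_above_of_compact_support
    (hc.fderiv (𝕜 := ℝ))
  set L := max b b' with hL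
  set C := ((n.factorial * L ^ n) * volume.real (tsupport θ)) with hC
  have hθL : ∀ x j, |fderiv ℝ θ x (stdVec j)| ≤ L := by
    intro x j
    refine ((fderiv ℝ θ x).le_opNorm _).trans ?_
    have : ‖(stdVec j : Euc n)‖ = 1 := by simp [stdVec]
    rw [this, mul_one]
    exact (hb' x).trans (le_max_right _ _)
  have hL0 : 0 ≤ L := (norm_nonneg _).trans ((hb' 0).trans (le_max_right _ _))
  have hC0 : 0 ≤ C := by positivity
  refine ⟨n * C, by positivity, fun a a' ε ha ha' hab ha'b hε => ?_⟩
  set F : Finset (Fin n) → Fin n → Euc n → ℝ := fun S i => if i ∈ S then a i else a' i with hF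
  have hFC : ∀ S i, ContDiffOn ℝ 1 (F S i) J := by
    intro S i; simp only [hF]; split_ifs
    exacts [ha i, ha' i]
  have hFb : ∀ S i j, ∀ x ∈ J, |fderiv ℝ (F S i) x (stdVec j)| ≤ L := by
    intro S i j x hx; simp only [hF]; split_ifs
    exacts [(hab i j x hx).trans (le_max_left _ _), (ha'b i j x hx).trans (le_max_left _ _)]
  have hint : ∀ {c : Fin n → Euc n → ℝ}, (∀ i, ContDiffOn ℝ 1 (c i) J) →
      IntegrableOn (fun x => θ x * (partials c x).det) J := fun {c} hcC =>
    integrableOn_of_compact_support hJ hc hθJ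
      (hθ.continuous.continuousOn.mul (continuousOn_det_partials hJ hcC)) fun x hx => by
        rw [image_eq_zero_of_notMem_tsupport hx, zero_mul]
  have hstep : ∀ (S : Finset (Fin n)) (i : Fin n), i ∉ S →
      |(∫ x in J, θ x * (partials (F (insert i S)) x).det) -
        ∫ x in J, θ x * (partials (F S) x).det| ≤ C * ε := by
    intro S i hi
    set d : Euc n → ℝ := fun x => a i x - a' i x with hd
    have hdC : ContDiffOn ℝ 1 d J := (ha i).sub (ha' i)
    have h1 : ∀ x ∈ J, (partials (F (insert i S)) x).det - (partials (F S) x).det =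
        (partials (Function.update (F S) i d) x).det := by
      intro x hx
      have e1 : F (insert i S) = Function.update (F S) i (a i) := by
        funext j
        by_cases hj : j = i
        · subst hj; simp [hF]
        · simp [hF, hj]
      have e2 : F S = Function.update (F S) i (a' i) := by
        rw [eq_comm, Function.update_eq_self_iff]; simp [hF, hi]
      have e3 : (fun j => fderiv ℝ (a i) x (stdVec j)) = (fun j => fderiv ℝ d x (stdVec j)) +
          fun j => fderiv ℝ (a' i) x (stdVec j) := by
        funext j
        rw [hd, fderiv_fun_sub (((ha i).contDiffAt (hJ.mem_nhds hx)).differentiableAt (by simp))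
          (((ha' i).contDiffAt (hJ.mem_nhds hx)).differentiableAt (by simp))]
        simp
      rw [e1, det_partials_update, e3, Matrix.det_updateRow_add, ← det_partials_update,
        ← det_partials_update, ← e2, add_sub_cancel_right]
    rw [← integral_sub (hint (hFC _)) (hint (hFC _))]
    have h2 : ∫ x in J, (θ x * (partials (F (insert i S)) x).det - θ x * (partials (F S) x).det) =
        ∫ x in J, θ x * (partials (Function.update (F S) i d) x).det :=
      setIntegral_congr_fun hJ.measurableSet fun x hx => by
        rw [← mul_sub, h1 x hx]
    rw [h2, integral_mul_det_partials hn hJ hθ hc hθJ (contDiffOn_update (hFC S) i hdC) i,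
      abs_neg, Function.update_self, Function.update_idem]
    rw [setIntegral_eq_of_subset_of_forall_sdiff_eq_zero hJ.measurableSet hθJ fun x hx => by
      rw [det_partials_update_eq_zero hx.2, mul_zero]]
    have hbound : ∀ x ∈ tsupport θ,
        ‖d x * (partials (Function.update (F S) i θ) x).det‖ ≤ ε * (n.factorial * L ^ n) := by
      intro x hx
      rw [norm_mul]
      refine mul_le_mul (hε i x (hθJ hx)) ?_ (norm_nonneg _)
        ((abs_nonneg _).trans (hε i x (hθJ hx)))
      refine abs_det_partials_le fun k j => ?_
      by_cases hk : k = i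
      · subst hk; simpa using hθL x j
      · simpa [hk] using hFb S k j x (hθJ hx)
    refine (norm_setIntegral_le_of_norm_le_const hc.measure_lt_top hbound).trans (le_of_eq ?_)
    rw [hC]; ring
  have hind : ∀ S : Finset (Fin n), |(∫ x in J, θ x * (partials (F S) x).det) -
      ∫ x in J, θ x * (partials a' x).det| ≤ S.card * (C * ε) := by
    intro S
    induction S using Finset.induction_on with
    | empty =>
      have : F ∅ = a' := by funext i; simp [hF]
      simp [this]
    | insert i S hi ih =>
      rw [Finset.card_insert_of_notMem hi]
      push_cast
      refine (abs_sub_le _ (∫ x in J, θ x * (partials (F S) x).det) _).trans ?_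
      linarith [hstep S i hi]
  have h := hind Finset.univ
  have e : F Finset.univ = a := by funext i; simp [hF]
  rw [e, Finset.card_univ, Fintype.card_fin] at h
  linarith [h, mul_assoc (n : ℝ) C ε]

end WeakContinuity

namespace LeafBox

variable {n : ℕ} {β : LeafBox n} {G : Euc (n + 1) → Euc (n + 1)}

/-- The flux is continuous at the heights of leaves. -/
lemma tendsto_flux (hG : IsDivFree β.X.target G) {χ : Euc (n + 1) → ℝ}
    (hχ : IsTestFun β.X.target χ) {k₀ : ℝ} (hk₀ : k₀ ∈ β.K) :
    Filter.Tendsto (β.flux G χ) (𝓝 k₀) (𝓝 (β.flux G χ k₀)) := by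
  have hI := integrableOn_flux hG hχ
  have heq : ∀ k, β.flux G χ k = ∫ z in β.X.target,
      {z ∈ β.X.target | β.ht z < k}.indicator (fun z => fderiv ℝ χ z (G z)) z := by
    intro k
    rw [setIntegral_indicator (measurableSet_below k), flux]
    congr 2
    ext z; exact ⟨fun h => ⟨h.1, h⟩, fun h => h.2⟩
  rw [heq, funext heq]
  refine tendsto_integral_filter_of_dominated_convergence (l := 𝓝 k₀)
    (fun z => ‖fderiv ℝ χ z (G z)‖) ?_ ?_ hI.norm ?_
  · exact Filter.Eventually.of_forall fun k => hI.aestronglyMeasurable.indicator (measurableSet_below k)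
  · exact Filter.Eventually.of_forall fun k => Filter.Eventually.of_forall fun z =>
      norm_indicator_le_norm_self _ _
  · have h0 : ∀ᵐ z ∂(volume.restrict β.X.target), β.ht z ≠ k₀ := by
      rw [ae_restrict_iff' β.X.open_target.measurableSet, ae_iff]
      convert volume_leaf hk₀ using 2
      ext z
      simp
    filter_upwards [h0, ae_restrict_mem β.X.open_target.measurableSet] with z hz hzt
    rcases lt_or_gt_of_ne hz with h | h
    · refine tendsto_const_nhds.congr' ?_
      filter_upwards [lt_mem_nhds h] with k hk
      rw [indicator_of_mem (show z ∈ {z ∈ β.X.target | β.ht z < k₀} from ⟨hzt, h⟩),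
        indicator_of_mem (show z ∈ {z ∈ β.X.target | β.ht z < k} from ⟨hzt, hk⟩)]
    · refine tendsto_const_nhds.congr' ?_
      filter_upwards [gt_mem_nhds h] with k hk
      rw [indicator_of_notMem fun h' => lt_asymm h h'.2,
        indicator_of_notMem fun h' => lt_asymm hk h'.2]

lemma _root_.stdDet_cons_stdVec (i : Fin (n + 1)) (v : Fin n → Euc (n + 1)) :
    stdDet (Fin.cons (stdVec i) v : Fin (n + 1) → Euc (n + 1)) =
      (-1) ^ (i : ℕ) * (Matrix.of fun a b => v b (i.succAbove a)).det := by
  rw [stdDet, Module.Basis.det_apply, Matrix.det_succ_column_zero]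
  rw [Finset.sum_eq_single i]
  · have h1 : (EuclideanSpace.basisFun (Fin (n + 1)) ℝ).toBasis.toMatrix
        (Fin.cons (stdVec i) v : Fin (n + 1) → Euc (n + 1)) i 0 = 1 := by
      simp [Module.Basis.toMatrix_apply, stdVec]
    rw [h1, mul_one]
    rfl
  · intro j _ hj
    have h1 : (EuclideanSpace.basisFun (Fin (n + 1)) ℝ).toBasis.toMatrix
        (Fin.cons (stdVec i) v : Fin (n + 1) → Euc (n + 1)) j 0 = 0 := by
      simp [Module.Basis.toMatrix_apply, stdVec, hj]
    rw [h1, mul_zero, zero_mul]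
  · intro h; exact absurd (Finset.mem_univ i) h

lemma _root_.exists_stdDet_cons_stdVec_ne_zero {v : Fin n → Euc (n + 1)}
    (hv : LinearIndependent ℝ v) :
    ∃ i, stdDet (Fin.cons (stdVec i) v : Fin (n + 1) → Euc (n + 1)) ≠ 0 := by
  by_contra! h
  obtain ⟨x, hx⟩ := exists_stdDet_cons_pos hv
  have h1 : x = ∑ i, x i • stdVec i := by
    rw [stdVec_eq_basis]
    exact ((EuclideanSpace.basisFun (Fin (n + 1)) ℝ).toBasis.sum_repr x).symm
  have h2 : vecForm n x v = 0 := by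
    rw [h1, map_sum, ContinuousAlternatingMap.sum_apply]
    refine Finset.sum_eq_zero fun i _ => ?_
    rw [map_smul, ContinuousAlternatingMap.smul_apply, vecForm_apply, h i, smul_zero]
  rw [vecForm_apply] at h2
  exact hx.ne' h2

/-- The coordinates of the leaf at height `k`, except the `i`-th. -/
noncomputable def coords (β : LeafBox n) (i : Fin (n + 1)) (k : ℝ) (l : Fin n) (y : Euc n) : ℝ :=
  β.leaf k y (i.succAbove l)

lemma contDiffOn_coords {k : ℝ} (hk : k ∈ β.K) (i : Fin (n + 1)) (l : Fin n) :
    ContDiffOn ℝ 1 (β.coords i k l) β.J :=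
  (EuclideanSpace.proj (i.succAbove l) : Euc (n + 1) →L[ℝ] ℝ).contDiff.comp_contDiffOn
    (contDiffOn_leaf hk)

lemma fderiv_coords {k : ℝ} (hk : k ∈ β.K) (i : Fin (n + 1)) (l : Fin n) {y : Euc n}
    (hy : y ∈ β.J) (v : Euc n) :
    fderiv ℝ (β.coords i k l) y v = fderiv ℝ (β.leaf k) y v (i.succAbove l) := by
  have h1 : HasFDerivAt (β.coords i k l) ((EuclideanSpace.proj (i.succAbove l) :
      Euc (n + 1) →L[ℝ] ℝ).comp (fderiv ℝ (β.leaf k) y)) y :=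
    (EuclideanSpace.proj (i.succAbove l) : Euc (n + 1) →L[ℝ] ℝ).hasFDerivAt.comp y
      (((contDiffOn_leaf hk).contDiffAt (β.J_open.mem_nhds hy)).differentiableAt
        (by simp)).hasFDerivAt
  rw [h1.fderiv]; rfl

lemma stdDet_cons_stdVec_tanVec {k : ℝ} (hk : k ∈ β.K) (i : Fin (n + 1)) {y : Euc n}
    (hy : y ∈ β.J) : stdDet (Fin.cons (stdVec i) (tanVec (β.leaf k) y) :
      Fin (n + 1) → Euc (n + 1)) = (-1) ^ (i : ℕ) * (partials (β.coords i k) y).det := by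
  rw [stdDet_cons_stdVec]
  congr 2
  ext a b
  rw [partials, Matrix.of_apply, Matrix.of_apply, fderiv_coords hk i a hy]
  rfl

lemma leafInt_stdVec {k : ℝ} (hk : k ∈ β.K) (i : Fin (n + 1)) (χ : Euc (n + 1) → ℝ) :
    β.leafInt (fun _ v => stdDet (Fin.cons (stdVec i) v : Fin (n + 1) → Euc (n + 1))) χ k =
      (-1) ^ (i : ℕ) * ∫ y in β.J, χ (β.leaf k y) * (partials (β.coords i k) y).det := by
  rw [← integral_const_mul]
  refine setIntegral_congr_fun β.J_open.measurableSet fun y hy => ?_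
  simp only
  rw [stdDet_cons_stdVec_tanVec hk i hy]; ring

/-- The integral of a test function against a minor is continuous in the height of the leaf. -/
lemma tendsto_integral_minor (hn : 1 ≤ n) {k₀ : ℝ} (hk₀ : k₀ ∈ β.K) (i : Fin (n + 1))
    {C : Set (Euc n)} (hC : IsCompact C) (hCJ : C ⊆ β.J) {χ : Euc (n + 1) → ℝ}
    (hχ : IsTestFun β.X.target χ) (hχC : ∀ k ∈ β.K, ∀ y ∈ β.J, y ∉ C →
      β.leaf k y ∉ tsupport χ) :
    Filter.Tendsto (fun k => ∫ y in β.J, χ (β.leaf k y) * (partials (β.coords i k) y).det)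
      (𝓝[β.K] k₀) (𝓝 (∫ y in β.J, χ (β.leaf k₀ y) * (partials (β.coords i k₀) y).det)) := by
  have hk₀I := β.K_subset hk₀
  obtain ⟨L, hL⟩ := β.lipschitz
  have hLk : ∀ k ∈ β.K, ∀ y ∈ β.J, ‖β.leaf k y - β.leaf k₀ y‖ ≤ L * |k - k₀| := by
    intro k hk y hy
    have := hL.dist_le_mul (k, y) ⟨β.K_subset hk, hy⟩ (k₀, y) ⟨hk₀I, hy⟩
    rw [dist_eq_norm] at this
    refine this.trans (le_of_eq ?_)
    rw [Prod.dist_eq, dist_self, Real.dist_eq, max_eq_left (abs_nonneg _)]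
  have hder : ∀ k ∈ β.K, ∀ l j, ∀ y ∈ β.J, |fderiv ℝ (β.coords i k l) y (stdVec j)| ≤ L := by
    intro k hk l j y hy
    rw [fderiv_coords hk i l hy]
    have hlip : LipschitzOnWith L (β.leaf k) β.J := LipschitzOnWith.of_dist_le_mul
      fun y hy y' hy' => by
        refine (hL.dist_le_mul (k, y) ⟨β.K_subset hk, hy⟩ (k, y') ⟨β.K_subset hk, hy'⟩).trans
          (le_of_eq ?_)
        rw [Prod.dist_eq, dist_self, max_eq_right dist_nonneg]
    have h1 := norm_fderiv_le_of_lipschitzOn ℝ (β.J_open.mem_nhds hy) hlip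
    refine (PiLp.norm_apply_le _ _).trans (((fderiv ℝ (β.leaf k) y).le_opNorm _).trans ?_)
    have : ‖(stdVec j : Euc n)‖ = 1 := by simp [stdVec]
    rw [this, mul_one]; exact h1
  set θ : Euc n → ℝ := β.J.indicator fun y => χ (β.leaf k₀ y) with hθ
  have hCc : IsClosed C := hC.isClosed
  have hθ0 : ∀ y ∉ C, θ y = 0 := by
    intro y hy
    by_cases hyJ : y ∈ β.J
    · rw [hθ, indicator_of_mem hyJ, image_eq_zero_of_notMem_tsupport (hχC k₀ hk₀ y hyJ hy)]
    · rw [hθ, indicator_of_notMem hyJ]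
  have hθsupp : tsupport θ ⊆ C := closure_minimal (fun y hy => by
    by_contra h; exact hy (hθ0 y h)) hCc
  have hθC1 : ContDiff ℝ 1 θ := by
    rw [contDiff_iff_contDiffAt]
    intro y
    by_cases hy : y ∈ C
    · refine ((hχ.1.of_le (by simp)).contDiffAt.comp y ((contDiffOn_leaf hk₀).contDiffAt
        (β.J_open.mem_nhds (hCJ hy)))).congr_of_eventuallyEq ?_
      filter_upwards [β.J_open.mem_nhds (hCJ hy)] with y' hy'
      rw [hθ, indicator_of_mem hy']; rfl
    · refine contDiffAt_const (c := (0 : ℝ)) |>.congr_of_eventuallyEq ?_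
      filter_upwards [hCc.isOpen_compl.mem_nhds hy] with y' hy' using hθ0 y' hy'
  have hθcs : HasCompactSupport θ := hC.of_isClosed_subset (isClosed_tsupport _) hθsupp
  obtain ⟨c, hc0, hc⟩ := exists_abs_integral_det_partials_sub_le hn β.J_open hθC1 hθcs
    (hθsupp.trans hCJ) L
  obtain ⟨b, hb⟩ := hχ.continuous_fderiv.bounded_above_of_compact_support
    (hχ.2.1.fderiv (𝕜 := ℝ))
  have hb0 : 0 ≤ b := (norm_nonneg _).trans (hb 0)
  have hχlip : ∀ z z', |χ z - χ z'| ≤ b * ‖z - z'‖ := fun z z' => by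
    have := Convex.norm_image_sub_le_of_norm_fderiv_le (𝕜 := ℝ)
      (fun x _ => hχ.differentiable x) (fun x _ => hb x) convex_univ (mem_univ z') (mem_univ z)
    exact this
  set D : ℝ → ℝ := fun k => ∫ y in β.J, χ (β.leaf k y) * (partials (β.coords i k) y).det with hD
  set N := (b * L * (n.factorial * (L : ℝ) ^ n)) * volume.real C + c * L with hN
  have hint : ∀ k ∈ β.K, ∀ f : Euc n → ℝ, ContinuousOn f β.J → (∀ y ∉ C, y ∈ β.J → f y = 0) →
      IntegrableOn (fun y => f y * (partials (β.coords i k) y).det) β.J := by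
    intro k hk f hf hf0
    have := integrableOn_of_compact_support (f := β.J.indicator fun y =>
      f y * (partials (β.coords i k) y).det) β.J_open hC hCJ ?_ ?_
    · exact this.congr_fun (fun y hy => indicator_of_mem hy _) β.J_open.measurableSet
    · exact (hf.mul (continuousOn_det_partials β.J_open
        fun l => contDiffOn_coords hk i l)).congr fun y hy => indicator_of_mem hy _
    · intro y hy
      by_cases hyJ : y ∈ β.J
      · rw [indicator_of_mem hyJ, hf0 y hy hyJ, zero_mul]
      · rw [indicator_of_notMem hyJ]
  have hχk : ∀ k ∈ β.K, ContinuousOn (fun y => χ (β.leaf k y)) β.J := fun k hk =>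
    hχ.1.continuous.comp_continuousOn (continuousOn_leaf (β.K_subset hk))
  have hχ0 : ∀ k ∈ β.K, ∀ y ∉ C, y ∈ β.J → χ (β.leaf k y) = 0 := fun k hk y hy hyJ =>
    image_eq_zero_of_notMem_tsupport (hχC k hk y hyJ hy)
  have hbound : ∀ k ∈ β.K, |D k - D k₀| ≤ N * |k - k₀| := by
    intro k hk
    have h1 : |D k - ∫ y in β.J, θ y * (partials (β.coords i k) y).det| ≤
        (b * L * (n.factorial * (L : ℝ) ^ n)) * volume.real C * |k - k₀| := by
      rw [hD]
      simp only
      rw [← integral_sub (hint k hk _ (hχk k hk) (hχ0 k hk))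
        (hint k hk _ hθC1.continuous.continuousOn fun y hy _ => hθ0 y hy)]
      rw [setIntegral_eq_of_subset_of_forall_sdiff_eq_zero β.J_open.measurableSet hCJ fun y hy => by
        rw [hχ0 k hk y hy.2 hy.1, hθ0 y hy.2]; ring]
      have hbd : ∀ y ∈ C, ‖χ (β.leaf k y) * (partials (β.coords i k) y).det -
          θ y * (partials (β.coords i k) y).det‖ ≤
          b * (L * |k - k₀|) * (n.factorial * (L : ℝ) ^ n) := by
        intro y hy
        rw [← sub_mul, norm_mul, hθ, indicator_of_mem (hCJ hy)]
        refine mul_le_mul ((hχlip _ _).trans ?_)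
          (abs_det_partials_le fun l j => hder k hk l j y (hCJ hy)) (norm_nonneg _) (by positivity)
        exact mul_le_mul_of_nonneg_left (hLk k hk y (hCJ hy)) hb0
      refine (norm_setIntegral_le_of_norm_le_const hC.measure_lt_top hbd).trans (le_of_eq ?_)
      ring
    have h2 := hc (β.coords i k) (β.coords i k₀) (L * |k - k₀|)
      (fun l => contDiffOn_coords hk i l) (fun l => contDiffOn_coords hk₀ i l)
      (fun l j y hy => hder k hk l j y hy) (fun l j y hy => hder k₀ hk₀ l j y hy)
      fun l y hy => (PiLp.norm_apply_le (β.leaf k y - β.leaf k₀ y) (i.succAbove l)).trans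
        (hLk k hk y hy)
    have h3 : D k₀ = ∫ y in β.J, θ y * (partials (β.coords i k₀) y).det :=
      setIntegral_congr_fun β.J_open.measurableSet fun y hy => by
        simp only [hθ]; rw [indicator_of_mem hy]
    rw [← h3] at h2
    refine (abs_sub_le _ (∫ y in β.J, θ y * (partials (β.coords i k) y).det) _).trans ?_
    rw [hN]
    linarith
  refine tendsto_iff_dist_tendsto_zero.2 (squeeze_zero' (Filter.Eventually.of_forall
    fun _ => dist_nonneg) (g := fun k => N * |k - k₀|) ?_ ?_)
  · filter_upwards [self_mem_nhdsWithin] with k hk using hbound k hk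
  · have : Filter.Tendsto (fun k : ℝ => N * |k - k₀|) (𝓝 k₀) (𝓝 (N * |k₀ - k₀|)) := by
      exact (Continuous.tendsto (by fun_prop) k₀)
    simp only [sub_self, abs_zero, mul_zero] at this
    exact this.mono_left nhdsWithin_le_nhds

/-- The side of the leaves to which their oriented normals point is locally constant. -/
lemma eventually_normalSign (hn : 1 ≤ n) {k₀ : ℝ} (hk₀ : k₀ ∈ β.K) :
    ∃ s : ℝ, (s = 1 ∨ s = -1) ∧ ∀ᶠ k in 𝓝 k₀, k ∈ β.K → ∀ y ∈ β.J, β.NormalSign k s y := by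
  have hk₀I := β.K_subset hk₀
  rcases β.J.eq_empty_or_nonempty with hJ | ⟨y₀, hy₀⟩
  · exact ⟨1, Or.inl rfl, Filter.Eventually.of_forall fun k _ y hy => by simp [hJ] at hy⟩
  obtain ⟨i, hi⟩ := exists_stdDet_cons_stdVec_ne_zero (indep_leaf hk₀ hy₀)
  rw [stdDet_cons_stdVec_tanVec hk₀ i hy₀] at hi
  have hd0 : (partials (β.coords i k₀) y₀).det ≠ 0 := right_ne_zero_of_mul hi
  set d : Euc n → ℝ := fun y => (partials (β.coords i k₀) y₀).det *
    (partials (β.coords i k₀) y).det with hd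
  have hdc : ContinuousOn d β.J := continuousOn_const.mul
    (continuousOn_det_partials β.J_open fun l => contDiffOn_coords hk₀ i l)
  have hnear : ∀ᶠ y in 𝓝 y₀, y ∈ β.J ∧ 0 < d y :=
    (β.J_open.eventually_mem hy₀).and ((hdc.continuousAt (β.J_open.mem_nhds hy₀)).eventually
      (lt_mem_nhds (mul_self_pos.2 hd0)))
  obtain ⟨r, hr, hball⟩ := Metric.nhds_basis_closedBall.mem_iff.1 hnear
  set C := Metric.closedBall y₀ r
  have hC : IsCompact C := isCompact_closedBall _ _
  have hCJ : C ⊆ β.J := fun y hy => (hball hy).1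
  set O := β.X '' (β.I ×ˢ Metric.ball y₀ r) with hO
  have hsub : β.I ×ˢ Metric.ball y₀ r ⊆ β.X.source := by
    rw [β.source_eq]; exact prod_mono_right (Metric.ball_subset_closedBall.trans hCJ)
  have hOo : IsOpen O := β.X.isOpen_image_of_subset_source (β.I_open.prod Metric.isOpen_ball) hsub
  have hOt : O ⊆ β.X.target := by rintro _ ⟨p, hp, rfl⟩; exact β.X.map_source (hsub hp)
  obtain ⟨χ, hχ, hχ01, hχ1⟩ := exists_testFun_eq_one (isCompact_singleton (x := β.leaf k₀ y₀)) hOo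
    (by rintro _ rfl; exact ⟨(k₀, y₀), ⟨hk₀I, Metric.mem_ball_self hr⟩, rfl⟩)
  have hχC : ∀ k ∈ β.K, ∀ y ∈ β.J, y ∉ C → β.leaf k y ∉ tsupport χ := by
    intro k hk y hy hyC h
    obtain ⟨p, hp, hpe⟩ := hχ.2.2 h
    have := β.X.injOn (hsub hp) (mem_source (β.K_subset hk) hy) hpe
    subst this
    exact hyC (Metric.ball_subset_closedBall hp.2)
  have hχX := hχ.mono hOt
  have htend := tendsto_integral_minor hn hk₀ i hC hCJ hχX hχC
  set D : ℝ → ℝ := fun k => ∫ y in β.J, χ (β.leaf k y) * (partials (β.coords i k) y).det with hD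
  have hD0 : D k₀ ≠ 0 := by
    have hpos : 0 < (partials (β.coords i k₀) y₀).det * D k₀ := by
      rw [hD]; simp only
      rw [← integral_const_mul, ← integral_indicator β.J_open.measurableSet]
      have h0 : ∀ y ∉ C, β.J.indicator (fun y => (partials (β.coords i k₀) y₀).det *
          (χ (β.leaf k₀ y) * (partials (β.coords i k₀) y).det)) y = 0 := by
        intro y hy
        by_cases hyJ : y ∈ β.J
        · rw [indicator_of_mem hyJ, image_eq_zero_of_notMem_tsupport (hχC k₀ hk₀ y hyJ hy)]; ring
        · rw [indicator_of_notMem hyJ]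
      refine Continuous.integral_pos_of_hasCompactSupport_nonneg_nonzero (x := y₀)
        (continuous_indicator_of_compact β.J_open hC hCJ (continuousOn_const.mul
          ((hχ.1.continuous.comp_continuousOn (continuousOn_leaf hk₀I)).mul
          (continuousOn_det_partials β.J_open fun l => contDiffOn_coords hk₀ i l))) ?_)
        (HasCompactSupport.intro hC h0) ?_ ?_
      · intro y hyJ hy
        have := h0 y hy
        rwa [indicator_of_mem hyJ] at this
      · intro y
        by_cases hy : y ∈ C
        · rw [indicator_of_mem (hCJ hy), mul_left_comm]
          exact mul_nonneg (hχ01 _).1 (hball hy).2.le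
        · rw [h0 y hy]; rfl
      · rw [indicator_of_mem hy₀, (hχ1.self_of_nhdsSet _ rfl), one_mul]
        exact mul_ne_zero hd0 hd0
    exact right_ne_zero_of_mul hpos.ne'
  obtain ⟨s, hs, hsJ⟩ := exists_normalSign hk₀
  refine ⟨s, hs, ?_⟩
  set Λ : ℝ → ℝ := fun k => (-1) ^ (i : ℕ) * β.flux (fun _ => stdVec i) χ k with hΛ
  have hrel : ∀ k ∈ β.K, ∀ s' : ℝ, (s' = 1 ∨ s' = -1) → (∀ y ∈ β.J, β.NormalSign k s' y) →
      D k = s' * Λ k := by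
    intro k hk s' hs' h
    have h1 := leafInt_const (stdVec i) hk hs' h hχX
    rw [leafInt_stdVec hk i χ] at h1
    have h2 : ((-1 : ℝ) ^ (i : ℕ)) * (-1) ^ (i : ℕ) = 1 := by rw [← mul_pow]; simp
    calc D k = ((-1 : ℝ) ^ (i : ℕ)) * ((-1) ^ (i : ℕ) * D k) := by rw [← mul_assoc, h2, one_mul]
      _ = _ := by rw [h1, hΛ]; ring
  have hΛt : Filter.Tendsto Λ (𝓝[β.K] k₀) (𝓝 (Λ k₀)) :=
    ((tendsto_flux (isDivFree_const β.X.open_target _) hχX hk₀).const_mul _).mono_left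
      nhdsWithin_le_nhds
  have hprod : Filter.Tendsto (fun k => s * (D k * Λ k)) (𝓝[β.K] k₀) (𝓝 (s * (D k₀ * Λ k₀))) :=
    (htend.mul hΛt).const_mul s
  have hpos : 0 < s * (D k₀ * Λ k₀) := by
    have h1 := hrel k₀ hk₀ s hs hsJ
    have h2 : Λ k₀ ≠ 0 := fun h => hD0 (by rw [h1, h, mul_zero])
    rw [h1]
    have h3 : s * s = 1 := by rcases hs with rfl | rfl <;> norm_num
    calc 0 < Λ k₀ * Λ k₀ := mul_self_pos.2 h2
      _ = _ := by linear_combination (-(Λ k₀ * Λ k₀)) * h3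
  have hev := hprod.eventually (lt_mem_nhds hpos)
  rw [eventually_nhdsWithin_iff] at hev
  filter_upwards [hev] with k hk hkK
  obtain ⟨s', hs', h'⟩ := exists_normalSign hkK
  have h1 := hk hkK
  rw [hrel k hkK s' hs' h'] at h1
  have h2 : s = s' := by
    rcases hs with rfl | rfl <;> rcases hs' with rfl | rfl <;>
      first | rfl | (exfalso; nlinarith [sq_nonneg (Λ k)])
  rw [h2]; exact h'

end LeafBox

namespace LeafBox

variable {n : ℕ} {β : LeafBox n} {G : Euc (n + 1) → Euc (n + 1)}
  {A : Euc (n + 1) → (Fin n → Euc (n + 1)) → ℝ}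

/-- `A` is a continuous area integrand, which is a supremum of forms with almost constant
coefficients. -/
structure IsAreaFun (β : LeafBox n) (A : Euc (n + 1) → (Fin n → Euc (n + 1)) → ℝ) : Prop where
  cont : ContinuousOn (fun p : Euc (n + 1) × (Fin n → Euc (n + 1)) => A p.1 p.2)
    (β.X.target ×ˢ univ)
  nonneg : ∀ z v, 0 ≤ A z v
  pos : ∀ z ∈ β.X.target, ∀ v, LinearIndependent ℝ v → 0 < A z v
  calib : ∀ z₀ ∈ β.X.target, ∀ v₀, LinearIndependent ℝ v₀ → ∃ η : Euc (n + 1),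
    stdDet (Fin.cons η v₀ : Fin (n + 1) → Euc (n + 1)) = A z₀ v₀ ∧ ∀ c > 1, ∀ᶠ z in 𝓝 z₀,
      ∀ v : Fin n → Euc (n + 1), stdDet (Fin.cons η v : Fin (n + 1) → Euc (n + 1)) ≤ c * A z v

lemma IsAreaFun.leafInt_nonneg (hA : β.IsAreaFun A) {χ : Euc (n + 1) → ℝ} (h0 : ∀ z, 0 ≤ χ z)
    (k : ℝ) : 0 ≤ β.leafInt A χ k :=
  integral_nonneg fun _ => mul_nonneg (h0 _) (hA.nonneg _ _)

lemma continuousOn_stdDet_const (η : Euc (n + 1)) (S : Set (Euc (n + 1))) :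
    ContinuousOn (fun p : Euc (n + 1) × (Fin n → Euc (n + 1)) =>
      stdDet (Fin.cons η p.2 : Fin (n + 1) → Euc (n + 1))) (S ×ˢ univ) :=
  continuousOn_stdDet_cons continuousOn_const fun i => by fun_prop

lemma IsAreaFun.exists_lsc (hA : β.IsAreaFun A) {s : ℝ} (hs : s = 1 ∨ s = -1)
    (hsK : ∀ k ∈ β.K, ∀ y ∈ β.J, β.NormalSign k s y) {k₀ : ℝ} (hk₀ : k₀ ∈ β.K) {c : ℝ} (hc : 1 < c)
    {z₀ : Euc (n + 1)} (hz₀ : z₀ ∈ β.X.target) :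
    ∃ O, IsOpen O ∧ z₀ ∈ O ∧ ∀ χ, IsTestFun (O ∩ β.X.target) χ → (∀ z, 0 ≤ χ z) →
      ∀ ε > 0, ∀ᶠ k in 𝓝[β.K] k₀, β.leafInt A χ k₀ - ε ≤ c ^ 2 * β.leafInt A χ k := by
  have hk₀I := β.K_subset hk₀
  have hc0 : 0 < c := by linarith
  by_cases hz : β.ht z₀ = k₀
  · set y₀ := (β.X.symm z₀).2
    have hy₀ : y₀ ∈ β.J := (symm_mem hz₀).2
    have hyz : β.leaf k₀ y₀ = z₀ := by rw [← hz]; exact leaf_ht hz₀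
    obtain ⟨η, hη, hηev⟩ := hA.calib z₀ hz₀ _ (indep_leaf hk₀ hy₀)
    obtain ⟨O₁, hO₁, hO₁o, hzO₁⟩ := eventually_nhds_iff.1 (hηev c hc)
    have hcA := continuousOn_leafInt hA.cont hk₀
    have hcη := continuousOn_leafInt (A := fun _ v => stdDet (Fin.cons η v : Fin (n + 1) → _))
      (continuousOn_stdDet_const η _) hk₀
    have hnear : ∀ᶠ y in 𝓝 y₀, A (β.leaf k₀ y) (tanVec (β.leaf k₀) y) <
        c * stdDet (Fin.cons η (tanVec (β.leaf k₀) y) : Fin (n + 1) → Euc (n + 1)) := by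
      refine ((hcA.continuousAt (β.J_open.mem_nhds hy₀)).eventually_lt
        ((continuousAt_const (y := c)).mul (hcη.continuousAt (β.J_open.mem_nhds hy₀))) ?_)
      have := hA.pos z₀ hz₀ _ (indep_leaf hk₀ hy₀)
      rw [hη, hyz]
      nlinarith
    obtain ⟨N, hN, hNo, hyN⟩ := eventually_nhds_iff.1 hnear
    refine ⟨O₁ ∩ (β.X.target ∩ β.X.symm ⁻¹' (Prod.snd ⁻¹' N)), hO₁o.inter
      (β.X.symm.isOpen_inter_preimage (hNo.preimage continuous_snd)), ⟨hzO₁, hz₀, hyN⟩, ?_⟩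
    intro χ hχ' h0 ε hε
    have hχ : IsTestFun β.X.target χ := hχ'.mono inter_subset_right
    set Λ := β.leafInt (fun _ v => stdDet (Fin.cons η v : Fin (n + 1) → Euc (n + 1))) χ with hΛ
    have hi := fun k (hk : k ∈ β.K) => integrableOn_leafInt hA.cont hχ.1.continuous hχ.2.1 hχ.2.2 hk
    have hi' := fun k (hk : k ∈ β.K) => integrableOn_leafInt
      (A := fun _ v => stdDet (Fin.cons η v : Fin (n + 1) → Euc (n + 1)))
      (continuousOn_stdDet_const η _) hχ.1.continuous hχ.2.1 hχ.2.2 hk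
    have h1 : ∀ k ∈ β.K, Λ k ≤ c * β.leafInt A χ k := by
      intro k hk
      rw [hΛ, leafInt, leafInt, ← integral_const_mul]
      refine setIntegral_mono_on (hi' k hk) ((hi k hk).const_mul c) β.J_open.measurableSet
        fun y hy => ?_
      by_cases hO : β.leaf k y ∈ O₁
      · have := mul_le_mul_of_nonneg_left (hO₁ _ hO (tanVec (β.leaf k) y)) (h0 (β.leaf k y))
        linarith
      · rw [hχ'.eq_zero_of_notMem fun h => hO h.1.1]; simp
    have h2 : β.leafInt A χ k₀ ≤ c * Λ k₀ := by
      rw [hΛ, leafInt, leafInt, ← integral_const_mul]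
      refine setIntegral_mono_on (hi k₀ hk₀) ((hi' k₀ hk₀).const_mul c) β.J_open.measurableSet
        fun y hy => ?_
      by_cases hyN' : y ∈ N
      · have := mul_le_mul_of_nonneg_left (hN y hyN').le (h0 (β.leaf k₀ y))
        linarith
      · rw [hχ'.eq_zero_of_notMem fun h => hyN' ?_]
        · simp
        · have := h.1.2.2
          rwa [mem_preimage, symm_leaf hk₀I hy] at this
    have h3 : Filter.Tendsto Λ (𝓝[β.K] k₀) (𝓝 (Λ k₀)) := by
      have h4 := ((tendsto_flux (isDivFree_const β.X.open_target η) hχ hk₀).const_mul s).mono_left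
        (nhdsWithin_le_nhds (s := β.K))
      rw [← leafInt_const η hk₀ hs (hsK k₀ hk₀) hχ] at h4
      refine h4.congr' ?_
      filter_upwards [self_mem_nhdsWithin] with k hk
      rw [hΛ, leafInt_const η hk hs (hsK k hk) hχ]
    filter_upwards [h3.eventually (lt_mem_nhds (show Λ k₀ - ε / c < Λ k₀ by
      linarith [div_pos hε hc0])), self_mem_nhdsWithin] with k hk hkK
    have h5 := h1 k hkK
    have h6 : c * (Λ k₀ - ε / c) = c * Λ k₀ - ε := by field_simp
    nlinarith
  · refine ⟨β.X.target ∩ β.ht ⁻¹' {k₀}ᶜ, continuousOn_ht.isOpen_inter_preimage β.X.open_target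
      isOpen_compl_singleton, ⟨hz₀, hz⟩, fun χ hχ h0 ε hε => Filter.Eventually.of_forall fun k => ?_⟩
    have : β.leafInt A χ k₀ = 0 := setIntegral_eq_zero_of_forall_eq_zero fun y hy => by
      rw [hχ.eq_zero_of_notMem fun h => h.1.2 (ht_leaf hk₀I hy), zero_mul]
    rw [this]
    have := mul_nonneg (sq_nonneg c) (hA.leafInt_nonneg h0 k)
    linarith

/-- The area of the leaves is lower semicontinuous. -/
lemma IsAreaFun.eventually_le (hA : β.IsAreaFun A) {s : ℝ} (hs : s = 1 ∨ s = -1)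
    (hsK : ∀ k ∈ β.K, ∀ y ∈ β.J, β.NormalSign k s y) {k₀ : ℝ} (hk₀ : k₀ ∈ β.K)
    {χ : Euc (n + 1) → ℝ} (hχ : IsTestFun β.X.target χ) (h0 : ∀ z, 0 ≤ χ z) {ε : ℝ} (hε : 0 < ε) :
    ∀ᶠ k in 𝓝[β.K] k₀, β.leafInt A χ k₀ - ε ≤ β.leafInt A χ k := by
  have main : ∀ c > 1, ∀ ε > 0, ∀ᶠ k in 𝓝[β.K] k₀,
      β.leafInt A χ k₀ - ε ≤ c ^ 2 * β.leafInt A χ k := by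
    intro c hc ε hε
    choose! O hO using fun z (hz : z ∈ β.X.target) => hA.exists_lsc hs hsK hk₀ hc hz
    obtain ⟨t, ζ, ht, hζ, hζχ, hsum⟩ := hχ.exists_partition (O := O)
      fun z hz => ⟨(hO z hz).1, (hO z hz).2.1⟩
    have hX : ∀ i ∈ t, IsTestFun β.X.target (fun z => ζ i z * χ z) := fun i hi =>
      (hζχ i hi).mono inter_subset_right
    have hN : (0 : ℝ) < t.card + 1 := Nat.cast_add_one_pos _
    have hε' : 0 < ε / (t.card + 1) := div_pos hε hN
    have hev : ∀ᶠ k in 𝓝[β.K] k₀, ∀ i ∈ t, β.leafInt A (fun z => ζ i z * χ z) k₀ -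
        ε / (t.card + 1) ≤ c ^ 2 * β.leafInt A (fun z => ζ i z * χ z) k :=
      (Filter.eventually_all_finset t).2 fun i hi => (hO i (ht i hi)).2.2 _ (hζχ i hi)
        (fun z => mul_nonneg (hζ i z) (h0 z)) _ hε'
    filter_upwards [hev, self_mem_nhdsWithin] with k hk hkK
    rw [funext hsum, leafInt_sum hA.cont t hX hkK, leafInt_sum hA.cont t hX hk₀, Finset.mul_sum]
    have h1 := Finset.sum_le_sum hk
    rw [Finset.sum_sub_distrib, Finset.sum_const, nsmul_eq_mul] at h1
    have h2 : (t.card : ℝ) * (ε / (t.card + 1)) ≤ ε := by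
      rw [mul_div_assoc', div_le_iff₀ hN]; linarith [mul_comm ε t.card]
    linarith
  set a := β.leafInt A χ k₀ with ha
  have ha0 : 0 ≤ a := hA.leafInt_nonneg h0 k₀
  set τ := ε / (2 * (a + 1)) with hτ
  have hτ0 : 0 < τ := by positivity
  have h1 := main (√(1 + τ)) (by rw [gt_iff_lt, Real.lt_sqrt (by norm_num)]; linarith) (ε / 2)
    (by positivity)
  rw [Real.sq_sqrt (by positivity)] at h1
  filter_upwards [h1] with k hk
  have h3 := hA.leafInt_nonneg h0 k
  have h4 : τ * a ≤ ε / 2 := by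
    rw [hτ, div_mul_eq_mul_div, div_le_div_iff₀ (by positivity) (by positivity)]
    nlinarith
  by_contra! h
  nlinarith

/-- If equality holds in the Gauss-Green inequality for leaves accumulating at a leaf, it holds for
this leaf. -/
lemma IsAreaFun.leafInt_eq_of_frequently (hA : β.IsAreaFun A) {s : ℝ} (hs : s = 1 ∨ s = -1)
    (hsK : ∀ k ∈ β.K, ∀ y ∈ β.J, β.NormalSign k s y) (hG : IsDivFree β.X.target G)
    (hle : ∀ᵐ z ∂(volume.restrict β.X.target), ∀ v : Fin n → Euc (n + 1),
      stdDet (Fin.cons (G z) v : Fin (n + 1) → Euc (n + 1)) ≤ A z v)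
    {k₀ : ℝ} (hk₀ : k₀ ∈ β.K)
    {χ : Euc (n + 1) → ℝ} (hχ : IsTestFun β.X.target χ) (h0 : ∀ z, 0 ≤ χ z)
    (hfr : ∃ᶠ k in 𝓝[β.K] k₀, β.leafInt A χ k = s * β.flux G χ k) :
    β.leafInt A χ k₀ = s * β.flux G χ k₀ := by
  refine le_antisymm (le_of_forall_pos_le_add fun ε hε => ?_)
    (flux_le hG hA.cont hle hk₀ hs (hsK k₀ hk₀) hχ h0)
  have h1 := hA.eventually_le hs hsK hk₀ hχ h0 (half_pos hε)
  have h2 := (((tendsto_flux hG hχ hk₀).const_mul s).mono_left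
    (nhdsWithin_le_nhds (s := β.K))).eventually
    (gt_mem_nhds (show s * β.flux G χ k₀ < s * β.flux G χ k₀ + ε / 2 by linarith))
  obtain ⟨k, hk, hk1, hk2⟩ := (hfr.and_eventually (h1.and h2)).exists
  linarith

section Potential

variable (μ : Measure ℝ) (β)

/-- The transverse measure of the leaves above a point. -/
noncomputable def above (z : Euc (n + 1)) : ℝ := μ.real (β.K ∩ Ioi (β.ht z))

variable {β μ}

lemma above_nonneg (z : Euc (n + 1)) : 0 ≤ β.above μ z := measureReal_nonneg

lemma above_le (hμ : μ β.K < ⊤) (z : Euc (n + 1)) : β.above μ z ≤ μ.real β.K :=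
  measureReal_mono inter_subset_left hμ.ne

lemma aestronglyMeasurable_above (hμ : μ β.K < ⊤) :
    AEStronglyMeasurable (β.above μ) (volume.restrict β.X.target) := by
  have h1 : Antitone fun t : ℝ => μ.real (β.K ∩ Ioi t) := fun t t' h =>
    measureReal_mono (inter_subset_inter_right _ (Ioi_subset_Ioi h))
      ((measure_mono inter_subset_left).trans_lt hμ).ne
  exact (h1.measurable.comp_aemeasurable
    (continuousOn_ht.aemeasurable β.X.open_target.measurableSet)).aestronglyMeasurable

lemma locallyIntegrableOn_above (hμ : μ β.K < ⊤) : LocallyIntegrableOn (β.above μ) β.X.target := by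
  refine (locallyIntegrableOn_iff β.X.open_target.isLocallyClosed).2 fun C hC hCc => ?_
  have hc : IntegrableOn (fun _ : Euc (n + 1) => μ.real β.K) C volume :=
    integrableOn_const hCc.measure_lt_top.ne
  refine hc.mono' ((aestronglyMeasurable_above hμ).mono_measure (Measure.restrict_mono hC le_rfl))
    (Filter.Eventually.of_forall fun z => ?_)
  rw [Real.norm_of_nonneg (above_nonneg z)]
  exact above_le hμ z

/-- The average of the fluxes below the leaves. -/
lemma integral_flux (hμ : μ β.K < ⊤) (hG : IsDivFree β.X.target G)
    {χ : Euc (n + 1) → ℝ} (hχ : IsTestFun β.X.target χ) :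
    Integrable (β.flux G χ) (μ.restrict β.K) ∧ ∫ k in β.K, β.flux G χ k ∂μ =
      ∫ z in β.X.target, β.above μ z * fderiv ℝ χ z (G z) := by
  have hI := integrableOn_flux hG hχ
  have : IsFiniteMeasure (μ.restrict β.K) := ⟨by simpa using hμ⟩
  set S : Set (ℝ × Euc (n + 1)) := {p | p.2 ∈ β.X.target ∧ β.ht p.2 < p.1} with hS
  have hSm : MeasurableSet S := by
    have h1 : ContinuousOn (fun p : ℝ × Euc (n + 1) => p.1 - β.ht p.2) (univ ×ˢ β.X.target) :=
      continuousOn_fst.sub (continuousOn_ht.comp continuousOn_snd fun p hp => hp.2)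
    convert (h1.isOpen_inter_preimage (isOpen_univ.prod β.X.open_target)
      (isOpen_Ioi (a := 0))).measurableSet using 1
    ext p
    simp [hS]
  set f : ℝ → Euc (n + 1) → ℝ := fun k z => S.indicator (fun p => fderiv ℝ χ p.2 (G p.2)) (k, z)
    with hf
  have hfint : Integrable (Function.uncurry f)
      ((μ.restrict β.K).prod (volume.restrict β.X.target)) :=
    (hI.comp_snd (μ.restrict β.K)).indicator hSm
  have hfk : ∀ k, ∫ z in β.X.target, f k z = β.flux G χ k := by
    intro k
    have : f k = {z ∈ β.X.target | β.ht z < k}.indicator fun z => fderiv ℝ χ z (G z) := by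
      funext z; simp only [hf, indicator]; rfl
    rw [this, setIntegral_indicator (measurableSet_below k), flux]
    congr 2
    ext z; exact ⟨fun h => h.2, fun h => ⟨h.1, h⟩⟩
  refine ⟨(hfint.integral_prod_left).congr (Filter.Eventually.of_forall hfk), ?_⟩
  rw [← integral_congr_ae (Filter.Eventually.of_forall hfk), integral_integral_swap hfint]
  refine setIntegral_congr_fun β.X.open_target.measurableSet fun z hz => ?_
  have : (fun k => f k z) = (Ioi (β.ht z)).indicator fun _ => fderiv ℝ χ z (G z) := by
    funext k; simp only [hf, hS, indicator, Set.mem_ofPred_eq, hz, true_and, mem_Ioi]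
  rw [this, integral_indicator measurableSet_Ioi, Measure.restrict_restrict measurableSet_Ioi,
    setIntegral_const, smul_eq_mul, inter_comm, above]

end Potential

end LeafBox

/-! ### Flow boxes of a manifold, read in charts -/

section FlowBoxes

variable {n : ℕ} {M : Type*} [TopologicalSpace M] [ChartedSpace (Euc (n + 1)) M]

/-- `β` is a part of the flow box `B`, read in the chart `e`. -/
structure FlowBox.IsLocal (B : FlowBox n M) (e : OpenPartialHomeomorph M (Euc (n + 1)))
    (β : LeafBox n) : Prop where
  K_eq : β.K = B.K ∩ β.I
  I_subset : ∃ C ⊆ B.I, IsCompact C ∧ β.I ⊆ C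
  J_subset : β.J ⊆ B.J
  mem_source : ∀ k ∈ β.I, ∀ y ∈ β.J, B.chart (k, y) ∈ e.source
  leaf_eq : ∀ k ∈ β.I, ∀ y ∈ β.J, β.leaf k y = e (B.chart (k, y))

lemma FlowBox.J_open (B : FlowBox n M) : IsOpen B.J := by
  obtain ⟨a, b, h⟩ := B.J_box
  rw [h, ofPred_forall]
  exact isOpen_iInter_of_finite fun i => isOpen_Ioo.preimage
    (EuclideanSpace.proj i : Euc n →L[ℝ] ℝ).continuous

lemma FlowBox.K_subset (B : FlowBox n M) : B.K ⊆ B.I := by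
  obtain ⟨C, -, h⟩ := B.K_closed
  rw [h]; exact inter_subset_right

lemma FlowBox.measurableSet_K (B : FlowBox n M) : MeasurableSet B.K := by
  obtain ⟨C, hC, h⟩ := B.K_closed
  rw [h]; exact hC.measurableSet.inter B.I_open.measurableSet

lemma FlowBox.mem_source (B : FlowBox n M) {k : ℝ} {y : Euc n} (hk : k ∈ B.I) (hy : y ∈ B.J) :
    (k, y) ∈ B.chart.source := by rw [B.source_eq]; exact ⟨hk, hy⟩

lemma FlowBox.leaf_mem (B : FlowBox n M) {k : ℝ} {y : Euc n} (hk : k ∈ B.I) (hy : y ∈ B.J) :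
    B.leaf k y ∈ B.chart.target := B.chart.map_source (B.mem_source hk hy)

lemma FlowBox.symm_leaf (B : FlowBox n M) {k : ℝ} {y : Euc n} (hk : k ∈ B.I) (hy : y ∈ B.J) :
    B.chart.symm (B.leaf k y) = (k, y) := B.chart.left_inv (B.mem_source hk hy)

lemma FlowBox.mdifferentiableAt_leaf (B : FlowBox n M) {k : ℝ} {y : Euc n} (hk : k ∈ B.K)
    (hy : y ∈ B.J) :
    MDifferentiableAt 𝓘(ℝ, Euc n) 𝓘(ℝ, Euc (n + 1)) (B.leaf k) y :=
  (((B.leaf_C1 k hk).1 y hy).contMDiffAt (B.J_open.mem_nhds hy)).mdifferentiableAt (by simp)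

variable [IsManifold 𝓘(ℝ, Euc (n + 1)) ∞ M]

lemma contDiffOn_chart_comp {e : OpenPartialHomeomorph M (Euc (n + 1))}
    (he : e ∈ atlas (Euc (n + 1)) M) {ψ : Euc n → M} {J : Set (Euc n)}
    (hψ : ContMDiffOn 𝓘(ℝ, Euc n) 𝓘(ℝ, Euc (n + 1)) 1 ψ J) (hJ : ∀ y ∈ J, ψ y ∈ e.source) :
    ContDiffOn ℝ 1 (fun y => e (ψ y)) J := by
  have h1 : ContMDiffOn 𝓘(ℝ, Euc (n + 1)) 𝓘(ℝ, Euc (n + 1)) ∞ e e.source :=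
    contMDiffOn_of_mem_maximalAtlas (IsManifold.subset_maximalAtlas he)
  exact contMDiffOn_iff_contDiffOn.1 ((h1.of_le (by simp)).comp hψ hJ)

lemma linearIndependent_tanVec_chart {e : OpenPartialHomeomorph M (Euc (n + 1))}
    (he : e ∈ atlas (Euc (n + 1)) M) {ψ : Euc n → M} {y : Euc n}
    (hψ : MDifferentiableAt 𝓘(ℝ, Euc n) 𝓘(ℝ, Euc (n + 1)) ψ y) (hy : ψ y ∈ e.source)
    (hinj : Function.Injective (mfderiv 𝓘(ℝ, Euc n) 𝓘(ℝ, Euc (n + 1)) ψ y)) :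
    LinearIndependent ℝ (tanVec (fun y => e (ψ y)) y) := by
  have h := (tanChart_mfderiv he hψ hy).2
  have hker : LinearMap.ker (fderiv ℝ (fun y => e (ψ y)) y : Euc n →ₗ[ℝ] Euc (n + 1)) = ⊥ := by
    rw [LinearMap.ker_eq_bot']
    intro v hv
    have h1 : tanChart e (ψ y) (mfderiv 𝓘(ℝ, Euc n) 𝓘(ℝ, Euc (n + 1)) ψ y v) = 0 := by
      rw [h v]; exact hv
    have h2 := chartTan_tanChart he hy (mfderiv 𝓘(ℝ, Euc n) 𝓘(ℝ, Euc (n + 1)) ψ y v)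
    have h3 : (0 : Euc (n + 1)) = mfderiv 𝓘(ℝ, Euc n) 𝓘(ℝ, Euc (n + 1)) ψ y v := by
      refine Eq.trans ?_ h2
      exact (congrArg (chartTan e (e (ψ y))) h1.symm ▸ (map_zero
        (mfderiv 𝓘(ℝ, Euc (n + 1)) 𝓘(ℝ, Euc (n + 1)) e.symm (e (ψ y)))).symm)
    exact hinj (h3.symm.trans (map_zero _).symm)
  have h3 := (EuclideanSpace.basisFun (Fin n) ℝ).toBasis.linearIndependent.map' _ hker
  rw [← stdVec_eq_basis] at h3
  exact h3

lemma FlowBox.exists_isLocal (B : FlowBox n M) {e : OpenPartialHomeomorph M (Euc (n + 1))}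
    (he : e ∈ atlas (Euc (n + 1)) M) {k₀ : ℝ} {y₀ : Euc n} (hk₀ : k₀ ∈ B.K) (hy₀ : y₀ ∈ B.J)
    {W : Set M} (hW : IsOpen W) (h₀ : B.leaf k₀ y₀ ∈ e.source ∩ W) {D : Set ℝ} (hD : D ∈ 𝓝 k₀) :
    ∃ β : LeafBox n, B.IsLocal e β ∧ k₀ ∈ β.K ∧ y₀ ∈ β.J ∧ β.I ⊆ D ∧
      ∀ k ∈ β.I, ∀ y ∈ β.J, B.leaf k y ∈ W := by
  set S := B.chart.source ∩ B.chart ⁻¹' e.source with hS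
  have hSo : IsOpen S := B.chart.isOpen_inter_preimage e.open_source
  have hsrc := B.mem_source (B.K_subset hk₀) hy₀
  have hpS : (k₀, y₀) ∈ S := ⟨hsrc, h₀.1⟩
  obtain ⟨C, t, ht, hLip⟩ := B.lipschitz e he hpS
  rw [hSo.nhdsWithin_eq hpS] at ht
  have hnhds : t ∩ (S ∩ (B.chart.source ∩ B.chart ⁻¹' W)) ∩ Prod.fst ⁻¹' D ∈ 𝓝 (k₀, y₀) :=
    Filter.inter_mem (Filter.inter_mem ht (Filter.inter_mem (hSo.mem_nhds hpS)
      ((B.chart.isOpen_inter_preimage hW).mem_nhds ⟨hsrc, h₀.2⟩)))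
      (continuous_fst.continuousAt.preimage_mem_nhds hD)
  obtain ⟨r, hr, hball⟩ := Metric.nhds_basis_closedBall.mem_iff.1 hnhds
  rw [← closedBall_prod_same] at hball
  set I' := Metric.ball k₀ r
  set J' := Metric.ball y₀ r
  have hsub : I' ×ˢ J' ⊆ t ∩ (S ∩ (B.chart.source ∩ B.chart ⁻¹' W)) ∩ Prod.fst ⁻¹' D :=
    (prod_mono Metric.ball_subset_closedBall Metric.ball_subset_closedBall).trans hball
  have hopen : IsOpen (I' ×ˢ J') := Metric.isOpen_ball.prod Metric.isOpen_ball
  have hJ' : J' ⊆ B.J := fun y hy => by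
    have := (hsub (show (k₀, y) ∈ I' ×ˢ J' from ⟨Metric.mem_ball_self hr, hy⟩)).1.2.1.1
    rw [B.source_eq] at this; exact this.2
  have hmem : ∀ k ∈ I', ∀ y ∈ J', B.leaf k y ∈ e.source := fun k hk y hy =>
    (hsub (show (k, y) ∈ I' ×ˢ J' from ⟨hk, hy⟩)).1.2.1.2
  refine ⟨{ X := (B.chart.trans e).restrOpen _ hopen, I := I', J := J', K := B.K ∩ I',
            source_eq := ?_, I_open := Metric.isOpen_ball, J_open := Metric.isOpen_ball,
            J_convex := convex_ball _ _, K_subset := inter_subset_right,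
            contDiffOn := ?_, indep := ?_, lipschitz := ⟨C, ?_⟩ }, ⟨rfl, ?_, hJ', ?_, ?_⟩,
            ⟨hk₀, Metric.mem_ball_self hr⟩, Metric.mem_ball_self hr,
            fun k hk => (hsub (show (k, y₀) ∈ I' ×ˢ J' from ⟨hk, Metric.mem_ball_self hr⟩)).2,
            fun k hk y hy => (hsub (show (k, y) ∈ I' ×ˢ J' from ⟨hk, hy⟩)).1.2.2.2⟩
  · rw [OpenPartialHomeomorph.restrOpen_source, OpenPartialHomeomorph.trans_source]
    exact inter_eq_right.2 fun p hp => (hsub hp).1.2.1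
  · intro k hk
    exact contDiffOn_chart_comp he ((B.leaf_C1 k hk.1).1.mono hJ') fun y hy => hmem k hk.2 y hy
  · intro k hk y hy
    exact linearIndependent_tanVec_chart he (B.mdifferentiableAt_leaf hk.1 (hJ' hy))
      (hmem k hk.2 y hy) ((B.leaf_C1 k hk.1).2 y (hJ' hy))
  · exact hLip.mono fun p hp => (hsub hp).1.1
  · refine ⟨Metric.closedBall k₀ r, fun k hk => ?_, isCompact_closedBall _ _,
      Metric.ball_subset_closedBall⟩
    have := (hball (show (k, y₀) ∈ Metric.closedBall k₀ r ×ˢ Metric.closedBall y₀ r from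
      ⟨hk, Metric.mem_closedBall_self hr.le⟩)).1.2.1.1
    rw [B.source_eq] at this; exact this.1
  · exact hmem
  · intro k _ y _
    rfl

namespace FlowBox.IsLocal

variable {B : FlowBox n M} {e : OpenPartialHomeomorph M (Euc (n + 1))} {β : LeafBox n}

lemma mem_K (h : B.IsLocal e β) {k : ℝ} (hk : k ∈ β.K) : k ∈ B.K := by
  rw [h.K_eq] at hk; exact hk.1

lemma I_sub (h : B.IsLocal e β) : β.I ⊆ B.I := by
  obtain ⟨C, hC, -, h⟩ := h.I_subset
  exact h.trans hC

lemma measurableSet_K (h : B.IsLocal e β) : MeasurableSet β.K := by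
  rw [h.K_eq]; exact B.measurableSet_K.inter β.I_open.measurableSet

lemma mem_target (h : B.IsLocal e β) {z : Euc (n + 1)} (hz : z ∈ β.X.target) :
    z ∈ e.target ∧ e.symm z = B.chart (β.X.symm z) := by
  have hm := LeafBox.symm_mem hz
  have h1 := h.leaf_eq _ hm.1 _ hm.2
  rw [LeafBox.leaf_ht hz] at h1
  have h2 := h.mem_source _ hm.1 _ hm.2
  constructor
  · rw [h1]; exact e.map_source h2
  · conv_lhs => rw [h1]
    exact e.left_inv h2

lemma symm_leaf (h : B.IsLocal e β) {k : ℝ} {y : Euc n} (hk : k ∈ β.I) (hy : y ∈ β.J) :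
    e.symm (β.leaf k y) = B.leaf k y := by
  rw [h.leaf_eq k hk y hy, e.left_inv (h.mem_source k hk y hy)]; rfl

lemma tanVec_eq (h : B.IsLocal e β) {k : ℝ} {y : Euc n} (hk : k ∈ β.I) (hy : y ∈ β.J) :
    tanVec (β.leaf k) y = fun i => fderiv ℝ (fun y' => e (B.leaf k y')) y (stdVec i) := by
  funext i
  have : β.leaf k =ᶠ[𝓝 y] fun y' => e (B.leaf k y') := by
    filter_upwards [β.J_open.mem_nhds hy] with y' hy' using h.leaf_eq k hk y' hy'
  rw [tanVec, this.fderiv_eq]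

lemma form_eq (h : B.IsLocal e β) (he : e ∈ atlas (Euc (n + 1)) M) (φ : RoughForm n M) {k : ℝ}
    {y : Euc n} (hk : k ∈ β.K) (hy : y ∈ β.J) :
    φ (B.leaf k y) (coordVec (B.leaf k) y) =
      formInChart φ e (β.leaf k y) (tanVec (β.leaf k) y) := by
  rw [form_coordVec_eq φ he (B.mdifferentiableAt_leaf (h.mem_K hk) (h.J_subset hy))
    (h.mem_source k (β.K_subset hk) y hy), h.tanVec_eq (β.K_subset hk) hy,
    h.leaf_eq k (β.K_subset hk) y hy]
  rfl

variable [RiemannianBundle (fun x : M => TangentSpace 𝓘(ℝ, Euc (n + 1)) x)]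

lemma area_eq (h : B.IsLocal e β) (he : e ∈ atlas (Euc (n + 1)) M) {k : ℝ}
    {y : Euc n} (hk : k ∈ β.K) (hy : y ∈ β.J) :
    areaDensity (B.leaf k) y = areaChart e (β.leaf k y) (tanVec (β.leaf k) y) := by
  rw [areaDensity_eq he (B.mdifferentiableAt_leaf (h.mem_K hk) (h.J_subset hy))
    (h.mem_source k (β.K_subset hk) y hy), h.tanVec_eq (β.K_subset hk) hy,
    h.leaf_eq k (β.K_subset hk) y hy]
  rfl

variable [IsContMDiffRiemannianBundle 𝓘(ℝ, Euc (n + 1)) ∞ (Euc (n + 1))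
      (fun x : M => TangentSpace 𝓘(ℝ, Euc (n + 1)) x)]

lemma isAreaFun (h : B.IsLocal e β) (he : e ∈ atlas (Euc (n + 1)) M) :
    β.IsAreaFun (areaChart e) where
  cont := ContinuousOn.areaChart he continuousOn_fst (fun p hp => (h.mem_target hp.1).1)
    fun i => by fun_prop
  nonneg := areaChart_nonneg e
  pos z hz v hv := areaChart_pos he (h.mem_target hz).1 hv
  calib z₀ hz₀ v₀ hv₀ := by
    have hz := (h.mem_target hz₀).1
    obtain ⟨w, hw, hwv⟩ := exists_comassLe_eq_areaChart he hz hv₀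
    refine ⟨formVec w, by rw [← form_apply_eq_stdDet, hwv], fun c hc => ?_⟩
    filter_upwards [hw.eventually he hz hc, e.open_target.mem_nhds hz] with z hz' hzt v
    rw [← form_apply_eq_stdDet]
    exact (le_abs_self _).trans (hz'.abs_le he hzt (by linarith) v)

end FlowBox.IsLocal

/-! ### Change of parametrization -/

section Reparametrization

variable {ψ ψ' : Euc n → M} {τ : Euc n → Euc n} {y : Euc n}

lemma fderiv_chart_comp {e : OpenPartialHomeomorph M (Euc (n + 1))}
    (he : e ∈ atlas (Euc (n + 1)) M)
    (hψ' : MDifferentiableAt 𝓘(ℝ, Euc n) 𝓘(ℝ, Euc (n + 1)) ψ' (τ y))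
    (hτ : DifferentiableAt ℝ τ y) (h : ∀ᶠ y' in 𝓝 y, ψ y' = ψ' (τ y')) (hy : ψ y ∈ e.source) :
    fderiv ℝ (fun y' => e (ψ y')) y =
      (fderiv ℝ (fun y' => e (ψ' y')) (τ y)).comp (fderiv ℝ τ y) := by
  have h1 : (fun y' => e (ψ y')) =ᶠ[𝓝 y] fun y' => e (ψ' (τ y')) := by
    filter_upwards [h] with y' hy' using by rw [hy']
  rw [h1.fderiv_eq]
  have h2 := (tanChart_mfderiv he hψ' (h.self_of_nhds ▸ hy)).1
  exact (h2.hasFDerivAt.comp y hτ.hasFDerivAt).fderiv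

lemma form_coordVec_comp (φ : RoughForm n M)
    (hψ : MDifferentiableAt 𝓘(ℝ, Euc n) 𝓘(ℝ, Euc (n + 1)) ψ y)
    (hψ' : MDifferentiableAt 𝓘(ℝ, Euc n) 𝓘(ℝ, Euc (n + 1)) ψ' (τ y))
    (hτ : DifferentiableAt ℝ τ y) (h : ∀ᶠ y' in 𝓝 y, ψ y' = ψ' (τ y')) :
    φ (ψ y) (coordVec ψ y) = (fderiv ℝ τ y).det * φ (ψ' (τ y)) (coordVec ψ' (τ y)) := by
  have he := chart_mem_atlas (Euc (n + 1)) (ψ y)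
  have hy := mem_chart_source (Euc (n + 1)) (ψ y)
  have h0 := h.self_of_nhds
  rw [form_coordVec_eq φ he hψ hy, form_coordVec_eq φ he hψ' (h0 ▸ hy),
    fderiv_chart_comp he hψ' hτ h hy, ← h0]
  set w := (formInChart φ (chartAt (Euc (n + 1)) (ψ y)) (chartAt (Euc (n + 1)) (ψ y) (ψ y))) with hw
  exact topForm_comp (w.compContinuousLinearMap
    (fderiv ℝ (fun y' => (chartAt (Euc (n + 1)) (ψ y)) (ψ' y')) (τ y))) (fderiv ℝ τ y)

lemma det_gram_comp {V : Type*} [NormedAddCommGroup V] [InnerProductSpace ℝ V]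
    (A : Euc n →ₗ[ℝ] V) (T : Euc n →L[ℝ] Euc n) :
    (Matrix.gram ℝ fun i => A (T (stdVec i))).det =
      T.det ^ 2 * (Matrix.gram ℝ fun i => A (stdVec i)).det := by
  set b := (EuclideanSpace.basisFun (Fin n) ℝ).toBasis
  set N := LinearMap.toMatrix b b (T : Euc n →ₗ[ℝ] Euc n) with hN
  have h1 : (Matrix.gram ℝ fun i => A (T (stdVec i))) =
      N.transpose * (Matrix.gram ℝ fun i => A (stdVec i)) * N := by
    have hT : ∀ i, T (stdVec i) = ∑ j, N j i • stdVec j := by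
      intro i
      rw [stdVec_eq_basis]
      conv_lhs => rw [← b.sum_repr (T (b i))]
      refine Finset.sum_congr rfl fun j _ => ?_
      rw [hN, LinearMap.toMatrix_apply]
      rfl
    ext i j
    rw [Matrix.gram_apply, hT i, hT j, map_sum, map_sum, sum_inner]
    simp only [Matrix.mul_apply, Matrix.transpose_apply, Matrix.gram_apply, map_smul, inner_sum,
      real_inner_smul_left, real_inner_smul_right, Finset.sum_mul]
    rw [Finset.sum_comm]
    refine Finset.sum_congr rfl fun a _ => Finset.sum_congr rfl fun c _ => ?_
    ring
  rw [h1, Matrix.det_mul, Matrix.det_mul, Matrix.det_transpose, ContinuousLinearMap.det,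
    ← LinearMap.det_toMatrix b, ← hN]
  ring

variable [RiemannianBundle (fun x : M => TangentSpace 𝓘(ℝ, Euc (n + 1)) x)]

lemma areaDensity_comp
    (hψ : MDifferentiableAt 𝓘(ℝ, Euc n) 𝓘(ℝ, Euc (n + 1)) ψ y)
    (hψ' : MDifferentiableAt 𝓘(ℝ, Euc n) 𝓘(ℝ, Euc (n + 1)) ψ' (τ y))
    (hτ : DifferentiableAt ℝ τ y) (h : ∀ᶠ y' in 𝓝 y, ψ y' = ψ' (τ y')) :
    areaDensity ψ y = |(fderiv ℝ τ y).det| * areaDensity ψ' (τ y) := by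
  have he := chart_mem_atlas (Euc (n + 1)) (ψ y)
  have hy := mem_chart_source (Euc (n + 1)) (ψ y)
  have h0 := h.self_of_nhds
  rw [areaDensity_eq he hψ hy, areaDensity_eq he hψ' (h0 ▸ hy),
    fderiv_chart_comp he hψ' hτ h hy, ← h0]
  set e := chartAt (Euc (n + 1)) (ψ y)
  have hc := det_gram_comp (V := TangentSpace 𝓘(ℝ, Euc (n + 1)) (e.symm (e (ψ y))))
    ((chartTanEquiv he (e.map_source hy)).toLinearMap.comp
      (fderiv ℝ (fun y' => e (ψ' y')) (τ y)).toLinearMap) (fderiv ℝ τ y)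
  rw [← Real.sqrt_sq_eq_abs, areaChart, areaChart, ← Real.sqrt_mul (sq_nonneg _)]
  exact congrArg Real.sqrt hc

lemma areaDensity_nonneg (ψ : Euc n → M) (y : Euc n) : 0 ≤ areaDensity ψ y := Real.sqrt_nonneg _

end Reparametrization

lemma FlowBox.areaDensity_pos
    [RiemannianBundle (fun x : M => TangentSpace 𝓘(ℝ, Euc (n + 1)) x)] (B : FlowBox n M) {k : ℝ}
    {y : Euc n} (hk : k ∈ B.K) (hy : y ∈ B.J) : 0 < areaDensity (B.leaf k) y := by
  have he := chart_mem_atlas (Euc (n + 1)) (B.leaf k y)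
  have hys := mem_chart_source (Euc (n + 1)) (B.leaf k y)
  rw [areaDensity_eq he (B.mdifferentiableAt_leaf hk hy) hys]
  exact areaChart_pos he (OpenPartialHomeomorph.map_source _ hys) (linearIndependent_tanVec_chart he
    (B.mdifferentiableAt_leaf hk hy) hys ((B.leaf_C1 k hk).2 y hy))

end FlowBoxes

/-! ### Measurability along the leaves -/

section Measurability

variable {n : ℕ}

lemma ContinuousOn.aemeasurable_comp {X Y : Type*} [TopologicalSpace X] [MeasurableSpace X]
    [BorelSpace X] [MeasurableSpace Y] {f : X → ℝ} {S : Set X} (hS : IsOpen S)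
    (hf : ContinuousOn f S) {κ : Measure Y} {g : Y → X} (hg : AEMeasurable g κ)
    (hgS : ∀ᵐ y ∂κ, g y ∈ S) : AEMeasurable (fun y => f (g y)) κ := by
  classical
  have h1 : Measurable (S.piecewise f fun _ => 0) :=
    hf.measurable_piecewise continuousOn_const hS.measurableSet
  refine (h1.comp_aemeasurable hg).congr ?_
  filter_upwards [hgS] with y hy
  exact piecewise_eq_of_mem S f _ hy

lemma LeafBox.aemeasurable_tanVec (β : LeafBox n) (hK : MeasurableSet β.K)
    (κ : Measure (ℝ × Euc n)) (i : Fin n) :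
    AEMeasurable (fun p : ℝ × Euc n => tanVec (β.leaf p.1) p.2 i) (κ.restrict (β.K ×ˢ β.J)) := by
  set f : ℕ → ℝ × Euc n → Euc (n + 1) := fun m =>
    {p : ℝ × Euc n | p ∈ β.X.source ∧ (p.1, p.2 + (1 / ((m : ℝ) + 1)) • stdVec i) ∈
      β.X.source}.indicator fun p => ((m : ℝ) + 1) •
        (β.X (p.1, p.2 + (1 / ((m : ℝ) + 1)) • stdVec i) - β.X p) with hf
  refine aemeasurable_of_tendsto_metrizable_ae Filter.atTop (f := f) (fun m => ?_) ?_
  · have hsh : Continuous fun p : ℝ × Euc n => (p.1, p.2 + (1 / ((m : ℝ) + 1)) • stdVec i) := by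
      fun_prop
    have hD : IsOpen {p : ℝ × Euc n | p ∈ β.X.source ∧
        (p.1, p.2 + (1 / ((m : ℝ) + 1)) • stdVec i) ∈ β.X.source} :=
      β.X.open_source.inter (β.X.open_source.preimage hsh)
    refine (aemeasurable_indicator_iff hD.measurableSet).2 (ContinuousOn.aemeasurable ?_
      hD.measurableSet)
    refine ContinuousOn.const_smul (g := fun p : ℝ × Euc n =>
      β.X (p.1, p.2 + (1 / ((m : ℝ) + 1)) • stdVec i) - β.X p) ?_ ((m : ℝ) + 1)
    exact ((β.X.continuousOn.comp hsh.continuousOn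
      fun p (hp : p ∈ β.X.source ∧ _) => hp.2).sub
      (β.X.continuousOn.mono fun p (hp : p ∈ β.X.source ∧ _) => hp.1))
  · filter_upwards [ae_restrict_mem (hK.prod β.J_open.measurableSet)] with p hp
    have hd : HasFDerivAt (β.leaf p.1) (fderiv ℝ (β.leaf p.1) p.2) p.2 :=
      (((β.contDiffOn p.1 hp.1).contDiffAt (β.J_open.mem_nhds hp.2)).differentiableAt
        (by simp)).hasFDerivAt
    have h0 : Filter.Tendsto (fun m : ℕ => 1 / ((m : ℝ) + 1)) Filter.atTop (𝓝 0) :=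
      tendsto_one_div_add_atTop_nhds_zero_nat
    have h1 : Filter.Tendsto (fun m : ℕ => ((m : ℝ) + 1) • (β.leaf p.1 (p.2 +
        (1 / ((m : ℝ) + 1)) • stdVec i) - β.leaf p.1 p.2)) Filter.atTop
        (𝓝 (fderiv ℝ (β.leaf p.1) p.2 (stdVec i))) := by
      have h2 : Filter.Tendsto (fun m : ℕ => (m : ℝ) + 1) Filter.atTop Filter.atTop :=
        Filter.tendsto_atTop_add_const_right _ _ tendsto_natCast_atTop_atTop
      refine ((hd.lim_real (stdVec i)).comp h2).congr fun m => ?_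
      simp only [Function.comp_apply, one_div]
    refine h1.congr' ?_
    have h2 : ∀ᶠ m : ℕ in Filter.atTop, p.2 + (1 / ((m : ℝ) + 1)) • stdVec i ∈ β.J := by
      have h3 : Filter.Tendsto (fun m : ℕ => p.2 + (1 / ((m : ℝ) + 1)) • (stdVec i : Euc n))
          Filter.atTop (𝓝 (p.2 + (0 : ℝ) • stdVec i)) :=
        (h0.smul_const _).const_add _
      rw [zero_smul, add_zero] at h3
      exact h3.eventually (β.J_open.mem_nhds hp.2)
    filter_upwards [h2] with m hm
    have hmem : p ∈ {p : ℝ × Euc n | p ∈ β.X.source ∧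
        (p.1, p.2 + (1 / ((m : ℝ) + 1)) • stdVec i) ∈ β.X.source} :=
      ⟨LeafBox.mem_source (β.K_subset hp.1) hp.2, LeafBox.mem_source (β.K_subset hp.1) hm⟩
    simp only [hf]
    rw [indicator_of_mem hmem]
    rfl

variable {M : Type*} [TopologicalSpace M] [ChartedSpace (Euc (n + 1)) M]
  [IsManifold 𝓘(ℝ, Euc (n + 1)) ∞ M]

/-- A function on the leaves of a flow box is measurable if in each chart it is a continuous
function of the point and of the coordinate tangent vectors. -/
lemma FlowBox.aemeasurable_of_charts (B : FlowBox n M) (κ : Measure (ℝ × Euc n))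
    {f : ℝ × Euc n → ℝ}
    (hf : ∀ e ∈ atlas (Euc (n + 1)) M, ∃ Ξ : Euc (n + 1) × (Fin n → Euc (n + 1)) → ℝ,
      ContinuousOn Ξ (e.target ×ˢ univ) ∧ ∀ β : LeafBox n, B.IsLocal e β → ∀ k ∈ β.K, ∀ y ∈ β.J,
        f (k, y) = Ξ (β.leaf k y, tanVec (β.leaf k) y)) :
    AEMeasurable f (κ.restrict (B.K ×ˢ B.J)) := by
  have hloc : ∀ p ∈ B.K ×ˢ B.J, ∃ O : Set (ℝ × Euc n), IsOpen O ∧ p ∈ O ∧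
      AEMeasurable f (κ.restrict (B.K ×ˢ B.J ∩ O)) := by
    intro p hp
    have he := chart_mem_atlas (Euc (n + 1)) (B.leaf p.1 p.2)
    obtain ⟨β, hβ, hk, hy, -, -⟩ := B.exists_isLocal he hp.1 hp.2 isOpen_univ
      ⟨mem_chart_source _ _, trivial⟩ Filter.univ_mem
    obtain ⟨Ξ, hΞ, hfΞ⟩ := hf _ he
    refine ⟨β.I ×ˢ β.J, β.I_open.prod β.J_open, ⟨β.K_subset hk, hy⟩, ?_⟩
    have hset : B.K ×ˢ B.J ∩ β.I ×ˢ β.J = β.K ×ˢ β.J := by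
      rw [prod_inter_prod, ← hβ.K_eq, inter_eq_right.2 hβ.J_subset]
    have hKm := hβ.measurableSet_K
    have hm := hKm.prod β.J_open.measurableSet
    rw [hset]
    have hX : AEMeasurable (fun p : ℝ × Euc n => β.leaf p.1 p.2) (κ.restrict (β.K ×ˢ β.J)) :=
      ContinuousOn.aemeasurable (β.X.continuousOn.mono fun p hp =>
        LeafBox.mem_source (β.K_subset hp.1) hp.2) hm
    have h1 : AEMeasurable (fun p : ℝ × Euc n => (β.leaf p.1 p.2, tanVec (β.leaf p.1) p.2))
        (κ.restrict (β.K ×ˢ β.J)) :=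
      hX.prodMk (aemeasurable_pi_lambda _ fun i => β.aemeasurable_tanVec hKm κ i)
    refine (ContinuousOn.aemeasurable_comp (OpenPartialHomeomorph.open_target _ |>.prod isOpen_univ)
      hΞ h1 ?_).congr ?_
    · filter_upwards [ae_restrict_mem hm] with p hp
      exact ⟨(hβ.mem_target (LeafBox.leaf_mem (β.K_subset hp.1) hp.2)).1, trivial⟩
    · filter_upwards [ae_restrict_mem hm] with p hp
      exact (hfΞ β hβ p.1 hp.1 p.2 hp.2).symm
  choose! O hO using hloc
  obtain ⟨t, htS, htc, hcov⟩ := TopologicalSpace.countable_cover_nhdsWithin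
    (s := B.K ×ˢ B.J) (f := O) fun p hp => mem_nhdsWithin_of_mem_nhds
      ((hO p hp).1.mem_nhds (hO p hp).2.1)
  have h1 : B.K ×ˢ B.J = ⋃ p ∈ t, B.K ×ˢ B.J ∩ O p := by
    rw [← inter_iUnion₂]; exact (inter_eq_left.2 hcov).symm
  rw [h1, biUnion_eq_iUnion]
  have := htc.to_subtype
  exact aemeasurable_iUnion_iff.2 fun p => (hO p (htS p.2)).2.2

end Measurability

/-! ### The area measure of a measured lamination -/

section AreaMeasure

variable {n : ℕ} {M : Type*} [TopologicalSpace M] [ChartedSpace (Euc (n + 1)) M]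
  {L : Lamination n M} (m : TransverseMeasure L)

lemma TransverseMeasure.sigmaFinite (B : L.atlas) : SigmaFinite ((m.μ B).restrict B.1.K) := by
  have h1 : LocallyCompactSpace B.1.I := B.1.I_open.locallyCompactSpace
  have h2 : IsSigmaCompact B.1.I := isSigmaCompact_iff_sigmaCompactSpace.2 inferInstance
  obtain ⟨C, hC, hCI⟩ := h2
  have hCsub : ∀ i, C i ⊆ B.1.I := fun i => hCI ▸ subset_iUnion C i
  refine (⟨fun i => C i ∪ B.1.Kᶜ, fun _ => trivial, fun i => ?_, ?_⟩ :
    ((m.μ B).restrict B.1.K).FiniteSpanningSetsIn univ).sigmaFinite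
  · refine (measure_union_le _ _).trans_lt (ENNReal.add_lt_top.2 ⟨?_, ?_⟩)
    · exact (Measure.restrict_apply_le _ _).trans_lt (m.radon B _ (hCsub i) (hC i))
    · rw [Measure.restrict_apply B.1.measurableSet_K.compl, compl_inter_self, measure_empty]
      exact ENNReal.zero_lt_top
  · rw [← iUnion_union, hCI, eq_univ_iff_forall]
    intro k
    by_cases hk : k ∈ B.1.K
    · exact Or.inl (B.1.K_subset hk)
    · exact Or.inr hk

/-- The product measure on the plaques of a flow box. -/
noncomputable def TransverseMeasure.base (B : L.atlas) : Measure (ℝ × Euc n) :=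
  ((m.μ B).restrict B.1.K).prod (volume.restrict B.1.J)

lemma TransverseMeasure.base_eq_restrict (B : L.atlas) :
    (m.base B).restrict (B.1.K ×ˢ B.1.J) = m.base B := by
  have := m.sigmaFinite B
  rw [base, ← Measure.prod_restrict, Measure.restrict_restrict B.1.measurableSet_K,
    Measure.restrict_restrict B.1.J_open.measurableSet, inter_self, inter_self]

lemma TransverseMeasure.ae_base (B : L.atlas) : ∀ᵐ p ∂(m.base B), p ∈ B.1.K ×ˢ B.1.J := by
  rw [← m.base_eq_restrict]
  exact ae_restrict_mem (B.1.measurableSet_K.prod B.1.J_open.measurableSet)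

lemma Lamination.chart_mem_supp (L : Lamination n M) (B : L.atlas) {k : ℝ} {y : Euc n}
    (hk : k ∈ B.1.K) (hy : y ∈ B.1.J) : B.1.leaf k y ∈ L.supp := by
  have : B.1.chart (k, y) ∈ L.supp ∩ B.1.chart.target := by
    rw [L.supp_inter B.1 B.2]; exact ⟨(k, y), ⟨hk, hy⟩, rfl⟩
  exact this.1

lemma Lamination.symm_mem (L : Lamination n M) (B : L.atlas) {x : M} (hx : x ∈ L.supp)
    (hxB : x ∈ B.1.chart.target) : B.1.chart.symm x ∈ B.1.K ×ˢ B.1.J := by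
  have : x ∈ B.1.chart '' (B.1.K ×ˢ B.1.J) := by
    rw [← L.supp_inter B.1 B.2]; exact ⟨hx, hxB⟩
  obtain ⟨p, hp, rfl⟩ := this
  rw [B.1.chart.left_inv (B.1.mem_source (B.1.K_subset hp.1) hp.2)]
  exact hp

variable [IsManifold 𝓘(ℝ, Euc (n + 1)) ∞ M]
  [RiemannianBundle (fun x : M => TangentSpace 𝓘(ℝ, Euc (n + 1)) x)]

/-- The area density of the plaques of a flow box. -/
noncomputable def FlowBox.density (B : FlowBox n M) (p : ℝ × Euc n) : ℝ :=
  areaDensity (B.leaf p.1) p.2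

variable [MeasurableSpace M]

/-- The area measure of the lamination in a flow box. -/
noncomputable def TransverseMeasure.area (B : L.atlas) : Measure M :=
  ((m.base B).withDensity fun p => ENNReal.ofReal (B.1.density p)).map B.1.chart

variable [BorelSpace M]

lemma TransverseMeasure.aemeasurable_chart (B : L.atlas) : AEMeasurable B.1.chart (m.base B) := by
  rw [← m.base_eq_restrict]
  exact ContinuousOn.aemeasurable (B.1.chart.continuousOn.mono fun p hp =>
    B.1.mem_source (B.1.K_subset hp.1) hp.2) (B.1.measurableSet_K.prod B.1.J_open.measurableSet)

lemma TransverseMeasure.aemeasurable_chart' (B : L.atlas) : AEMeasurable B.1.chart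
    ((m.base B).withDensity fun p => ENNReal.ofReal (B.1.density p)) :=
  (m.aemeasurable_chart B).mono_ac (withDensity_absolutelyContinuous _ _)

lemma measurableSet_chart_preimage (B : FlowBox n M) {S : Set M} (hS : MeasurableSet S) :
    MeasurableSet {p | p ∈ B.chart.source ∧ B.chart p ∈ S} := by
  have h := (B.chart.continuousOn.aemeasurable B.chart.open_source.measurableSet (μ := volume))
  classical
  rcases isEmpty_or_nonempty M with hM | ⟨⟨x⟩⟩
  · have : B.chart.source = ∅ := eq_empty_of_forall_notMem fun p _ => hM.elim (B.chart p)
    simp [this]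
  have h1 : Measurable (B.chart.source.piecewise B.chart fun _ => x) :=
    B.chart.continuousOn.measurable_piecewise continuousOn_const B.chart.open_source.measurableSet
  convert B.chart.open_source.measurableSet.inter (h1 hS) using 1
  ext p
  constructor
  · rintro ⟨h, h'⟩; exact ⟨h, by rwa [mem_preimage, piecewise_eq_of_mem _ _ _ h]⟩
  · rintro ⟨h, h'⟩; exact ⟨h, by rwa [mem_preimage, piecewise_eq_of_mem _ _ _ h] at h'⟩

lemma FlowBox.aemeasurable_density
    [IsContMDiffRiemannianBundle 𝓘(ℝ, Euc (n + 1)) ∞ (Euc (n + 1))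
      (fun x : M => TangentSpace 𝓘(ℝ, Euc (n + 1)) x)] (B : L.atlas) :
    AEMeasurable B.1.density (m.base B) := by
  rw [← m.base_eq_restrict]
  refine B.1.aemeasurable_of_charts _ fun e he => ⟨fun q => areaChart e q.1 q.2, ?_, ?_⟩
  · exact ContinuousOn.areaChart he continuousOn_fst (fun q hq => hq.1)
      fun i => ((continuous_apply i).comp continuous_snd).continuousOn
  · intro β hβ k hk y hy
    exact hβ.area_eq he hk hy

/-- The area of the part of a plaque in a set. -/
noncomputable def FlowBox.sliceArea (B : FlowBox n M) (S : Set M) (k : ℝ) : ℝ≥0∞ :=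
  ∫⁻ y in B.J, {p | p ∈ B.chart.source ∧ B.chart p ∈ S}.indicator
    (fun p => ENNReal.ofReal (B.density p)) (k, y)

variable [IsContMDiffRiemannianBundle 𝓘(ℝ, Euc (n + 1)) ∞ (Euc (n + 1))
      (fun x : M => TangentSpace 𝓘(ℝ, Euc (n + 1)) x)]

lemma TransverseMeasure.area_apply (B : L.atlas) {S : Set M} (hS : MeasurableSet S) :
    AEMeasurable (B.1.sliceArea S) ((m.μ B).restrict B.1.K) ∧
      m.area B S = ∫⁻ k in B.1.K, B.1.sliceArea S k ∂(m.μ B) := by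
  have := m.sigmaFinite B
  have hm := measurableSet_chart_preimage B.1 hS
  have h1 : AEMeasurable ({p | p ∈ B.1.chart.source ∧ B.1.chart p ∈ S}.indicator
      (fun p => ENNReal.ofReal (B.1.density p))) (m.base B) :=
    (FlowBox.aemeasurable_density m B).ennreal_ofReal.indicator hm
  refine ⟨h1.lintegral_prod_right', ?_⟩
  have h2 : (m.base B).restrict (B.1.chart ⁻¹' S) =
      (m.base B).restrict {p | p ∈ B.1.chart.source ∧ B.1.chart p ∈ S} := by
    refine Measure.restrict_congr_set ?_
    filter_upwards [m.ae_base B] with p hp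
    exact propext ⟨fun h => ⟨B.1.mem_source (B.1.K_subset hp.1) hp.2, h⟩, fun h => h.2⟩
  have : SFinite (m.base B) := by unfold base; infer_instance
  rw [area, Measure.map_apply_of_aemeasurable (m.aemeasurable_chart' B) hS,
    withDensity_apply', h2, ← lintegral_indicator hm]
  exact lintegral_prod _ h1

lemma TransverseMeasure.area_compl_supp (B : L.atlas) :
    m.area B (L.supp ∩ B.1.chart.target)ᶜ = 0 := by
  have hS : MeasurableSet (L.supp ∩ B.1.chart.target)ᶜ :=
    (L.supp_closed.measurableSet.inter B.1.chart.open_target.measurableSet).compl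
  rw [area, Measure.map_apply_of_aemeasurable (m.aemeasurable_chart' B) hS]
  refine withDensity_absolutelyContinuous _ _ ?_
  have := m.ae_base B
  rw [ae_iff] at this
  refine measure_mono_null (fun p hp (hp' : p ∈ B.1.K ×ˢ B.1.J) => hp ?_) this
  rw [L.supp_inter B.1 B.2]
  exact ⟨p, hp', rfl⟩

lemma TransverseMeasure.area_eq_zero (B : L.atlas) {S : Set M} (hS : S ⊆ L.suppᶜ) :
    m.area B S = 0 :=
  measure_mono_null (fun _ hy (hy' : _ ∈ L.supp ∩ B.1.chart.target) => hS hy hy'.1)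
    (m.area_compl_supp B)

lemma setLIntegral_eq_of_subset {X : Type*} [MeasurableSpace X] {κ : Measure X} {s t : Set X}
    (hs : MeasurableSet s) (hst : t ⊆ s) {f : X → ℝ≥0∞} (h : ∀ x ∈ s \ t, f x = 0) :
    ∫⁻ x in s, f x ∂κ = ∫⁻ x in t, f x ∂κ := by
  refine le_antisymm ?_ (lintegral_mono_set hst)
  rw [← lintegral_indicator hs]
  refine le_trans (lintegral_mono fun x => ?_) (lintegral_indicator_le f t)
  by_cases hx : x ∈ t
  · rw [indicator_of_mem hx, indicator_of_mem (hst hx)]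
  · by_cases hxs : x ∈ s
    · rw [indicator_of_mem hxs, h x ⟨hxs, hx⟩]; exact zero_le
    · rw [indicator_of_notMem hxs]; exact zero_le

/-- The restrictions of two transverse measures correspond under holonomy. -/
lemma TransverseMeasure.map_holonomy {B B' : L.atlas} {P : Set ℝ} {Q : Set (Euc n)} {h : ℝ → ℝ}
    (hh : IsLocalHolonomy B.1 B'.1 P Q h) (hQ : Q.Nonempty) (hm : Measurable h) :
    ((m.μ B).restrict (P ∩ B.1.K)).map h = (m.μ B').restrict (h '' (P ∩ B.1.K)) := by
  ext S hS
  rw [Measure.map_apply hm hS, Measure.restrict_apply hS, Measure.restrict_apply (hm hS),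
    inter_comm S, image_inter_preimage h (P ∩ B.1.K) S |>.symm, inter_comm (h ⁻¹' S)]
  exact (m.invariant B B' P Q h hh hQ _ inter_subset_left
    ((hh.1.measurableSet.inter B.1.measurableSet_K).inter (hm hS))).symm

lemma IsLocalHolonomy.exists_measurable {B B' : FlowBox n M} {P : Set ℝ} {Q : Set (Euc n)}
    {h : ℝ → ℝ} (hh : IsLocalHolonomy B B' P Q h) (hQ : Q.Nonempty) :
    ∃ h', IsLocalHolonomy B B' P Q h' ∧ Measurable h' ∧ ContinuousOn h' (P ∩ B.K) := by
  obtain ⟨hP, hQ', hPQ, heq, hinj⟩ := hh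
  obtain ⟨y, hy⟩ := hQ
  have hc : ContinuousOn h (P ∩ B.K) := by
    have : ContinuousOn (fun k => (B'.chart.symm (B.chart (k, y))).1) (P ∩ B.K) := by
      refine continuous_fst.comp_continuousOn (B'.chart.continuousOn_symm.comp
        (B.chart.continuousOn.comp (by fun_prop) ?_) ?_)
      · exact fun k hk => (hPQ ⟨hk.1, hy⟩).1
      · exact fun k hk => (hPQ ⟨hk.1, hy⟩).2
    exact this.congr fun k hk => (heq k hk y hy).symm
  classical
  have he : EqOn ((P ∩ B.K).piecewise h fun _ => 0) h (P ∩ B.K) := piecewise_eqOn _ _ _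
  refine ⟨(P ∩ B.K).piecewise h fun _ => 0, ⟨hP, hQ', hPQ, fun k hk y hy => ?_, ?_⟩, ?_, ?_⟩
  · rw [he hk]; exact heq k hk y hy
  · exact hinj.congr he.symm
  · exact hc.measurable_piecewise continuousOn_const
      (hP.measurableSet.inter B.measurableSet_K)
  · exact hc.congr he

lemma differentiableAt_of_det_fderiv_ne_zero (hn : 1 ≤ n) {τ : Euc n → Euc n} {y : Euc n}
    (h : (fderiv ℝ τ y).det ≠ 0) : DifferentiableAt ℝ τ y := by
  by_contra hd
  rw [fderiv_zero_of_not_differentiableAt hd] at h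
  have : Nontrivial (Euc n) := by
    have : Nonempty (Fin n) := ⟨⟨0, hn⟩⟩
    infer_instance
  exact h (by rw [ContinuousLinearMap.det, ContinuousLinearMap.toLinearMap_zero,
    LinearMap.det_zero, finrank_euclideanSpace_fin, zero_pow (by omega)])

/-- The change of plaque coordinates from `B` to `B'`. -/
noncomputable def FlowBox.trans (B B' : FlowBox n M) (k : ℝ) (y : Euc n) : Euc n :=
  (B'.chart.symm (B.chart (k, y))).2

lemma Lamination.leaf_eq_trans {B B' : L.atlas} {P : Set ℝ} {Q : Set (Euc n)} {h : ℝ → ℝ}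
    (hh : IsLocalHolonomy B.1 B'.1 P Q h) {k : ℝ} (hk : k ∈ P ∩ B.1.K) {y : Euc n} (hy : y ∈ Q) :
    B.1.leaf k y = B'.1.leaf (h k) (B.1.trans B'.1 k y) ∧ h k ∈ B'.1.K ∧
      B.1.trans B'.1 k y ∈ B'.1.J ∧ y ∈ B.1.J := by
  have h1 := hh.2.2.1 (⟨hk.1, hy⟩ : (k, y) ∈ P ×ˢ Q)
  have hyJ : y ∈ B.1.J := by
    have := h1.1
    rw [B.1.source_eq] at this
    exact this.2
  have h2 : B'.1.chart.symm (B.1.chart (k, y)) = (h k, B.1.trans B'.1 k y) :=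
    Prod.ext (hh.2.2.2.1 k hk y hy) rfl
  have h3 := L.symm_mem B' (L.chart_mem_supp B hk.2 hyJ) h1.2
  have h4 : B'.1.chart.symm (B.1.leaf k y) = _ := h2
  rw [h4] at h3
  refine ⟨?_, h3.1, h3.2, hyJ⟩
  rw [FlowBox.leaf, FlowBox.leaf, ← h2, B'.1.chart.right_inv h1.2]

lemma FlowBox.sliceArea_eq (hn : 1 ≤ n) (hL : L.IsOriented) {B B' : L.atlas} {P : Set ℝ}
    {Q : Set (Euc n)} {h : ℝ → ℝ} (hh : IsLocalHolonomy B.1 B'.1 P Q h) {S : Set M}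
    (hSR : S ∩ L.supp ⊆ B.1.chart '' (P ×ˢ Q)) (hS : S ⊆ L.supp) {k : ℝ} (hk : k ∈ P ∩ B.1.K) :
    B.1.sliceArea S k = B'.1.sliceArea S (h k) := by
  obtain ⟨hP, hQ, hPQ, heq, hinj⟩ := hh
  have hle := fun {y} (hy : y ∈ Q) => L.leaf_eq_trans ⟨hP, hQ, hPQ, heq, hinj⟩ hk hy
  have hQJ : Q ⊆ B.1.J := fun y hy => (hle hy).2.2.2
  have hdiff : ∀ y ∈ Q, DifferentiableAt ℝ (B.1.trans B'.1 k) y := fun y hy =>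
    differentiableAt_of_det_fderiv_ne_zero hn
      (hL B.1 B.2 B'.1 B'.2 k hk.2 y (hQJ hy) (hPQ (⟨hk.1, hy⟩ : (k, y) ∈ P ×ˢ Q)).2).ne'
  have hinjτ : InjOn (B.1.trans B'.1 k) Q := by
    intro y hy y' hy' hyy
    have h1 : B.1.leaf k y = B.1.leaf k y' := by rw [(hle hy).1, (hle hy').1, hyy]
    have := B.1.chart.injOn (hPQ (⟨hk.1, hy⟩ : (k, y) ∈ P ×ˢ Q)).1
      (hPQ (⟨hk.1, hy'⟩ : (k, y') ∈ P ×ˢ Q)).1 h1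
    exact (Prod.ext_iff.1 this).2
  set g : Euc n → ℝ≥0∞ := fun y => {p | p ∈ B'.1.chart.source ∧ B'.1.chart p ∈ S}.indicator
    (fun p => ENNReal.ofReal (B'.1.density p)) (h k, y) with hg
  have e1 := lintegral_image_eq_lintegral_abs_det_fderiv_mul volume hQ.measurableSet
    (fun y hy => (hdiff y hy).hasFDerivAt.hasFDerivWithinAt) hinjτ g
  have e2 : B'.1.sliceArea S (h k) = ∫⁻ y in B.1.trans B'.1 k '' Q, g y := by
    have hsub : B.1.trans B'.1 k '' Q ⊆ B'.1.J := by
      rintro _ ⟨y, hy, rfl⟩; exact (hle hy).2.2.1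
    refine setLIntegral_eq_of_subset B'.1.J_open.measurableSet hsub ?_
    intro y' hy'
    refine indicator_of_notMem (fun hS' => hy'.2 ?_) _
    obtain ⟨⟨k₂, y₂⟩, h₂, h₂'⟩ := hSR ⟨hS'.2, hS hS'.2⟩
    have hk₂ : k₂ ∈ B.1.K := by
      have h3 := L.symm_mem B (hS hS'.2)
        (h₂' ▸ B.1.chart.map_source (hPQ h₂).1)
      rw [← h₂', B.1.chart.left_inv (hPQ h₂).1] at h3
      exact h3.1
    have h4 := heq k₂ ⟨h₂.1, hk₂⟩ y₂ h₂.2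
    rw [h₂', B'.1.chart.left_inv hS'.1] at h4
    have h5 : k = k₂ := hinj hk ⟨h₂.1, hk₂⟩ h4
    refine ⟨y₂, h₂.2, ?_⟩
    rw [FlowBox.trans, h5, h₂', B'.1.chart.left_inv hS'.1]
  have e3 : B.1.sliceArea S k = ∫⁻ y in Q, {p | p ∈ B.1.chart.source ∧ B.1.chart p ∈ S}.indicator
      (fun p => ENNReal.ofReal (B.1.density p)) (k, y) := by
    refine setLIntegral_eq_of_subset B.1.J_open.measurableSet hQJ ?_
    intro y hy
    refine indicator_of_notMem (fun hS' => hy.2 ?_) _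
    obtain ⟨p, h₂, h₂'⟩ := hSR ⟨hS'.2, hS hS'.2⟩
    have := B.1.chart.injOn (hPQ h₂).1 hS'.1 h₂'
    rw [this] at h₂
    exact h₂.2
  rw [e2, e1, e3]
  refine setLIntegral_congr_fun hQ.measurableSet fun y hy => ?_
  have hsrc := (hPQ (⟨hk.1, hy⟩ : (k, y) ∈ P ×ˢ Q)).1
  have hsrc' := B'.1.mem_source (B'.1.K_subset (hle hy).2.1) (hle hy).2.2.1
  have hev : ∀ᶠ y' in 𝓝 y, B.1.leaf k y' = B'.1.leaf (h k) (B.1.trans B'.1 k y') := by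
    filter_upwards [hQ.mem_nhds hy] with y' hy' using (hle hy').1
  have hd : B.1.density (k, y) = |(fderiv ℝ (B.1.trans B'.1 k) y).det| *
      B'.1.density (h k, B.1.trans B'.1 k y) :=
    areaDensity_comp (B.1.mdifferentiableAt_leaf hk.2 (hQJ hy))
      (B'.1.mdifferentiableAt_leaf (hle hy).2.1 (hle hy).2.2.1) (hdiff y hy) hev
  by_cases hyS : B.1.leaf k y ∈ S
  · have hyS' : B'.1.chart (h k, B.1.trans B'.1 k y) ∈ S := by
      have := (hle hy).1; rw [this] at hyS; exact hyS
    simp only [hg]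
    rw [indicator_of_mem, indicator_of_mem, hd, ENNReal.ofReal_mul (abs_nonneg _)]
    exacts [⟨hsrc', hyS'⟩, ⟨hsrc, hyS⟩]
  · have hyS' : B'.1.chart (h k, B.1.trans B'.1 k y) ∉ S := by
      have := (hle hy).1; rw [this] at hyS; exact hyS
    simp only [hg]
    rw [indicator_of_notMem, indicator_of_notMem, mul_zero]
    exacts [fun h => hyS' h.2, fun h => hyS h.2]

lemma TransverseMeasure.area_eq_of_holonomy (hn : 1 ≤ n) (hL : L.IsOriented) {B B' : L.atlas}
    {P : Set ℝ} {Q : Set (Euc n)} {h : ℝ → ℝ} (hh : IsLocalHolonomy B.1 B'.1 P Q h)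
    (hQ : Q.Nonempty) {S : Set M} (hS : MeasurableSet S) (hSL : S ⊆ L.supp)
    (hSR : S ⊆ B.1.chart '' (P ×ˢ Q)) : m.area B S = m.area B' S := by
  obtain ⟨h, hh, hm, hc⟩ := hh.exists_measurable hQ
  have hPK := hh.1.measurableSet.inter B.1.measurableSet_K
  have him : MeasurableSet (h '' (P ∩ B.1.K)) :=
    hPK.image_of_continuousOn_injOn hc hh.2.2.2.2
  have hsub : h '' (P ∩ B.1.K) ⊆ B'.1.K := by
    rintro _ ⟨k, hk, rfl⟩
    exact (L.leaf_eq_trans hh hk hQ.some_mem).2.1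
  have hmem : ∀ p : ℝ × Euc n, p ∈ B.1.chart.source → B.1.chart p ∈ S →
      p.1 ∈ P ∩ B.1.K ∧ p.2 ∈ Q := by
    intro p hp hpS
    obtain ⟨q, h₂, h₂'⟩ := hSR hpS
    have := B.1.chart.injOn (hh.2.2.1 h₂).1 hp h₂'
    rw [this] at h₂
    have h3 := L.symm_mem B (hSL hpS) (B.1.chart.map_source hp)
    rw [B.1.chart.left_inv hp] at h3
    exact ⟨⟨h₂.1, h3.1⟩, h₂.2⟩
  rw [(m.area_apply B hS).2, (m.area_apply B' hS).2]
  calc ∫⁻ k in B.1.K, B.1.sliceArea S k ∂(m.μ B)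
      = ∫⁻ k in P ∩ B.1.K, B.1.sliceArea S k ∂(m.μ B) := by
        refine setLIntegral_eq_of_subset B.1.measurableSet_K
          inter_subset_right fun k hk => ?_
        rw [FlowBox.sliceArea]
        refine (lintegral_congr fun y => indicator_of_notMem (fun h => hk.2 ?_) _).trans
          lintegral_zero
        exact (hmem _ h.1 h.2).1
    _ = ∫⁻ k in P ∩ B.1.K, B'.1.sliceArea S (h k) ∂(m.μ B) :=
        setLIntegral_congr_fun hPK fun k hk =>
          FlowBox.sliceArea_eq hn hL hh (inter_subset_left.trans hSR) hSL hk
    _ = ∫⁻ k in h '' (P ∩ B.1.K), B'.1.sliceArea S k ∂(m.μ B') := by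
        rw [← m.map_holonomy hh hQ hm, lintegral_map' _ hm.aemeasurable]
        rw [m.map_holonomy hh hQ hm]
        exact (m.area_apply B' hS).1.mono_measure (Measure.restrict_mono hsub le_rfl)
    _ = ∫⁻ k in B'.1.K, B'.1.sliceArea S k ∂(m.μ B') := by
        refine (setLIntegral_eq_of_subset B'.1.measurableSet_K
          hsub fun k hk => ?_).symm
        rw [FlowBox.sliceArea]
        refine (lintegral_congr fun y => indicator_of_notMem (fun h' => hk.2 ?_) _).trans
          lintegral_zero
        obtain ⟨q, h₂, h₂'⟩ := hSR h'.2
        have h3 := hmem q (hh.2.2.1 h₂).1 (by rw [h₂']; exact h'.2)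
        refine ⟨q.1, h3.1, ?_⟩
        rw [← hh.2.2.2.1 q.1 h3.1 q.2 h3.2, Prod.mk.eta, h₂', B'.1.chart.left_inv h'.1]

variable [SecondCountableTopology M]

lemma TransverseMeasure.area_restrict_congr (hn : 1 ≤ n) (hL : L.IsOriented) (B B' : L.atlas) :
    (m.area B).restrict (B.1.chart.target ∩ B'.1.chart.target) =
      (m.area B').restrict (B.1.chart.target ∩ B'.1.chart.target) := by
  have hex : ∀ x : (L.supp ∩ (B.1.chart.target ∩ B'.1.chart.target) : Set M), ∃ O : Set M,
      IsOpen O ∧ x.1 ∈ O ∧ (m.area B).restrict O = (m.area B').restrict O := by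
    rintro ⟨x, hx, hxB, hxB'⟩
    have h1 := L.symm_mem B hx hxB
    obtain ⟨P, Q, h, hP, hQ, hh⟩ := L.compatible B.1 B.2 B'.1 B'.2 _ h1.1 _ h1.2
      (by rwa [Prod.mk.eta, B.1.chart.right_inv hxB])
    have hsrc : P ×ˢ Q ⊆ B.1.chart.source := fun p hp => (hh.2.2.1 hp).1
    have hO : IsOpen (B.1.chart '' (P ×ˢ Q)) :=
      B.1.chart.isOpen_image_of_subset_source (hh.1.prod hh.2.1) hsrc
    refine ⟨_, hO, ⟨B.1.chart.symm x, ⟨hP, hQ⟩, B.1.chart.right_inv hxB⟩, ?_⟩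
    ext S hS
    rw [Measure.restrict_apply hS, Measure.restrict_apply hS]
    have hL' := L.supp_closed.measurableSet
    rw [← measure_inter_add_sdiff _ hL', ← measure_inter_add_sdiff (μ := m.area B') _ hL']
    congr 1
    · exact m.area_eq_of_holonomy hn hL hh ⟨_, hQ⟩ ((hS.inter hO.measurableSet).inter hL')
        inter_subset_right (inter_subset_left.trans inter_subset_right)
    · rw [m.area_eq_zero B fun _ hy => hy.2, m.area_eq_zero B' fun _ hy => hy.2]
  choose O hO hxO hOeq using hex
  obtain ⟨T, hT, hTU⟩ := TopologicalSpace.isOpen_iUnion_countable O hO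
  have : Countable T := hT.to_subtype
  have h2 : (m.area B).restrict (L.suppᶜ ∪ ⋃ i ∈ T, O i) =
      (m.area B').restrict (L.suppᶜ ∪ ⋃ i ∈ T, O i) := by
    rw [Measure.restrict_union_congr, Measure.restrict_biUnion_congr hT]
    refine ⟨?_, fun i _ => hOeq i⟩
    rw [Measure.restrict_eq_zero.2, Measure.restrict_eq_zero.2]
    · exact m.area_eq_zero B' subset_rfl
    · exact m.area_eq_zero B subset_rfl
  refine Measure.restrict_congr_mono (fun x hx => ?_) h2
  by_cases hxL : x ∈ L.supp
  · right; rw [hTU]; exact mem_iUnion.2 ⟨⟨x, hxL, hx⟩, hxO _⟩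
  · exact Or.inl hxL

/-- The area measures of the flow boxes glue to a measure on `M`. -/
lemma TransverseMeasure.exists_areaMeasure (hn : 1 ≤ n) (hL : L.IsOriented) :
    ∃ A : Measure M, A L.suppᶜ = 0 ∧ ∀ B : L.atlas, A.restrict B.1.chart.target = m.area B := by
  obtain ⟨T, hT, hTU⟩ := TopologicalSpace.isOpen_iUnion_countable
    (fun B : L.atlas => B.1.chart.target) fun B => B.1.chart.open_target
  have hcov : L.supp ⊆ ⋃ B ∈ T, B.1.chart.target := by
    rw [hTU]
    intro x hx
    obtain ⟨B, hB, hxB⟩ := mem_iUnion₂.1 (L.cover hx)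
    exact mem_iUnion.2 ⟨⟨B, hB⟩, hxB⟩
  obtain ⟨x₀, hx₀⟩ := L.supp_nonempty
  obtain ⟨B₀, hB₀, -⟩ := mem_iUnion₂.1 (hcov hx₀)
  obtain ⟨b, hb⟩ := hT.exists_eq_range ⟨B₀, hB₀⟩
  rw [hb, biUnion_range] at hcov
  set D : ℕ → Set M := disjointed fun i => (b i).1.chart.target with hD
  have hDm : ∀ i, MeasurableSet (D i) :=
    MeasurableSet.disjointed fun i => (b i).1.chart.open_target.measurableSet
  have hDs : ∀ i, D i ⊆ (b i).1.chart.target := disjointed_subset _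
  refine ⟨Measure.sum fun i => (m.area (b i)).restrict (D i), ?_, fun B => ?_⟩
  · rw [Measure.sum_apply _ L.supp_closed.measurableSet.compl, ENNReal.tsum_eq_zero]
    intro i
    exact (Measure.restrict_apply_le _ _).trans_eq
      (m.area_eq_zero (b i) subset_rfl) |>.antisymm
      zero_le
  · ext S hS
    have hT := B.1.chart.open_target.measurableSet
    rw [Measure.restrict_apply hS, Measure.sum_apply _ (hS.inter hT)]
    have h1 : ∀ i, (m.area (b i)).restrict (D i) (S ∩ B.1.chart.target) =
        m.area B (S ∩ B.1.chart.target ∩ D i) := by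
      intro i
      rw [Measure.restrict_apply (hS.inter hT)]
      have h2 : S ∩ B.1.chart.target ∩ D i ⊆ (b i).1.chart.target ∩ B.1.chart.target :=
        fun x hx => ⟨hDs i hx.2, hx.1.2⟩
      rw [← Measure.restrict_eq_self (m.area (b i)) h2, m.area_restrict_congr hn hL,
        Measure.restrict_eq_self _ h2]
    simp_rw [h1]
    rw [← measure_iUnion, ← inter_iUnion, hD, iUnion_disjointed]
    · have h3 := m.area_compl_supp B
      refine measure_congr ?_
      filter_upwards [compl_mem_ae_iff.2 h3] with x hx
      rw [compl_compl] at hx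
      exact propext ⟨fun h => h.1.1, fun h => ⟨⟨h, hx.2⟩, hcov hx.1⟩⟩
    · exact fun i j hij => (disjoint_disjointed _ hij).mono inter_subset_right inter_subset_right
    · exact fun i => (hS.inter hT).inter (hDm i)

end AreaMeasure

lemma LeafBox.norm_tanVec_le {n : ℕ} {β : LeafBox n} {C : NNReal}
    (hC : LipschitzOnWith C β.X (β.I ×ˢ β.J)) {k : ℝ} (hk : k ∈ β.K) {y : Euc n} (hy : y ∈ β.J)
    (i : Fin n) : ‖tanVec (β.leaf k) y i‖ ≤ C := by
  have hlip : LipschitzOnWith C (β.leaf k) β.J := by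
    intro a ha b hb
    refine (hC (⟨β.K_subset hk, ha⟩ : (k, a) ∈ β.I ×ˢ β.J)
      (⟨β.K_subset hk, hb⟩ : (k, b) ∈ β.I ×ˢ β.J)).trans_eq ?_
    rw [Prod.edist_eq, edist_self, max_eq_right zero_le]
  have h1 := norm_fderiv_le_of_lipschitzOn ℝ (β.J_open.mem_nhds hy) hlip
  refine ((fderiv ℝ (β.leaf k) y).le_opNorm _).trans ?_
  simpa [stdVec] using h1

/-! ### The current as integration against the area measure -/

section Current

variable {n : ℕ} {M : Type*} [TopologicalSpace M] [ChartedSpace (Euc (n + 1)) M]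
  {L : Lamination n M} (m : TransverseMeasure L)

/-- The value of a form on the coordinate vectors of a plaque. -/
noncomputable def FlowBox.eval (B : FlowBox n M) (φ : RoughForm n M) (p : ℝ × Euc n) : ℝ :=
  φ (B.leaf p.1 p.2) (coordVec (B.leaf p.1) p.2)

variable [IsManifold 𝓘(ℝ, Euc (n + 1)) ∞ M]
  [RiemannianBundle (fun x : M => TangentSpace 𝓘(ℝ, Euc (n + 1)) x)]

variable [MeasurableSpace M] [BorelSpace M]
  [IsContMDiffRiemannianBundle 𝓘(ℝ, Euc (n + 1)) ∞ (Euc (n + 1))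
      (fun x : M => TangentSpace 𝓘(ℝ, Euc (n + 1)) x)]

open Classical in
/-- The value of a form on the oriented unit tangent `n`-vector of the lamination. -/
noncomputable def Lamination.tau (L : Lamination n M) (φ : RoughForm n M) (x : M) : ℝ :=
  if h : ∃ B ∈ L.atlas, x ∈ L.supp ∩ B.chart.target then
    h.choose.eval φ (h.choose.chart.symm x) / h.choose.density (h.choose.chart.symm x)
  else 0

lemma Lamination.tau_leaf (hn : 1 ≤ n) (hL : L.IsOriented) (φ : RoughForm n M) (B : L.atlas)
    {k : ℝ} (hk : k ∈ B.1.K) {y : Euc n} (hy : y ∈ B.1.J) :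
    L.tau φ (B.1.leaf k y) * B.1.density (k, y) = B.1.eval φ (k, y) := by
  have hx := L.chart_mem_supp B hk hy
  have h : ∃ B' ∈ L.atlas, B.1.leaf k y ∈ L.supp ∩ B'.chart.target :=
    ⟨B.1, B.2, hx, B.1.leaf_mem (B.1.K_subset hk) hy⟩
  rw [Lamination.tau, dif_pos h]
  obtain ⟨hB', -, hxB'⟩ := h.choose_spec
  set B' := h.choose
  obtain ⟨P, Q, g, hP, hQ, hh⟩ := L.compatible B.1 B.2 B' hB' k hk y hy hxB'
  have hle := fun {y'} (hy' : y' ∈ Q) =>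
    L.leaf_eq_trans (B := B) (B' := ⟨B', hB'⟩) hh ⟨hP, hk⟩ hy'
  have hdet := hL B.1 B.2 B' hB' k hk y hy hxB'
  have hdiff := differentiableAt_of_det_fderiv_ne_zero hn hdet.ne'
  have hev : ∀ᶠ y' in 𝓝 y, B.1.leaf k y' = B'.leaf (g k) (B.1.trans B' k y') := by
    filter_upwards [hh.2.1.mem_nhds hQ] with y' hy' using (hle hy').1
  obtain ⟨h1, h2, h3, -⟩ := hle hQ
  have hs : B'.chart.symm (B.1.leaf k y) = (g k, B.1.trans B' k y) := by
    rw [h1, B'.symm_leaf (B'.K_subset h2) h3]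
  have hd1 := B.1.mdifferentiableAt_leaf hk hy
  have hd2 := B'.mdifferentiableAt_leaf h2 h3
  have e1 : B.1.eval φ (k, y) = _ := form_coordVec_comp φ hd1 hd2 hdiff hev
  have e2 : B.1.density (k, y) = _ := areaDensity_comp hd1 hd2 hdiff hev
  have e3 : 0 < B'.density (g k, B.1.trans B' k y) := B'.areaDensity_pos h2 h3
  have hdet' : 0 < (fderiv ℝ (fun y' => B.1.trans B' k y') y).det := hdet
  rw [hs, e1, e2, abs_of_pos hdet']
  change _ / B'.density _ * (_ * B'.density (g k, B.1.trans B' k y)) =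
    _ * B'.eval φ (g k, B.1.trans B' k y)
  field_simp

lemma Lamination.abs_tau_le {φ : RoughForm n M} {x : M} {c : ℝ} (hc : 0 ≤ c)
    (h : ptComass φ x ≤ ENNReal.ofReal c) : |L.tau φ x| ≤ c := by
  by_cases hx : ∃ B ∈ L.atlas, x ∈ L.supp ∩ B.chart.target
  swap
  · rw [Lamination.tau, dif_neg hx, abs_zero]; exact hc
  rw [Lamination.tau, dif_pos hx]
  obtain ⟨hB, hxs, hxB⟩ := hx.choose_spec
  set B := hx.choose
  set p := B.chart.symm x with hp
  have hpK : p ∈ B.K ×ˢ B.J := L.symm_mem ⟨B, hB⟩ hxs hxB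
  have hpx : B.leaf p.1 p.2 = x := B.chart.right_inv hxB
  have hpos : 0 < B.density p := B.areaDensity_pos hpK.1 hpK.2
  have hd := B.mdifferentiableAt_leaf hpK.1 hpK.2
  have he := chart_mem_atlas (Euc (n + 1)) x
  have hs : B.leaf p.1 p.2 ∈ (chartAt (Euc (n + 1)) x).source := by
    rw [hpx]; exact mem_chart_source _ x
  rw [abs_div, abs_of_pos hpos, div_le_iff₀ hpos, FlowBox.eval, form_coordVec_eq φ he hd hs,
    FlowBox.density, areaDensity_eq he hd hs]
  have hz := (chartAt (Euc (n + 1)) x).map_source hs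
  refine ComassLe.abs_le he hz hc ((comassLe_formInChart_iff φ he hz hc).2 ?_) _
  rwa [(chartAt (Euc (n + 1)) x).left_inv hs, hpx]

lemma Lamination.tau_eq_zero {φ : RoughForm n M} {x : M} (h : φ x = 0) : L.tau φ x = 0 := by
  refine abs_nonpos_iff.1 (Lamination.abs_tau_le le_rfl ?_)
  simp [ptComass, h]

lemma Lamination.tau_add (φ φ' : RoughForm n M) (x : M) :
    L.tau (fun x => φ x + φ' x) x = L.tau φ x + L.tau φ' x := by
  by_cases hx : ∃ B ∈ L.atlas, x ∈ L.supp ∩ B.chart.target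
  · rw [Lamination.tau, Lamination.tau, Lamination.tau, dif_pos hx, dif_pos hx, dif_pos hx,
      ← add_div]
    rfl
  · rw [Lamination.tau, Lamination.tau, Lamination.tau, dif_neg hx, dif_neg hx, dif_neg hx,
      add_zero]

/-- The measure `A` is the area measure of the measured lamination. -/
structure TransverseMeasure.IsAreaMeasure (A : Measure M) : Prop where
  compl_supp : A L.suppᶜ = 0
  restrict_eq : ∀ B : L.atlas, A.restrict B.1.chart.target = m.area B

lemma aemeasurable_of_comp_chart (B : FlowBox n M) {κ : Measure (ℝ × Euc n)}
    (hκ : ∀ᵐ p ∂κ, p ∈ B.chart.source) (hm : AEMeasurable B.chart κ) {f : M → ℝ}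
    (hf : AEMeasurable (fun p => f (B.chart p)) κ) : AEMeasurable f (κ.map B.chart) := by
  have ht : ∀ᵐ x ∂(κ.map B.chart), x ∈ B.chart.target := by
    refine (ae_map_iff hm (p := (· ∈ B.chart.target)) B.chart.open_target.measurableSet).2 ?_
    filter_upwards [hκ] with p hp using B.chart.map_source hp
  have h1 : AEMeasurable B.chart.symm (κ.map B.chart) := by
    rw [← Measure.restrict_eq_self_of_ae_mem ht]
    exact B.chart.continuousOn_symm.aemeasurable B.chart.open_target.measurableSet
  have h2 : (κ.map B.chart).map B.chart.symm = κ := by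
    rw [AEMeasurable.map_map_of_aemeasurable h1 hm]
    conv_rhs => rw [← Measure.map_id (μ := κ)]
    refine Measure.map_congr ?_
    filter_upwards [hκ] with p hp using B.chart.left_inv hp
  have h3 := AEMeasurable.comp_aemeasurable (g := fun p => f (B.chart p)) (by rwa [h2]) h1
  refine h3.congr ?_
  filter_upwards [ht] with x hx
  simp [B.chart.right_inv hx]

lemma TransverseMeasure.aemeasurable_eval (B : L.atlas) {φ : RoughForm n M}
    (hφ : ∀ e ∈ atlas (Euc (n + 1)) M, ContinuousOn (formInChart φ e) e.target) :
    AEMeasurable (B.1.eval φ) (m.base B) := by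
  rw [← m.base_eq_restrict]
  refine B.1.aemeasurable_of_charts _ fun e he => ⟨fun q => formInChart φ e q.1 q.2, ?_, ?_⟩
  · have h1 : ContinuousOn (fun q : Euc (n + 1) × (Fin n → Euc (n + 1)) => formInChart φ e q.1)
        (e.target ×ˢ univ) := (hφ e he).comp continuousOn_fst fun q hq => hq.1
    exact h1.eval continuousOn_snd
  · intro β hβ k hk y hy
    exact hβ.form_eq he φ hk hy

variable {m} {A : Measure M}

namespace TransverseMeasure.IsAreaMeasure

lemma ae_mem_supp (hA : m.IsAreaMeasure A) : ∀ᵐ x ∂A, x ∈ L.supp := hA.compl_supp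

lemma integral_target (hA : m.IsAreaMeasure A) (B : L.atlas) {f : M → ℝ} (hf : AEMeasurable f A) :
    (Integrable f (A.restrict B.1.chart.target) ↔
      Integrable (fun p => B.1.density p * f (B.1.chart p)) (m.base B)) ∧
    ∫ x in B.1.chart.target, f x ∂A = ∫ p, B.1.density p * f (B.1.chart p) ∂(m.base B) := by
  have hf' : AEMeasurable f (m.area B) := by
    rw [← hA.restrict_eq B]; exact hf.restrict
  have hd := (FlowBox.aemeasurable_density m B).ennreal_ofReal
  have ht : ∀ᵐ p ∂(m.base B), ENNReal.ofReal (B.1.density p) < ⊤ :=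
    Filter.Eventually.of_forall fun _ => ENNReal.ofReal_lt_top
  have e : ∀ p, (ENNReal.ofReal (B.1.density p)).toReal • f (B.1.chart p) =
      B.1.density p * f (B.1.chart p) := fun p => by
    rw [FlowBox.density, ENNReal.toReal_ofReal (areaDensity_nonneg _ _), smul_eq_mul]
  rw [hA.restrict_eq B, TransverseMeasure.area] at *
  rw [integrable_map_measure hf'.aestronglyMeasurable (m.aemeasurable_chart' B),
    integral_map (m.aemeasurable_chart' B) hf'.aestronglyMeasurable,
    integral_withDensity_eq_integral_toReal_smul₀ hd ht,
    integrable_withDensity_iff_integrable_smul₀' hd ht]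
  simp only [Function.comp, e, and_self]

variable [SecondCountableTopology M]

lemma ae_of_target (hA : m.IsAreaMeasure A) : ∃ T : Set L.atlas, T.Countable ∧
    A.restrict (⋃ B ∈ T, B.1.chart.target) = A := by
  obtain ⟨T, hT, hTU⟩ := TopologicalSpace.isOpen_iUnion_countable
    (fun B : L.atlas => B.1.chart.target) fun B => B.1.chart.open_target
  refine ⟨T, hT, Measure.restrict_eq_self_of_ae_mem ?_⟩
  filter_upwards [hA.ae_mem_supp] with x hx
  rw [hTU]
  obtain ⟨B, hB, hxB⟩ := mem_iUnion₂.1 (L.cover hx)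
  exact mem_iUnion.2 ⟨⟨B, hB⟩, hxB⟩

lemma aemeasurable_tau (hn : 1 ≤ n) (hL : L.IsOriented) (hA : m.IsAreaMeasure A)
    {φ : RoughForm n M}
    (hφ : ∀ e ∈ atlas (Euc (n + 1)) M, ContinuousOn (formInChart φ e) e.target) :
    AEMeasurable (L.tau φ) A := by
  obtain ⟨T, hT, hTA⟩ := hA.ae_of_target
  have : Countable T := hT.to_subtype
  rw [← hTA, biUnion_eq_iUnion, aemeasurable_iUnion_iff]
  rintro ⟨B, -⟩
  rw [hA.restrict_eq B]
  refine aemeasurable_of_comp_chart B.1 ?_ (m.aemeasurable_chart' B) ?_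
  · refine withDensity_absolutelyContinuous _ _ ?_
    exact (m.ae_base B).mono fun p hp => B.1.mem_source (B.1.K_subset hp.1) hp.2
  · refine AEMeasurable.mono_ac ?_ (withDensity_absolutelyContinuous _ _)
    refine ((m.aemeasurable_eval B hφ).div (FlowBox.aemeasurable_density m B)).congr ?_
    filter_upwards [m.ae_base B] with p hp
    have h1 := Lamination.tau_leaf hn hL φ B hp.1 hp.2
    have h2 : 0 < B.1.density p := B.1.areaDensity_pos hp.1 hp.2
    rw [Pi.div_apply, div_eq_iff h2.ne']
    exact h1.symm

/-- Integration over a local box. -/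
lemma integral_box (hA : m.IsAreaMeasure A) (B : L.atlas) {e : OpenPartialHomeomorph M (Euc (n + 1))}
    {β : LeafBox n} (hβ : B.1.IsLocal e β) {f : M → ℝ} (hf : Integrable f A)
    (h0 : ∀ x, (∀ k ∈ β.I, ∀ y ∈ β.J, B.1.leaf k y ≠ x) → f x = 0) :
    Integrable (fun k => ∫ y in β.J, B.1.density (k, y) * f (B.1.leaf k y))
      ((m.μ B).restrict β.K) ∧
    ∫ x, f x ∂A =
      ∫ k in β.K, (∫ y in β.J, B.1.density (k, y) * f (B.1.leaf k y)) ∂(m.μ B) := by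
  have := m.sigmaFinite B
  obtain ⟨h1, h2⟩ := hA.integral_target B hf.aemeasurable
  have h3 := h1.1 hf.restrict
  have hz : ∀ k ∈ B.1.K, ∀ y ∈ B.1.J, ¬(k ∈ β.I ∧ y ∈ β.J) → f (B.1.leaf k y) = 0 := by
    intro k hk y hy hky
    refine h0 _ fun k' hk' y' hy' heq => hky ?_
    have := B.1.chart.injOn (B.1.mem_source (hβ.I_sub hk') (hβ.J_subset hy'))
      (B.1.mem_source (B.1.K_subset hk) hy) heq
    rw [Prod.mk.injEq] at this
    exact ⟨this.1 ▸ hk', this.2 ▸ hy'⟩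
  have hin : ∀ k ∈ B.1.K, ∫ y in B.1.J, B.1.density (k, y) * f (B.1.leaf k y) =
      ∫ y in β.J, B.1.density (k, y) * f (B.1.leaf k y) := fun k hk =>
    setIntegral_eq_of_subset_of_forall_sdiff_eq_zero B.1.J_open.measurableSet hβ.J_subset
      fun y hy => by rw [hz k hk y hy.1 fun h => hy.2 h.2, mul_zero]
  have hout : ∀ k ∈ B.1.K \ β.K, ∫ y in B.1.J, B.1.density (k, y) * f (B.1.leaf k y) = 0 := by
    intro k hk
    refine (setIntegral_congr_fun B.1.J_open.measurableSet fun y hy => ?_).trans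
      (integral_zero _ _)
    rw [hz k hk.1 y hy fun h => hk.2 (by rw [hβ.K_eq]; exact ⟨hk.1, h.1⟩), mul_zero]
  have hKsub : β.K ⊆ B.1.K := fun k hk => hβ.mem_K hk
  constructor
  · have h4 : Integrable (fun k => ∫ y in B.1.J, B.1.density (k, y) * f (B.1.leaf k y))
        ((m.μ B).restrict B.1.K) := h3.integral_prod_left
    refine (h4.mono_measure (Measure.restrict_mono hKsub le_rfl)).congr ?_
    filter_upwards [ae_restrict_mem hβ.measurableSet_K] with k hk
    exact hin k (hKsub hk)
  · have h5 : ∫ x, f x ∂A = ∫ x in B.1.chart.target, f x ∂A := by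
      refine (setIntegral_eq_integral_of_forall_compl_eq_zero fun x hx => h0 x ?_).symm
      rintro k hk y hy rfl
      exact hx (B.1.leaf_mem (hβ.I_sub hk) (hβ.J_subset hy))
    rw [h5, h2, TransverseMeasure.base, integral_prod _ h3]
    change ∫ k in B.1.K, (∫ y in B.1.J, B.1.density (k, y) * f (B.1.leaf k y)) ∂(m.μ B) = _
    rw [setIntegral_eq_of_subset_of_forall_sdiff_eq_zero B.1.measurableSet_K hKsub hout]
    exact setIntegral_congr_fun hβ.measurableSet_K fun k hk => hin k (hKsub hk)

lemma measure_lt_top_nhds (hA : m.IsAreaMeasure A) (x : M) : ∃ O, IsOpen O ∧ x ∈ O ∧ A O < ⊤ := by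
  by_cases hx : x ∈ L.supp
  swap
  · exact ⟨L.suppᶜ, L.supp_closed.isOpen_compl, hx, by simp [hA.compl_supp]⟩
  obtain ⟨B, hB, hxB⟩ := mem_iUnion₂.1 (L.cover hx)
  have hp := L.symm_mem ⟨B, hB⟩ hx hxB
  set p := B.chart.symm x with hpd
  have hpx : B.leaf p.1 p.2 = x := B.chart.right_inv hxB
  set e := chartAt (Euc (n + 1)) x
  have he : e ∈ atlas (Euc (n + 1)) M := chart_mem_atlas _ x
  have hxe : x ∈ e.source := mem_chart_source _ x
  obtain ⟨r, hr, hrt⟩ := Metric.nhds_basis_closedBall.mem_iff.1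
    (e.open_target.mem_nhds (e.map_source hxe))
  have hW : IsOpen (e.source ∩ e ⁻¹' Metric.ball (e x) r) :=
    e.isOpen_inter_preimage Metric.isOpen_ball
  obtain ⟨β, hβ, hkβ, hyβ, -, hβW⟩ := B.exists_isLocal he hp.1 hp.2 hW
    (by rw [hpx]; exact ⟨hxe, hxe, Metric.mem_ball_self hr⟩) Filter.univ_mem
  have hO : IsOpen (B.chart '' (β.I ×ˢ β.J)) := by
    refine B.chart.isOpen_image_of_subset_source (β.I_open.prod β.J_open) fun q hq => ?_
    exact B.mem_source (hβ.I_sub hq.1) (hβ.J_subset hq.2)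
  refine ⟨_, hO, ⟨p, ⟨β.K_subset hkβ, hyβ⟩, hpx⟩, ?_⟩
  obtain ⟨C, hC⟩ := β.lipschitz
  obtain ⟨b, hb⟩ : ∃ b : ℝ, ∀ z ∈ Metric.closedBall (e x) r,
      ∀ v ∈ univ.pi fun _ : Fin n => Metric.closedBall (0 : Euc (n + 1)) C,
        areaChart e z v ≤ b := by
    have hcpt := (isCompact_closedBall (e x) r).prod
      (isCompact_univ_pi fun _ : Fin n => isCompact_closedBall (0 : Euc (n + 1)) C)
    have hcont : ContinuousOn (fun q : Euc (n + 1) × (Fin n → Euc (n + 1)) => areaChart e q.1 q.2)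
        (Metric.closedBall (e x) r ×ˢ univ.pi fun _ => Metric.closedBall 0 C) :=
      ContinuousOn.areaChart he continuousOn_fst (fun q hq => hrt hq.1)
        fun i => ((continuous_apply i).comp continuous_snd).continuousOn
    obtain ⟨b, hb⟩ := hcpt.bddAbove_image hcont
    exact ⟨b, fun z hz v hv => hb ⟨(z, v), ⟨hz, hv⟩, rfl⟩⟩
  have hbd : ∀ k ∈ β.K, ∀ y ∈ β.J, B.density (k, y) ≤ b := by
    intro k hk y hy
    rw [FlowBox.density, hβ.area_eq he hk hy]
    refine hb _ ?_ _ fun i _ => ?_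
    · rw [hβ.leaf_eq k (β.K_subset hk) y hy]
      exact Metric.ball_subset_closedBall (hβW k (β.K_subset hk) y hy).2
    · rw [mem_closedBall_zero_iff]
      exact LeafBox.norm_tanVec_le hC hk hy i
  have hvol : volume B.J < ⊤ := by
    obtain ⟨a, c, hJ⟩ := B.J_box
    have hsub : B.J ⊆ WithLp.ofLp ⁻¹' (univ.pi fun i => Icc (a i) (c i)) := by
      rw [hJ]; exact fun y hy i _ => Ioo_subset_Icc_self (hy i)
    refine (measure_mono hsub).trans_lt ?_
    have := (EuclideanSpace.volume_preserving_symm_measurableEquiv_toLp (Fin n)).symm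
    refine IsCompact.measure_lt_top ?_
    have h1 : IsCompact (univ.pi fun i => Icc (a i) (c i)) :=
      isCompact_univ_pi fun i => isCompact_Icc
    exact (PiLp.homeomorph 2 fun _ : Fin n => ℝ).isCompact_preimage.2 h1
  have hμ : m.μ ⟨B, hB⟩ β.K < ⊤ := by
    obtain ⟨C', hC', hcpt, hI⟩ := hβ.I_subset
    exact (measure_mono (β.K_subset.trans hI)).trans_lt (m.radon ⟨B, hB⟩ C' hC' hcpt)
  have hsubT : B.chart '' (β.I ×ˢ β.J) ⊆ B.chart.target := by
    rintro _ ⟨q, hq, rfl⟩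
    exact B.leaf_mem (hβ.I_sub hq.1) (hβ.J_subset hq.2)
  rw [← Measure.restrict_eq_self A hsubT, hA.restrict_eq ⟨B, hB⟩,
    (m.area_apply ⟨B, hB⟩ hO.measurableSet).2]
  have hmem : ∀ k y, y ∈ B.J → k ∈ B.K → B.chart (k, y) ∈ B.chart '' (β.I ×ˢ β.J) →
      k ∈ β.K ∧ y ∈ β.J := by
    rintro k y hy hk ⟨q, hq, hqe⟩
    have := B.chart.injOn (B.mem_source (hβ.I_sub hq.1) (hβ.J_subset hq.2))
      (B.mem_source (B.K_subset hk) hy) hqe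
    obtain ⟨rfl, rfl⟩ := Prod.mk.inj this
    exact ⟨by rw [hβ.K_eq]; exact ⟨hk, hq.1⟩, hq.2⟩
  have hle : ∀ k ∈ B.K, B.sliceArea (B.chart '' (β.I ×ˢ β.J)) k ≤
      β.K.indicator (fun _ => ENNReal.ofReal b * volume B.J) k := by
    intro k hk
    by_cases hkβ' : k ∈ β.K
    · rw [indicator_of_mem hkβ', FlowBox.sliceArea]
      refine le_trans (setLIntegral_mono' (g := fun _ => ENNReal.ofReal b)
        B.J_open.measurableSet fun y hy => ?_) (by simp)
      refine indicator_apply_le' (fun h => ?_) fun _ => zero_le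
      exact ENNReal.ofReal_le_ofReal (hbd k hkβ' y (hmem k y hy hk h.2).2)
    · rw [indicator_of_notMem hkβ', FlowBox.sliceArea, nonpos_iff_eq_zero]
      refine setLIntegral_eq_zero B.J_open.measurableSet fun y hy => ?_
      exact indicator_of_notMem (fun h => hkβ' (hmem k y hy hk h.2).1) _
  refine (setLIntegral_mono' B.measurableSet_K hle).trans_lt ?_
  rw [lintegral_indicator hβ.measurableSet_K, lintegral_const]
  refine ENNReal.mul_lt_top (ENNReal.mul_lt_top ENNReal.ofReal_lt_top hvol) ?_
  rw [Measure.restrict_apply_univ]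
  exact (Measure.restrict_apply_le _ _).trans_lt hμ

lemma isLocallyFinite (hA : m.IsAreaMeasure A) : IsLocallyFiniteMeasure A :=
  ⟨fun x => by
    obtain ⟨O, hO, hx, h⟩ := hA.measure_lt_top_nhds x
    exact ⟨O, hO.mem_nhds hx, h⟩⟩

lemma integrable_tau (hn : 1 ≤ n) (hL : L.IsOriented) (hA : m.IsAreaMeasure A)
    {φ : RoughForm n M} {U : Set M} (hφ : IsContCptForm U φ) {c : ℝ}
    (hc : ∀ x, ptComass φ x ≤ ENNReal.ofReal c) : Integrable (L.tau φ) A := by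
  have := hA.isLocallyFinite
  have h0 : ∀ x, x ∉ closure {x | φ x ≠ 0} → L.tau φ x = 0 := fun x hx =>
    Lamination.tau_eq_zero (by_contra fun h => hx (subset_closure h))
  have h1 : IntegrableOn (L.tau φ) (closure {x | φ x ≠ 0}) A := by
    refine Measure.integrableOn_of_bounded (M := max c 0) hφ.2.1.measure_lt_top.ne
      (hA.aemeasurable_tau hn hL hφ.1).aestronglyMeasurable ?_
    refine Filter.Eventually.of_forall fun x => ?_
    exact Lamination.abs_tau_le (le_max_right _ _)
      ((hc x).trans (ENNReal.ofReal_le_ofReal (le_max_left _ _)))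
  exact h1.integrable_of_forall_notMem_eq_zero h0

/-- The Ruelle-Sullivan current is integration of `tau` against the area measure. -/
lemma ruelleSullivan_eq (hn : 1 ≤ n) (hL : L.IsOriented) (hA : m.IsAreaMeasure A)
    {ρ : PartitionOfUnity L.atlas M L.supp} (hρ : ρ.IsSubordinate fun B => B.1.chart.target)
    {φ : RoughForm n M} {U : Set M} (hφ : IsContCptForm U φ) {c : ℝ}
    (hc : ∀ x, ptComass φ x ≤ ENNReal.ofReal c) :
    ruelleSullivan L m ρ φ = ∫ x, L.tau φ x ∂A := by
  have hint := hA.integrable_tau hn hL hφ hc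
  have hintρ : ∀ B, Integrable (fun x => ρ B x * L.tau φ x) A := fun B => by
    refine hint.bdd_mul (c := 1) (ρ B).continuous.aestronglyMeasurable
      (Filter.Eventually.of_forall fun x => ?_)
    rw [Real.norm_eq_abs, abs_of_nonneg (ρ.nonneg B x)]
    exact ρ.le_one B x
  have hterm : ∀ B : L.atlas, (∫ k in B.1.K, (∫ y in B.1.J, ρ B (B.1.leaf k y) *
      φ (B.1.leaf k y) (coordVec (B.1.leaf k) y)) ∂(m.μ B)) = ∫ x, ρ B x * L.tau φ x ∂A := by
    intro B
    have := m.sigmaFinite B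
    obtain ⟨h1, h2⟩ := hA.integral_target B (hintρ B).aemeasurable
    have h3 := h1.1 (hintρ B).restrict
    have h4 : ∫ x, ρ B x * L.tau φ x ∂A =
        ∫ x in B.1.chart.target, ρ B x * L.tau φ x ∂A := by
      refine (setIntegral_eq_integral_of_forall_compl_eq_zero fun x hx => ?_).symm
      rw [image_eq_zero_of_notMem_tsupport fun h => hx (hρ B h), zero_mul]
    rw [h4, h2, TransverseMeasure.base, integral_prod _ h3]
    refine setIntegral_congr_fun B.1.measurableSet_K fun k hk => ?_
    refine setIntegral_congr_fun B.1.J_open.measurableSet fun y hy => ?_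
    have h5 := Lamination.tau_leaf hn hL φ B hk hy
    change _ * B.1.eval φ (k, y) = B.1.density (k, y) * (ρ B (B.1.leaf k y) * L.tau φ (B.1.leaf k y))
    rw [← h5]; ring
  have h0 : ∀ x, x ∉ closure {x | φ x ≠ 0} → L.tau φ x = 0 := fun x hx =>
    Lamination.tau_eq_zero (by_contra fun h => hx (subset_closure h))
  have hfin := ρ.locallyFinite.finite_nonempty_inter_compact hφ.2.1
  have hS : ∀ B, B ∉ hfin.toFinset → ∀ x ∈ closure {x | φ x ≠ 0}, ρ B x = 0 := by
    intro B hB x hx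
    by_contra h
    exact hB (hfin.mem_toFinset.2 ⟨x, h, hx⟩)
  rw [ruelleSullivan, finsum_congr hterm, finsum_eq_sum_of_support_subset (s := hfin.toFinset),
    ← integral_finsetSum _ fun B _ => hintρ B]
  · refine integral_congr_ae ?_
    filter_upwards [hA.ae_mem_supp] with x hx
    by_cases hxC : x ∈ closure {x | φ x ≠ 0}
    · rw [← Finset.sum_mul, ← finsum_eq_sum_of_support_subset (fun B => ρ B x), ρ.sum_eq_one hx,
        one_mul]
      intro B hB
      by_contra h
      exact hB (hS B h x hxC)
    · simp [h0 x hxC]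
  · intro B hB
    by_contra h
    refine hB ((integral_congr_ae (Filter.Eventually.of_forall fun x => ?_)).trans
      (integral_zero _ _))
    by_cases hxC : x ∈ closure {x | φ x ≠ 0}
    · simp [hS B h x hxC]
    · simp [h0 x hxC]

end TransverseMeasure.IsAreaMeasure

end Current

/-! ### The mass of the current -/

lemma exists_cutoff {M : Type*} [TopologicalSpace M] [T2Space M] [LocallyCompactSpace M]
    {C V : Set M} (hC : IsCompact C) (hV : IsOpen V) (hCV : C ⊆ V) :
    ∃ f : C(M, ℝ), HasCompactSupport f ∧ tsupport f ⊆ V ∧ (∀ x ∈ C, f x = 1) ∧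
      ∀ x, f x ∈ Icc (0 : ℝ) 1 := by
  obtain ⟨K, hK, hCK, hKV⟩ := exists_compact_between hC hV hCV
  obtain ⟨f, hf, hf1, hf2⟩ := exists_tsupport_one_of_isOpen_isClosed isOpen_interior
    (hK.closure_of_subset interior_subset) hC.isClosed hCK
  exact ⟨f, hK.of_isClosed_subset (isClosed_tsupport f) (hf.trans interior_subset),
    hf.trans (interior_subset.trans hKV), fun x hx => hf1 hx, hf2⟩

section Mass

variable {n : ℕ} {M : Type*} [TopologicalSpace M] [ChartedSpace (Euc (n + 1)) M]

lemma IsContCptForm.mono {U V : Set M} {φ : RoughForm n M} (h : IsContCptForm U φ) (hUV : U ⊆ V) :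
    IsContCptForm V φ := ⟨h.1, h.2.1, h.2.2.trans hUV⟩

lemma isContCptForm_zero (U : Set M) : IsContCptForm U (fun _ => 0 : RoughForm n M) := by
  refine ⟨fun e _ => ?_, by simp, by simp⟩
  exact (continuousOn_const (c := (0 : Euc (n + 1) [⋀^Fin n]→L[ℝ] ℝ))).congr fun z _ => rfl

lemma IsContCptForm.add {U V : Set M} {φ ψ : RoughForm n M} (hφ : IsContCptForm U φ)
    (hψ : IsContCptForm V ψ) : IsContCptForm (U ∪ V) (fun x => φ x + ψ x) := by
  have hsub : closure {x | φ x + ψ x ≠ 0} ⊆ closure {x | φ x ≠ 0} ∪ closure {x | ψ x ≠ 0} := by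
    rw [← closure_union]
    refine closure_mono fun x hx => ?_
    by_contra h
    simp only [mem_union, mem_ofPred_eq, not_or, not_not] at h
    exact hx (by rw [h.1, h.2, add_zero])
  refine ⟨fun e he => ?_, (hφ.2.1.union hψ.2.1).of_isClosed_subset isClosed_closure hsub,
    hsub.trans (union_subset_union hφ.2.2 hψ.2.2)⟩
  exact ((hφ.1 e he).add (hψ.1 e he)).congr fun z _ => rfl

lemma IsContCptForm.smul {U V : Set M} {φ : RoughForm n M} (hφ : IsContCptForm U φ) (f : C(M, ℝ))
    (hf : tsupport f ⊆ V) : IsContCptForm V (fun x => f x • φ x) := by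
  have h1 : closure {x | f x • φ x ≠ 0} ⊆ closure {x | φ x ≠ 0} :=
    closure_mono fun x hx h => hx (show f x • φ x = 0 by rw [h, smul_zero])
  refine ⟨fun e he => ?_, hφ.2.1.of_isClosed_subset isClosed_closure h1, ?_⟩
  · exact ((f.continuous.comp_continuousOn e.continuousOn_symm).smul (hφ.1 e he)).congr
      fun z _ => rfl
  · refine subset_trans (closure_mono fun x hx => ?_) hf
    exact fun h => hx (show f x • φ x = 0 by rw [h, zero_smul])

variable [RiemannianBundle (fun x : M => TangentSpace 𝓘(ℝ, Euc (n + 1)) x)]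

lemma ptComass_smul_le {φ ψ : RoughForm n M} {x : M} {a c : ℝ} (hc : 0 ≤ c)
    (h : φ x = a • ψ x) (hψ : ptComass ψ x ≤ ENNReal.ofReal c) :
    ptComass φ x ≤ ENNReal.ofReal (|a| * c) := by
  rw [ptComass_le_iff _ _ (by positivity)]
  rw [ptComass_le_iff _ _ hc] at hψ
  intro v hv
  rw [h]
  change |a * ψ x v| ≤ _
  rw [abs_mul]
  exact mul_le_mul_of_nonneg_left (hψ v hv) (abs_nonneg a)

lemma massOn_mono (T : RoughForm n M → ℝ) {U V : Set M} (h : U ⊆ V) : massOn T U ≤ massOn T V :=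
  iSup₂_le fun φ hφ => le_iSup₂_of_le φ ⟨hφ.1.mono h, hφ.2⟩ le_rfl

lemma ptComass_zero_le (x : M) (c : ℝ≥0∞) : ptComass (fun _ => 0 : RoughForm n M) x ≤ c := by
  simp [ptComass]

variable [IsManifold 𝓘(ℝ, Euc (n + 1)) ∞ M]

lemma ptComass_formOfChart_le {e : OpenPartialHomeomorph M (Euc (n + 1))}
    (he : e ∈ atlas (Euc (n + 1)) M) {η : Euc (n + 1) → Euc (n + 1) [⋀^Fin n]→L[ℝ] ℝ} {c : ℝ}
    (hc : 0 ≤ c) (h : ∀ z ∈ e.target, ComassLe e z (η z) c) (x : M) :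
    ptComass (formOfChart e η) x ≤ ENNReal.ofReal c := by
  by_cases hx : x ∈ e.source
  · have hz := e.map_source hx
    have := (comassLe_formInChart_iff (formOfChart e η) he hz hc).1
      (by rw [formInChart_formOfChart he _ hz]; exact h _ hz)
    rwa [e.left_inv hx] at this
  · rw [ptComass_le_iff _ _ hc]
    intro v _
    rw [formOfChart_of_notMem η hx]
    simpa using hc

variable [IsContMDiffRiemannianBundle 𝓘(ℝ, Euc (n + 1)) ∞ (Euc (n + 1))
      (fun x : M => TangentSpace 𝓘(ℝ, Euc (n + 1)) x)]

/-- Locally, the comass is bounded by the norm of the form in a chart. -/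
lemma exists_comassLe_norm {e : OpenPartialHomeomorph M (Euc (n + 1))}
    (he : e ∈ atlas (Euc (n + 1)) M) {z₀ : Euc (n + 1)} (hz₀ : z₀ ∈ e.target) :
    ∃ C : ℝ, 0 ≤ C ∧ ∀ᶠ z in 𝓝 z₀, ∀ w, ComassLe e z w (C * ‖w‖) := by
  have hc := (continuousOn_norm_chartTan he)
  have hpos : ∀ u ∈ Metric.sphere (0 : Euc (n + 1)) 1, 0 < ‖chartTan e z₀ u‖ := by
    intro u hu
    rw [norm_pos_iff]
    intro h0
    have : (chartTanEquiv he hz₀) u = 0 := h0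
    rw [LinearEquiv.map_eq_zero_iff] at this
    simp [this] at hu
  have hcs : ContinuousOn (fun u => ‖chartTan e z₀ u‖) (Metric.sphere (0 : Euc (n + 1)) 1) :=
    hc.comp (f := fun u => (z₀, u)) (by fun_prop) fun u _ => ⟨hz₀, trivial⟩
  obtain ⟨a, ha, hle⟩ : ∃ a > 0, ∀ u ∈ Metric.sphere (0 : Euc (n + 1)) 1,
      a < ‖chartTan e z₀ u‖ := by
    obtain ⟨u, hu, hmin⟩ := (isCompact_sphere (0 : Euc (n + 1)) 1).exists_isMinOn
      ⟨stdVec 0, by simp [stdVec]⟩ hcs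
    refine ⟨‖chartTan e z₀ u‖ / 2, half_pos (hpos u hu), fun u' hu' => ?_⟩
    exact (half_lt_self (hpos u hu)).trans_le (hmin hu')
  have key : ∀ᶠ z in 𝓝 z₀, ∀ u ∈ Metric.sphere (0 : Euc (n + 1)) 1, a < ‖chartTan e z u‖ := by
    refine (isCompact_sphere (0 : Euc (n + 1)) 1).eventually_forall_of_forall_eventually
      fun u hu => ?_
    exact (hc.continuousAt (prod_mem_nhds (e.open_target.mem_nhds hz₀)
      Filter.univ_mem)).eventually (lt_mem_nhds (hle u hu))
  refine ⟨(a⁻¹) ^ n, by positivity, ?_⟩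
  filter_upwards [key] with z hz w u hu
  have hu' : ∀ i, ‖u i‖ ≤ a⁻¹ := by
    intro i
    by_cases hv : u i = 0
    · rw [hv, norm_zero]; positivity
    · have h1 := hz ((‖u i‖⁻¹ : ℝ) • u i) (by simp [norm_smul, hv])
      have h2 : chartTan e z ((‖u i‖⁻¹ : ℝ) • u i) = (‖u i‖⁻¹ : ℝ) • chartTan e z (u i) :=
        map_smul (mfderiv 𝓘(ℝ, Euc (n + 1)) 𝓘(ℝ, Euc (n + 1)) e.symm z) _ _
      have hpos : 0 < ‖u i‖ := norm_pos_iff.2 hv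
      rw [h2, norm_smul, norm_inv, norm_norm] at h1
      have h3 : a < ‖u i‖⁻¹ := h1.trans_le (mul_le_of_le_one_right (by positivity) (hu i))
      exact (le_inv_comm₀ hpos ha).2 h3.le
  calc |w u| ≤ ‖w‖ * ∏ i, ‖u i‖ := w.le_opNorm u
    _ ≤ ‖w‖ * ∏ _i : Fin n, a⁻¹ := by gcongr; exact hu' _
    _ = _ := by simp [mul_comm]

variable [MeasurableSpace M] [BorelSpace M] {L : Lamination n M}

lemma Lamination.tau_smul {φ ψ : RoughForm n M} {x : M} {a : ℝ} (h : φ x = a • ψ x) :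
    L.tau φ x = a * L.tau ψ x := by
  by_cases hx : ∃ B ∈ L.atlas, x ∈ L.supp ∩ B.chart.target
  · rw [Lamination.tau, Lamination.tau, dif_pos hx, dif_pos hx, mul_div_assoc']
    congr 1
    obtain ⟨hB, hxs, hxB⟩ := hx.choose_spec
    have h' : ∀ x', x' = x → φ x' = a • ψ x' := by rintro _ rfl; exact h
    have := h' _ (hx.choose.chart.right_inv hxB)
    change φ (hx.choose.chart (hx.choose.chart.symm x)) _ = _
    rw [this]
    rfl
  · rw [Lamination.tau, Lamination.tau, dif_neg hx, dif_neg hx, mul_zero]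

variable {m : TransverseMeasure L} {A : Measure M} [T2Space M] [SecondCountableTopology M]

/-- The current acts on bounded continuous forms as integration of `tau`. -/
def Lamination.IsRepresentedBy (L : Lamination n M) (T : RoughForm n M → ℝ) (A : Measure M) :
    Prop := ∀ (U : Set M) (φ : RoughForm n M) (c : ℝ), IsContCptForm U φ →
      (∀ x, ptComass φ x ≤ ENNReal.ofReal c) → Integrable (L.tau φ) A ∧ T φ = ∫ x, L.tau φ x ∂A

variable {T : RoughForm n M → ℝ} (hT : L.IsRepresentedBy T A)
include hT

lemma Lamination.IsRepresentedBy.massOn_le {U : Set M} (hU : IsOpen U) : massOn T U ≤ A U := by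
  refine iSup₂_le fun φ hφ => ?_
  obtain ⟨h1, h2⟩ := hT U φ 1 hφ.1 (by simpa using hφ.2)
  rw [h2]
  calc ENNReal.ofReal (∫ x, L.tau φ x ∂A) ≤ ‖∫ x, L.tau φ x ∂A‖ₑ := by
        rw [← ofReal_norm]; exact ENNReal.ofReal_le_ofReal (Real.le_norm_self _)
    _ ≤ ∫⁻ x, ‖L.tau φ x‖ₑ ∂A := enorm_integral_le_lintegral_enorm _
    _ ≤ ∫⁻ x, U.indicator (fun _ => 1) x ∂A := by
        refine lintegral_mono fun x => ?_
        by_cases hx : x ∈ U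
        · rw [indicator_of_mem hx, ← ofReal_norm, ← ENNReal.ofReal_one]
          exact ENNReal.ofReal_le_ofReal
            (Lamination.abs_tau_le zero_le_one (by simpa using hφ.2 x))
        · rw [Lamination.tau_eq_zero (by_contra fun h => hx (hφ.1.2.2 (subset_closure h)))]
          simp
    _ = A U := by rw [lintegral_indicator hU.measurableSet]; simp

lemma Lamination.IsRepresentedBy.massOn_add_le {U V : Set M} (hUV : Disjoint U V) :
    massOn T U + massOn T V ≤ massOn T (U ∪ V) := by
  refine ENNReal.biSup_add_biSup_le' ⟨_, isContCptForm_zero U, fun x => ptComass_zero_le x 1⟩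
    ⟨_, isContCptForm_zero V, fun x => ptComass_zero_le x 1⟩ fun φ hφ ψ hψ => ?_
  have hl : ENNReal.ofReal (T φ) ≤ massOn T (U ∪ V) :=
    le_iSup₂_of_le φ ⟨hφ.1.mono subset_union_left, hφ.2⟩ le_rfl
  have hr : ENNReal.ofReal (T ψ) ≤ massOn T (U ∪ V) :=
    le_iSup₂_of_le ψ ⟨hψ.1.mono subset_union_right, hψ.2⟩ le_rfl
  rcases le_total (T φ) 0 with h | hφ0
  · rw [ENNReal.ofReal_of_nonpos h, zero_add]; exact hr
  rcases le_total (T ψ) 0 with h | hψ0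
  · rw [ENNReal.ofReal_of_nonpos h, add_zero]; exact hl
  have hle : ∀ x, ptComass (fun x => φ x + ψ x) x ≤ 1 := by
    intro x
    by_cases hx : φ x = 0
    · have := ptComass_smul_le (φ := fun x => φ x + ψ x) (ψ := ψ) (x := x) (a := 1) zero_le_one
        (by simp [hx]) (by simpa using hψ.2 x)
      simpa using this
    · have hx' : ψ x = 0 := by
        by_contra h
        exact hUV.le_bot ⟨hφ.1.2.2 (subset_closure hx), hψ.1.2.2 (subset_closure h)⟩
      have := ptComass_smul_le (φ := fun x => φ x + ψ x) (ψ := φ) (x := x) (a := 1) zero_le_one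
        (by simp [hx']) (by simpa using hφ.2 x)
      simpa using this
  refine le_iSup₂_of_le (fun x => φ x + ψ x) ⟨hφ.1.add hψ.1, hle⟩ ?_
  obtain ⟨h1, h2⟩ := hT _ φ 1 hφ.1 (by simpa using hφ.2)
  obtain ⟨h3, h4⟩ := hT _ ψ 1 hψ.1 (by simpa using hψ.2)
  rw [← ENNReal.ofReal_add hφ0 hψ0, (hT _ _ 1 (hφ.1.add hψ.1) (by simpa using hle)).2, h2, h4,
    ← integral_add h1 h3]
  simp_rw [Lamination.tau_add]
  exact le_rfl

variable [IsLocallyFiniteMeasure A]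

lemma Lamination.IsRepresentedBy.mul_measure_le {U C : Set M} (hU : IsOpen U) (hC : IsCompact C)
    (hCU : C ⊆ U) {φ : RoughForm n M} (hφ : IsContCptForm univ φ) {a c : ℝ} (ha : 0 ≤ a)
    (hc : 0 < c) (hφc : ∀ x, ptComass φ x ≤ ENNReal.ofReal c) (hCa : ∀ x ∈ C, a ≤ L.tau φ x) :
    ENNReal.ofReal a * A C ≤ ENNReal.ofReal c * massOn T U := by
  have := ChartedSpace.locallyCompactSpace (Euc (n + 1)) M
  have : TopologicalSpace.PseudoMetrizableSpace M := inferInstance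
  by_cases hm : massOn T U = ⊤
  · rw [hm, ENNReal.mul_top (by simpa using hc)]; exact le_top
  have hCfin := hC.measure_lt_top (μ := A)
  suffices h : ∀ δ : ℝ, 0 < δ → c⁻¹ * a * A.real C - δ ≤ (massOn T U).toReal by
    have h1 : c⁻¹ * a * A.real C ≤ (massOn T U).toReal :=
      le_of_forall_pos_sub_le h
    have h2 : a * A.real C ≤ c * (massOn T U).toReal := by
      rwa [mul_assoc, inv_mul_le_iff₀ hc] at h1
    rw [← ENNReal.ofReal_toReal hm, ← ENNReal.ofReal_mul hc.le,
      ← ENNReal.ofReal_toReal hCfin.ne, ← ENNReal.ofReal_mul ha]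
    exact ENNReal.ofReal_le_ofReal h2
  intro δ hδ
  obtain ⟨N, hCN, hN, hNδ⟩ := C.exists_isOpen_lt_add (μ := A) hCfin.ne
    (ε := ENNReal.ofReal δ) (by simpa using hδ)
  obtain ⟨f, hfc, hfV, hf1, hf01⟩ := exists_cutoff hC (hN.inter hU)
    (subset_inter hCN hCU)
  have hψ := IsContCptForm.smul hφ (c⁻¹ • f) (V := N ∩ U)
    ((closure_mono (by simp)).trans hfV)
  set ψ : RoughForm n M := fun x => (c⁻¹ • f) x • φ x with hψd
  have hψ1 : ∀ x, ptComass ψ x ≤ ENNReal.ofReal 1 := by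
    intro x
    refine (ptComass_smul_le hc.le rfl (hφc x)).trans (ENNReal.ofReal_le_ofReal ?_)
    change |c⁻¹ * f x| * c ≤ 1
    rw [abs_of_nonneg (mul_nonneg (inv_nonneg.2 hc.le) (hf01 x).1), mul_right_comm,
      inv_mul_cancel₀ hc.ne', one_mul]
    exact (hf01 x).2
  obtain ⟨h1, h2⟩ := hT _ ψ 1 hψ hψ1
  have h3 : T ψ ≤ (massOn T U).toReal := by
    rw [← ENNReal.ofReal_le_iff_le_toReal hm]
    exact le_iSup₂_of_le ψ ⟨hψ.mono inter_subset_right, by simpa using hψ1⟩ le_rfl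
  refine le_trans ?_ h3
  rw [h2]
  have hNfin : A N < ⊤ := hNδ.trans (ENNReal.add_lt_top.2 ⟨hCfin, ENNReal.ofReal_lt_top⟩)
  have hCm := hC.measurableSet
  have hNC : A.real (N \ C) ≤ δ := by
    rw [measureReal_def, measure_sdiff hCN hCm.nullMeasurableSet hCfin.ne]
    refine ENNReal.toReal_le_of_le_ofReal hδ.le ?_
    rw [tsub_le_iff_left]
    exact hNδ.le
  have hi1 : Integrable (C.indicator fun _ => c⁻¹ * a) A :=
    (integrable_indicator_iff hCm).2 (integrableOn_const hCfin.ne)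
  have hNm := hN.measurableSet.diff hCm
  have hi2 : Integrable ((N \ C).indicator fun _ => (1 : ℝ)) A :=
    (integrable_indicator_iff hNm).2
      (integrableOn_const (measure_mono sdiff_subset |>.trans_lt hNfin).ne)
  have h4 : ∫ x, (C.indicator (fun _ => c⁻¹ * a) x - (N \ C).indicator (fun _ => (1 : ℝ)) x) ∂A ≤
      ∫ x, L.tau ψ x ∂A := by
    refine integral_mono (hi1.sub hi2) h1 fun x => ?_
    by_cases hxC : x ∈ C
    · simp only
      rw [indicator_of_mem hxC, indicator_of_notMem fun h => h.2 hxC, sub_zero,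
        Lamination.tau_smul (ψ := φ) (a := (c⁻¹ • f) x) rfl]
      change _ ≤ c⁻¹ * f x * _
      rw [hf1 x hxC, mul_one]
      exact mul_le_mul_of_nonneg_left (hCa x hxC) (inv_nonneg.2 hc.le)
    · by_cases hxN : x ∈ N
      · simp only
        rw [indicator_of_notMem hxC, indicator_of_mem (show x ∈ N \ C from ⟨hxN, hxC⟩), zero_sub]
        exact neg_le_of_abs_le (Lamination.abs_tau_le zero_le_one (hψ1 x))
      · simp only
        rw [indicator_of_notMem hxC, indicator_of_notMem fun h => hxN h.1, sub_zero,
          Lamination.tau_eq_zero (by_contra fun h => hxN (hψ.2.2 (subset_closure h)).1)]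
  rw [integral_sub hi1 hi2, integral_indicator hCm, integral_indicator hNm] at h4
  simp only [integral_const, MeasurableSet.univ, measureReal_restrict_apply, univ_inter,
    smul_eq_mul, mul_one] at h4
  linarith

lemma Lamination.IsRepresentedBy.sum_measure_le {ι : Type*} (s : Finset ι) {U : Set M}
    (hU : IsOpen U) {C : ι → Set M} (hC : ∀ i, IsCompact (C i)) (hCU : ∀ i, C i ⊆ U)
    (hd : Pairwise fun i j => Disjoint (C i) (C j)) {φ : ι → RoughForm n M}
    (hφ : ∀ i, IsContCptForm univ (φ i)) {a c : ℝ} (ha : 0 ≤ a)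
    (hc : 0 < c) (hφc : ∀ i x, ptComass (φ i) x ≤ ENNReal.ofReal c)
    (hCa : ∀ i, ∀ x ∈ C i, a ≤ L.tau (φ i) x) :
    ∑ i ∈ s, ENNReal.ofReal a * A (C i) ≤ ENNReal.ofReal c * massOn T U := by
  classical
  have key : ∀ V, IsOpen V → (∀ i ∈ s, C i ⊆ V) →
      ∑ i ∈ s, ENNReal.ofReal a * A (C i) ≤ ENNReal.ofReal c * massOn T V := by
    induction s using Finset.induction_on with
    | empty => intro V _ _; simp
    | insert i s hi ih =>
      intro V hV hCV
      have hcs : IsCompact (⋃ j ∈ s, C j) := s.isCompact_biUnion fun j _ => hC j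
      have hdis : Disjoint (C i) (⋃ j ∈ s, C j) := by
        rw [disjoint_iUnion₂_right]
        exact fun j hj => hd (by rintro rfl; exact hi hj)
      obtain ⟨V₁, V₂, hV₁, hV₂, h1, h2, h12⟩ :=
        SeparatedNhds.of_isCompact_isCompact (hC i) hcs hdis
      rw [Finset.sum_insert hi]
      calc _ ≤ ENNReal.ofReal c * massOn T (V ∩ V₁) + ENNReal.ofReal c * massOn T (V ∩ V₂) := by
            refine add_le_add ?_ (ih _ (hV.inter hV₂) fun j hj => ?_)
            · exact hT.mul_measure_le (hV.inter hV₁) (hC i)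
                (subset_inter (hCV i (Finset.mem_insert_self i s)) h1) (hφ i) ha hc (hφc i) (hCa i)
            · exact subset_inter (hCV j (Finset.mem_insert_of_mem hj))
                ((subset_biUnion_of_mem (u := fun j => C j) hj).trans h2)
        _ ≤ ENNReal.ofReal c * massOn T (V ∩ V₁ ∪ V ∩ V₂) := by
            rw [← mul_add]
            gcongr
            exact hT.massOn_add_le (h12.mono inter_subset_right inter_subset_right)
        _ ≤ _ := by
            gcongr
            exact massOn_mono T (union_subset inter_subset_left inter_subset_left)
  exact key U hU fun i _ => hCU i

lemma Lamination.IsRepresentedBy.mul_measure_le_of_cover {U : Set M} (hU : IsOpen U)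
    (hsupp : A L.suppᶜ = 0) {φ : ℕ → RoughForm n M} (hφ : ∀ i, IsContCptForm univ (φ i)) {a c : ℝ}
    (ha : 0 ≤ a) (ha1 : a ≤ 1)
    (hc : 0 < c) (hφc : ∀ i x, ptComass (φ i) x ≤ ENNReal.ofReal c)
    (hcov : ∀ x ∈ L.supp, ∃ i, a < L.tau (φ i) x) :
    ENNReal.ofReal a * A U ≤ ENNReal.ofReal c * massOn T U := by
  have := ChartedSpace.locallyCompactSpace (Euc (n + 1)) M
  have : TopologicalSpace.PseudoMetrizableSpace M := inferInstance
  have hE : ∀ i, ∃ E ⊆ {x | a < L.tau (φ i) x}, MeasurableSet E ∧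
      E =ᵐ[A] {x | a < L.tau (φ i) x} := fun i =>
    (nullMeasurableSet_lt aemeasurable_const
      (hT _ _ c (hφ i) (hφc i)).1.aemeasurable).exists_measurable_subset_ae_eq
  choose E hEs hEm hEe using hE
  set D := disjointed E with hD
  have hDm : ∀ i, MeasurableSet (D i) := MeasurableSet.disjointed hEm
  have hDE : ∀ i, D i ⊆ E i := disjointed_subset E
  have hfin : ∀ i, A (U ∩ D i) ≠ ⊤ := by
    intro i
    refine ne_of_lt ((measure_mono ?_).trans_lt ((hφ i).2.1.measure_lt_top))
    intro x hx
    by_contra h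
    have h1 : a < L.tau (φ i) x := hEs i (hDE i hx.2)
    rw [Lamination.tau_eq_zero (by_contra fun h' => h (subset_closure h'))] at h1
    exact absurd h1 (not_lt.2 ha)
  have hAU : A U = ∑' i, A (U ∩ D i) := by
    rw [← measure_iUnion (fun i j hij => (disjoint_disjointed E hij).mono inter_subset_right
      inter_subset_right) fun i => hU.measurableSet.inter (hDm i), ← inter_iUnion,
      iUnion_disjointed]
    refine measure_congr ?_
    filter_upwards [compl_mem_ae_iff.2 hsupp, ae_all_iff.2 hEe] with x hx hx'
    rw [compl_compl] at hx
    obtain ⟨i, hi⟩ := hcov x hx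
    refine propext ⟨fun h => ⟨h, mem_iUnion.2 ⟨i, ?_⟩⟩, fun h => h.1⟩
    exact (hx' i).mpr hi
  rw [hAU, ← ENNReal.tsum_mul_left, ENNReal.tsum_eq_iSup_sum]
  refine iSup_le fun s => ?_
  refine ENNReal.le_of_forall_pos_le_add fun ε hε _ => ?_
  obtain ⟨δ, hδ, hδs⟩ := ENNReal.exists_pos_sum_of_countable (ε := ε) (by simpa using hε.ne') ℕ
  have hex : ∀ i, ∃ C ⊆ U ∩ D i, IsCompact C ∧ A (U ∩ D i) < A C + δ i := fun i =>
    (hU.measurableSet.inter (hDm i)).exists_isCompact_lt_add (hfin i) (by simpa using (hδ i).ne')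
  choose C hCs hC hCδ using hex
  calc ∑ i ∈ s, ENNReal.ofReal a * A (U ∩ D i)
      ≤ ∑ i ∈ s, (ENNReal.ofReal a * A (C i) + δ i) := by
        refine Finset.sum_le_sum fun i _ => ?_
        refine (mul_le_mul_right (hCδ i).le _).trans ?_
        rw [mul_add]
        gcongr
        exact mul_le_of_le_one_left zero_le (by simpa using ha1)
    _ = ∑ i ∈ s, ENNReal.ofReal a * A (C i) + ∑ i ∈ s, (δ i : ℝ≥0∞) := Finset.sum_add_distrib
    _ ≤ _ := by
        refine add_le_add (hT.sum_measure_le s hU hC (fun i => (hCs i).trans inter_subset_left)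
          (fun i j hij => (disjoint_disjointed E hij).mono ((hCs i).trans inter_subset_right)
            ((hCs j).trans inter_subset_right)) hφ ha hc hφc fun i x hx => ?_)
          ((ENNReal.sum_le_tsum s).trans hδs.le)
        exact (hEs i (hDE i (hCs i hx).2)).le

omit hT [IsLocallyFiniteMeasure A]

lemma Lamination.tau_formOfChart_leaf (hn : 1 ≤ n) (hL : L.IsOriented)
    {e : OpenPartialHomeomorph M (Euc (n + 1))} (he : e ∈ _root_.atlas (Euc (n + 1)) M) (B : L.atlas)
    {k : ℝ} (hk : k ∈ B.1.K) {y : Euc n} (hy : y ∈ B.1.J) (hs : B.1.leaf k y ∈ e.source)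
    (η : Euc (n + 1) → Euc (n + 1) [⋀^Fin n]→L[ℝ] ℝ) :
    L.tau (formOfChart e η) (B.1.leaf k y) * B.1.density (k, y) =
      η (e (B.1.leaf k y)) (fun i => fderiv ℝ (fun y' => e (B.1.leaf k y')) y (stdVec i)) := by
  rw [Lamination.tau_leaf hn hL _ B hk hy, FlowBox.eval,
    form_coordVec_eq _ he (B.1.mdifferentiableAt_leaf hk hy) hs,
    formInChart_formOfChart he _ (e.map_source hs)]

/-- Near a point of the lamination, the forms which almost calibrate it contain an open set of forms
that are constant in a chart. -/
lemma Lamination.exists_forms_near (hn : 1 ≤ n) (hL : L.IsOriented) {x : M} (hx : x ∈ L.supp)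
    {e : OpenPartialHomeomorph M (Euc (n + 1))} (he : e ∈ _root_.atlas (Euc (n + 1)) M)
    (hxe : x ∈ e.source) {ε : ℝ} (hε : 0 < ε) :
    ∃ Q : Set (Euc (n + 1)), IsOpen Q ∧ Q.Nonempty ∧ ∀ q ∈ Q, ∃ O, IsOpen O ∧ x ∈ O ∧
      (∃ φ : RoughForm n M, IsContCptForm univ φ ∧
        (∀ y, ptComass φ y ≤ ENNReal.ofReal (1 + ε)) ∧
        ∀ y ∈ O, φ y = formOfChart e (fun _ => vecForm n q) y) ∧
      1 - ε < L.tau (formOfChart e fun _ => vecForm n q) x := by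
  obtain ⟨B, hB, hxB⟩ := mem_iUnion₂.1 (L.cover hx)
  have hp := L.symm_mem ⟨B, hB⟩ hx hxB
  set p := B.chart.symm x with hpd
  have hpx : B.leaf p.1 p.2 = x := B.chart.right_inv hxB
  have hs : B.leaf p.1 p.2 ∈ e.source := hpx ▸ hxe
  have hd := B.mdifferentiableAt_leaf hp.1 hp.2
  have hz := e.map_source hxe
  set v : Fin n → Euc (n + 1) :=
    fun i => fderiv ℝ (fun y' => e (B.leaf p.1 y')) p.2 (stdVec i) with hv
  have hvi : LinearIndependent ℝ v :=
    linearIndependent_tanVec_chart he hd hs ((B.leaf_C1 p.1 hp.1).2 p.2 hp.2)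
  obtain ⟨w, hw, hwv⟩ := exists_comassLe_eq_areaChart he hz hvi
  obtain ⟨C, hC, hCn⟩ := exists_comassLe_norm he hz
  have htau := fun q : Euc (n + 1) => Lamination.tau_formOfChart_leaf hn hL he ⟨B, hB⟩ hp.1 hp.2 hs
    fun _ => vecForm n q
  have hdens : B.density p = areaChart e (e x) v := by
    rw [FlowBox.density, areaDensity_eq he hd hs, hpx]
  have hpos := areaChart_pos he hz hvi
  refine ⟨{q | C * ‖vecForm n q - w‖ < ε / 2}, isOpen_lt (by fun_prop) continuous_const,
    ⟨formVec w, by simpa [vecForm_formVec] using hε⟩, fun q hq => ?_⟩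
  have h1 : ∀ᶠ z in 𝓝 (e x), ComassLe e z (vecForm n q) (1 + ε) ∧ z ∈ e.target := by
    filter_upwards [hw.eventually he hz (c := 1 + ε / 2) (by linarith), hCn,
      e.open_target.mem_nhds hz] with z h1 h2 h3
    refine ⟨fun u hu => ?_, h3⟩
    have h4 : vecForm n q u = w u + (vecForm n q - w) u := by
      rw [ContinuousAlternatingMap.sub_apply]; ring
    rw [h4]
    have h5 := h1 u hu
    have h6 := (h2 (vecForm n q - w) u hu).trans hq.le
    exact (abs_add_le _ _).trans (by linarith)
  obtain ⟨N, hN, hNo, hxN⟩ := eventually_nhds_iff.1 h1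
  obtain ⟨f, hf, hf01, hf1⟩ := exists_testFun_eq_one isCompact_singleton hNo
    (singleton_subset_iff.2 hxN)
  rw [nhdsSet_singleton] at hf1
  obtain ⟨N', hN', hN'o, hxN'⟩ := eventually_nhds_iff.1 hf1
  have hsub : tsupport (fun z => f z • vecForm n q) ⊆ tsupport f :=
    closure_mono fun z hz h => hz (show f z • _ = 0 by rw [h, zero_smul])
  refine ⟨e.source ∩ e ⁻¹' N', e.isOpen_inter_preimage hN'o, ⟨hxe, hxN'⟩,
    ⟨formOfChart e fun z => f z • vecForm n q, ?_, ?_, ?_⟩, ?_⟩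
  · exact isContCptForm_formOfChart he (hf.1.continuous.smul continuous_const)
      (hf.2.1.of_isClosed_subset (isClosed_tsupport _) hsub)
      (hsub.trans (hf.2.2.trans fun z hz => (hN z hz).2)) (subset_univ _)
  · refine ptComass_formOfChart_le he (by positivity) fun z _ u hu => ?_
    change |f z * vecForm n q u| ≤ _
    by_cases hzN : z ∈ N
    · rw [abs_mul, abs_of_nonneg (hf01 z).1]
      exact (mul_le_of_le_one_left (abs_nonneg _) (hf01 z).2).trans ((hN z hzN).1 u hu)
    · rw [hf.eq_zero_of_notMem hzN, zero_mul, abs_zero]; positivity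
  · intro y hy
    simp only [formOfChart, if_pos hy.1]
    rw [hN' _ hy.2, one_smul]
  · have h2 := htau q
    have h3 := ComassLe.abs_le he hz (by positivity) (hCn.self_of_nhds (vecForm n q - w)) v
    have h4 : vecForm n q v = w v + (vecForm n q - w) v := by
      rw [ContinuousAlternatingMap.sub_apply]; ring
    have h5 : L.tau (formOfChart e fun _ => vecForm n q) x * areaChart e (e x) v =
        vecForm n q v := by
      rw [← hdens, ← h2]
      change _ = L.tau _ (B.leaf p.1 p.2) * _
      rw [hpx]
    rw [h4, hwv] at h5
    have h6 := neg_le_of_abs_le h3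
    have h7 : C * ‖vecForm n q - w‖ * areaChart e (e x) v ≤ ε / 2 * areaChart e (e x) v := by
      have := le_of_lt (show C * ‖vecForm n q - w‖ < ε / 2 from hq)
      gcongr
    by_contra h8
    have h9 := mul_le_mul_of_nonneg_right (not_lt.1 h8) hpos.le
    nlinarith [mul_pos hε hpos]

lemma Lamination.exists_forms (hn : 1 ≤ n) (hL : L.IsOriented) {ε : ℝ} (hε : 0 < ε) :
    ∃ φ : ℕ → RoughForm n M, (∀ i, IsContCptForm univ (φ i)) ∧
      (∀ i x, ptComass (φ i) x ≤ ENNReal.ofReal (1 + ε)) ∧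
      ∀ x ∈ L.supp, ∃ i, 1 - ε < L.tau (φ i) x := by
  obtain ⟨s, hs, hsU⟩ := TopologicalSpace.countable_cover_nhds fun x : M =>
    (chartAt (Euc (n + 1)) x).open_source.mem_nhds (mem_chart_source _ x)
  obtain ⟨S, hS, hSd⟩ := TopologicalSpace.exists_countable_dense (Euc (n + 1))
  have := hs.to_subtype
  have := hS.to_subtype
  have := (TopologicalSpace.countable_countableBasis M).to_subtype
  let good : M → Set M → Euc (n + 1) → RoughForm n M → Prop := fun x O q φ =>
    IsContCptForm univ φ ∧ (∀ y, ptComass φ y ≤ ENNReal.ofReal (1 + ε)) ∧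
      ∀ y ∈ O, φ y = formOfChart (chartAt (Euc (n + 1)) x) (fun _ => vecForm n q) y
  have hfam : ∀ i : Option (s × TopologicalSpace.countableBasis M × S), ∃ φ : RoughForm n M,
      IsContCptForm univ φ ∧ (∀ y, ptComass φ y ≤ ENNReal.ofReal (1 + ε)) ∧
      ∀ j, i = some j → (∃ φ', good j.1 j.2.1 j.2.2 φ') → good j.1 j.2.1 j.2.2 φ := by
    have h0 : IsContCptForm univ (fun _ => 0 : RoughForm n M) ∧
        ∀ y : M, ptComass (fun _ => 0 : RoughForm n M) y ≤ ENNReal.ofReal (1 + ε) :=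
      ⟨isContCptForm_zero univ, fun y => ptComass_zero_le y _⟩
    rintro (_ | j)
    · exact ⟨_, h0.1, h0.2, by simp⟩
    · by_cases h : ∃ φ', good j.1 j.2.1 j.2.2 φ'
      · obtain ⟨φ, hφ⟩ := h
        exact ⟨φ, hφ.1, hφ.2.1, fun j' hj _ => Option.some.inj hj ▸ hφ⟩
      · exact ⟨_, h0.1, h0.2, fun j' hj h' => absurd (Option.some.inj hj ▸ h') h⟩
  choose φ h1 h2 h3 using hfam
  obtain ⟨g, hg⟩ := exists_surjective_nat (Option (s × TopologicalSpace.countableBasis M × S))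
  refine ⟨fun i => φ (g i), fun i => h1 _, fun i => h2 _, fun x hx => ?_⟩
  obtain ⟨x₁, hx₁, hxs⟩ := mem_iUnion₂.1 (hsU ▸ mem_univ x)
  obtain ⟨Q, hQ, hQne, hQq⟩ := Lamination.exists_forms_near hn hL hx (chart_mem_atlas _ x₁) hxs hε
  obtain ⟨q, hq, hqS⟩ := hSd.inter_open_nonempty Q hQ hQne
  obtain ⟨O, hO, hxO, ⟨φ', hφ'⟩, ht⟩ := hQq q hq
  obtain ⟨O', hO', hxO', hOO'⟩ :=
    (TopologicalSpace.isBasis_countableBasis M).exists_subset_of_mem_open hxO hO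
  obtain ⟨i, hi⟩ := hg (some (⟨x₁, hx₁⟩, ⟨O', hO'⟩, ⟨q, hqS⟩))
  refine ⟨i, ht.trans_eq ?_⟩
  have h4 := (h3 (g i) _ hi ⟨φ', hφ'.1, hφ'.2.1, fun y hy => hφ'.2.2 y (hOO' hy)⟩).2.2 x hxO'
  have h5 := Lamination.tau_smul (L := L) (φ := φ (g i))
    (ψ := formOfChart (chartAt (Euc (n + 1)) x₁) fun _ => vecForm n q) (x := x) (a := 1)
    (by rw [h4, one_smul])
  rw [h5, one_mul]

/-- The mass of the current is the area of the lamination. -/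
lemma Lamination.IsRepresentedBy.massOn_eq [IsLocallyFiniteMeasure A] (hn : 1 ≤ n)
    (hL : L.IsOriented) (hT : L.IsRepresentedBy T A) (hsupp : A L.suppᶜ = 0) {U : Set M}
    (hU : IsOpen U) : massOn T U = A U := by
  refine le_antisymm (hT.massOn_le hU) ?_
  have key : ∀ ε : ℝ, 0 < ε → ε < 1 →
      ENNReal.ofReal (1 - ε) * A U ≤ ENNReal.ofReal (1 + ε) * massOn T U := by
    intro ε hε hε1
    obtain ⟨φ, h1, h2, h3⟩ := Lamination.exists_forms (L := L) hn hL hε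
    exact hT.mul_measure_le_of_cover hU hsupp h1 (by linarith) (by linarith) (by linarith) h2 h3
  by_cases hm : massOn T U = ⊤
  · rw [hm]; exact le_top
  have hl : Filter.Tendsto (fun ε : ℝ => ENNReal.ofReal (1 - ε) * A U) (𝓝[>] 0)
      (𝓝 (ENNReal.ofReal (1 - 0) * A U)) := by
    refine ENNReal.Tendsto.mul_const ?_ (Or.inl (by simp))
    exact (ENNReal.continuous_ofReal.comp (continuous_const.sub continuous_id)).continuousAt.mono_left
      nhdsWithin_le_nhds
  have hr : Filter.Tendsto (fun ε : ℝ => ENNReal.ofReal (1 + ε) * massOn T U) (𝓝[>] 0)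
      (𝓝 (ENNReal.ofReal (1 + 0) * massOn T U)) := by
    refine ENNReal.Tendsto.mul_const ?_ (Or.inr hm)
    exact (ENNReal.continuous_ofReal.comp (continuous_const.add continuous_id)).continuousAt.mono_left
      nhdsWithin_le_nhds
  have := le_of_tendsto_of_tendsto hl hr (by
    filter_upwards [Ioo_mem_nhdsGT one_pos] with ε hε using key ε hε.1 hε.2)
  simpa using this

end Mass

/-! ### The current and the calibration in a flow box -/

lemma IsTestFun.formVec_apply {n : ℕ} {V : Set (Euc (n + 1))}
    {η : Euc (n + 1) → Euc (n + 1) [⋀^Fin n]→L[ℝ] ℝ} (h : IsTestFun V η) (i : Fin (n + 1)) :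
    IsTestFun V fun z => formVec (η z) i := by
  have h0 : (fun z => formVec (η z) i) =
      ((EuclideanSpace.proj i : Euc (n + 1) →L[ℝ] ℝ).comp (formVecL n)) ∘ η := rfl
  have hs : tsupport (fun z => formVec (η z) i) ⊆ tsupport η := by
    rw [h0]
    exact closure_mono (Function.support_comp_subset (map_zero _) _)
  refine ⟨?_, h.2.1.of_isClosed_subset (isClosed_tsupport _) hs, hs.trans h.2.2⟩
  rw [h0]
  exact (ContinuousLinearMap.contDiff _).comp h.1

lemma LeafBox.integrableOn_above_mul {n : ℕ} {β : LeafBox n} {μ : Measure ℝ} (hμ : μ β.K < ⊤)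
    {G : Euc (n + 1) → Euc (n + 1)} (hG : IsDivFree β.X.target G)
    {χ : Euc (n + 1) → ℝ} (hχ : IsTestFun β.X.target χ) :
    IntegrableOn (fun z => β.above μ z * fderiv ℝ χ z (G z)) β.X.target :=
  (integrableOn_flux hG hχ).bdd_mul (aestronglyMeasurable_above hμ) (c := μ.real β.K)
    (Filter.Eventually.of_forall fun z => by
      rw [Real.norm_of_nonneg (above_nonneg z)]; exact above_le hμ z)

section LocalFormulas

variable {n : ℕ} {M : Type*} [TopologicalSpace M] [ChartedSpace (Euc (n + 1)) M]

lemma chart_image_inter {Y : Type*} [TopologicalSpace Y] (X : OpenPartialHomeomorph Y M) {S : Set Y}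
    (hS : S ⊆ X.source) {p : Y} (hp : p ∈ X.source) (h : X p ∈ X '' S) : p ∈ S := by
  obtain ⟨q, hq, hqp⟩ := h
  exact X.injOn (hS hq) hp hqp ▸ hq

variable [IsManifold 𝓘(ℝ, Euc (n + 1)) ∞ M]

/-- A local box on which the orientation is compatible with the height function. -/
lemma FlowBox.exists_isLocal_sign (hn : 1 ≤ n) (B : FlowBox n M)
    {e : OpenPartialHomeomorph M (Euc (n + 1))} (he : e ∈ atlas (Euc (n + 1)) M) {k₀ : ℝ}
    {y₀ : Euc n} (hk₀ : k₀ ∈ B.K) (hy₀ : y₀ ∈ B.J) {W : Set M} (hW : IsOpen W)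
    (h₀ : B.leaf k₀ y₀ ∈ e.source ∩ W) :
    ∃ (β : LeafBox n) (s : ℝ), B.IsLocal e β ∧ k₀ ∈ β.K ∧ y₀ ∈ β.J ∧ (s = 1 ∨ s = -1) ∧
      (∀ k ∈ β.K, ∀ y ∈ β.J, β.NormalSign k s y) ∧ ∀ k ∈ β.I, ∀ y ∈ β.J, B.leaf k y ∈ W := by
  obtain ⟨β₁, h₁, hk₁, hy₁, -, -⟩ := B.exists_isLocal he hk₀ hy₀ hW h₀ Filter.univ_mem
  obtain ⟨s, hs, hD⟩ := LeafBox.eventually_normalSign hn hk₁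
  have hsrc : β₁.I ×ˢ β₁.J ⊆ B.chart.source := fun q hq =>
    B.mem_source (h₁.I_sub hq.1) (h₁.J_subset hq.2)
  have hO : IsOpen (B.chart '' (β₁.I ×ˢ β₁.J)) :=
    B.chart.isOpen_image_of_subset_source (β₁.I_open.prod β₁.J_open) hsrc
  obtain ⟨β, h, hk, hy, hID, hβ⟩ := B.exists_isLocal he hk₀ hy₀ (hW.inter hO)
    ⟨h₀.1, h₀.2, ⟨(k₀, y₀), ⟨β₁.K_subset hk₁, hy₁⟩, rfl⟩⟩ hD
  refine ⟨β, s, h, hk, hy, hs, fun k hkK y hyJ w hw => ?_, fun k hkI y hyJ => (hβ k hkI y hyJ).1⟩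
  have hkI := β.K_subset hkK
  obtain ⟨hkI₁, hyJ₁⟩ : k ∈ β₁.I ∧ y ∈ β₁.J := chart_image_inter B.chart hsrc
    (B.mem_source (h.I_sub hkI) (h.J_subset hyJ)) (hβ k hkI y hyJ).2
  have hkK₁ : k ∈ β₁.K := by rw [h₁.K_eq]; exact ⟨h.mem_K hkK, hkI₁⟩
  have e1 : β.leaf k y = β₁.leaf k y := by rw [h.leaf_eq k hkI y hyJ, h₁.leaf_eq k hkI₁ y hyJ₁]
  have e2 : tanVec (β.leaf k) y = tanVec (β₁.leaf k) y := by
    rw [h.tanVec_eq hkI hyJ, h₁.tanVec_eq hkI₁ hyJ₁]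
  rw [e2] at hw
  have hev := hID hkI hkK₁ y hyJ₁ w hw
  have hcont : Filter.Tendsto (fun t : ℝ => β.leaf k y + t • w) (𝓝[>] 0) (𝓝 (β.leaf k y)) := by
    have : Continuous fun t : ℝ => β.leaf k y + t • w := by fun_prop
    simpa using (this.tendsto 0).mono_left nhdsWithin_le_nhds
  filter_upwards [hev, hcont.eventually (β.X.open_target.mem_nhds (LeafBox.leaf_mem hkI hyJ)),
    hcont.eventually (β₁.X.open_target.mem_nhds (e1 ▸ LeafBox.leaf_mem hkI₁ hyJ₁))] with t h1 h2 h3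
  have h4 : β.ht (β.leaf k y + t • w) = β₁.ht (β.leaf k y + t • w) := by
    have h5 := (h.mem_target h2).2.symm.trans (h₁.mem_target h3).2
    have h6 := LeafBox.symm_mem h2
    have h7 := LeafBox.symm_mem h3
    have := B.chart.injOn (B.mem_source (h.I_sub h6.1) (h.J_subset h6.2))
      (B.mem_source (h₁.I_sub h7.1) (h₁.J_subset h7.2)) h5
    exact congrArg Prod.fst this
  rw [h4, e1]
  exact h1

variable [RiemannianBundle (fun x : M => TangentSpace 𝓘(ℝ, Euc (n + 1)) x)]
  [IsContMDiffRiemannianBundle 𝓘(ℝ, Euc (n + 1)) ∞ (Euc (n + 1))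
      (fun x : M => TangentSpace 𝓘(ℝ, Euc (n + 1)) x)]

lemma exists_ptComass_formOfChart_le {e : OpenPartialHomeomorph M (Euc (n + 1))}
    (he : e ∈ atlas (Euc (n + 1)) M) {η : Euc (n + 1) → Euc (n + 1) [⋀^Fin n]→L[ℝ] ℝ}
    (hη : Continuous η) (hc : HasCompactSupport η) (ht : tsupport η ⊆ e.target) :
    ∃ c : ℝ, ∀ x, ptComass (formOfChart e η) x ≤ ENNReal.ofReal c := by
  obtain ⟨C, hC, hCK⟩ : ∃ C : ℝ, 0 ≤ C ∧ ∀ z ∈ tsupport η, ∀ w, ComassLe e z w (C * ‖w‖) := by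
    refine hc.isCompact.induction_on (p := fun S => ∃ C : ℝ, 0 ≤ C ∧ ∀ z ∈ S, ∀ w,
      ComassLe e z w (C * ‖w‖)) ⟨0, le_rfl, by simp⟩ ?_ ?_ ?_
    · rintro S S' hSS' ⟨C, hC, h⟩
      exact ⟨C, hC, fun z hz => h z (hSS' hz)⟩
    · rintro S S' ⟨C, hC, h⟩ ⟨C', hC', h'⟩
      refine ⟨max C C', le_max_of_le_left hC, fun z hz w u hu => ?_⟩
      rcases hz with hz | hz
      · exact (h z hz w u hu).trans (by gcongr; exact le_max_left _ _)
      · exact (h' z hz w u hu).trans (by gcongr; exact le_max_right _ _)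
    · intro z hz
      obtain ⟨C, hC, h⟩ := exists_comassLe_norm he (ht hz)
      exact ⟨_, mem_nhdsWithin_of_mem_nhds h, C, hC, fun z hz => hz⟩
  obtain ⟨b, hb⟩ := hη.bounded_above_of_compact_support hc
  have hb0 : 0 ≤ b := (norm_nonneg _).trans (hb 0)
  refine ⟨C * b, ptComass_formOfChart_le he (by positivity) fun z _ u hu => ?_⟩
  by_cases hz : z ∈ tsupport η
  · exact (hCK z hz _ u hu).trans (by gcongr; exact hb z)
  · rw [image_eq_zero_of_notMem_tsupport hz]
    change |(0 : ℝ)| ≤ _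
    rw [abs_zero]
    positivity

section Calibration

variable {F : RoughForm n M}

lemma IsCalibration.ae_ptComass_le (hF : IsCalibration F)
    {e : OpenPartialHomeomorph M (Euc (n + 1))} (he : e ∈ atlas (Euc (n + 1)) M) :
    ∀ᵐ z ∂(volume.restrict e.target), ptComass F (e.symm z) ≤ 1 := by
  have h1 : ∀ i : ℕ, ∀ᵐ z ∂(volume.restrict e.target),
      ptComass F (e.symm z) ≤ 1 + (i : ℝ≥0∞)⁻¹ := by
    intro i
    have h2 : comass F < 1 + (i : ℝ≥0∞)⁻¹ := by
      rw [hF.comass_eq]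
      exact ENNReal.lt_add_right ENNReal.one_ne_top (by simp)
    obtain ⟨c, hc, hlt⟩ := sInf_lt_iff.1 h2
    exact (hc e he).mono fun z hz => hz.trans hlt.le
  filter_upwards [ae_all_iff.2 h1] with z hz
  have h3 : Filter.Tendsto (fun i : ℕ => 1 + (i : ℝ≥0∞)⁻¹) Filter.atTop (𝓝 (1 + 0)) :=
    tendsto_const_nhds.add ENNReal.tendsto_inv_nat_nhds_zero
  simpa using ge_of_tendsto' h3 hz

variable {B : FlowBox n M} {e : OpenPartialHomeomorph M (Euc (n + 1))} {β : LeafBox n}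

/-- The vector field representing the calibration in a chart. -/
noncomputable def chartField (F : RoughForm n M) (e : OpenPartialHomeomorph M (Euc (n + 1)))
    (z : Euc (n + 1)) : Euc (n + 1) := formVec (formInChart F e z)

lemma IsCalibration.ae_form_le (hF : IsCalibration F) (he : e ∈ atlas (Euc (n + 1)) M) :
    ∀ᵐ z ∂(volume.restrict e.target), ∀ v : Fin n → Euc (n + 1),
      |stdDet (Fin.cons (chartField F e z) v : Fin (n + 1) → Euc (n + 1))| ≤ areaChart e z v := by
  filter_upwards [hF.ae_ptComass_le he, ae_restrict_mem e.open_target.measurableSet] with z hz hzt v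
  have := ComassLe.abs_le he hzt zero_le_one
    ((comassLe_formInChart_iff F he hzt zero_le_one).2 (by simpa using hz)) v
  rwa [one_mul, form_apply_eq_stdDet] at this

lemma IsCalibration.isDivFree (hF : IsCalibration F) (he : e ∈ atlas (Euc (n + 1)) M)
    {V : Set (Euc (n + 1))} (hV : IsOpen V) (hVe : V ⊆ e.target) :
    IsDivFree V (chartField F e) where
  isOpen := hV
  meas := (continuous_formVec.comp_aestronglyMeasurable (hF.measurable e he)).mono_measure
    (Measure.restrict_mono hVe le_rfl)
  bdd C hCV hC := by
    have hcont : ContinuousOn (fun z => ∑ i : Fin (n + 1),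
        areaChart e z (fun j => stdVec (i.succAbove j))) C := by
      refine continuousOn_finsetSum _ fun i _ => ?_
      exact ContinuousOn.areaChart he continuousOn_id (fun z hz => hVe (hCV hz))
        fun _ => continuousOn_const
    obtain ⟨b, hb⟩ := hC.bddAbove_image hcont
    refine ⟨b, ?_⟩
    filter_upwards [(hF.ae_form_le he).filter_mono
      (ae_mono (Measure.restrict_mono (hCV.trans hVe) le_rfl)),
      ae_restrict_mem hC.measurableSet] with z hz hzC
    refine le_trans ?_ (hb ⟨z, hzC, rfl⟩)
    rw [chartField, formVec]
    refine (norm_sum_le _ _).trans (Finset.sum_le_sum fun i _ => ?_)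
    have h1 : ‖(stdVec i : Euc (n + 1))‖ = 1 := by simp [stdVec]
    rw [norm_smul, h1, mul_one, norm_mul, norm_pow, norm_neg, norm_one, one_pow, one_mul, omitCoeff,
      form_apply_eq_stdDet]
    exact hz _
  closed χ hχ := by
    rw [← hF.closed e he χ (hχ.mono hVe)]
    simp_rw [wedgeCoeff_eq]
    refine (setIntegral_eq_of_subset_of_forall_sdiff_eq_zero e.open_target.measurableSet hVe
      fun z hz => ?_).symm
    rw [hχ.fderiv_eq_zero hz.2]; rfl

lemma FlowBox.IsLocal.target_subset (hβ : B.IsLocal e β) : β.X.target ⊆ e.target :=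
  fun _ hz => (hβ.mem_target hz).1

lemma FlowBox.IsLocal.isDivFree (hβ : B.IsLocal e β) (hF : IsCalibration F)
    (he : e ∈ atlas (Euc (n + 1)) M) : IsDivFree β.X.target (chartField F e) :=
  hF.isDivFree he β.X.open_target hβ.target_subset

lemma FlowBox.IsLocal.ae_form_le (hβ : B.IsLocal e β) (hF : IsCalibration F)
    (he : e ∈ atlas (Euc (n + 1)) M) : ∀ᵐ z ∂(volume.restrict β.X.target),
      ∀ v : Fin n → Euc (n + 1),
        stdDet (Fin.cons (chartField F e z) v : Fin (n + 1) → Euc (n + 1)) ≤ areaChart e z v :=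
  ((hF.ae_form_le he).filter_mono (ae_mono (Measure.restrict_mono hβ.target_subset le_rfl))).mono
    fun z hz v => (le_abs_self _).trans (hz v)

end Calibration

open Classical in
/-- A function read in a chart, extended by zero. -/
noncomputable def ofChart (e : OpenPartialHomeomorph M (Euc (n + 1))) (χ : Euc (n + 1) → ℝ) (x : M) :
    ℝ := if x ∈ e.source then χ (e x) else 0

omit [RiemannianBundle (fun x : M => TangentSpace 𝓘(ℝ, Euc (n + 1)) x)]
  [IsContMDiffRiemannianBundle 𝓘(ℝ, Euc (n + 1)) ∞ (Euc (n + 1))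
      (fun x : M => TangentSpace 𝓘(ℝ, Euc (n + 1)) x)] [IsManifold 𝓘(ℝ, Euc (n + 1)) ∞ M]

lemma ofChart_nonneg {e : OpenPartialHomeomorph M (Euc (n + 1))} {χ : Euc (n + 1) → ℝ}
    (h : ∀ z, 0 ≤ χ z) (x : M) : 0 ≤ ofChart e χ x := by
  rw [ofChart]; split_ifs
  exacts [h _, le_rfl]

lemma ofChart_eq_zero {e : OpenPartialHomeomorph M (Euc (n + 1))} {χ : Euc (n + 1) → ℝ}
    {V : Set (Euc (n + 1))} (hχ : IsTestFun V χ) {x : M} (hx : x ∈ e.source → e x ∉ V) :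
    ofChart e χ x = 0 := by
  rw [ofChart]; split_ifs with h
  · exact hχ.eq_zero_of_notMem (hx h)
  · rfl

lemma ofChart_continuous [T2Space M] {e : OpenPartialHomeomorph M (Euc (n + 1))}
    {χ : Euc (n + 1) → ℝ} (hχ : IsTestFun e.target χ) :
    Continuous (ofChart e χ) ∧ HasCompactSupport (ofChart e χ) := by
  have hcpt : IsCompact (e.symm '' tsupport χ) :=
    hχ.2.1.isCompact.image_of_continuousOn (e.continuousOn_symm.mono hχ.2.2)
  have hsub : e.symm '' tsupport χ ⊆ e.source := by
    rintro _ ⟨z, hz, rfl⟩; exact e.map_target (hχ.2.2 hz)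
  have h0 : ∀ x ∉ e.symm '' tsupport χ, ofChart e χ x = 0 := by
    intro x hx
    rw [ofChart]; split_ifs with h
    · refine image_eq_zero_of_notMem_tsupport fun h' => hx ⟨_, h', e.left_inv h⟩
    · rfl
  have h1 : e.source.indicator (ofChart e χ) = ofChart e χ :=
    indicator_eq_self.2 fun x hx => by_contra fun h => hx (by rw [ofChart, if_neg h])
  refine ⟨?_, HasCompactSupport.intro hcpt h0⟩
  rw [← h1]
  refine continuous_indicator_of_compact e.open_source hcpt hsub ?_ fun x _ => h0 x
  exact (hχ.1.continuous.comp_continuousOn e.continuousOn).congr fun x hx => by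
    rw [ofChart, if_pos hx]; rfl

end LocalFormulas

section LocalCurrent

variable {n : ℕ} {M : Type*} [TopologicalSpace M] [ChartedSpace (Euc (n + 1)) M]
  [RiemannianBundle (fun x : M => TangentSpace 𝓘(ℝ, Euc (n + 1)) x)]
  [IsManifold 𝓘(ℝ, Euc (n + 1)) ∞ M]
  [IsContMDiffRiemannianBundle 𝓘(ℝ, Euc (n + 1)) ∞ (Euc (n + 1))
      (fun x : M => TangentSpace 𝓘(ℝ, Euc (n + 1)) x)]
  [MeasurableSpace M] [BorelSpace M] [T2Space M] [SecondCountableTopology M]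
  {L : Lamination n M} {m : TransverseMeasure L} {A : Measure M} {T : RoughForm n M → ℝ}
  {B : L.atlas} {e : OpenPartialHomeomorph M (Euc (n + 1))} {β : LeafBox n}

lemma TransverseMeasure.measure_box_lt_top (hβ : B.1.IsLocal e β) : m.μ B β.K < ⊤ := by
  obtain ⟨C, hC, hcpt, hI⟩ := hβ.I_subset
  exact (measure_mono (β.K_subset.trans hI)).trans_lt (m.radon B C hC hcpt)

lemma FlowBox.IsLocal.ne_leaf (hβ : B.1.IsLocal e β) {V : Set (Euc (n + 1))} (hV : V ⊆ β.X.target)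
    {x : M} (h : ∀ k ∈ β.I, ∀ y ∈ β.J, B.1.leaf k y ≠ x) (hx : x ∈ e.source) : e x ∉ V := by
  intro hz
  have h1 := LeafBox.symm_mem (hV hz)
  refine h _ h1.1 _ h1.2 ?_
  change B.1.chart (β.X.symm (e x)) = x
  rw [← (hβ.mem_target (hV hz)).2, e.left_inv hx]

/-- The area integral of a function supported in a box. -/
lemma TransverseMeasure.IsAreaMeasure.integral_ofChart (hA : m.IsAreaMeasure A)
    (he : e ∈ _root_.atlas (Euc (n + 1)) M) (hβ : B.1.IsLocal e β) {χ : Euc (n + 1) → ℝ}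
    (hχ : IsTestFun β.X.target χ) :
    Integrable (β.leafInt (areaChart e) χ) ((m.μ B).restrict β.K) ∧
      ∫ x, ofChart e χ x ∂A = ∫ k in β.K, β.leafInt (areaChart e) χ k ∂(m.μ B) := by
  have := hA.isLocallyFinite
  have hc := ofChart_continuous (hχ.mono hβ.target_subset)
  have h := hA.integral_box B hβ (f := ofChart e χ)
    (hc.1.integrable_of_hasCompactSupport hc.2)
    fun x hx => ofChart_eq_zero hχ fun h => hβ.ne_leaf subset_rfl hx h
  have h1 : ∀ k ∈ β.K, ∫ y in β.J, B.1.density (k, y) * ofChart e χ (B.1.leaf k y) =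
      β.leafInt (areaChart e) χ k := by
    intro k hk
    refine setIntegral_congr_fun β.J_open.measurableSet fun y hy => ?_
    have hkI := β.K_subset hk
    simp only [FlowBox.density]
    have h1 : ofChart e χ (B.1.leaf k y) = χ (β.leaf k y) := by
      rw [ofChart, if_pos (show B.1.leaf k y ∈ e.source from hβ.mem_source k hkI y hy),
        hβ.leaf_eq k hkI y hy]
      rfl
    rw [hβ.area_eq he hk hy, h1, mul_comm]
  refine ⟨h.1.congr ?_, h.2.trans (setIntegral_congr_fun hβ.measurableSet_K h1)⟩
  filter_upwards [ae_restrict_mem hβ.measurableSet_K] with k hk using h1 k hk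

lemma LeafBox.integral_form_leaf {k s : ℝ} (hk : k ∈ β.K) (hs : s = 1 ∨ s = -1)
    (hsJ : ∀ y ∈ β.J, β.NormalSign k s y)
    {η : Euc (n + 1) → Euc (n + 1) [⋀^Fin n]→L[ℝ] ℝ} (hη : IsTestFun β.X.target η) :
    ∫ y in β.J, η (β.leaf k y) (tanVec (β.leaf k) y) =
      ∑ i, s * β.flux (fun _ => stdVec i) (fun z => formVec (η z) i) k := by
  have hχ : ∀ i, IsTestFun β.X.target fun z => formVec (η z) i := hη.formVec_apply
  have h1 : ∀ y, η (β.leaf k y) (tanVec (β.leaf k) y) = ∑ i, formVec (η (β.leaf k y)) i *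
      stdDet (Fin.cons (stdVec i) (tanVec (β.leaf k) y) : Fin (n + 1) → Euc (n + 1)) := by
    intro y
    rw [← vecForm_formVec (η (β.leaf k y))]
    have h2 : formVec (η (β.leaf k y)) = ∑ i, formVec (η (β.leaf k y)) i • (stdVec i : Euc (n + 1)) :=
      by
        conv_lhs => rw [← (EuclideanSpace.basisFun (Fin (n + 1)) ℝ).sum_repr
          (formVec (η (β.leaf k y)))]
        simp [stdVec]
    conv_lhs => rw [h2]
    rw [map_sum, ContinuousAlternatingMap.sum_apply]
    refine Finset.sum_congr rfl fun i _ => ?_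
    rw [map_smul, ContinuousAlternatingMap.smul_apply, smul_eq_mul, vecForm_apply, vecForm_formVec]
  simp_rw [h1]
  rw [integral_finsetSum]
  · exact Finset.sum_congr rfl fun i _ => leafInt_const (stdVec i) hk hs hsJ (hχ i)
  · exact fun i _ => integrableOn_leafInt
      (A := fun _ v => stdDet (Fin.cons (stdVec i) v : Fin (n + 1) → Euc (n + 1)))
      (continuousOn_stdDet_const _ _) (hχ i).1.continuous (hχ i).2.1 (hχ i).2.2 hk

/-- The height function integrates to a potential of the current. -/
lemma Lamination.IsRepresentedBy.isPotential (hn : 1 ≤ n) (hL : L.IsOriented)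
    (hA : m.IsAreaMeasure A) (hT : L.IsRepresentedBy T A) (he : e ∈ _root_.atlas (Euc (n + 1)) M)
    (hβ : B.1.IsLocal e β) {s : ℝ} (hs : s = 1 ∨ s = -1)
    (hsK : ∀ k ∈ β.K, ∀ y ∈ β.J, β.NormalSign k s y) :
    IsPotential T e β.X.target fun z => -(s * β.above (m.μ B) z) := by
  have hμ := m.measure_box_lt_top hβ
  refine ⟨((LeafBox.locallyIntegrableOn_above hμ).smul s).neg, fun η hη => ?_⟩
  have hηe := hη.mono hβ.target_subset
  have hcpt := isContCptForm_formOfChart he hη.1.continuous hη.2.1 hηe.2.2 (subset_univ _)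
  obtain ⟨c, hc⟩ := exists_ptComass_formOfChart_le he hη.1.continuous hη.2.1 hηe.2.2
  obtain ⟨h1, h2⟩ := hT _ _ c hcpt hc
  have hz : ∀ x, (∀ k ∈ β.I, ∀ y ∈ β.J, B.1.leaf k y ≠ x) → L.tau (formOfChart e η) x = 0 := by
    intro x hx
    refine Lamination.tau_eq_zero ?_
    by_cases hxe : x ∈ e.source
    · ext v
      rw [formOfChart_apply η hxe, hη.eq_zero_of_notMem (hβ.ne_leaf subset_rfl hx hxe)]
      rfl
    · exact formOfChart_of_notMem η hxe
  rw [h2, (hA.integral_box B hβ h1 hz).2]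
  have h3 : ∀ k ∈ β.K, ∫ y in β.J, B.1.density (k, y) * L.tau (formOfChart e η) (B.1.leaf k y) =
      ∑ i, s * β.flux (fun _ => stdVec i) (fun z => formVec (η z) i) k := by
    intro k hk
    rw [← LeafBox.integral_form_leaf hk hs (hsK k hk) hη]
    refine setIntegral_congr_fun β.J_open.measurableSet fun y hy => ?_
    have hkI := β.K_subset hk
    rw [mul_comm, Lamination.tau_formOfChart_leaf hn hL he B (hβ.mem_K hk) (hβ.J_subset hy)
      (hβ.mem_source k hkI y hy), ← hβ.tanVec_eq hkI hy, hβ.leaf_eq k hkI y hy]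
    rfl
  rw [setIntegral_congr_fun hβ.measurableSet_K h3]
  have h4 := fun i => LeafBox.integral_flux (β := β) hμ
    (LeafBox.isDivFree_const β.X.open_target (stdVec i)) (hη.formVec_apply i)
  have h5 : ∀ z, topCoeff (extDeriv η z) =
      ∑ i, fderiv ℝ (fun x => formVec (η x) i) z (stdVec i) := by
    intro z
    rw [topCoeff_extDeriv (hη.differentiable z)]
    simp_rw [wedgeCoeff_eq, formVec_vecForm]
  rw [integral_finsetSum _ fun i _ => (h4 i).1.const_mul s]
  simp_rw [integral_const_mul, (h4 _).2, h5]
  rw [← integral_neg]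
  have h6 : ∀ z, -(-(s * β.above (m.μ B) z) *
      ∑ i, fderiv ℝ (fun x => formVec (η x) i) z (stdVec i)) =
      ∑ i, s * (β.above (m.μ B) z * fderiv ℝ (fun x => formVec (η x) i) z (stdVec i)) := by
    intro z; rw [neg_mul, neg_neg, mul_assoc, Finset.mul_sum, Finset.mul_sum]
  simp_rw [h6]
  rw [integral_finsetSum]
  · simp_rw [integral_const_mul]
  · intro i _
    exact (LeafBox.integrableOn_above_mul hμ
      (LeafBox.isDivFree_const β.X.open_target (stdVec i)) (hη.formVec_apply i)).const_mul s

end LocalCurrent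

/-! ### Calibrated plaques -/

section Transition

variable {n : ℕ} {M : Type*} [TopologicalSpace M] [ChartedSpace (Euc (n + 1)) M]
  [IsManifold 𝓘(ℝ, Euc (n + 1)) ∞ M] {e e' : OpenPartialHomeomorph M (Euc (n + 1))}
  {V : Set (Euc (n + 1))} {χ : Euc (n + 1) → ℝ}

open Classical in
/-- A function read in the chart `e`, expressed in the chart `e'`. -/
noncomputable def changeChart (e e' : OpenPartialHomeomorph M (Euc (n + 1))) (χ : Euc (n + 1) → ℝ)
    (z : Euc (n + 1)) : ℝ := if z ∈ e'.target then ofChart e χ (e'.symm z) else 0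

omit [IsManifold 𝓘(ℝ, Euc (n + 1)) ∞ M] in
lemma changeChart_apply {x : M} (hx : x ∈ e'.source) :
    changeChart e e' χ (e' x) = ofChart e χ x := by
  rw [changeChart, if_pos (e'.map_source hx), e'.left_inv hx]

lemma IsTestFun.changeChart (he : e ∈ atlas (Euc (n + 1)) M) (he' : e' ∈ atlas (Euc (n + 1)) M)
    (hV : V ⊆ e.target ∩ e.symm ⁻¹' e'.source) (hχ : IsTestFun V χ) :
    IsTestFun ((fun z => e' (e.symm z)) '' V) (_root_.changeChart e e' χ) := by
  have hcpt : IsCompact ((fun z => e' (e.symm z)) '' tsupport χ) :=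
    hχ.2.1.isCompact.image_of_continuousOn
      ((contDiffOn_transition he he').continuousOn.mono (hχ.2.2.trans hV))
  have h0 : ∀ z ∉ (fun z => e' (e.symm z)) '' tsupport χ, _root_.changeChart e e' χ z = 0 := by
    intro z hz
    rw [_root_.changeChart]; split_ifs with h1
    · rw [ofChart]; split_ifs with h2
      · refine image_eq_zero_of_notMem_tsupport fun h' => hz ⟨_, h', ?_⟩
        simp only [e.left_inv h2, e'.right_inv h1]
      · rfl
    · rfl
  have hsupp : tsupport (_root_.changeChart e e' χ) ⊆ (fun z => e' (e.symm z)) '' tsupport χ :=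
    closure_minimal (fun z hz => by_contra fun h => hz (h0 z h)) hcpt.isClosed
  refine ⟨contDiff_iff_contDiffAt.2 fun z => ?_, HasCompactSupport.intro hcpt h0,
    hsupp.trans (image_mono hχ.2.2)⟩
  by_cases hz : z ∈ (fun z => e' (e.symm z)) '' tsupport χ
  · have hzD : z ∈ e'.target ∩ e'.symm ⁻¹' e.source := by
      obtain ⟨z, hz, rfl⟩ := hz
      have := hV (hχ.2.2 hz)
      exact ⟨e'.map_source this.2, by
        rw [mem_preimage, e'.left_inv this.2]; exact e.map_target this.1⟩
    have hD := (isOpen_transition_domain e' e).mem_nhds hzD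
    refine (hχ.1.contDiffAt.comp z ((contDiffOn_transition he' he).contDiffAt hD)).congr_of_eventuallyEq ?_
    filter_upwards [hD] with z' hz'
    rw [_root_.changeChart, if_pos hz'.1, ofChart,
      if_pos (show e'.symm z' ∈ e.source from hz'.2)]; rfl
  · refine contDiffAt_const.congr_of_eventuallyEq (f := fun _ => (0 : ℝ)) ?_
    filter_upwards [hcpt.isClosed.isOpen_compl.mem_nhds hz] with z' hz' using h0 z' hz'

lemma hasFDerivAt_transition (he : e ∈ atlas (Euc (n + 1)) M) (he' : e' ∈ atlas (Euc (n + 1)) M)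
    {z : Euc (n + 1)} (hz : z ∈ e.target ∩ e.symm ⁻¹' e'.source) :
    HasFDerivAt (fun z => e' (e.symm z)) (fderiv ℝ (fun z => e' (e.symm z)) z) z :=
  (((contDiffOn_transition he he').contDiffAt
    ((isOpen_transition_domain e e').mem_nhds hz)).differentiableAt (by simp)).hasFDerivAt

omit [IsManifold 𝓘(ℝ, Euc (n + 1)) ∞ M] in
lemma IsOrientedAtlas.det_pos (hM : IsOrientedAtlas n M) (he : e ∈ atlas (Euc (n + 1)) M)
    (he' : e' ∈ atlas (Euc (n + 1)) M) {z : Euc (n + 1)}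
    (hz : z ∈ e.target ∩ e.symm ⁻¹' e'.source) :
    0 < (fderiv ℝ (fun z => e' (e.symm z)) z).det := by
  have := hM e he e' he' (e.symm z) ⟨e.map_target hz.1, hz.2⟩
  rwa [e.right_inv hz.1] at this

lemma setIntegral_wedgeCoeff_transition (hM : IsOrientedAtlas n M)
    (he : e ∈ atlas (Euc (n + 1)) M) (he' : e' ∈ atlas (Euc (n + 1)) M)
    (hV : V ⊆ e.target ∩ e.symm ⁻¹' e'.source) (hχ : IsTestFun V χ) (F : RoughForm n M)
    {Ω : Set (Euc (n + 1))} (hΩ : MeasurableSet Ω) (hΩV : Ω ⊆ V) :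
    ∫ z in (fun z => e' (e.symm z)) '' Ω,
        wedgeCoeff (fderiv ℝ (changeChart e e' χ) z) (formInChart F e' z) =
      ∫ z in Ω, wedgeCoeff (fderiv ℝ χ z) (formInChart F e z) := by
  have hd : ∀ z ∈ Ω, HasFDerivWithinAt (fun z => e' (e.symm z))
      (fderiv ℝ (fun z => e' (e.symm z)) z) Ω z := fun z hz =>
    (hasFDerivAt_transition he he' (hV (hΩV hz))).hasFDerivWithinAt
  have hinj : InjOn (fun z => e' (e.symm z)) Ω := by
    intro z hz z' hz' h
    have h1 := hV (hΩV hz)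
    have h2 := hV (hΩV hz')
    exact e.symm.injOn h1.1 h2.1 (e'.injOn h1.2 h2.2 h)
  rw [integral_image_eq_integral_abs_det_fderiv_smul volume hΩ hd hinj]
  refine setIntegral_congr_fun hΩ fun z hz => ?_
  have hzV := hV (hΩV hz)
  have h1 : χ =ᶠ[𝓝 z] fun z => changeChart e e' χ (e' (e.symm z)) := by
    filter_upwards [(isOpen_transition_domain e e').mem_nhds hzV] with z' hz'
    rw [changeChart_apply hz'.2, ofChart, if_pos (e.map_target hz'.1), e.right_inv hz'.1]
  have h2 : fderiv ℝ χ z = (fderiv ℝ (changeChart e e' χ) (e' (e.symm z))).comp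
      (fderiv ℝ (fun z => e' (e.symm z)) z) := by
    rw [h1.fderiv_eq]
    exact (((hχ.changeChart he he' hV).differentiable _).hasFDerivAt.comp z
      (hasFDerivAt_transition he he' hzV)).fderiv
  rw [h2, formInChart_transition F he he' hzV.1 hzV.2, wedgeCoeff_comp,
    abs_of_pos (hM.det_pos he he' hzV), smul_eq_mul]

end Transition

section Patch

variable {n : ℕ} {M : Type*} [TopologicalSpace M] [ChartedSpace (Euc (n + 1)) M]
  [IsManifold 𝓘(ℝ, Euc (n + 1)) ∞ M]
  [RiemannianBundle (fun x : M => TangentSpace 𝓘(ℝ, Euc (n + 1)) x)]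
  [IsContMDiffRiemannianBundle 𝓘(ℝ, Euc (n + 1)) ∞ (Euc (n + 1))
      (fun x : M => TangentSpace 𝓘(ℝ, Euc (n + 1)) x)]
  {B : FlowBox n M} {e e' : OpenPartialHomeomorph M (Euc (n + 1))} {β : LeafBox n}
  {F : RoughForm n M} {k s : ℝ}

lemma ae_eq_of_forall_isCompact {m : ℕ} {C : Set (Euc m)} (hC : IsCompact C) {f g : Euc m → ℝ}
    (hf : IntegrableOn f C) (hg : IntegrableOn g C)
    (h : ∀ C' ⊆ C, IsCompact C' → ∫ y in C', f y = ∫ y in C', g y) :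
    f =ᵐ[volume.restrict C] g := by
  have h1 := ae_eq_zero_of_forall_setIntegral_isCompact_eq_zero (μ := volume.restrict C)
    (f := fun y => f y - g y) (hf.sub hg) fun C' hC' => by
      rw [Measure.restrict_restrict hC'.measurableSet]
      have hs : C' ∩ C ⊆ C := inter_subset_right
      rw [integral_sub (hf.mono_set hs) (hg.mono_set hs), h _ hs (hC'.inter hC), sub_self]
  filter_upwards [h1] with y hy using sub_eq_zero.1 hy

lemma FlowBox.IsLocal.continuousOn_areaDensity (hβ : B.IsLocal e β)
    (he : e ∈ atlas (Euc (n + 1)) M) (hk : k ∈ β.K) :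
    ContinuousOn (areaDensity (B.leaf k)) β.J :=
  (LeafBox.continuousOn_leafInt (hβ.isAreaFun he).cont hk).congr fun _ hy => hβ.area_eq he hk hy

omit [RiemannianBundle (fun x : M => TangentSpace 𝓘(ℝ, Euc (n + 1)) x)]
  [IsContMDiffRiemannianBundle 𝓘(ℝ, Euc (n + 1)) ∞ (Euc (n + 1))
      (fun x : M => TangentSpace 𝓘(ℝ, Euc (n + 1)) x)] in
lemma FlowBox.IsLocal.symm_eq (hβ : B.IsLocal e β) {y : Euc n} (hk : k ∈ B.I) (hy : y ∈ B.J)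
    {z : Euc (n + 1)} (hz : z ∈ β.X.target) (h : e.symm z = B.leaf k y) :
    β.ht z = k ∧ y ∈ β.J ∧ β.leaf k y = z := by
  have h1 := LeafBox.symm_mem hz
  have h2 : β.X.symm z = (k, y) := B.chart.injOn (B.mem_source (hβ.I_sub h1.1)
    (hβ.J_subset h1.2)) (B.mem_source hk hy) ((hβ.mem_target hz).2.symm.trans h)
  have h3 := LeafBox.leaf_ht hz
  rw [h2] at h1 h3
  have h4 : β.ht z = k := by rw [LeafBox.ht, h2]
  rw [h4] at h3
  exact ⟨h4, h1.2, h3⟩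

omit [RiemannianBundle (fun x : M => TangentSpace 𝓘(ℝ, Euc (n + 1)) x)]
  [IsContMDiffRiemannianBundle 𝓘(ℝ, Euc (n + 1)) ∞ (Euc (n + 1))
      (fun x : M => TangentSpace 𝓘(ℝ, Euc (n + 1)) x)] in
lemma FlowBox.IsLocal.symm_mem_plaque_iff (hβ : B.IsLocal e β) (hk : k ∈ β.I) {z : Euc (n + 1)}
    (hz : z ∈ β.X.target) : e.symm z ∈ B.leaf k '' B.J ↔ β.ht z = k := by
  constructor
  · rintro ⟨y, hy, hyz⟩
    exact (hβ.symm_eq (hβ.I_sub hk) hy hz hyz.symm).1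
  · intro h
    refine ⟨_, hβ.J_subset (LeafBox.symm_mem hz).2, ?_⟩
    rw [← hβ.symm_leaf hk (LeafBox.symm_mem hz).2, ← h, LeafBox.leaf_ht hz]

lemma FlowBox.IsLocal.exists_leafInt_eq (hM : IsOrientedAtlas n M) (hF : IsCalibration F)
    (he : e ∈ atlas (Euc (n + 1)) M) (hβ : B.IsLocal e β) (hk : k ∈ β.K) (hs : s = 1 ∨ s = -1)
    (hsJ : ∀ y ∈ β.J, β.NormalSign k s y) (hc : IsCalibratedPatch F (B.leaf k) B.J)
    {z₀ : Euc (n + 1)} (hz₀ : z₀ ∈ β.X.target) :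
    ∃ O, IsOpen O ∧ z₀ ∈ O ∧ ∀ χ, IsTestFun (O ∩ β.X.target) χ →
      β.leafInt (areaChart e) χ k = s * β.flux (chartField F e) χ k := by
  have hkI := β.K_subset hk
  have hkB := B.K_subset (hβ.mem_K hk)
  have hG := hβ.isDivFree hF he
  by_cases hzk : β.ht z₀ = k
  swap
  · obtain ⟨O, hO, hzO, h⟩ := LeafBox.exists_off_leaf hG (areaChart e) hkI hz₀ hzk
    exact ⟨O, hO, hzO, fun χ hχ => by rw [(h χ hχ).1, (h χ hχ).2, mul_zero]⟩
  obtain ⟨f, ⟨hfi, hf⟩, hfa⟩ := hc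
  obtain ⟨y₀, hy₀, rfl⟩ : ∃ y ∈ β.J, β.leaf k y = z₀ :=
    ⟨_, (LeafBox.symm_mem hz₀).2, by rw [← hzk, LeafBox.leaf_ht hz₀]⟩
  obtain ⟨e', he', V', g, hye', hV', hV't, hyV', hg, hdg, hg0, hor, htr⟩ :=
    hf y₀ (hβ.J_subset hy₀)
  set τ : Euc (n + 1) → Euc (n + 1) := fun z => e' (e.symm z) with hτ
  have hD := isOpen_transition_domain e e'
  have hτc := contDiffOn_transition he he'
  set V : Set (Euc (n + 1)) := ((e.target ∩ e.symm ⁻¹' e'.source) ∩ τ ⁻¹' V') ∩ β.X.target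
  have hV : IsOpen V := (hτc.continuousOn.isOpen_inter_preimage hD hV').inter β.X.open_target
  have hy₀V : β.leaf k y₀ ∈ V := by
    refine ⟨⟨⟨hβ.target_subset hz₀, ?_⟩, ?_⟩, hz₀⟩
    · rw [mem_preimage, hβ.symm_leaf hkI hy₀]; exact hye'
    · rw [mem_preimage, hτ]; simp only; rw [hβ.symm_leaf hkI hy₀]; exact hyV'
  have hgτ : ContDiffOn ℝ 1 (fun z => g (τ z)) V :=
    hg.comp ((hτc.of_le (by simp)).mono fun z hz => hz.1.1) fun z hz => hz.1.2
  have hdτ : ∀ z ∈ V, fderiv ℝ (fun z => g (τ z)) z = (fderiv ℝ g (τ z)).comp (fderiv ℝ τ z) :=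
    fun z hz => (((hg.contDiffAt (hV'.mem_nhds hz.1.2)).differentiableAt
      (by simp)).hasFDerivAt.comp z (hasFDerivAt_transition he he' hz.1.1)).fderiv
  have hdet := hM.det_pos he he' hy₀V.1.1
  have hdne : fderiv ℝ (fun z => g (τ z)) (β.leaf k y₀) ≠ 0 := by
    rw [hdτ _ hy₀V]
    intro h
    refine hdg _ hy₀V.1.2 (ContinuousLinearMap.ext fun x => ?_)
    have h1 : IsUnit (fderiv ℝ τ (β.leaf k y₀)).toLinearMap.det := hdet.ne'.isUnit
    obtain ⟨w, rfl⟩ := ((LinearMap.isUnit_iff_range_eq_top _).1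
      ((LinearMap.isUnit_iff_isUnit_det _).2 h1)) ▸ (Submodule.mem_top : x ∈ ⊤)
    exact congrArg (fun l : Euc (n + 1) →L[ℝ] ℝ => l w) h
  have hzero : ∀ z ∈ V, g (τ z) = 0 ↔ β.ht z = k := by
    intro z hz
    have h1 : τ z ∈ V' ∧ g (τ z) = 0 ↔ τ z ∈ V' ∧ e'.symm (τ z) ∈ B.leaf k '' B.J :=
      Set.ext_iff.1 hg0 (τ z)
    have h2 : e'.symm (τ z) = e.symm z := e'.left_inv hz.1.1.2
    have hz' : τ z ∈ V' := hz.1.2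
    rw [and_iff_right hz', and_iff_right hz', h2] at h1
    rw [h1, hβ.symm_mem_plaque_iff hkI hz.2]
  obtain ⟨s', hs', W, hWV, hW, hyW, hside⟩ := LeafBox.exists_side hkI hy₀ hV hy₀V
    hgτ.continuousOn hdne fun z hz _ => hzero z hz
  have hWV' : W ⊆ V := fun z hz => (hWV hz).1
  have hsign : β.NormalSign k s' y₀ := by
    refine LeafBox.normalSign_of_side hk hy₀ hW hyW
      ((hgτ.contDiffAt (hV.mem_nhds hy₀V)).differentiableAt (by simp)) hdne (fun w hw => ?_)
      (fun z hz => hzero z (hWV' hz)) fun z hz => (hside z hz).2.1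
    rw [hdτ _ hy₀V] at hw
    have h1 : e' (B.leaf k y₀) = τ (β.leaf k y₀) := by rw [hτ]; simp only; rw [hβ.symm_leaf hkI hy₀]
    have h2 := hor y₀ (hβ.J_subset hy₀) hye' hyV' (fderiv ℝ τ (β.leaf k y₀) w) (by rw [h1]; exact hw)
    have h3 : fderiv ℝ (fun y' => e' (B.leaf k y')) y₀ =
        (fderiv ℝ τ (β.leaf k y₀)).comp (fderiv ℝ (β.leaf k) y₀) := by
      have h4 : (fun y' => e' (B.leaf k y')) =ᶠ[𝓝 y₀] fun y' => τ (β.leaf k y') := by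
        filter_upwards [β.J_open.mem_nhds hy₀] with y hy
        rw [hτ]; simp only; rw [hβ.symm_leaf hkI hy]
      rw [h4.fderiv_eq]
      exact ((hasFDerivAt_transition he he' hy₀V.1.1).comp y₀
        (((LeafBox.contDiffOn_leaf hk).contDiffAt (β.J_open.mem_nhds hy₀)).differentiableAt
          (by simp)).hasFDerivAt).fderiv
    have h5 : (Fin.cons (fderiv ℝ τ (β.leaf k y₀) w) (fun i => fderiv ℝ
        (fun y' => e' (B.leaf k y')) y₀ (stdVec i)) : Fin (n + 1) → Euc (n + 1)) =
        fun i => fderiv ℝ τ (β.leaf k y₀)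
          ((Fin.cons w (tanVec (β.leaf k) y₀) : Fin (n + 1) → Euc (n + 1)) i) := by
      rw [h3]
      ext1 i
      refine Fin.cases rfl (fun i => rfl) i
    rw [h5] at h2
    change 0 < stdDet _ at h2
    rw [stdDet_comp] at h2
    exact pos_of_mul_pos_right h2 hdet.le
  obtain rfl := LeafBox.NormalSign.unique hk hy₀ hs hs' (hsJ y₀ hy₀) hsign
  refine ⟨W, hW, hyW, fun χ hχ' => ?_⟩
  have hχ : IsTestFun W χ := hχ'.mono inter_subset_left
  have hWt : W ⊆ e.target ∩ e.symm ⁻¹' e'.source := fun z hz => (hWV' hz).1.1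
  have hχτ := hχ.changeChart he he' hWt
  have hWX : W ⊆ β.X.target := fun z hz => (hWV hz).2
  have h1 := htr _ (hχτ.mono (by rintro _ ⟨z, hz, rfl⟩; exact (hWV' hz).1.2))
  have hΩ : MeasurableSet {z ∈ W | g (τ z) < 0} :=
    ((hgτ.continuousOn.mono hWV').isOpen_inter_preimage hW isOpen_Iio).measurableSet
  have hR : ∫ z in {z ∈ V' | g z < 0}, wedgeCoeff (fderiv ℝ (changeChart e e' χ) z)
      (formInChart F e' z) = s * β.flux (chartField F e) χ k := by
    rw [LeafBox.mul_flux_eq hG hWX hχ hk hs]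
    have h2 : {z ∈ W | s * β.ht z < s * k} = {z ∈ W | g (τ z) < 0} := by
      ext z; exact and_congr_right fun hz => (hside z hz).1.symm
    rw [h2]
    have h3 := setIntegral_wedgeCoeff_transition hM he he' hWt hχ F hΩ fun z hz => hz.1
    simp_rw [wedgeCoeff_eq] at h3 ⊢
    refine Eq.trans ?_ h3
    refine setIntegral_eq_of_subset_of_forall_sdiff_eq_zero
      (hg.continuousOn.isOpen_inter_preimage hV' isOpen_Iio).measurableSet ?_ fun z hz => ?_
    · rintro _ ⟨z, hz, rfl⟩
      exact ⟨(hWV' hz.1).1.2, hz.2⟩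
    · rw [hχτ.fderiv_eq_zero]
      · rfl
      · rintro ⟨z', hz', rfl⟩
        exact hz.2 ⟨z', ⟨hz', hz.1.2⟩, rfl⟩
  rw [hR] at h1
  rw [← h1]
  set C : Set (Euc n) := {y ∈ β.J | β.leaf k y ∈ tsupport χ} with hCdef
  have hC : IsCompact C := LeafBox.isCompact_leaf_preimage hkI hχ.2.1 (hχ.2.2.trans hWX)
  have hCJ : C ⊆ β.J := fun y hy => hy.1
  have hval : ∀ y ∈ C, ofChart e χ (B.leaf k y) = χ (β.leaf k y) := by
    intro y hy
    rw [ofChart, if_pos (show B.leaf k y ∈ e.source from hβ.mem_source k hkI y hy.1),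
      hβ.leaf_eq k hkI y hy.1]
    rfl
  have hCS : C ⊆ B.J ∩ B.leaf k ⁻¹' (e'.source ∩ e' ⁻¹' V') := by
    intro y hy
    have h2 := (hWV' (hχ.2.2 hy.2)).1
    have h3 := h2.1.2
    have h4 := h2.2
    rw [mem_preimage, hβ.symm_leaf hkI hy.1] at h3
    rw [mem_preimage, hτ] at h4
    simp only at h4
    rw [hβ.symm_leaf hkI hy.1] at h4
    exact ⟨hβ.J_subset hy.1, h3, h4⟩
  have hS : IsOpen (B.J ∩ B.leaf k ⁻¹' (e'.source ∩ e' ⁻¹' V')) :=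
    (B.leaf_C1 k (hβ.mem_K hk)).1.continuousOn.isOpen_inter_preimage B.J_open
      (e'.isOpen_inter_preimage hV')
  have hL : ∫ y in B.J ∩ B.leaf k ⁻¹' (e'.source ∩ e' ⁻¹' V'),
      changeChart e e' χ (e' (B.leaf k y)) * f y = ∫ y in C, χ (β.leaf k y) * f y := by
    rw [setIntegral_eq_of_subset_of_forall_sdiff_eq_zero hS.measurableSet hCS]
    · refine setIntegral_congr_fun hC.measurableSet fun y hy => ?_
      rw [changeChart_apply (hCS hy).2.1, hval y hy]
    · intro y hy
      rw [changeChart_apply hy.1.2.1, ofChart]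
      split_ifs with h2
      · refine mul_eq_zero_of_left (image_eq_zero_of_notMem_tsupport fun h3 => ?_) _
        have h4 := hβ.symm_eq hkB hy.1.1 (hWX (hχ.2.2 h3)) (e.left_inv h2)
        exact hy.2 ⟨h4.2.1, by rw [h4.2.2]; exact h3⟩
      · rw [zero_mul]
  rw [hL]
  have hfC : IntegrableOn f C :=
    hfi.integrableOn_compact_subset (hCJ.trans hβ.J_subset) hC
  have haC := ((hβ.continuousOn_areaDensity he hk).mono hCJ).integrableOn_compact hC (μ := volume)
  have hae := ae_eq_of_forall_isCompact hC hfC haC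
    fun C' hC' h => hfa C' (hC'.trans (hCJ.trans hβ.J_subset)) h
  rw [LeafBox.leafInt, setIntegral_eq_of_subset_of_forall_sdiff_eq_zero β.J_open.measurableSet hCJ]
  · refine integral_congr_ae ?_
    filter_upwards [hae, ae_restrict_mem hC.measurableSet] with y hy hyC
    rw [hy, hβ.area_eq he hk (hCJ hyC)]
  · intro y hy
    rw [image_eq_zero_of_notMem_tsupport fun h => hy.2 ⟨hy.1, h⟩, zero_mul]

lemma FlowBox.IsLocal.leafInt_eq (hM : IsOrientedAtlas n M) (hF : IsCalibration F)
    (he : e ∈ atlas (Euc (n + 1)) M) (hβ : B.IsLocal e β) (hk : k ∈ β.K) (hs : s = 1 ∨ s = -1)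
    (hsJ : ∀ y ∈ β.J, β.NormalSign k s y) (hc : IsCalibratedPatch F (B.leaf k) B.J)
    {χ : Euc (n + 1) → ℝ} (hχ : IsTestFun β.X.target χ) :
    β.leafInt (areaChart e) χ k = s * β.flux (chartField F e) χ k := by
  choose! O hO using fun z (hz : z ∈ β.X.target) => hβ.exists_leafInt_eq hM hF he hk hs hsJ hc hz
  obtain ⟨t, ζ, ht, hζ, hζχ, hsum⟩ := hχ.exists_partition (O := O)
    fun z hz => ⟨(hO z hz).1, (hO z hz).2.1⟩
  have hX : ∀ i ∈ t, IsTestFun β.X.target (fun z => ζ i z * χ z) := fun i hi =>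
    (hζχ i hi).mono inter_subset_right
  rw [funext hsum, LeafBox.flux_sum (hβ.isDivFree hF he) t hX,
    LeafBox.leafInt_sum (hβ.isAreaFun he).cont t hX hk, Finset.mul_sum]
  exact Finset.sum_congr rfl fun i hi => (hO i (ht i hi)).2.2 _ (hζχ i hi)

end Patch

/-! ### Signed measures -/

section Signed

variable {M : Type*} [MeasurableSpace M] {ν : SignedMeasure M} {A : Measure M} {U : Set M}

lemma signedMeasure_apply_eq (ν : SignedMeasure M) {S : Set M} (hS : MeasurableSet S) :
    ν S = ν.toJordanDecomposition.posPart.real S - ν.toJordanDecomposition.negPart.real S := by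
  conv_lhs => rw [← ν.toSignedMeasure_toJordanDecomposition]
  rw [JordanDecomposition.toSignedMeasure, Measure.toSignedMeasure_sub_apply hS]

lemma signedIntegral_toSignedMeasure (κ : Measure M) [IsFiniteMeasure κ] (g : M → ℝ) :
    signedIntegral κ.toSignedMeasure g = ∫ x, g x ∂κ := by
  have h : κ.toSignedMeasure =
      (⟨κ, 0, Measure.MutuallySingular.zero_right⟩ : JordanDecomposition M).toSignedMeasure := by
    ext S hS
    rw [JordanDecomposition.toSignedMeasure, Measure.toSignedMeasure_sub_apply hS,
      Measure.toSignedMeasure_apply_measurable hS]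
    simp
  rw [signedIntegral, h, JordanDecomposition.toJordanDecomposition_toSignedMeasure]
  simp

lemma signedIntegral_eq_of_forall_apply_eq (hU : MeasurableSet U) (hAU : A U < ⊤)
    (h : ∀ S ⊆ U, MeasurableSet S → ν S = A.real S) {g : M → ℝ}
    (hg : ∀ κ : Measure M, IsFiniteMeasure κ → Integrable g κ) (hgU : ∀ x ∉ U, g x = 0) :
    signedIntegral ν g = ∫ x, g x ∂A := by
  have : IsFiniteMeasure (A.restrict U) := ⟨by rwa [Measure.restrict_apply_univ]⟩
  set p := ν.toJordanDecomposition.posPart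
  set q := ν.toJordanDecomposition.negPart
  have hpq : p.restrict U = A.restrict U + q.restrict U := by
    ext S hS
    have h1 := h _ (inter_subset_right : S ∩ U ⊆ U) (hS.inter hU)
    rw [signedMeasure_apply_eq ν (hS.inter hU)] at h1
    have h2 : A (S ∩ U) ≠ ⊤ := ((measure_mono inter_subset_right).trans_lt hAU).ne
    rw [Measure.add_apply, Measure.restrict_apply hS, Measure.restrict_apply hS,
      Measure.restrict_apply hS, ← ENNReal.toReal_eq_toReal_iff' (measure_ne_top _ _)
        (ENNReal.add_ne_top.2 ⟨h2, measure_ne_top _ _⟩), ENNReal.toReal_add h2 (measure_ne_top _ _)]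
    simp only [measureReal_def] at h1
    linarith
  have hr : ∀ κ : Measure M, ∫ x in U, g x ∂κ = ∫ x, g x ∂κ := fun κ =>
    setIntegral_eq_integral_of_forall_compl_eq_zero hgU
  rw [signedIntegral, ← hr p, ← hr q, ← hr A, hpq,
    integral_add_measure (hg _ inferInstance) (hg _ inferInstance)]
  ring

variable [TopologicalSpace M] [BorelSpace M] [T2Space M] [SecondCountableTopology M]
  [LocallyCompactSpace M]

/-- A measure dominated by another one locally, on open sets, and of the same total mass. -/
lemma signedMeasure_eq_of_le_locally (hU : IsOpen U) (hAU : A U < ⊤)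
    (hloc : ∀ x ∈ U, ∃ O, IsOpen O ∧ x ∈ O ∧ O ⊆ U ∧ ∀ W, IsOpen W → W ⊆ O → ∀ C ⊆ W, IsCompact C →
      ν.toJordanDecomposition.posPart C ≤ A W + ν.toJordanDecomposition.negPart W)
    (hνU : ν U = A.real U) : ∀ S ⊆ U, MeasurableSet S → ν S = A.real S := by
  have : TopologicalSpace.PseudoMetrizableSpace M := inferInstance
  have : IsFiniteMeasure (A.restrict U) := ⟨by rwa [Measure.restrict_apply_univ]⟩
  choose! O hO using hloc
  set p := ν.toJordanDecomposition.posPart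
  set q := ν.toJordanDecomposition.negPart
  have hopen : ∀ x ∈ U, ∀ W, IsOpen W → W ⊆ O x → p W ≤ (A.restrict U + q) W := by
    intro x hx W hW hWO
    rw [hW.measure_eq_iSup_isCompact]
    refine iSup₂_le fun C hC => iSup_le fun hCc => ?_
    rw [Measure.add_apply, Measure.restrict_apply hW.measurableSet,
      inter_eq_left.2 (hWO.trans (hO x hx).2.2.1)]
    exact (hO x hx).2.2.2 W hW hWO C hC hCc
  have hle : ∀ x ∈ U, ν ≤[O x] (A.restrict U).toSignedMeasure := by
    intro x hx
    refine VectorMeasure.restrict_le_restrict_of_subset_le _ _ fun S hS hSO => ?_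
    have h1 : p S ≤ (A.restrict U + q) S := by
      rw [S.measure_eq_iInf_isOpen (A.restrict U + q)]
      refine le_iInf₂ fun W hSW => le_iInf fun hW => ?_
      calc p S ≤ p (W ∩ O x) := measure_mono (subset_inter hSW hSO)
        _ ≤ _ := hopen x hx _ (hW.inter (hO x hx).1) inter_subset_right
        _ ≤ _ := measure_mono inter_subset_left
    have h2 := ENNReal.toReal_mono (measure_ne_top _ _) h1
    rw [Measure.add_apply, ENNReal.toReal_add (measure_ne_top _ _) (measure_ne_top _ _)] at h2
    rw [signedMeasure_apply_eq ν hS, Measure.toSignedMeasure_apply_measurable hS]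
    simp only [measureReal_def]
    linarith
  obtain ⟨t, htU, htc, ht⟩ := TopologicalSpace.countable_cover_nhdsWithin (s := U) (f := O)
    fun x hx => mem_nhdsWithin_of_mem_nhds ((hO x hx).1.mem_nhds (hO x hx).2.1)
  have : Countable t := htc.to_subtype
  have hcov : U = ⋃ x : t, O x := by
    refine Subset.antisymm ?_ (iUnion_subset fun x => (hO _ (htU x.2)).2.2.1)
    rwa [iUnion_coe_set (s := t) (f := fun x => O x)]
  have hUle : ν ≤[U] (A.restrict U).toSignedMeasure := by
    have h := VectorMeasure.restrict_le_restrict_countable_iUnion ν (A.restrict U).toSignedMeasure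
      (f := fun x : t => O x) (fun x => (hO _ (htU x.2)).1.measurableSet) fun x => hle _ (htU x.2)
    rwa [← hcov] at h
  have hA : ∀ S ⊆ U, MeasurableSet S → (A.restrict U).toSignedMeasure S = A.real S := by
    intro S hSU hS
    rw [Measure.toSignedMeasure_apply_measurable hS, measureReal_restrict_apply hS,
      inter_eq_left.2 hSU]
  intro S hSU hS
  have h1 := VectorMeasure.subset_le_of_restrict_le_restrict _ _ hU.measurableSet hUle hSU
  have h2 := VectorMeasure.subset_le_of_restrict_le_restrict _ _ hU.measurableSet hUle
    (sdiff_subset : U \ S ⊆ U)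
  have h3 := VectorMeasure.of_add_of_sdiff (v := ν) hS hU.measurableSet hSU
  have h4 := VectorMeasure.of_add_of_sdiff (v := (A.restrict U).toSignedMeasure) hS
    hU.measurableSet hSU
  rw [hνU, ← hA U subset_rfl hU.measurableSet] at h3
  rw [← hA S hSU hS]
  linarith

end Signed

section FromLeaves

variable {n : ℕ} {M : Type*} [TopologicalSpace M] [ChartedSpace (Euc (n + 1)) M]
  [RiemannianBundle (fun x : M => TangentSpace 𝓘(ℝ, Euc (n + 1)) x)]
  [IsManifold 𝓘(ℝ, Euc (n + 1)) ∞ M]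
  [IsContMDiffRiemannianBundle 𝓘(ℝ, Euc (n + 1)) ∞ (Euc (n + 1))
      (fun x : M => TangentSpace 𝓘(ℝ, Euc (n + 1)) x)]
  {L : Lamination n M} {F : RoughForm n M}

omit [IsManifold 𝓘(ℝ, Euc (n + 1)) ∞ M]
  [IsContMDiffRiemannianBundle 𝓘(ℝ, Euc (n + 1)) ∞ (Euc (n + 1))
      (fun x : M => TangentSpace 𝓘(ℝ, Euc (n + 1)) x)] in
lemma Lamination.IsCalibrated.isCalibratedPatch (h : L.IsCalibrated F) (B : L.atlas) {k : ℝ}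
    (hk : k ∈ B.1.K) {y : Euc n} (hy : y ∈ B.1.J) : IsCalibratedPatch F (B.1.leaf k) B.1.J := by
  refine h {x' | Relation.EqvGen L.SamePlaque (B.1.leaf k y) x'}
    ⟨_, L.chart_mem_supp B hk hy, rfl⟩ B.1 B.2 k hk fun x hx => ?_
  exact Relation.EqvGen.rel _ _ ⟨B.1, B.2, k, hk, ⟨y, hy, rfl⟩, hx⟩

variable [MeasurableSpace M] [BorelSpace M] [T2Space M] [SecondCountableTopology M]
  {m : TransverseMeasure L} {A : Measure M} {T : RoughForm n M → ℝ} {U : Set M}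
  {B : L.atlas} {e : OpenPartialHomeomorph M (Euc (n + 1))} {β : LeafBox n}

omit [RiemannianBundle (fun x : M => TangentSpace 𝓘(ℝ, Euc (n + 1)) x)] [IsManifold 𝓘(ℝ, Euc (n + 1)) ∞ M]
  [IsContMDiffRiemannianBundle 𝓘(ℝ, Euc (n + 1)) ∞ (Euc (n + 1))
      (fun x : M => TangentSpace 𝓘(ℝ, Euc (n + 1)) x)] [MeasurableSpace M] [BorelSpace M]
  [T2Space M] [SecondCountableTopology M] in
lemma Lamination.exists_leaf_eq {x : M} (hx : x ∈ L.supp) :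
    ∃ B : L.atlas, ∃ k ∈ B.1.K, ∃ y ∈ B.1.J, B.1.leaf k y = x := by
  obtain ⟨B, hB, hxB⟩ := mem_iUnion₂.1 (L.cover hx)
  have h1 := L.symm_mem ⟨B, hB⟩ hx hxB
  exact ⟨⟨B, hB⟩, _, h1.1, _, h1.2, B.chart.right_inv hxB⟩

omit [MeasurableSpace M] [BorelSpace M] [T2Space M] [SecondCountableTopology M] in
/-- A flow box through a given point of a plaque. -/
lemma Lamination.exists_box (hn : 1 ≤ n) (B : L.atlas) {k : ℝ} (hk : k ∈ B.1.K) {y : Euc n}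
    (hy : y ∈ B.1.J) {W : Set M} (hW : IsOpen W) (hyW : B.1.leaf k y ∈ W)
    (he : e ∈ _root_.atlas (Euc (n + 1)) M) (hye : B.1.leaf k y ∈ e.source) :
    ∃ (β : LeafBox n) (s : ℝ), B.1.IsLocal e β ∧ k ∈ β.K ∧ y ∈ β.J ∧ (s = 1 ∨ s = -1) ∧
      (∀ k ∈ β.K, ∀ y ∈ β.J, β.NormalSign k s y) ∧ β.X.target ⊆ e.target ∩ e.symm ⁻¹' W := by
  obtain ⟨β, s, hβ, hk, hy, hs, hsK, hW⟩ := B.1.exists_isLocal_sign hn he hk hy hW ⟨hye, hyW⟩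
  refine ⟨β, s, hβ, hk, hy, hs, hsK, fun z hz => ⟨hβ.target_subset hz, ?_⟩⟩
  have h4 := LeafBox.symm_mem hz
  rw [mem_preimage, (hβ.mem_target hz).2]
  exact hW _ h4.1 _ h4.2

omit [T2Space M] [SecondCountableTopology M] in
lemma Lamination.IsRepresentedBy.eq_zero [T2Space M] (hT : L.IsRepresentedBy T A)
    (hA : m.IsAreaMeasure A) (he : e ∈ _root_.atlas (Euc (n + 1)) M)
    {V : Set (Euc (n + 1))} (hV : V ⊆ e.target ∩ e.symm ⁻¹' L.suppᶜ)
    {η : Euc (n + 1) → Euc (n + 1) [⋀^Fin n]→L[ℝ] ℝ} (hη : IsTestFun V η) :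
    T (formOfChart e η) = 0 := by
  have hηe := hη.mono fun z hz => (hV hz).1
  obtain ⟨c, hc⟩ := exists_ptComass_formOfChart_le he hη.1.continuous hη.2.1 hηe.2.2
  rw [(hT _ _ c (isContCptForm_formOfChart he hη.1.continuous hη.2.1 hηe.2.2
    (subset_univ _)) hc).2]
  refine integral_eq_zero_of_ae ?_
  filter_upwards [hA.ae_mem_supp] with x hx
  refine Lamination.tau_eq_zero ?_
  by_cases hxe : x ∈ e.source
  · ext v
    rw [formOfChart_apply η hxe, hη.eq_zero_of_notMem]
    · rfl
    · intro h
      have := (hV h).2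
      rw [mem_preimage, e.left_inv hxe] at this
      exact this hx
  · exact formOfChart_of_notMem η hxe

omit [SecondCountableTopology M] [T2Space M] in
lemma TransverseMeasure.IsAreaMeasure.integral_ofChart_eq_zero (hA : m.IsAreaMeasure A)
    {V : Set (Euc (n + 1))} (hV : V ⊆ e.target ∩ e.symm ⁻¹' L.suppᶜ)
    {χ : Euc (n + 1) → ℝ} (hχ : IsTestFun V χ) : ∫ x, ofChart e χ x ∂A = 0 := by
  refine integral_eq_zero_of_ae ?_
  filter_upwards [hA.ae_mem_supp] with x hx
  refine ofChart_eq_zero hχ fun hxe h => ?_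
  have := (hV h).2
  rw [mem_preimage, e.left_inv hxe] at this
  exact this hx

omit [MeasurableSpace M] [BorelSpace M] [T2Space M] [SecondCountableTopology M]
  [RiemannianBundle (fun x : M => TangentSpace 𝓘(ℝ, Euc (n + 1)) x)] [IsManifold 𝓘(ℝ, Euc (n + 1)) ∞ M]
  [IsContMDiffRiemannianBundle 𝓘(ℝ, Euc (n + 1)) ∞ (Euc (n + 1))
      (fun x : M => TangentSpace 𝓘(ℝ, Euc (n + 1)) x)] in
lemma ofChart_eq_zero_of_notMem {V : Set (Euc (n + 1))} (hV : V ⊆ e.target ∩ e.symm ⁻¹' U)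
    {χ : Euc (n + 1) → ℝ} (hχ : IsTestFun V χ) {x : M} (hx : x ∉ U) : ofChart e χ x = 0 := by
  refine ofChart_eq_zero hχ fun hxe h => hx ?_
  have := (hV h).2
  rwa [mem_preimage, e.left_inv hxe] at this

omit [IsManifold 𝓘(ℝ, Euc (n + 1)) ∞ M]
  [RiemannianBundle (fun x : M => TangentSpace 𝓘(ℝ, Euc (n + 1)) x)]
  [IsContMDiffRiemannianBundle 𝓘(ℝ, Euc (n + 1)) ∞ (Euc (n + 1))
      (fun x : M => TangentSpace 𝓘(ℝ, Euc (n + 1)) x)] [MeasurableSpace M] [BorelSpace M]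
  [T2Space M] [SecondCountableTopology M] in
lemma FlowBox.IsLocal.leaf_mem_target (hβ : B.1.IsLocal e β) {k : ℝ} (hk : k ∈ β.K) {y : Euc n}
    (hy : y ∈ β.J) : e (B.1.leaf k y) ∈ β.X.target := by
  have h := LeafBox.leaf_mem (β.K_subset hk) hy
  rwa [hβ.leaf_eq _ (β.K_subset hk) _ hy] at h

lemma FlowBox.IsLocal.integral_wedge (hβ : B.1.IsLocal e β)
    (he : e ∈ _root_.atlas (Euc (n + 1)) M) (hF : IsCalibration F) (m : TransverseMeasure L) (s : ℝ)
    {χ : Euc (n + 1) → ℝ} (hχ : IsTestFun β.X.target χ) :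
    - ∫ z in β.X.target, -(s * β.above (m.μ B) z) * wedgeCoeff (fderiv ℝ χ z) (formInChart F e z) =
      ∫ k in β.K, s * β.flux (chartField F e) χ k ∂(m.μ B) := by
  rw [integral_const_mul, (LeafBox.integral_flux (m.measure_box_lt_top hβ) (hβ.isDivFree hF he) hχ).2,
    ← integral_neg, ← integral_const_mul]
  simp_rw [wedgeCoeff_eq]
  exact integral_congr_ae (Filter.Eventually.of_forall fun z => by simp only [chartField]; ring)

/-- A current whose leaves are calibrated is calibrated. -/
lemma Lamination.IsCalibrated.isCalibratedCurrentOn (hn : 1 ≤ n) (hM : IsOrientedAtlas n M)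
    (hF : IsCalibration F) (hL : L.IsOriented) (hA : m.IsAreaMeasure A)
    (hT : L.IsRepresentedBy T A) (hU : IsOpen U) (hAU : A U < ⊤) (h : L.IsCalibrated F) :
    IsCalibratedCurrentOn T F U := by
  have hfin : IsFiniteMeasure (A.restrict U) := ⟨by rwa [Measure.restrict_apply_univ]⟩
  have := hA.isLocallyFinite
  refine ⟨(A.restrict U).toSignedMeasure, fun x hx => ?_, ?_⟩
  swap
  · rw [hT.massOn_eq hn hL hA.compl_supp hU, Measure.toSignedMeasure_apply_measurable
      hU.measurableSet, measureReal_restrict_apply hU.measurableSet, inter_self, measureReal_def,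
      EReal.coe_ennreal_toReal hAU.ne]
  have he : chartAt (Euc (n + 1)) x ∈ _root_.atlas (Euc (n + 1)) M := chart_mem_atlas _ x
  have hxe := mem_chart_source (Euc (n + 1)) x
  set e := chartAt (Euc (n + 1)) x
  have hint : ∀ {V : Set (Euc (n + 1))}, V ⊆ e.target ∩ e.symm ⁻¹' U → ∀ χ, IsTestFun V χ →
      signedIntegral (A.restrict U).toSignedMeasure (ofChart e χ) = ∫ x, ofChart e χ x ∂A := by
    intro V hV χ hχ
    rw [signedIntegral_toSignedMeasure]
    exact setIntegral_eq_integral_of_forall_compl_eq_zero fun x hx =>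
      ofChart_eq_zero_of_notMem hV hχ hx
  by_cases hxs : x ∈ L.supp
  · obtain ⟨B, k₀, hk₀, y₀, hy₀, rfl⟩ := L.exists_leaf_eq hxs
    obtain ⟨β, s, hβ, hkβ, hyβ, hs, hsK, hW⟩ := L.exists_box hn B hk₀ hy₀ hU hx he hxe
    have hxβ := hβ.leaf_mem_target hkβ hyβ
    refine ⟨e, he, β.X.target, fun z => -(s * β.above (m.μ B) z), hxe, β.X.open_target, hW, hxβ,
      hT.isPotential hn hL hA he hβ hs hsK, fun χ hχ => ?_⟩
    refine (hint hW χ hχ).trans ?_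
    rw [hβ.integral_wedge he hF m s hχ, (hA.integral_ofChart he hβ hχ).2]
    refine setIntegral_congr_fun hβ.measurableSet_K fun k hk => ?_
    exact hβ.leafInt_eq hM hF he hk hs (hsK k hk)
      (h.isCalibratedPatch B (hβ.mem_K hk) (hβ.J_subset hyβ)) hχ
  · have hO : IsOpen (U ∩ L.suppᶜ) := hU.inter L.supp_closed.isOpen_compl
    have hV : e.target ∩ e.symm ⁻¹' (U ∩ L.suppᶜ) ⊆ e.target ∩ e.symm ⁻¹' L.suppᶜ :=
      fun z hz => ⟨hz.1, hz.2.2⟩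
    refine ⟨e, he, e.target ∩ e.symm ⁻¹' (U ∩ L.suppᶜ), fun _ => 0, hxe,
      e.isOpen_inter_preimage_symm hO, fun z hz => ⟨hz.1, hz.2.1⟩, ⟨e.map_source hxe, ?_⟩,
      ⟨locallyIntegrable_zero.locallyIntegrableOn _, fun η hη => ?_⟩, fun χ hχ => ?_⟩
    · rw [mem_preimage, e.left_inv hxe]; exact ⟨hx, hxs⟩
    · rw [hT.eq_zero hA he hV hη]; simp
    · refine (hint (fun z hz => ⟨hz.1, hz.2.1⟩) χ hχ).trans ?_
      rw [hA.integral_ofChart_eq_zero hV hχ]; simp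

end FromLeaves

/-! ### From the current to the leaves -/

section Potentials

variable {n : ℕ} {M : Type*} [TopologicalSpace M] [ChartedSpace (Euc (n + 1)) M]
  {T : RoughForm n M → ℝ} {e : OpenPartialHomeomorph M (Euc (n + 1))} {V V' : Set (Euc (n + 1))}
  {u u' : Euc (n + 1) → ℝ}

lemma IsTestFun.setIntegral_mul {m : ℕ} {S S' : Set (Euc m)} (hS : IsOpen S) (hSS' : S' ⊆ S)
    {χ : Euc m → ℝ} (hχ : IsTestFun S' χ) (u : Euc m → ℝ) (G : Euc m → Euc m) :
    ∫ z in S, u z * fderiv ℝ χ z (G z) = ∫ z in S', u z * fderiv ℝ χ z (G z) := by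
  refine setIntegral_eq_of_subset_of_forall_sdiff_eq_zero hS.measurableSet hSS' fun z hz => ?_
  rw [hχ.fderiv_eq_zero hz.2]
  exact mul_zero _

lemma IsTestFun.integrableOn_mul {m : ℕ} {S : Set (Euc m)} {χ : Euc m → ℝ} (hχ : IsTestFun S χ)
    {u : Euc m → ℝ} (hu : LocallyIntegrableOn u S) (v : Euc m) :
    IntegrableOn (fun z => u z * fderiv ℝ χ z v) S := by
  have h1 : IntegrableOn (fun z => u z * fderiv ℝ χ z v) (tsupport χ) :=
    (hu.integrableOn_compact_subset hχ.2.2 hχ.2.1).mul_continuousOn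
      (hχ.continuous_fderiv.clm_apply continuous_const).continuousOn hχ.2.1
  refine Integrable.integrableOn ((integrableOn_iff_integrable_of_support_subset fun z hz => ?_).1 h1)
  by_contra h
  have h2 : z ∉ tsupport (fderiv ℝ χ) := fun h' => h (tsupport_fderiv_subset ℝ h')
  rw [Function.mem_support, image_eq_zero_of_notMem_tsupport h2] at hz
  exact hz (mul_zero _)

/-- Two potentials of a current differ locally by a constant. -/
lemma IsPotential.exists_ae_eq (hV : IsOpen V) (hV' : IsOpen V') (h : IsPotential T e V u)
    (h' : IsPotential T e V' u') {z₀ : Euc (n + 1)} (hz : z₀ ∈ V ∩ V') :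
    ∃ O ⊆ V ∩ V', IsOpen O ∧ z₀ ∈ O ∧ ∃ c, ∀ᵐ z ∂(volume.restrict O), u z = u' z + c := by
  have hu := h.1.mono_set (inter_subset_left : V ∩ V' ⊆ V)
  have hu' := h'.1.mono_set (inter_subset_right : V ∩ V' ⊆ V')
  suffices h0 : ∀ χ : Euc (n + 1) → ℝ, IsTestFun (V ∩ V') χ → ∀ v,
      ∫ z in V ∩ V', (u - u') z * fderiv ℝ χ z v = 0 by
    obtain ⟨r, hr, c, hs, hc⟩ := exists_ae_eq_const_of_integral_mul_fderiv_eq_zero (hV.inter hV')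
      (hu.sub hu') h0 hz
    refine ⟨_, hs, Metric.isOpen_ball, Metric.mem_ball_self hr, c, hc.mono fun z hz => ?_⟩
    rw [Pi.sub_apply] at hz
    linarith
  intro χ hχ v
  have hη : IsTestFun (V ∩ V') fun z => χ z • vecForm n v := by
    have hs : tsupport (fun z => χ z • vecForm n v) ⊆ tsupport χ :=
      closure_mono fun z hz h => hz (by
        change χ z • vecForm n v = 0
        rw [h, zero_smul])
    exact ⟨hχ.1.smul contDiff_const, hχ.2.1.of_isClosed_subset (isClosed_tsupport _) hs,
      hs.trans hχ.2.2⟩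
  have hd : ∀ z, topCoeff (extDeriv (fun z => χ z • vecForm n v) z) = fderiv ℝ χ z v := by
    intro z
    have h1 : ∀ i, (fun x => formVec (χ x • vecForm n v) i) = fun x => χ x * v i := by
      intro i; ext x
      rw [← map_smul, formVec_vecForm]; rfl
    rw [topCoeff_extDeriv (hη.differentiable z)]
    simp_rw [wedgeCoeff_eq, formVec_vecForm, h1]
    have h2 : ∀ i, fderiv ℝ (fun x => χ x * v i) z (stdVec i) = fderiv ℝ χ z (v i • stdVec i) := by
      intro i
      rw [fderiv_mul_const (hχ.differentiable z)]
      simp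
    simp_rw [h2]
    rw [← map_sum]
    congr 1
    conv_rhs => rw [← (EuclideanSpace.basisFun (Fin (n + 1)) ℝ).sum_repr v]
    simp [stdVec]
  have e1 := h.2 _ (hη.mono inter_subset_left)
  have e2 := h'.2 _ (hη.mono inter_subset_right)
  simp_rw [hd] at e1 e2
  rw [hχ.setIntegral_mul hV inter_subset_left u fun _ => v] at e1
  rw [hχ.setIntegral_mul hV' inter_subset_right u' fun _ => v] at e2
  simp_rw [Pi.sub_apply, sub_mul]
  rw [integral_sub (hχ.integrableOn_mul hu v) (hχ.integrableOn_mul hu' v)]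
  linarith

variable [IsManifold 𝓘(ℝ, Euc (n + 1)) ∞ M]
  [RiemannianBundle (fun x : M => TangentSpace 𝓘(ℝ, Euc (n + 1)) x)]
  [IsContMDiffRiemannianBundle 𝓘(ℝ, Euc (n + 1)) ∞ (Euc (n + 1))
      (fun x : M => TangentSpace 𝓘(ℝ, Euc (n + 1)) x)] {F : RoughForm n M}

/-- The Anzellotti product does not depend on the potential. -/
lemma IsPotential.exists_integral_eq (hF : IsCalibration F) (he : e ∈ atlas (Euc (n + 1)) M)
    (hV : IsOpen V) (hV' : IsOpen V') (hVe : V ⊆ e.target) (h : IsPotential T e V u)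
    (h' : IsPotential T e V' u') {z₀ : Euc (n + 1)} (hz : z₀ ∈ V ∩ V') :
    ∃ O ⊆ V ∩ V', IsOpen O ∧ z₀ ∈ O ∧ ∀ χ, IsTestFun O χ →
      IntegrableOn (fun z => u' z * fderiv ℝ χ z (chartField F e z)) V' →
      ∫ z in V, u z * wedgeCoeff (fderiv ℝ χ z) (formInChart F e z) =
        ∫ z in V', u' z * wedgeCoeff (fderiv ℝ χ z) (formInChart F e z) := by
  obtain ⟨O, hOs, hO, hzO, c, hc⟩ := h.exists_ae_eq hV hV' h' hz
  refine ⟨O, hOs, hO, hzO, fun χ hχ hi => ?_⟩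
  have hG := hF.isDivFree he hO fun z hz => hVe (hOs hz).1
  simp_rw [wedgeCoeff_eq]
  change ∫ z in V, u z * fderiv ℝ χ z (chartField F e z) =
    ∫ z in V', u' z * fderiv ℝ χ z (chartField F e z)
  rw [hχ.setIntegral_mul hV (fun z hz => (hOs hz).1), hχ.setIntegral_mul hV' fun z hz => (hOs hz).2]
  have h1 : ∫ z in O, u z * fderiv ℝ χ z (chartField F e z) = ∫ z in O,
      (u' z * fderiv ℝ χ z (chartField F e z) + c * fderiv ℝ χ z (chartField F e z)) := by
    refine integral_congr_ae ?_
    filter_upwards [hc] with z hz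
    rw [hz, add_mul]
  rw [h1, integral_add (hi.mono_set fun z hz => (hOs hz).2), integral_const_mul, hG.closed χ hχ,
    mul_zero, add_zero]
  exact (hG.integrableOn_apply hχ.continuous_fderiv (hχ.2.1.fderiv ℝ)
    ((tsupport_fderiv_subset ℝ).trans hχ.2.2)).const_mul c

end Potentials

section ToLeaves

variable {n : ℕ} {M : Type*} [TopologicalSpace M] [ChartedSpace (Euc (n + 1)) M]
  [RiemannianBundle (fun x : M => TangentSpace 𝓘(ℝ, Euc (n + 1)) x)]
  [IsManifold 𝓘(ℝ, Euc (n + 1)) ∞ M]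
  [IsContMDiffRiemannianBundle 𝓘(ℝ, Euc (n + 1)) ∞ (Euc (n + 1))
      (fun x : M => TangentSpace 𝓘(ℝ, Euc (n + 1)) x)]
  [MeasurableSpace M] [BorelSpace M] [T2Space M] [SecondCountableTopology M]
  {L : Lamination n M} {F : RoughForm n M} {ν : SignedMeasure M}
  {m : TransverseMeasure L} {A : Measure M} {T : RoughForm n M → ℝ} {U : Set M}
  {B : L.atlas} {e : OpenPartialHomeomorph M (Euc (n + 1))} {β : LeafBox n} {k s : ℝ} {y : Euc n}

lemma IsAnzellottiWedgeOn.exists_box (hn : 1 ≤ n) (hF : IsCalibration F) (hL : L.IsOriented)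
    (hA : m.IsAreaMeasure A) (hT : L.IsRepresentedBy T A)
    (hν : IsAnzellottiWedgeOn T F U ν) (B : L.atlas) (hk : k ∈ B.1.K) (hy : y ∈ B.1.J)
    (hyU : B.1.leaf k y ∈ U) :
    ∃ e ∈ _root_.atlas (Euc (n + 1)) M, ∃ (β : LeafBox n) (s : ℝ), B.1.leaf k y ∈ e.source ∧
      B.1.IsLocal e β ∧ k ∈ β.K ∧ y ∈ β.J ∧ (s = 1 ∨ s = -1) ∧
      (∀ k ∈ β.K, ∀ y ∈ β.J, β.NormalSign k s y) ∧
      ∃ O ⊆ β.X.target ∩ (e.target ∩ e.symm ⁻¹' U), IsOpen O ∧ e (B.1.leaf k y) ∈ O ∧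
        ∀ χ, IsTestFun O χ → signedIntegral ν (ofChart e χ) =
          ∫ k in β.K, s * β.flux (chartField F e) χ k ∂(m.μ B) := by
  obtain ⟨e, he, V, u, hxe, hV, hVU, hxV, hp, hw⟩ := hν _ hyU
  obtain ⟨β, s, hβ, hkβ, hyβ, hs, hsK, -⟩ := L.exists_box hn B hk hy isOpen_univ trivial he hxe
  have hxβ := hβ.leaf_mem_target hkβ hyβ
  obtain ⟨O, hOs, hO, hxO, h⟩ := hp.exists_integral_eq hF he hV β.X.open_target
    (fun z hz => (hVU hz).1) (hT.isPotential hn hL hA he hβ hs hsK) ⟨hxV, hxβ⟩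
  refine ⟨e, he, β, s, hxe, hβ, hkβ, hyβ, hs, hsK, O, fun z hz => ⟨(hOs hz).2, hVU (hOs hz).1⟩, hO,
    hxO, fun χ hχ => ?_⟩
  have hχβ : IsTestFun β.X.target χ := hχ.mono fun z hz => (hOs hz).2
  refine (hw χ (hχ.mono fun z hz => (hOs hz).1)).trans ?_
  rw [h χ hχ, hβ.integral_wedge he hF m s hχβ]
  refine ((LeafBox.integrableOn_above_mul (m.measure_box_lt_top hβ) (hβ.isDivFree hF he)
    hχβ).const_mul (-s)).congr (Filter.Eventually.of_forall fun z => ?_)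
  simp only
  ring

lemma IsAnzellottiWedgeOn.exists_le (hn : 1 ≤ n) (hF : IsCalibration F) (hL : L.IsOriented)
    (hA : m.IsAreaMeasure A) (hT : L.IsRepresentedBy T A)
    (hν : IsAnzellottiWedgeOn T F U ν) {x : M} (hx : x ∈ U) :
    ∃ e ∈ _root_.atlas (Euc (n + 1)) M, x ∈ e.source ∧ ∃ O ⊆ e.target ∩ e.symm ⁻¹' U, IsOpen O ∧
      e x ∈ O ∧ ∀ χ, IsTestFun O χ → (∀ z, 0 ≤ χ z) →
        signedIntegral ν (ofChart e χ) ≤ ∫ x, ofChart e χ x ∂A := by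
  by_cases hxs : x ∈ L.supp
  · obtain ⟨B, k, hk, y, hy, rfl⟩ := L.exists_leaf_eq hxs
    obtain ⟨e, he, β, s, hxe, hβ, -, -, hs, hsK, O, hOs, hO, hxO, h⟩ :=
      hν.exists_box hn hF hL hA hT B hk hy hx
    refine ⟨e, he, hxe, O, fun z hz => (hOs hz).2, hO, hxO, fun χ hχ h0 => ?_⟩
    have hχβ : IsTestFun β.X.target χ := hχ.mono fun z hz => (hOs hz).1
    have hI := hA.integral_ofChart he hβ hχβ
    rw [h χ hχ, hI.2]
    refine setIntegral_mono_on ?_ hI.1 hβ.measurableSet_K fun k hk => ?_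
    · exact (LeafBox.integral_flux (m.measure_box_lt_top hβ) (hβ.isDivFree hF he) hχβ).1.const_mul s
    · exact LeafBox.flux_le (hβ.isDivFree hF he) (hβ.isAreaFun he).cont (hβ.ae_form_le hF he) hk hs
        (hsK k hk) hχβ h0
  · obtain ⟨e, he, V, u, hxe, hV, hVU, hxV, hp, hw⟩ := hν _ hx
    have hV' : IsOpen (e.target ∩ e.symm ⁻¹' L.suppᶜ) :=
      e.isOpen_inter_preimage_symm L.supp_closed.isOpen_compl
    have h0 : IsPotential T e (e.target ∩ e.symm ⁻¹' L.suppᶜ) fun _ => 0 :=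
      ⟨locallyIntegrable_zero.locallyIntegrableOn _, fun η hη => by
        rw [hT.eq_zero hA he subset_rfl hη]; simp⟩
    obtain ⟨O, hOs, hO, hxO, h⟩ := hp.exists_integral_eq hF he hV hV' (fun z hz => (hVU hz).1) h0
      ⟨hxV, e.map_source hxe, by rw [mem_preimage, e.left_inv hxe]; exact hxs⟩
    refine ⟨e, he, hxe, O, fun z hz => hVU (hOs hz).1, hO, hxO, fun χ hχ _ => le_of_eq ?_⟩
    rw [hA.integral_ofChart_eq_zero subset_rfl (hχ.mono fun z hz => (hOs hz).2)]
    refine (hw χ (hχ.mono fun z hz => (hOs hz).1)).trans ?_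
    rw [h χ hχ (by simp)]
    simp

omit [RiemannianBundle (fun x : M => TangentSpace 𝓘(ℝ, Euc (n + 1)) x)]
  [IsManifold 𝓘(ℝ, Euc (n + 1)) ∞ M]
  [IsContMDiffRiemannianBundle 𝓘(ℝ, Euc (n + 1)) ∞ (Euc (n + 1))
      (fun x : M => TangentSpace 𝓘(ℝ, Euc (n + 1)) x)] in
lemma integrable_ofChart {χ : Euc (n + 1) → ℝ} (hχ : IsTestFun e.target χ) (κ : Measure M)
    [IsFiniteMeasureOnCompacts κ] : Integrable (ofChart e χ) κ :=
  (ofChart_continuous hχ).1.integrable_of_hasCompactSupport (ofChart_continuous hχ).2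

lemma IsAnzellottiWedgeOn.apply_eq (hn : 1 ≤ n) (hF : IsCalibration F) (hL : L.IsOriented)
    (hA : m.IsAreaMeasure A) (hT : L.IsRepresentedBy T A) (hU : IsOpen U) (hAU : A U < ⊤)
    (hν : IsAnzellottiWedgeOn T F U ν) (hνU : ν U = A.real U) :
    ∀ S ⊆ U, MeasurableSet S → ν S = A.real S := by
  have := ChartedSpace.locallyCompactSpace (Euc (n + 1)) M
  have := hA.isLocallyFinite
  refine signedMeasure_eq_of_le_locally hU hAU (fun x hx => ?_) hνU
  obtain ⟨e, he, hxe, O, hOs, hO, hxO, h⟩ := hν.exists_le hn hF hL hA hT hx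
  refine ⟨e.source ∩ e ⁻¹' O, e.isOpen_inter_preimage hO, ⟨hxe, hxO⟩, fun x hx => ?_,
    fun W hW hWO C hCW hC => ?_⟩
  · have := (hOs hx.2).2
    rwa [mem_preimage, e.left_inv hx.1] at this
  have hCe : C ⊆ e.source := fun x hx => (hWO (hCW hx)).1
  have hWU : W ⊆ U := fun x hx => by
    have := (hOs (hWO hx).2).2
    rwa [mem_preimage, e.left_inv (hWO hx).1] at this
  obtain ⟨χ, hχ, h01, h1⟩ := exists_testFun_eq_one
    (hC.image_of_continuousOn (e.continuousOn.mono hCe)) (e.isOpen_inter_preimage_symm hW) (by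
      rintro _ ⟨x, hx, rfl⟩
      exact ⟨e.map_source (hCe hx), by rw [mem_preimage, e.left_inv (hCe hx)]; exact hCW hx⟩)
  have hχO : IsTestFun O χ := hχ.mono fun z hz => by
    have := (hWO hz.2).2
    rwa [mem_preimage, e.right_inv hz.1] at this
  have hχe : IsTestFun e.target χ := hχ.mono fun z hz => hz.1
  have hup : ∀ κ : Measure M, IsFiniteMeasureOnCompacts κ → κ W ≠ ⊤ →
      ∫ x, ofChart e χ x ∂κ ≤ κ.real W := by
    intro κ _ hκ
    rw [← setIntegral_eq_integral_of_forall_compl_eq_zero (s := W) fun x hx =>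
      ofChart_eq_zero_of_notMem subset_rfl hχ hx]
    refine (setIntegral_mono_on (integrable_ofChart hχe κ).integrableOn (integrableOn_const hκ)
      hW.measurableSet fun x _ => ?_).trans_eq (setIntegral_one_eq_measureReal (μ := κ))
    rw [ofChart]; split_ifs
    exacts [(h01 _).2, zero_le_one]
  set p := ν.toJordanDecomposition.posPart
  set q := ν.toJordanDecomposition.negPart
  have hlow : p.real C ≤ ∫ x, ofChart e χ x ∂p := by
    refine le_trans ?_ (setIntegral_le_integral (s := C) (integrable_ofChart hχe p)
      (Filter.Eventually.of_forall (ofChart_nonneg fun z => (h01 z).1)))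
    rw [← setIntegral_one_eq_measureReal]
    refine le_of_eq (setIntegral_congr_fun hC.measurableSet fun x hx => ?_)
    rw [ofChart, if_pos (hCe hx)]
    exact (h1.self_of_nhdsSet _ ⟨x, hx, rfl⟩).symm
  have hAW : A W ≠ ⊤ := ((measure_mono hWU).trans_lt hAU).ne
  have h2 := h χ hχO fun z => (h01 z).1
  rw [signedIntegral] at h2
  have h3 := hup A inferInstance hAW
  have h4 := hup q inferInstance (measure_ne_top _ _)
  rw [← ENNReal.toReal_le_toReal (measure_ne_top _ _)
    (ENNReal.add_ne_top.2 ⟨hAW, measure_ne_top _ _⟩), ENNReal.toReal_add hAW (measure_ne_top _ _)]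
  simp only [measureReal_def] at h3 h4 hlow
  linarith

lemma IsCalibratedCurrentOn.exists_leafInt_eq (hn : 1 ≤ n) (hF : IsCalibration F)
    (hL : L.IsOriented) (hA : m.IsAreaMeasure A) (hT : L.IsRepresentedBy T A) (hU : IsOpen U)
    (hAU : A U < ⊤) (h : IsCalibratedCurrentOn T F U) (B : L.atlas) (hk : k ∈ B.1.K)
    (hy : y ∈ B.1.J) (hyU : B.1.leaf k y ∈ U) :
    ∃ e ∈ _root_.atlas (Euc (n + 1)) M, ∃ (β : LeafBox n) (s : ℝ), B.1.leaf k y ∈ e.source ∧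
      B.1.IsLocal e β ∧ k ∈ β.K ∧ y ∈ β.J ∧ (s = 1 ∨ s = -1) ∧
      (∀ k ∈ β.K, ∀ y ∈ β.J, β.NormalSign k s y) ∧
      ∃ O ⊆ β.X.target, IsOpen O ∧ e (B.1.leaf k y) ∈ O ∧
        ∀ χ, IsTestFun O χ → β.leafInt (areaChart e) χ k = s * β.flux (chartField F e) χ k := by
  have := hA.isLocallyFinite
  obtain ⟨ν, hν, hνU⟩ := h
  have hνU' : ν U = A.real U := by
    rw [hT.massOn_eq hn hL hA.compl_supp hU, ← EReal.coe_ennreal_toReal hAU.ne] at hνU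
    exact_mod_cast hνU
  have happ := hν.apply_eq hn hF hL hA hT hU hAU hνU'
  obtain ⟨e, he, β, s, hxe, hβ, hkβ, hyβ, hs, hsK, O, hOs, hO, hxO, h⟩ :=
    hν.exists_box hn hF hL hA hT B hk hy hyU
  have hOX : O ⊆ β.X.target := fun z hz => (hOs hz).1
  have hG := hβ.isDivFree hF he
  refine ⟨e, he, β, s, hxe, hβ, hkβ, hyβ, hs, hsK, O, hOX, hO, hxO, fun χ hχ =>
    LeafBox.leafInt_eq_of_nonneg hG (hβ.isAreaFun he).cont hkβ hO hOX (fun χ hχ h0 => ?_) hχ⟩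
  have hχβ := hχ.mono hOX
  refine (hβ.isAreaFun he).leafInt_eq_of_frequently hs hsK hG (hβ.ae_form_le hF he) hkβ hχβ h0 ?_
  have hI := hA.integral_ofChart he hβ hχβ
  have hJ := (LeafBox.integral_flux (m.measure_box_lt_top hβ) hG hχβ).1.const_mul s
  have hχe := hχβ.mono hβ.target_subset
  have h1 := signedIntegral_eq_of_forall_apply_eq hU.measurableSet hAU happ (g := ofChart e χ)
    (fun κ _ => integrable_ofChart hχe κ)
    fun x hx => ofChart_eq_zero_of_notMem (fun z hz => (hOs hz).2) hχ hx
  rw [h χ hχ, hI.2] at h1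
  have h2 : ∀ᵐ k ∂((m.μ B).restrict β.K), β.leafInt (areaChart e) χ k -
      s * β.flux (chartField F e) χ k = 0 := by
    refine (integral_eq_zero_iff_of_nonneg_ae ?_ (hI.1.sub hJ)).1 ?_
    · filter_upwards [ae_restrict_mem hβ.measurableSet_K] with k hk
      exact sub_nonneg.2 (LeafBox.flux_le hG (hβ.isAreaFun he).cont (hβ.ae_form_le hF he) hk hs
        (hsK k hk) hχβ h0)
    · exact (integral_sub hI.1 hJ).trans (by rw [h1, sub_self])
  rw [ae_restrict_iff' hβ.measurableSet_K] at h2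
  by_contra hfr
  rw [Filter.not_frequently, eventually_nhdsWithin_iff] at hfr
  obtain ⟨P, hPs, hP, hkP⟩ := mem_nhds_iff.1 hfr
  refine (m.full_support B k hk _ (hP.inter β.I_open) ⟨hkP, β.K_subset hkβ⟩).ne'
    (measure_mono_null (t := (B.1.K)ᶜ ∪ {k | ¬(k ∈ β.K → β.leafInt (areaChart e) χ k -
      s * β.flux (chartField F e) χ k = 0)}) (fun k' hk' => ?_)
      (measure_union_null (m.null_compl B) h2))
  by_cases hkB : k' ∈ B.1.K
  · refine Or.inr fun h3 => ?_
    have hkβ' : k' ∈ β.K := by rw [hβ.K_eq]; exact ⟨hkB, hk'.2⟩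
    exact hPs hk'.1 hkβ' (sub_eq_zero.1 (h3 hkβ'))
  · exact Or.inl hkB

omit [MeasurableSpace M] [BorelSpace M] [T2Space M] [SecondCountableTopology M] in
/-- The Gauss-Green formula for the area density in a flow box. -/
lemma FlowBox.IsLocal.exists_trace (hF : IsCalibration F)
    (he : e ∈ _root_.atlas (Euc (n + 1)) M) (hβ : B.1.IsLocal e β) (hk : k ∈ β.K) (hy : y ∈ β.J)
    (hs : s = 1 ∨ s = -1) (hsK : ∀ y ∈ β.J, β.NormalSign k s y) {O : Set (Euc (n + 1))}
    (hO : IsOpen O) (hyO : e (B.1.leaf k y) ∈ O)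
    (h : ∀ χ, IsTestFun O χ → β.leafInt (areaChart e) χ k = s * β.flux (chartField F e) χ k) :
    ∃ V : Set (Euc (n + 1)), ∃ g : Euc (n + 1) → ℝ,
      IsOpen V ∧ V ⊆ e.target ∧ e (B.1.leaf k y) ∈ V ∧
      ContDiffOn ℝ 1 g V ∧ (∀ z ∈ V, fderiv ℝ g z ≠ 0) ∧
      {z ∈ V | g z = 0} = V ∩ e.symm ⁻¹' (B.1.leaf k '' B.1.J) ∧
      (∀ y ∈ B.1.J, B.1.leaf k y ∈ e.source → e (B.1.leaf k y) ∈ V →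
        ∀ w : Euc (n + 1), 0 < fderiv ℝ g (e (B.1.leaf k y)) w →
          0 < (EuclideanSpace.basisFun (Fin (n + 1)) ℝ).toBasis.det
            (Fin.cons w (fun i => fderiv ℝ (fun y' => e (B.1.leaf k y')) y (stdVec i)))) ∧
      ∀ χ : Euc (n + 1) → ℝ, IsTestFun V χ →
        ∫ y in B.1.J ∩ B.1.leaf k ⁻¹' (e.source ∩ e ⁻¹' V),
            χ (e (B.1.leaf k y)) * areaDensity (B.1.leaf k) y =
          ∫ z in {z ∈ V | g z < 0}, wedgeCoeff (fderiv ℝ χ z) (formInChart F e z) := by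
  have hkI := β.K_subset hk
  have hψ := LeafBox.contDiffOn_leaf hk
  obtain ⟨w₀, Fl, s', hs', W, hWs, hW, hyW, hsrc, hside, hsign⟩ :=
    LeafBox.exists_local_flattening hk hy
  obtain rfl := LeafBox.NormalSign.unique hk hy hs hs' (hsK y hy) (hsign y hy hyW)
  have hWX : W ∩ O ⊆ β.X.target := fun z hz => (hWs hz.1).2
  have hWF : W ∩ O ⊆ Fl.Φ.target := fun z hz => (hWs hz.1).1
  have hsym : ∀ y ∈ B.1.J, B.1.leaf k y ∈ e.source → e (B.1.leaf k y) ∈ W ∩ O →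
      y ∈ β.J ∧ β.leaf k y = e (B.1.leaf k y) := fun y hy hye hyV =>
    (hβ.symm_eq (hβ.I_sub hkI) hy (hWX hyV) (e.left_inv hye)).2
  have hWO : IsOpen (W ∩ O) := hW.inter hO
  refine ⟨W ∩ O, Fl.g, hWO, hWX.trans hβ.target_subset,
    ⟨by rwa [hβ.leaf_eq k hkI y hy] at hyW, hyO⟩, Fl.contDiffOn_g.mono hWF, fun z hz h0 => ?_, ?_,
    fun y hy hye hyV w hw => ?_, fun χ hχ => ?_⟩
  · have := (Fl.fderiv_g β.J_open hψ (hWF hz)).1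
    rw [h0] at this
    exact zero_ne_one this
  · ext z
    refine and_congr_right fun hz => ?_
    rw [(hside z hz.1).1, mem_preimage, hβ.symm_mem_plaque_iff hkI (hWX hz)]
  · obtain ⟨hyβ, hyz⟩ := hsym y hy hye hyV
    have h1 := Fl.fderiv_g_mul β.J_open hψ (hWF hyV) w
    have hy0 : consE 0 y ∈ Fl.Φ.source := hsrc y hyβ (hyz ▸ hyV.1)
    have h2 : Fl.Φ (consE 0 y) = e (B.1.leaf k y) := by rw [Fl.apply, ← hyz]; simp
    have h3 : Fl.vec (e (B.1.leaf k y)) = tanVec (β.leaf k) y := by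
      rw [Flattening.vec, ← h2, Fl.Φ.left_inv hy0, tailE_consE]
    have h4 := Fl.det_pos _ hy0
    rw [tailE_consE] at h4
    rw [h3] at h1
    rw [← hβ.tanVec_eq hkI hyβ]
    exact (mul_pos hw h4).trans_eq h1
  · have hχβ := hχ.mono hWX
    have hS : IsOpen (B.1.J ∩ B.1.leaf k ⁻¹' (e.source ∩ e ⁻¹' (W ∩ O))) :=
      (B.1.leaf_C1 k (hβ.mem_K hk)).1.continuousOn.isOpen_inter_preimage B.1.J_open
        (e.isOpen_inter_preimage hWO)
    have h1 : {z ∈ W ∩ O | Fl.g z < 0} = {z ∈ W ∩ O | s * β.ht z < s * k} := by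
      ext z; exact and_congr_right fun hz => (hside z hz.1).2.1
    simp_rw [wedgeCoeff_eq]
    rw [h1]
    refine Eq.trans ?_ ((h χ (hχ.mono inter_subset_right)).trans
      (LeafBox.mul_flux_eq (hβ.isDivFree hF he) hWX hχ hk hs))
    rw [LeafBox.leafInt, setIntegral_eq_of_subset_of_forall_sdiff_eq_zero β.J_open.measurableSet
      (show B.1.J ∩ B.1.leaf k ⁻¹' (e.source ∩ e ⁻¹' (W ∩ O)) ⊆ β.J from
        fun y hy => (hsym y hy.1 hy.2.1 hy.2.2).1)]
    · refine setIntegral_congr_fun hS.measurableSet fun y hy => ?_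
      obtain ⟨h2, h3⟩ := hsym y hy.1 hy.2.1 hy.2.2
      rw [hβ.area_eq he hk h2, h3]
    · intro y hy
      rw [hχ.eq_zero_of_notMem fun h2 => hy.2 ?_, zero_mul]
      rw [hβ.leaf_eq k hkI y hy.1] at h2
      exact ⟨hβ.J_subset hy.1, hβ.mem_source k hkI y hy.1, h2⟩

/-- The leaves of a calibrated current are calibrated. -/
lemma Lamination.isCalibrated_of_currents (hn : 1 ≤ n) (hF : IsCalibration F)
    (hL : L.IsOriented) (hA : m.IsAreaMeasure A) (hT : L.IsRepresentedBy T A)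
    (h : ∀ x ∈ L.supp, ∃ U, IsOpen U ∧ x ∈ U ∧ A U < ⊤ ∧ IsCalibratedCurrentOn T F U) :
    L.IsCalibrated F := by
  intro N _ B hB k hk _
  have hbox : ∀ y ∈ B.J, ∃ e ∈ _root_.atlas (Euc (n + 1)) M, ∃ (β : LeafBox n) (s : ℝ),
      B.leaf k y ∈ e.source ∧ B.IsLocal e β ∧ k ∈ β.K ∧ y ∈ β.J ∧ (s = 1 ∨ s = -1) ∧
      (∀ k ∈ β.K, ∀ y ∈ β.J, β.NormalSign k s y) ∧
      ∃ O ⊆ β.X.target, IsOpen O ∧ e (B.leaf k y) ∈ O ∧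
        ∀ χ, IsTestFun O χ → β.leafInt (areaChart e) χ k = s * β.flux (chartField F e) χ k := by
    intro y hy
    obtain ⟨U, hU, hyU, hAU, hc⟩ := h _ (L.chart_mem_supp ⟨B, hB⟩ hk hy)
    exact hc.exists_leafInt_eq hn hF hL hA hT hU hAU ⟨B, hB⟩ hk hy hyU
  refine ⟨areaDensity (B.leaf k), ⟨?_, fun y hy => ?_⟩, fun _ _ _ => rfl⟩
  · refine ContinuousOn.locallyIntegrableOn (fun y hy => ?_) B.J_open.measurableSet
    obtain ⟨e, he, β, s, -, hβ, hkβ, hyβ, -⟩ := hbox y hy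
    exact ((hβ.continuousOn_areaDensity he hkβ).continuousAt
      (β.J_open.mem_nhds hyβ)).continuousWithinAt
  · obtain ⟨e, he, β, s, hye, hβ, hkβ, hyβ, hs, hsK, O, hOX, hO, hyO, h⟩ := hbox y hy
    obtain ⟨V, g, hV⟩ := FlowBox.IsLocal.exists_trace (B := ⟨B, hB⟩) hF he hβ hkβ hyβ hs (hsK k hkβ)
      hO hyO h
    exact ⟨e, he, V, g, hye, hV⟩

end ToLeaves

theorem mainTheorem8 {n : ℕ} (hn : 1 ≤ n)
    {M : Type*} [TopologicalSpace M] [T2Space M] [SecondCountableTopology M]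
    [MeasurableSpace M] [BorelSpace M]
    [ChartedSpace (Euc (n + 1)) M] [IsManifold 𝓘(ℝ, Euc (n + 1)) ∞ M]
    [RiemannianBundle (fun x : M => TangentSpace 𝓘(ℝ, Euc (n + 1)) x)]
    [IsContMDiffRiemannianBundle 𝓘(ℝ, Euc (n + 1)) ∞ (Euc (n + 1))
      (fun x : M => TangentSpace 𝓘(ℝ, Euc (n + 1)) x)]
    (hM : IsOrientedAtlas n M)
    (F : RoughForm n M) (hF : IsCalibration F)
    (L : Lamination n M) (hL : L.IsOriented) (m : TransverseMeasure L)
    (ρ : PartitionOfUnity L.atlas M L.supp)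
    (hρ : ρ.IsSubordinate (fun B => B.1.chart.target)) :
    (CompactSpace M ∨ massOn (ruelleSullivan L m ρ) univ ≠ ⊤ →
      (IsCalibratedCurrentOn (ruelleSullivan L m ρ) F univ ↔ L.IsCalibrated F)) ∧
    ((∀ U : Set M, IsOpen U → IsCompact (closure U) →
        IsCalibratedCurrentOn (ruelleSullivan L m ρ) F U) ↔ L.IsCalibrated F) := by
  obtain ⟨A, hA₁, hA₂⟩ := m.exists_areaMeasure hn hL
  have hA : m.IsAreaMeasure A := ⟨hA₁, hA₂⟩
  have := hA.isLocallyFinite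
  have := ChartedSpace.locallyCompactSpace (Euc (n + 1)) M
  have hT : L.IsRepresentedBy (ruelleSullivan L m ρ) A := fun U φ c hφ hc =>
    ⟨hA.integrable_tau hn hL hφ hc, hA.ruelleSullivan_eq hn hL hρ hφ hc⟩
  refine ⟨fun hfin => ?_, fun h => ?_, fun h U hU hUc => ?_⟩
  · have hAu : A univ < ⊤ := by
      rcases hfin with hc | hm
      · exact isCompact_univ.measure_lt_top
      · rw [hT.massOn_eq hn hL hA₁ isOpen_univ] at hm
        exact hm.lt_top
    exact ⟨fun h => L.isCalibrated_of_currents hn hF hL hA hT fun x _ =>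
      ⟨univ, isOpen_univ, trivial, hAu, h⟩,
      fun h => h.isCalibratedCurrentOn hn hM hF hL hA hT isOpen_univ hAu⟩
  · refine L.isCalibrated_of_currents hn hF hL hA hT fun x _ => ?_
    obtain ⟨U, hU, hxU, hUc⟩ := exists_isOpen_mem_isCompact_closure x
    exact ⟨U, hU, hxU, (measure_mono subset_closure).trans_lt hUc.measure_lt_top, h U hU hUc⟩
  · exact h.isCalibratedCurrentOn hn hM hF hL hA hT hU
      ((measure_mono subset_closure).trans_lt hUc.measure_lt_top)
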